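/- Let $k$ be a field of characteristic $0$ and $\mathfrak g$ a finite-dimensional Lie algebra over $k$ with a symmetric, non-degenerate, invariant scalar product $\langle\cdot,\cdot\rangle$. Let $\mathrm{Ch}(\mathfrak g)=\Lambda^*\mathfrak g^\vee$ be the Chevalley--Eilenberg dg-algebra ($\mathfrak g^\vee$ in degree $1$, $(d\xi)(x,y)=-\xi([x,y])$), and let $\Omega=\mathrm{Ch}(\mathfrak g,k[[\mathfrak g^\vee]]^{ad})=\Lambda^*\mathfrak g^\vee\otimes k[[\mathfrak g^\vee]]$ be its complex of differential forms, with $k[[\mathfrak g^\vee]]$ in degree $0$ and $d_{dR}\colon\mathrm{Ch}(\mathfrak g)\to\Omega$ the odd derivation sending $\xi\in\mathfrak g^\vee\subset\mathrm{Ch}(\mathfrak g)$ to $\xi\in k[[\mathfrak g^\vee]]$. Let $C_*(A)$ denote the reduced Hochschild complex of a unital dg-algebra $A$, that is, the total complex with degree $n$ part $\prod_i (A\otimes (A/k)^{\otimes i})_{n+i}$ and differential $b+(-1)^i\delta$, where $\delta$ is induced by the differential of $A$ and $$b(a_0\otimes\cdots\otimes a_i)=\sum_{j<i}(-1)^j a_0\otimes\cdots\otimes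 a_ja_{j+1}\otimes\cdots\otimes a_i+(-1)^{i+\deg a_i(\deg a_0+\dots+\deg a_{i-1})}a_ia_0\otimes a_1\otimes\cdots\otimes a_{i-1}.$$ Let $\{\cdot,\cdot\}$ be the Poisson bracket on $\mathrm{Ch}(\mathfrak g)$ extending the scalar product on $\mathfrak g^\vee$ by the Leibniz rule, and let $\mathrm{Ch}(\mathfrak g)\otimes k[\varepsilon]$ ($\varepsilon^2=0$, $\deg\varepsilon=2$) carry the undeformed differential and the product $x\cdot y=x\wedge y+\frac12\varepsilon\{x,y\}$. Its reduced Hochschild complex over $k[\varepsilon]$ is a complex; filter it by powers of $\varepsilon$, and let $d_0\colon H^n(C_*(\mathrm{Ch}(\mathfrak g)))\to H^{n-1}(C_*(\mathrm{Ch}(\mathfrak g)))$ be the differential of the associated spectral sequence, which is induced by the first order deformation $D_1$ of the Hochschild differential, i.e. by its $\varepsilon$-component. Let $\exp^*\colon F(G)=U(\mathfrak g)^\vee\to k[[\mathfrak g^\vee]]$ be the map dual to the Poincaré--Birkhoff--Witt symmetrization, $(\exp^* f)(x)=\sum_m f(x^m)/m!$. Then: 1. The Hochschild--Kostant--Rosenberg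 map $$\mathrm{HKR}(a_0\otimes\cdots\otimes a_i)=\frac{(-1)^{\,i+\sum_{m}(i-m)\deg a_m}}{i!}\,a_0\,d_{dR}a_1\cdots d_{dR}a_i$$ is a quasi-isomorphism $C_*(\mathrm{Ch}(\mathfrak g))\to\Omega$. 2. The map $\exp^*$ is bijective, and there are linear maps $V_L,V_R\colon\mathfrak g\to Vect(\mathfrak g)=\mathrm{Der}\,k[[\mathfrak g^\vee]]$ (the left and right invariant vector fields in exponential coordinates) with $V_L(y)\exp^*f=\exp^*(f(\,\cdot\,y))$ and $V_R(y)\exp^*f=\exp^*(f(y\,\cdot\,))$ for all $y\in\mathfrak g$, $f\in U(\mathfrak g)^\vee$. 3. Contract $V_L,V_R\in Vect(\mathfrak g)\otimes\mathfrak g^\vee$ with the scalar product to elements of $Vect(\mathfrak g)\otimes\mathfrak g$ and regard these as second order differential operators $\Delta_L,\Delta_R$ on $\Omega$, where $Vect(\mathfrak g)$ differentiates $k[[\mathfrak g^\vee]]$ and $\mathfrak g$ differentiates $\mathrm{Ch}(\mathfrak g)$ by contraction. Then $\Delta=\frac12(\Delta_L+\Delta_R)$ anticommutes with the differential of $\Omega$,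 and under the quasi-isomorphism $\mathrm{HKR}$ the differential $d_0$ is given by $\Delta$: $\mathrm{HKR}_*\circ d_0=\Delta_*\circ\mathrm{HKR}_*$ in cohomology. Moreover $\mathrm{HKR}(D_1z)=\Delta(\mathrm{HKR}(z))$ holds exactly for every homogeneous chain $z$ such that in $z$ and in its Hochschild differential only tensors $a_0\otimes a_1\otimes\cdots\otimes a_i$ with $\deg a_1=\dots=\deg a_i=1$ occur. 4. The matrix of $\Delta$, i.e. of $\frac12(V_L+V_R)$ with respect to the constant vector fields, is $$\mathrm{id}+\sum_{n\ge1}\frac{B_{2n}}{(2n)!}\mathrm{Ad}^{2n},$$ where $\sum_{n\ge 0} B_nz^n/n!=z/(e^z-1)$ and $\mathrm{Ad}$ is the linear function $x\mapsto\mathrm{ad}_x$ on $\mathfrak g$ with values in $\mathrm{End}(\mathfrak g)$. -/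

import Mathlib

open scoped TensorProduct DualNumber

namespace ChevalleyHochschild

noncomputable section

/-! ### The reduced Hochschild complex of a dg-algebra with a homogeneous basis -/

/-- The data of a graded dg-algebra over `R` which is free as an `R`-module with a finite
homogeneous basis `β_s`, `s ∈ S`, containing the unit, written out in structure constants:
`β_t β_u = ∑ s, mul t u s • β_s` and `d β_t = ∑ s, diff t s • β_s`. -/
structure BasedDGAlgebra (R S : Type*) where
  /-- the degree of `β_s` -/
  deg : S → ℕ
  /-- the index of the unit element -/
  unit : S
  /-- the structure constants of the product -/
  mul : S → S → S → R
  /-- the matrix of the differential -/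
  diff : S → S → R

/-- Elements of the product over `i` of the `R`-modules `A^{⊗ (i + 1)}` (tensor products over `R`),
in coordinates: `c i w` is the coefficient of `c` at `β_{w 0} ⊗ β_{w 1} ⊗ ⋯ ⊗ β_{w i}`. -/
abbrev HChain (R S : Type*) := (i : ℕ) → (Fin (i + 1) → S) → R

/-- A basis tensor is degenerate if one of its factors with a non-zero index is the unit. The
remaining ones form a basis of `A ⊗ A/R ⊗ ⋯ ⊗ A/R`. -/
def IsDegenerate {R S : Type*} (A : BasedDGAlgebra R S) {i : ℕ} (w : Fin (i + 1) → S) : Prop :=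
  ∃ j : Fin i, w j.succ = A.unit

/-- The cohomological degree `∑ deg a_j - i` of `a_0 ⊗ ⋯ ⊗ a_i`. -/
def wordDeg {R S : Type*} (A : BasedDGAlgebra R S) {i : ℕ} (w : Fin (i + 1) → S) : ℤ :=
  (∑ j, (A.deg (w j) : ℤ)) - i

section Hochschild

variable {R S : Type*} [CommRing R] [Fintype S]

/-- The first differential
`a_0 ⊗ ⋯ ⊗ a_i ↦ ∑ j, (-1)^(deg a_0 + ⋯ + deg a_{j-1}) a_0 ⊗ ⋯ ⊗ d a_j ⊗ ⋯ ⊗ a_i`. -/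
def internalDiff (A : BasedDGAlgebra R S) (c : HChain R S) : HChain R S := fun i w =>
  ∑ j : Fin (i + 1), ∑ t : S,
    (-1) ^ (∑ l ∈ Finset.Iio j, A.deg (w l)) * c i (Function.update w j t) * A.diff t (w j)

/-- The second differential
`a_0 ⊗ ⋯ ⊗ a_{i+1} ↦ ∑ j ≤ i, (-1)^j a_0 ⊗ ⋯ ⊗ a_j a_{j+1} ⊗ ⋯ ⊗ a_{i+1}
  + (-1)^(i + 1 + deg a_{i+1} (deg a_0 + ⋯ + deg a_i)) a_{i+1} a_0 ⊗ a_1 ⊗ ⋯ ⊗ a_i`.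
The coefficient at `w` collects the basis tensors obtained from `w` by replacing the entry `w j`
by two consecutive entries `t`, `u`, respectively by replacing `w 0` by `t` and appending `u`. -/
def multDiff (A : BasedDGAlgebra R S) (c : HChain R S) : HChain R S := fun i w =>
  (∑ j : Fin (i + 1), ∑ t : S, ∑ u : S,
    (-1) ^ (j : ℕ) *
      c (i + 1) (Fin.insertNth (α := fun _ => S) j.succ u (Function.update w j t)) *
      A.mul t u (w j)) +
  ∑ t : S, ∑ u : S,
    (-1) ^ (i + 1 + A.deg u * (A.deg t + ∑ l : Fin i, A.deg (w l.succ))) *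
      c (i + 1) (Fin.snoc (α := fun _ => S) (Function.update w 0 t) u) *
      A.mul u t (w 0)

open Classical in
/-- The differential of the total complex, `(second differential) + (-1)^i (first differential)`
on `A ⊗ (A/R)^{⊗ i}`. Chains of the reduced complex are represented by families with vanishing
coefficients at degenerate basis tensors; after applying the formulas the degenerate components
are dropped, which is passing to the quotient. -/
def hochD (A : BasedDGAlgebra R S) : HChain R S →ₗ[R] HChain R S where
  toFun c := fun i w =>
    if IsDegenerate A w then 0 else multDiff A c i w + (-1) ^ i * internalDiff A c i w
  map_add' c c' := by
    funext i w
    by_cases h : IsDegenerate A w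
    · simp [h]
    · simp only [h, if_false, multDiff, internalDiff, Pi.add_apply, mul_add, add_mul,
        Finset.sum_add_distrib]
      ring
  map_smul' r c := by
    funext i w
    by_cases h : IsDegenerate A w
    · simp [h]
    · simp only [h, if_false, multDiff, internalDiff, Pi.smul_apply, smul_eq_mul, RingHom.id_apply,
        mul_add, Finset.mul_sum]
      congr 1
      · congr 1
        · exact Finset.sum_congr rfl fun _ _ => Finset.sum_congr rfl fun _ _ =>
            Finset.sum_congr rfl fun _ _ => by ring
        · exact Finset.sum_congr rfl fun _ _ => Finset.sum_congr rfl fun _ _ => by ring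
      · exact Finset.sum_congr rfl fun _ _ => Finset.sum_congr rfl fun _ _ => by ring

end Hochschild

/-- The degree `n` part of the reduced Hochschild complex over a field. -/
def hochChains {k S : Type*} [Field k] (A : BasedDGAlgebra k S) (n : ℤ) :
    Submodule k (HChain k S) where
  carrier := {c | ∀ i w, c i w ≠ 0 → ¬ IsDegenerate A w ∧ wordDeg A w = n}
  zero_mem' := by intro i w h; simp at h
  add_mem' := by
    intro a b ha hb i w h
    by_cases h' : a i w = 0
    · exact hb i w (by intro h''; exact h (by simp [h', h'']))
    · exact ha i w h'
  smul_mem' := by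
    intro r a ha i w h
    exact ha i w (by intro h'; exact h (by simp [h']))

/-- The degree `n` part of the reduced Hochschild complex of a based dg-algebra over `k[ε]`, where
`deg ε = 2` (the components of a dual number are its coefficients at `1` and at `ε`). -/
def hochChainsEps {k S : Type*} [Field k] (A : BasedDGAlgebra k[ε] S) (n : ℤ) :
    Set (HChain k[ε] S) :=
  {c | ∀ i w, (c i w ≠ 0 → ¬ IsDegenerate A w) ∧
    (TrivSqZeroExt.fst (c i w) ≠ 0 → wordDeg A w = n) ∧
    (TrivSqZeroExt.snd (c i w) ≠ 0 → wordDeg A w + 2 = n)}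

/-- `φ` is a quasi-isomorphism from the complex with terms `C n` and differential `d` to the complex
with terms `C' n` and differential `d'` (both differentials of degree one). -/
structure IsQuasiIso {k M N : Type*} [Field k] [AddCommGroup M] [Module k M]
    [AddCommGroup N] [Module k N] (C : ℤ → Submodule k M) (d : M →ₗ[k] M)
    (C' : ℤ → Submodule k N) (d' : N →ₗ[k] N) (φ : M →ₗ[k] N) : Prop where
  source_deg : ∀ n, ∀ z ∈ C n, d z ∈ C (n + 1)
  source_sq : ∀ n, ∀ z ∈ C n, d (d z) = 0
  target_deg : ∀ n, ∀ z ∈ C' n, d' z ∈ C' (n + 1)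
  target_sq : ∀ n, ∀ z ∈ C' n, d' (d' z) = 0
  map_deg : ∀ n, ∀ z ∈ C n, φ z ∈ C' n
  map_comm : ∀ n, ∀ z ∈ C n, φ (d z) = d' (φ z)
  injective : ∀ n, ∀ z ∈ C n, d z = 0 → (∃ y ∈ C' (n - 1), φ z = d' y) →
    ∃ y ∈ C (n - 1), z = d y
  surjective : ∀ n, ∀ y ∈ C' n, d' y = 0 →
    ∃ z ∈ C n, d z = 0 ∧ ∃ x ∈ C' (n - 1), y = φ z + d' x

/-! ### The Chevalley--Eilenberg algebra and its differential forms -/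

section ChevalleyEilenberg

variable {k g ι : Type*} [Field k] [LieRing g] [LieAlgebra k g]

variable (k g) in
/-- The graded algebra `S^*(g^∨[1])`. -/
abbrev Ch := ExteriorAlgebra k (Module.Dual k g)

/-- The odd derivation (from the left) of `Ch` given by contraction with `v ∈ g`. -/
def contrL (v : g) : Ch k g →ₗ[k] Ch k g :=
  CliffordAlgebra.contractLeft (Q := (0 : QuadraticForm k (Module.Dual k g)))
    (Module.Dual.eval k g v)

/-- Contraction with `v ∈ g` from the right. -/
def contrR (v : g) : Ch k g →ₗ[k] Ch k g :=
  (CliffordAlgebra.contractRight (Q := (0 : QuadraticForm k (Module.Dual k g)))).flip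
    (Module.Dual.eval k g v)

/-- Multiplication from the left by a generator. -/
def wedge (ξ : Module.Dual k g) : Ch k g →ₗ[k] Ch k g :=
  LinearMap.mulLeft k (ExteriorAlgebra.ι k ξ)

variable [Fintype ι] [LinearOrder ι] (e : Module.Basis ι k g)

/-- The Chevalley--Eilenberg differential `-1/2 ∑ e^a ∧ e^b ∧ ι_{[e_a, e_b]}`: the derivation with
`(d ξ)(x, y) = - ξ [x, y]` for `ξ ∈ g^∨`. -/
def ceD : Ch k g →ₗ[k] Ch k g :=
  (-(2 : k)⁻¹) • ∑ a, ∑ b, wedge (e.coord a) ∘ₗ wedge (e.coord b) ∘ₗ contrL ⁅e a, e b⁆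

/-- The Poisson bracket on `Ch`: the biderivation that extends the scalar product on `g^∨` which is
inverse to the scalar product `B` on `g`. -/
def poisson (B : LinearMap.BilinForm k g) : Ch k g →ₗ[k] Ch k g →ₗ[k] Ch k g :=
  ∑ p, ∑ q, (LinearMap.BilinForm.toMatrix e B)⁻¹ p q •
    (LinearMap.mul k (Ch k g)).compl₁₂ (contrR (e p)) (contrL (e q))

/-- The basis of `Ch` by the monomials in the basis of `g^∨` dual to `e`. -/
def chBasis : Module.Basis (Finset ι) k (Ch k g) :=
  Module.Basis.ExteriorAlgebra e.dualBasis

/-- The Chevalley--Eilenberg dg-algebra over `k`. -/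
def chAlg : BasedDGAlgebra k (Finset ι) where
  deg s := s.card
  unit := ∅
  mul t u s := (chBasis e).repr (chBasis e t * chBasis e u) s
  diff t s := (chBasis e).repr (ceD e (chBasis e t)) s

/-- The dg-algebra `Ch ⊗ k[ε]` over `k[ε]`, with the differential as before and the product
`x · y = x ∧ y + 1/2 ε {x, y}`. -/
def chAlgEps (B : LinearMap.BilinForm k g) : BasedDGAlgebra k[ε] (Finset ι) where
  deg s := s.card
  unit := ∅
  mul t u s := TrivSqZeroExt.inl ((chBasis e).repr (chBasis e t * chBasis e u) s) +
    TrivSqZeroExt.inr ((2 : k)⁻¹ * (chBasis e).repr (poisson e B (chBasis e t) (chBasis e u)) s)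
  diff t s := TrivSqZeroExt.inl ((chBasis e).repr (ceD e (chBasis e t)) s)

/-- The power series with given coefficients. -/
def series {k ι : Type*} [Field k] : ((ι →₀ ℕ) → k) →ₗ[k] MvPowerSeries ι k where
  toFun f := f
  map_add' _ _ := rfl
  map_smul' _ _ := rfl

variable (k g ι) in
/-- The underlying algebra of the differential forms `Ch(g, k[[g^∨]])`. The variable `X i` of
`k[[g^∨]]` is the `i`-th coordinate function on `g`; inside the forms, it is `d_dR` of the
corresponding generator of `Ch`. -/
abbrev Forms := Ch k g ⊗[k] MvPowerSeries ι k

/-- Forms of cohomological degree `n` (the elements of `k[[g^∨]]` have degree zero). -/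
def formsDeg (n : ℤ) : Submodule k (Forms k g ι) :=
  Submodule.span k {ω | ∃ m : ℕ, (m : ℤ) = n ∧ ∃ a ∈ ⋀[k]^m (Module.Dual k g),
    ∃ p : MvPowerSeries ι k, ω = a ⊗ₜ[k] p}

/-- The matrix `Ad` over `k[[g^∨]]` of the linear function `x ↦ ad x` on `g` with values in
`End g`. -/
def adMatrix : Matrix ι ι (MvPowerSeries ι k) := fun b c =>
  ∑ a, MvPowerSeries.C (e.repr ⁅e a, e c⁆ b) * MvPowerSeries.X a

/-- The action of `e c` on `k[[g^∨]]` that extends the coadjoint action on `g^∨`. -/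
def coadj (c : ι) : Derivation k (MvPowerSeries ι k) (MvPowerSeries ι k) :=
  ∑ b, adMatrix e b c • MvPowerSeries.pderiv k b

/-- The differential of `Ch(g, k[[g^∨]]^{ad})`, namely
`a ⊗ p ↦ d a ⊗ p + ∑ c, e^c ∧ a ⊗ (e_c · p)`. -/
def formsD : Forms k g ι →ₗ[k] Forms k g ι :=
  TensorProduct.map (ceD e) LinearMap.id +
    ∑ c, TensorProduct.map (wedge (e.coord c)) (coadj e c).toLinearMap

/-- The de Rham differential `Ch → Ch(g, g^∨)`: the odd derivation with `d_dR e^j = X j`. -/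
def deRham : Ch k g →ₗ[k] Forms k g ι :=
  ∑ j, (TensorProduct.mk k (Ch k g) (MvPowerSeries ι k)).flip (MvPowerSeries.X j) ∘ₗ contrL (e j)

/-! ### The Hochschild--Kostant--Rosenberg map -/

/-- The form `± 1/i! a_0 d_dR a_1 ⋯ d_dR a_i` for the monomials `a_j` given by `w`, with the Koszul
sign `(-1)^(i + ∑ m, (i - m) deg a_m)`. -/
def hkrTerm (i : ℕ) (w : Fin (i + 1) → Finset ι) : Forms k g ι :=
  ((-1 : k) ^ (i + ∑ m : Fin (i + 1), (i - (m : ℕ)) * (w m).card) / (i.factorial : k)) •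
    (chBasis e (w 0) ⊗ₜ[k] 1 * (List.ofFn fun j : Fin i => deRham e (chBasis e (w j.succ))).prod)

/-- The coefficient in `Ch` of a form at a monomial `α` of `k[[g^∨]]`. -/
def formCoeff (α : ι →₀ ℕ) : Forms k g ι →ₗ[k] Ch k g :=
  (TensorProduct.rid k (Ch k g)).toLinearMap ∘ₗ
    TensorProduct.map LinearMap.id (MvPowerSeries.coeff α)

/-- The image of the `i`-th component of a chain. -/
def hkrComponent (i : ℕ) (c : HChain k (Finset ι)) : Forms k g ι :=
  ∑ w : Fin (i + 1) → Finset ι, c i w • hkrTerm e i w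

/-- The Hochschild--Kostant--Rosenberg map `c ↦ ∑ i, hkrComponent i c`. As `hkrComponent i c` is
homogeneous of degree `i` in the variables of `k[[g^∨]]`, the coefficient of this infinite sum at a
monomial `α` is the one of the summand with `i = |α|`. -/
def hkr : HChain k (Finset ι) →ₗ[k] Forms k g ι where
  toFun c := ∑ s, chBasis e s ⊗ₜ[k] series fun α =>
    (chBasis e).repr (formCoeff α (hkrComponent e α.degree c)) s
  map_add' c c' := by
    rw [← Finset.sum_add_distrib]
    refine Finset.sum_congr rfl fun s _ => ?_
    rw [← TensorProduct.tmul_add, ← map_add]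
    congr 2
    funext α
    simp [hkrComponent, add_smul, Finset.sum_add_distrib]
  map_smul' r c := by
    rw [RingHom.id_apply, Finset.smul_sum]
    refine Finset.sum_congr rfl fun s _ => ?_
    rw [← TensorProduct.tmul_smul, ← map_smul]
    congr 2
    funext α
    have h : hkrComponent e α.degree (r • c) = r • hkrComponent e α.degree c := by
      simp [hkrComponent, mul_smul, Finset.smul_sum]
    rw [h]
    simp

/-! ### Invariant vector fields in exponential coordinates -/

open Classical in
/-- The map `exp^* : F(G) = U(g)^∨ → k[[g^∨]]` dual to the Poincaré--Birkhoff--Witt symmetrization: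
the coefficient at `x^α` of the function `f (exp (∑ x_a e_a))`. -/
def expStar : Module.Dual k (UniversalEnvelopingAlgebra k g) →ₗ[k] MvPowerSeries ι k where
  toFun f := series fun α => (α.degree.factorial : k)⁻¹ *
    ∑ w : Fin α.degree → ι, if ∑ j, Finsupp.single (w j) 1 = α then
      f (List.ofFn fun j => UniversalEnvelopingAlgebra.ι k (e (w j))).prod else 0
  map_add' f f' := by
    refine Eq.trans ?_ ((series (k := k) (ι := ι)).map_add _ _)
    congr 1
    funext α
    rw [Pi.add_apply, ← mul_add, ← Finset.sum_add_distrib]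
    congr 1
    refine Finset.sum_congr rfl fun w _ => ?_
    split_ifs <;> simp
  map_smul' r f := by
    refine Eq.trans ?_ ((series (k := k) (ι := ι)).map_smul r _)
    congr 1
    funext α
    simp only [Pi.smul_apply, smul_eq_mul, Finset.mul_sum]
    refine Finset.sum_congr rfl fun w _ => ?_
    split_ifs
    · simp only [LinearMap.smul_apply, smul_eq_mul]
      ring
    · simp

/-- In exponential coordinates, `V : g → Vect(g)` is dual to `U(g) ⊗ g → U(g)`: these are the left
invariant vector fields. -/
def IsLeftInvariant (V : g →ₗ[k] Derivation k (MvPowerSeries ι k) (MvPowerSeries ι k)) : Prop :=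
  ∀ (y : g) (f : Module.Dual k (UniversalEnvelopingAlgebra k g)),
    V y (expStar e f) =
      expStar e (f ∘ₗ LinearMap.mulRight k (UniversalEnvelopingAlgebra.ι k y))

/-- In exponential coordinates, `V : g → Vect(g)` is dual to `g ⊗ U(g) → U(g)`: these are the right
invariant vector fields. -/
def IsRightInvariant (V : g →ₗ[k] Derivation k (MvPowerSeries ι k) (MvPowerSeries ι k)) : Prop :=
  ∀ (y : g) (f : Module.Dual k (UniversalEnvelopingAlgebra k g)),
    V y (expStar e f) =
      expStar e (f ∘ₗ LinearMap.mulLeft k (UniversalEnvelopingAlgebra.ι k y))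

/-- The second order operator on forms given by the contraction of `V ∈ Vect(g) ⊗ g^∨` with the
scalar product: `Vect(g)` differentiates `k[[g^∨]]` and `g` differentiates `Ch`. -/
def secondOrder (B : LinearMap.BilinForm k g)
    (V : g →ₗ[k] Derivation k (MvPowerSeries ι k) (MvPowerSeries ι k)) :
    Forms k g ι →ₗ[k] Forms k g ι :=
  ∑ p, ∑ q, (LinearMap.BilinForm.toMatrix e B)⁻¹ p q •
    TensorProduct.map (contrL (e q)) (V (e p)).toLinearMap

/-- The half-sum of the second order operators of `V` and `W`. -/
def halfSum (B : LinearMap.BilinForm k g)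
    (V W : g →ₗ[k] Derivation k (MvPowerSeries ι k) (MvPowerSeries ι k)) :
    Forms k g ι →ₗ[k] Forms k g ι :=
  (2 : k)⁻¹ • (secondOrder e B V + secondOrder e B W)

/-- The matrix `id + ∑_{n ≥ 1} B_{2n} / (2n)! Ad^{2n}`. As the entries of `Ad^{2n}` are homogeneous
of degree `2n`, only terms with `2n ≤ |α|` contribute to the coefficient at `α`. -/
def bernoulliMatrix [CharZero k] : Matrix ι ι (MvPowerSeries ι k) := fun b c =>
  series fun α => MvPowerSeries.coeff α ((1 : Matrix ι ι (MvPowerSeries ι k)) b c) +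
    ∑ n ∈ Finset.Icc 1 α.degree, ((bernoulli (2 * n) / ((2 * n).factorial : ℚ) : ℚ) : k) *
      MvPowerSeries.coeff α ((adMatrix e ^ (2 * n)) b c)

/-! ### The spectral sequence of the filtration by powers of `ε` -/

/-- The class of `w` is the image of the class of `z` under the differential
`H(F^0 / F^1) → H(F^1)` of the spectral sequence of the two-step filtration
`F^1 = ε C ⊆ F^0 = C` of the Hochschild complex `C` of `Ch ⊗ k[ε]`: some lift `c` of the cocycle `z`
of `F^0 / F^1` has differential `ε w`. -/
def IsSpectralDifferential (B : LinearMap.BilinForm k g) (n : ℤ)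
    (z w : HChain k (Finset ι)) : Prop :=
  ∃ c ∈ hochChainsEps (chAlgEps e B) n,
    (∀ i v, TrivSqZeroExt.fst (c i v) = z i v) ∧
    ∀ i v, hochD (chAlgEps e B) c i v = TrivSqZeroExt.inr (w i v)

/-- The first order deformation of the differential: the `ε`-component of the differential of the
Hochschild complex of `Ch ⊗ k[ε]` on chains with coefficients in `k`. -/
def firstOrder (B : LinearMap.BilinForm k g) (z : HChain k (Finset ι)) : HChain k (Finset ι) :=
  fun i v => TrivSqZeroExt.snd
    (hochD (chAlgEps e B) (fun i v => TrivSqZeroExt.inl (z i v)) i v)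

/-- All factors with non-zero index of the basis tensors that occur in `z` have degree one. -/
def HasLinearEntries (z : HChain k (Finset ι)) : Prop :=
  ∀ i v, z i v ≠ 0 → ∀ j : Fin i, (v j.succ).card = 1

end ChevalleyEilenberg

end

end ChevalleyHochschild

open ChevalleyHochschild

/-!
# Hochschild chains of the Chevalley--Eilenberg algebra and invariant vector fields

A Hochschild chain is handled as a function of the first factor and of the list of the other factors
(`toChain`, `ofChain`), so that the differentials are defined and their identities proved by
recursion on lists. The laws of a dg-algebra with a homogeneous basis (`DGLaws`) imply that the
reduced Hochschild differential squares to zero (`hochD_hochD`). They hold for `Ch(g)`, where the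
square of `d` vanishes by the Jacobi identity, and for its deformation over `k[ε]`, as the Poisson
bracket is a Hochschild cocycle and as the invariance of the scalar product makes `d` a derivation
of the bracket.

**The quasi-isomorphism.** The map `hkr` commutes with the differentials (`hkr_hochD`). Its kernel
is acyclic (`exists_hochD_eq`): one filters by the length of tensors, and the multiplicative part of
the differential is exact modulo tensors whose factors after the first one are generators, in which
they are symmetric (`hochMul_cycle`). On these tensors, `hkr` is injective since symmetric functions
of words of length `i` are polynomials of degree `i`. The exactness reduces to the bar complex of
the exterior algebra (`bar_cycle`), whose homology is computed by a filtration by the first factor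
and by the Koszul homotopy. It remains to lift forms to chains in a way that is compatible with
differentials.

**Invariant fields.** The vector fields with matrix `Ad / (1 - e^{-Ad})` satisfy the commutation
relations of `g` (`lie_leftField`): their defect is multiplied by its degree and by `-2`, up to
terms of lower degree, under the commutator with the Euler field, which is `∑ x_a V_a`. So the
enveloping algebra acts on power series, and `p ↦ (u ↦ (u p)(0))` is the inverse of `exp^*`
(`expStar_bijective`). The construction makes the fields left invariant; the right invariant ones
differ from them by the coadjoint action, i.e. by the field with matrix `Ad`. The half-sum thus has
the matrix `Ad / (1 - e^{-Ad}) - Ad / 2`, which is the even part of `Ad / (e^{Ad} - 1)`.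

**Linear chains.** Up to signs (`wordSign`), a chain whose factors after the first one are
generators is a family of functions on words in the basis of `g`, indexed by the monomials of
`Ch(g)`. Its Hochschild differential has again such entries only if and only if these functions
satisfy the commutation relations of `g`, that is, if they come from linear forms on the enveloping
algebra (`hochTot_pair`, `exists_eq_linChain`, `isLinear_hochRed_linChain`). The map `hkr` sends
such a chain to the form with coefficients `exp^* f_s` (`hkr_linChain`). So it is a bijection from
this subcomplex to forms. This gives the surjectivity in cohomology and `formsD_formsD`.

**The deformation.** On linear chains, only the first and the last summand of the Hochschild
differential of the Poisson bracket contribute, since the bracket of two generators is a scalar and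
vanishes in the reduced complex. They contract the first factor with a generator and translate the
functions from the left and from the right (`poissonD_linChain`), which is `Δ` in exponential
coordinates (`hkr_poissonD_linChain`). Since the first order deformation anticommutes with the
Hochschild differential (`hochD_firstOrder`), so does `Δ` with the one of forms (`formsD_halfSum`).
Finally, a cocycle is the sum of a linear chain and of the boundary of a chain in the kernel of
`hkr` (`exists_eq_linChain_add`), so the comparison on linear chains determines the differential of
the spectral sequence (`hkr_firstOrder_of_cocycle`).
-/

set_option linter.unusedSectionVars false
set_option linter.unusedSimpArgs false

namespace ChevalleyHochschild

/-! ### Signs -/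

section Sign

variable {R : Type*} [CommRing R]

/-- The sign `(-1)^a` of a parity `a`. -/
def psign (R : Type*) [CommRing R] (a : ZMod 2) : R := if a = 0 then 1 else -1

@[simp] lemma psign_zero : psign R 0 = 1 := by simp [psign]

@[simp] lemma psign_one : psign R 1 = -1 := by simp [psign]

lemma psign_add (a b : ZMod 2) : psign R (a + b) = psign R a * psign R b := by
  have h : ∀ c : ZMod 2, c = 0 ∨ c = 1 := by decide
  have h11 : (1 + 1 : ZMod 2) = 0 := by decide
  rcases h a with rfl | rfl <;> rcases h b with rfl | rfl <;> simp [h11]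

lemma psign_natCast (n : ℕ) : psign R (n : ZMod 2) = (-1) ^ n := by
  induction n with
  | zero => simp
  | succ n ih => rw [Nat.cast_succ, psign_add, ih, psign_one, pow_succ]

@[simp] lemma psign_mul_self (a : ZMod 2) : psign R a * psign R a = 1 := by
  rw [← psign_add, CharTwo.add_self_eq_zero, psign_zero]

end Sign

/-! ### The Hochschild differential on functions of lists -/

section Lists

variable {R S : Type*} [CommRing R] [Fintype S]

/-- The underlying function of the bar differential. -/
def barFun (m : S → S → S → R) : List S → (List S → R) → R
  | [], _ => 0
  | s :: l, F => ∑ t, ∑ u, m t u s * F (t :: u :: l) - barFun m l fun l' => F (s :: l')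

/-- The bar differential `[a_1 | ⋯ | a_n] ↦ ∑ (-1)^(j-1) [a_1 | ⋯ | a_j a_{j+1} | ⋯ | a_n]` in
coordinates, where `m` are the structure constants of the product; `F l` is the coefficient of the
chain `F` at the tensor of the basis elements listed in `l`. -/
def barD (m : S → S → S → R) : (List S → R) →ₗ[R] (List S → R) where
  toFun F l := barFun m l F
  map_add' F G := by
    funext l
    induction l generalizing F G with
    | nil => simp [barFun]
    | cons s l ih =>
      have := ih (fun l' => F (s :: l')) (fun l' => G (s :: l'))
      simp only [Pi.add_apply] at this
      simp only [barFun, Pi.add_apply, mul_add, Finset.sum_add_distrib]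
      erw [this]
      ring
  map_smul' c F := by
    funext l
    induction l generalizing F with
    | nil => simp [barFun]
    | cons s l ih =>
      have := ih (fun l' => F (s :: l'))
      simp only [Pi.smul_apply, smul_eq_mul, RingHom.id_apply] at this
      simp only [barFun, Pi.smul_apply, smul_eq_mul, RingHom.id_apply, mul_sub, Finset.mul_sum]
      erw [this]
      simp only [mul_left_comm]

@[simp] lemma barD_nil (m : S → S → S → R) (F : List S → R) : barD m F [] = 0 := rfl

/-- The slice of a chain at a first letter. -/
def cut (s : S) : (List S → R) →ₗ[R] (List S → R) where
  toFun F l := F (s :: l)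
  map_add' _ _ := rfl
  map_smul' _ _ := rfl

@[simp] lemma cut_apply (s : S) (F : List S → R) (l : List S) : cut s F l = F (s :: l) := rfl

/-- The slice of a chain at a last letter. -/
def cutLast (s : S) : (List S → R) →ₗ[R] (List S → R) where
  toFun F l := F (l ++ [s])
  map_add' _ _ := rfl
  map_smul' _ _ := rfl

@[simp] lemma cutLast_apply (s : S) (F : List S → R) (l : List S) :
    cutLast s F l = F (l ++ [s]) := rfl

lemma cut_cutLast (s u : S) (F : List S → R) : cut s (cutLast u F) = cutLast u (cut s F) := rfl

lemma barD_cons (m : S → S → S → R) (F : List S → R) (s : S) (l : List S) :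
    barD m F (s :: l) = ∑ t, ∑ u, m t u s * F (t :: u :: l) - barD m (cut s F) l := rfl

lemma cut_barD (m : S → S → S → R) (F : List S → R) (s : S) :
    cut s (barD m F) = ∑ t, ∑ u, m t u s • cut u (cut t F) - barD m (cut s F) := by
  funext l
  simp [barD_cons, Finset.sum_apply]

/-- The underlying function of the internal differential. -/
def intFun (d : S → S → R) (p : S → ZMod 2) : List S → (List S → R) → R
  | [], _ => 0
  | s :: l, F => ∑ t, d t s * F (t :: l) + psign R (p s) * intFun d p l fun l' => F (s :: l')

/-- The differential on lists induced by the differential with matrix `d`, where `p` is the parity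
of the basis elements. -/
def intD (d : S → S → R) (p : S → ZMod 2) : (List S → R) →ₗ[R] (List S → R) where
  toFun F l := intFun d p l F
  map_add' F G := by
    funext l
    induction l generalizing F G with
    | nil => simp [intFun]
    | cons s l ih =>
      have := ih (fun l' => F (s :: l')) (fun l' => G (s :: l'))
      simp only [Pi.add_apply] at this
      simp only [intFun, Pi.add_apply, mul_add, Finset.sum_add_distrib]
      erw [this]
      ring
  map_smul' c F := by
    funext l
    induction l generalizing F with
    | nil => simp [intFun]
    | cons s l ih =>
      have := ih (fun l' => F (s :: l'))
      simp only [Pi.smul_apply, smul_eq_mul, RingHom.id_apply] at this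
      simp only [intFun, Pi.smul_apply, smul_eq_mul, RingHom.id_apply, mul_add, Finset.mul_sum]
      erw [this]
      simp only [mul_left_comm]

@[simp] lemma intD_nil (d : S → S → R) (p : S → ZMod 2) (F : List S → R) : intD d p F [] = 0 := rfl

lemma intD_cons (d : S → S → R) (p : S → ZMod 2) (F : List S → R) (s : S) (l : List S) :
    intD d p F (s :: l) =
      ∑ t, d t s * F (t :: l) + psign R (p s) * intD d p (cut s F) l := rfl

lemma cut_intD (d : S → S → R) (p : S → ZMod 2) (F : List S → R) (s : S) :
    cut s (intD d p F) = ∑ t, d t s • cut t F + psign R (p s) • intD d p (cut s F) := by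
  funext l
  simp [intD_cons, Finset.sum_apply]

/-- The parity of a list. -/
def lpar (p : S → ZMod 2) (l : List S) : ZMod 2 := (l.map p).sum

@[simp] lemma lpar_nil (p : S → ZMod 2) : lpar p [] = 0 := rfl

@[simp] lemma lpar_cons (p : S → ZMod 2) (s : S) (l : List S) :
    lpar p (s :: l) = p s + lpar p l := by simp [lpar]

@[simp] lemma lpar_append (p : S → ZMod 2) (l l' : List S) :
    lpar p (l ++ l') = lpar p l + lpar p l' := by simp [lpar]

/-- The axioms of a unital dg-algebra in terms of structure constants, with parities instead of
degrees. -/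
structure DGLaws (m : S → S → S → R) (d : S → S → R) (p : S → ZMod 2) (e : S) : Prop where
  one_mul_self : ∀ s, m e s s = 1
  one_mul_ne : ∀ s t, t ≠ s → m e t s = 0
  mul_one_self : ∀ s, m s e s = 1
  mul_one_ne : ∀ s t, t ≠ s → m t e s = 0
  assoc : ∀ a b c s, ∑ x, m a b x * m x c s = ∑ x, m b c x * m a x s
  d_one : ∀ s, d e s = 0
  leibniz : ∀ t u s, ∑ x, m t u x * d x s =
    ∑ x, d t x * m x u s + psign R (p t) * ∑ x, d u x * m t x s
  d_sq : ∀ t s, ∑ x, d t x * d x s = 0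
  par_one : p e = 0
  par_mul : ∀ t u s, m t u s ≠ 0 → p s = p t + p u
  par_d : ∀ t s, d t s ≠ 0 → p s = p t + 1

section Laws

variable {m : S → S → S → R} {d : S → S → R} {p : S → ZMod 2} {e : S}

/-- Associativity, paired with a function `H` of three basis elements. -/
lemma DGLaws.assoc_sum (h : DGLaws m d p e) (H : S → S → S → R) (s : S) :
    ∑ t, ∑ u, m t u s * ∑ a, ∑ b, m a b t * H a b u =
      ∑ t, ∑ u, m t u s * ∑ a, ∑ b, m a b u * H t a b := by
  have e1 : ∑ t, ∑ u, m t u s * ∑ a, ∑ b, m a b t * H a b u =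
      ∑ u, ∑ a, ∑ b, (∑ t, m a b t * m t u s) * H a b u := by
    rw [Finset.sum_comm]
    refine Finset.sum_congr rfl fun u _ => ?_
    simp only [Finset.mul_sum, Finset.sum_mul]
    rw [Finset.sum_comm]
    refine Finset.sum_congr rfl fun a _ => ?_
    rw [Finset.sum_comm]
    exact Finset.sum_congr rfl fun b _ => Finset.sum_congr rfl fun t _ => by ring
  have e2 : ∑ t, ∑ u, m t u s * ∑ a, ∑ b, m a b u * H t a b =
      ∑ t, ∑ a, ∑ b, (∑ u, m a b u * m t u s) * H t a b := by
    refine Finset.sum_congr rfl fun t _ => ?_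
    simp only [Finset.mul_sum, Finset.sum_mul]
    rw [Finset.sum_comm]
    refine Finset.sum_congr rfl fun a _ => ?_
    rw [Finset.sum_comm]
    exact Finset.sum_congr rfl fun b _ => Finset.sum_congr rfl fun t _ => by ring
  rw [e1, e2]
  simp only [h.assoc]
  rw [Finset.sum_comm]
  refine Finset.sum_congr rfl fun a _ => ?_
  rw [Finset.sum_comm]

/-- The Leibniz rule, paired with a function `H` of two basis elements. -/
lemma DGLaws.leibniz_sum (h : DGLaws m d p e) (H : S → S → R) (s : S) :
    ∑ t, ∑ u, m t u s * (∑ a, d a t * H a u + psign R (p t) * ∑ a, d a u * H t a) =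
      ∑ a, d a s * ∑ t, ∑ u, m t u a * H t u := by
  have e0 : ∑ a, d a s * ∑ t, ∑ u, m t u a * H t u =
      ∑ t, ∑ u, (∑ a, m t u a * d a s) * H t u := by
    simp only [Finset.mul_sum, Finset.sum_mul]
    rw [Finset.sum_comm]
    refine Finset.sum_congr rfl fun t _ => ?_
    rw [Finset.sum_comm]
    exact Finset.sum_congr rfl fun _ _ => Finset.sum_congr rfl fun _ _ => by ring
  rw [e0]
  simp only [h.leibniz, add_mul, mul_add, Finset.sum_add_distrib]
  congr 1
  · simp only [Finset.mul_sum, Finset.sum_mul]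
    rw [Finset.sum_comm]
    rw [Finset.sum_congr rfl fun u _ => Finset.sum_comm]
    rw [Finset.sum_comm]
    exact Finset.sum_congr rfl fun _ _ => Finset.sum_congr rfl fun _ _ =>
      Finset.sum_congr rfl fun _ _ => by ring
  · refine Finset.sum_congr rfl fun t _ => ?_
    simp only [Finset.mul_sum, Finset.sum_mul]
    rw [Finset.sum_comm]
    exact Finset.sum_congr rfl fun _ _ => Finset.sum_congr rfl fun _ _ => by ring

lemma DGLaws.mul_par (h : DGLaws m d p e) (f : ZMod 2 → R) (t u s : S) :
    m t u s * f (p s) = m t u s * f (p t + p u) := by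
  by_cases h0 : m t u s = 0
  · simp [h0]
  · rw [h.par_mul _ _ _ h0]

lemma DGLaws.d_par (h : DGLaws m d p e) (f : ZMod 2 → R) (t s : S) :
    d t s * f (p s) = d t s * f (p t + 1) := by
  by_cases h0 : d t s = 0
  · simp [h0]
  · rw [h.par_d _ _ h0]

theorem barD_barD (h : DGLaws m d p e) (F : List S → R) : barD m (barD m F) = 0 := by
  funext l
  induction l generalizing F with
  | nil => rfl
  | cons s l ih =>
    rw [barD_cons, cut_barD, map_sub, Pi.sub_apply, ih (cut s F)]
    simp only [barD_cons, map_sum, map_smul, Finset.sum_apply, Pi.smul_apply, smul_eq_mul,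
      cut_apply, mul_sub, Finset.sum_sub_distrib, Pi.zero_apply]
    have := h.assoc_sum (fun a b c => F (a :: b :: c :: l)) s
    rw [this]
    ring

theorem intD_intD (h : DGLaws m d p e) (F : List S → R) : intD d p (intD d p F) = 0 := by
  funext l
  induction l generalizing F with
  | nil => rfl
  | cons s l ih =>
    rw [intD_cons, cut_intD, map_add, Pi.add_apply, map_smul, Pi.smul_apply, ih (cut s F)]
    simp only [intD_cons, map_sum, map_smul, Finset.sum_apply, Pi.smul_apply, smul_eq_mul,
      cut_apply, mul_add, Finset.sum_add_distrib, Pi.zero_apply]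
    have e1 : ∑ t, d t s * ∑ a, d a t * F (a :: l) = 0 := by
      simp only [Finset.mul_sum]
      rw [Finset.sum_comm]
      refine Finset.sum_eq_zero fun a _ => ?_
      have := h.d_sq a s
      calc _ = (∑ x, d a x * d x s) * F (a :: l) := by
            rw [Finset.sum_mul]; exact Finset.sum_congr rfl fun _ _ => by ring
        _ = 0 := by rw [this, zero_mul]
    rw [e1, Finset.mul_sum, zero_add, mul_zero, mul_zero, add_zero, ← Finset.sum_add_distrib]
    refine Finset.sum_eq_zero fun t _ => ?_
    have := h.d_par (psign R) t s
    rw [psign_add, psign_one] at this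
    linear_combination (intD d p (cut t F) l) * this

theorem barD_intD (h : DGLaws m d p e) (F : List S → R) :
    barD m (intD d p F) = intD d p (barD m F) := by
  funext l
  induction l generalizing F with
  | nil => rfl
  | cons s l ih =>
    rw [barD_cons, cut_intD, intD_cons, cut_barD, map_add, Pi.add_apply, map_smul, Pi.smul_apply,
      ih (cut s F), map_sub, Pi.sub_apply]
    have key := h.leibniz_sum (fun a u => F (a :: u :: l)) s
    have e1 : ∀ t u, m t u s * intD d p F (t :: u :: l) =
        m t u s * (∑ a, d a t * F (a :: u :: l) + psign R (p t) * ∑ a, d a u * F (t :: a :: l)) +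
        psign R (p s) * (m t u s * intD d p (cut u (cut t F)) l) := by
      intro t u
      have := h.mul_par (psign R) t u s
      rw [psign_add] at this
      simp only [intD_cons, cut_apply]
      linear_combination -(intD d p (cut u (cut t F)) l) * this
    simp only [e1, Finset.sum_add_distrib, key, ← Finset.mul_sum]
    simp only [barD_cons, map_sum, map_smul, Finset.sum_apply, Pi.smul_apply, smul_eq_mul,
      mul_sub, Finset.sum_sub_distrib]
    ring

lemma barD_append (m : S → S → S → R) (F : List S → R) (l : List S) (u : S) :
    barD m F (l ++ [u]) = barD m (cutLast u F) l +
      psign R l.length * ∑ a, ∑ b, m a b u * F (l ++ [a, b]) := by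
  induction l generalizing F with
  | nil => simp [barD_cons]
  | cons s l ih =>
    rw [List.cons_append, barD_cons, ih, barD_cons, cut_cutLast, List.length_cons, Nat.cast_succ,
      psign_add, psign_one]
    simp only [cut_apply, cutLast_apply, List.cons_append]
    ring

lemma intD_append (d : S → S → R) (p : S → ZMod 2) (F : List S → R) (l : List S) (u : S) :
    intD d p F (l ++ [u]) = intD d p (cutLast u F) l +
      psign R (lpar p l) * ∑ a, d a u * F (l ++ [a]) := by
  induction l generalizing F with
  | nil => simp [intD_cons]
  | cons s l ih =>
    rw [List.cons_append, intD_cons, ih, intD_cons, cut_cutLast, lpar_cons, psign_add]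
    simp only [cut_apply, cutLast_apply, List.cons_append]
    ring

/-- The bar differential lowers the length by one and preserves the parity. -/
lemma barD_twist (hm : ∀ t u s, m t u s ≠ 0 → p s = p t + p u) (g : ZMod 2 → ZMod 2 → R)
    (F : List S → R) (l : List S) :
    barD m (fun l' => g l'.length (lpar p l') * F l') l =
      g (l.length + 1) (lpar p l) * barD m F l := by
  induction l generalizing F g with
  | nil => simp
  | cons s l ih =>
    rw [barD_cons, barD_cons]
    have e1 := ih (fun a b => g (a + 1) (p s + b)) (cut s F)
    have e2 : cut s (fun l' => g l'.length (lpar p l') * F l') =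
        fun l' => g (l'.length + 1) (p s + lpar p l') * cut s F l' := by
      funext l'; simp
    rw [e2, e1, mul_sub, Finset.mul_sum]
    simp only [List.length_cons, Nat.cast_succ, lpar_cons]
    congr 1
    refine Finset.sum_congr rfl fun t _ => ?_
    rw [Finset.mul_sum]
    refine Finset.sum_congr rfl fun u _ => ?_
    by_cases h0 : m t u s = 0
    · simp [h0]
    · rw [hm _ _ _ h0, add_assoc (p t)]; ring

/-- The internal differential preserves the length and changes the parity. -/
lemma intD_twist (hd : ∀ t s, d t s ≠ 0 → p s = p t + 1) (g : ZMod 2 → ZMod 2 → R)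
    (F : List S → R) (l : List S) :
    intD d p (fun l' => g l'.length (lpar p l') * F l') l =
      g l.length (lpar p l + 1) * intD d p F l := by
  induction l generalizing F g with
  | nil => simp
  | cons s l ih =>
    rw [intD_cons, intD_cons]
    have e1 := ih (fun a b => g (a + 1) (p s + b)) (cut s F)
    have e2 : cut s (fun l' => g l'.length (lpar p l') * F l') =
        fun l' => g (l'.length + 1) (p s + lpar p l') * cut s F l' := by
      funext l'; simp
    rw [e2, e1, mul_add, Finset.mul_sum]
    simp only [List.length_cons, Nat.cast_succ, lpar_cons, add_assoc]
    congr 1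
    · refine Finset.sum_congr rfl fun t _ => ?_
      by_cases h0 : d t s = 0
      · simp [h0]
      · have : p t + lpar p l = p s + (lpar p l + 1) := by
          have h11 : (1 + 1 : ZMod 2) = 0 := by decide
          rw [hd _ _ h0]; linear_combination -h11
        rw [this]; ring
    · ring

end Laws

end Lists

/-! ### The Hochschild differential and its cyclic part -/

section Cyclic

variable {R S : Type*} [CommRing R] [Fintype S]

/-- A Hochschild chain, given by the coefficients `Y s l` at `β_s ⊗ β_{l_1} ⊗ ⋯ ⊗ β_{l_n}`, as a
function on lists. -/
def uncons : (S → List S → R) →ₗ[R] (List S → R) where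
  toFun Y l := match l with
    | [] => 0
    | s :: l => Y s l
  map_add' Y Z := by funext l; cases l <;> simp
  map_smul' c Y := by funext l; cases l <;> simp

@[simp] lemma uncons_nil (Y : S → List S → R) : uncons Y [] = 0 := rfl

@[simp] lemma uncons_cons (Y : S → List S → R) (s : S) (l : List S) :
    uncons Y (s :: l) = Y s l := rfl

@[simp] lemma cut_uncons (Y : S → List S → R) (s : S) : cut s (uncons Y) = Y s := rfl

/-- The summand of the Hochschild differential that multiplies the last factor with the first. -/
def cycD (m : S → S → S → R) (p : S → ZMod 2) :
    (S → List S → R) →ₗ[R] (S → List S → R) where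
  toFun Y s l := psign R (l.length + 1) *
    ∑ t, ∑ u, psign R (p u * (p t + lpar p l)) * m u t s * Y t (l ++ [u])
  map_add' Y Z := by
    funext s l
    simp only [Pi.add_apply, mul_add, Finset.sum_add_distrib]
  map_smul' c Y := by
    funext s l
    simp only [Pi.smul_apply, smul_eq_mul, RingHom.id_apply, Finset.mul_sum]
    exact Finset.sum_congr rfl fun _ _ => Finset.sum_congr rfl fun _ _ => by ring

lemma cycD_apply (m : S → S → S → R) (p : S → ZMod 2) (Y : S → List S → R) (s : S) (l : List S) :
    cycD m p Y s l = psign R (l.length + 1) *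
      ∑ t, ∑ u, psign R (p u * (p t + lpar p l)) * m u t s * Y t (l ++ [u]) := rfl

/-- The Hochschild differential of the multiplication. -/
def hochMul (m : S → S → S → R) (p : S → ZMod 2) :
    (S → List S → R) →ₗ[R] (S → List S → R) where
  toFun Y s l := barD m (uncons Y) (s :: l) + cycD m p Y s l
  map_add' Y Z := by
    funext s l
    simp only [map_add, Pi.add_apply]
    ring
  map_smul' c Y := by
    funext s l
    simp only [map_smul, Pi.smul_apply, smul_eq_mul, RingHom.id_apply]
    ring

lemma hochMul_apply (m : S → S → S → R) (p : S → ZMod 2) (Y : S → List S → R) (s : S)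
    (l : List S) :
    hochMul m p Y s l = barD m (uncons Y) (s :: l) + cycD m p Y s l := rfl

/-- The internal differential of Hochschild chains. -/
def hochInt (d : S → S → R) (p : S → ZMod 2) :
    (S → List S → R) →ₗ[R] (S → List S → R) where
  toFun Y s l := intD d p (uncons Y) (s :: l)
  map_add' Y Z := by
    funext s l
    simp only [map_add, Pi.add_apply]
  map_smul' c Y := by
    funext s l
    simp only [map_smul, Pi.smul_apply, smul_eq_mul, RingHom.id_apply]

lemma hochInt_apply (d : S → S → R) (p : S → ZMod 2) (Y : S → List S → R) (s : S) (l : List S) :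
    hochInt d p Y s l = intD d p (uncons Y) (s :: l) := rfl

/-- The differential of the total Hochschild complex, without normalization. -/
def hochTot (m : S → S → S → R) (d : S → S → R) (p : S → ZMod 2) :
    (S → List S → R) →ₗ[R] (S → List S → R) where
  toFun Y s l := hochMul m p Y s l + psign R l.length * hochInt d p Y s l
  map_add' Y Z := by
    funext s l
    simp only [map_add, Pi.add_apply]
    ring
  map_smul' c Y := by
    funext s l
    simp only [map_smul, Pi.smul_apply, smul_eq_mul, RingHom.id_apply]
    ring

lemma hochTot_apply (m : S → S → S → R) (d : S → S → R) (p : S → ZMod 2) (Y : S → List S → R)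
    (s : S) (l : List S) :
    hochTot m d p Y s l = hochMul m p Y s l + psign R l.length * hochInt d p Y s l := rfl

variable {m : S → S → S → R} {d : S → S → R} {p : S → ZMod 2} {e : S}

lemma uncons_hochInt (Y : S → List S → R) :
    uncons (hochInt d p Y) = intD d p (uncons Y) := by
  funext l; cases l <;> rfl

lemma uncons_bar (Y : S → List S → R) :
    uncons (fun s l => barD m (uncons Y) (s :: l)) = barD m (uncons Y) := by
  funext l; cases l <;> rfl

lemma hochInt_hochInt (h : DGLaws m d p e) (Y : S → List S → R) :
    hochInt d p (hochInt d p Y) = 0 := by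
  funext s l
  rw [hochInt_apply, uncons_hochInt, intD_intD h]
  rfl

/-- Multiplying the first two factors anticommutes with multiplying the last with the first. -/
lemma DGLaws.first_cyc (h : DGLaws m d p e) (Y : S → List S → R) (s : S) (l : List S) :
    ∑ t, ∑ u, m t u s * cycD m p Y t (u :: l) =
      - (psign R (l.length + 1) * ∑ t, ∑ u, psign R (p u * (p t + lpar p l)) * m u t s *
        ∑ a, ∑ b, m a b t * Y a (b :: (l ++ [u]))) := by
  have key := h.assoc_sum
    (fun b a u => psign R (p b * (p a + p u + lpar p l)) * Y a (u :: (l ++ [b]))) s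
  have e1 : ∑ t, ∑ u, m t u s * cycD m p Y t (u :: l) = psign R l.length *
      ∑ t, ∑ u, m t u s * ∑ b, ∑ a, m b a t *
        (psign R (p b * (p a + p u + lpar p l)) * Y a (u :: (l ++ [b]))) := by
    simp only [Finset.mul_sum (a := psign R (l.length : ZMod 2))]
    refine Finset.sum_congr rfl fun t _ => Finset.sum_congr rfl fun u _ => ?_
    rw [cycD_apply, Finset.sum_comm]
    simp only [List.length_cons, Nat.cast_succ, lpar_cons, List.cons_append]
    have h2 : psign R (l.length + 1 + 1 : ZMod 2) = psign R l.length := by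
      rw [add_assoc, CharTwo.add_self_eq_zero, add_zero]
    rw [h2, ← mul_assoc, mul_comm (m t u s), mul_assoc]
    congr 2
    refine Finset.sum_congr rfl fun b _ => Finset.sum_congr rfl fun a _ => ?_
    rw [← add_assoc]; ring
  have e2 : ∑ t, ∑ u, m t u s * ∑ a, ∑ b, m a b u *
        (psign R (p t * (p a + p b + lpar p l)) * Y a (b :: (l ++ [t]))) =
      ∑ t, ∑ u, psign R (p u * (p t + lpar p l)) * m u t s *
        ∑ a, ∑ b, m a b t * Y a (b :: (l ++ [u])) := by
    rw [Finset.sum_comm]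
    refine Finset.sum_congr rfl fun t _ => Finset.sum_congr rfl fun u _ => ?_
    simp only [Finset.mul_sum]
    refine Finset.sum_congr rfl fun a _ => Finset.sum_congr rfl fun b _ => ?_
    have := h.mul_par (fun x => psign R (p u * (x + lpar p l))) a b t
    linear_combination (-m u t s * Y a (b :: (l ++ [u]))) * this
  rw [e1, key, e2, psign_add, psign_one]
  ring

/-- Multiplying two inner factors anticommutes with multiplying the last factor with the first
one. -/
lemma DGLaws.bar_cyc (h : DGLaws m d p e) (Y : S → List S → R) (s : S) (l : List S) :
    barD m (cycD m p Y s) l =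
      psign R l.length * ∑ t, ∑ u, psign R (p u * (p t + lpar p l)) * m u t s *
        barD m (cutLast u (Y t)) l := by
  have e1 : cycD m p Y s = ∑ t, ∑ u, m u t s • fun l' : List S =>
      (fun a b => psign R (a + 1) * psign R (p u * (p t + b))) l'.length (lpar p l') *
        cutLast u (Y t) l' := by
    funext l'
    rw [cycD_apply]
    simp only [Finset.sum_apply, Pi.smul_apply, smul_eq_mul, cutLast_apply, Finset.mul_sum]
    exact Finset.sum_congr rfl fun _ _ => Finset.sum_congr rfl fun _ _ => by ring
  rw [e1]
  simp only [map_sum, map_smul, Finset.sum_apply, Pi.smul_apply, smul_eq_mul, Finset.mul_sum]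
  refine Finset.sum_congr rfl fun t _ => Finset.sum_congr rfl fun u _ => ?_
  have := barD_twist h.par_mul (fun a b => psign R (a + 1) * psign R (p u * (p t + b)))
    (cutLast u (Y t)) l
  rw [this]
  have h2 : psign R (l.length + 1 + 1 : ZMod 2) = psign R l.length := by
    rw [add_assoc, CharTwo.add_self_eq_zero, add_zero]
  rw [h2]
  ring

/-- Multiplying the last factor with the first one twice is, by associativity, the same as
multiplying the last two factors before. -/
lemma DGLaws.cyc_cyc (h : DGLaws m d p e) (Y : S → List S → R) (s : S) (l : List S) :
    cycD m p (cycD m p Y) s l =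
      - ∑ t, ∑ u, psign R (p u * (p t + lpar p l)) * m u t s *
        ∑ a, ∑ b, m a b u * Y t (l ++ [a, b]) := by
  have key := h.assoc_sum
    (fun u b a => psign R ((p u + p b) * (p a + lpar p l)) * Y a (l ++ [u, b])) s
  have e1 : cycD m p (cycD m p Y) s l = - ∑ t, ∑ u, m t u s * ∑ b, ∑ a, m b a u *
        (psign R ((p t + p b) * (p a + lpar p l)) * Y a (l ++ [t, b])) := by
    rw [cycD_apply]
    simp only [Finset.mul_sum (a := psign R (l.length + 1 : ZMod 2)), ← Finset.sum_neg_distrib]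
    rw [Finset.sum_comm]
    refine Finset.sum_congr rfl fun t _ => Finset.sum_congr rfl fun u _ => ?_
    rw [cycD_apply]
    simp only [Finset.mul_sum, ← Finset.sum_neg_distrib]
    rw [Finset.sum_comm]
    refine Finset.sum_congr rfl fun b _ => Finset.sum_congr rfl fun a _ => ?_
    have h1 := h.mul_par (fun x => psign R (p t * (x + lpar p l))) b a u
    have h2 : psign R ((l ++ [t]).length + 1 : ZMod 2) = psign R l.length := by
      rw [List.length_append, List.length_singleton, Nat.cast_succ, add_assoc,
        CharTwo.add_self_eq_zero, add_zero]
    have h3 : psign R (p t * (p b + p a + lpar p l)) * psign R (p b * (p a + lpar p (l ++ [t]))) =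
        psign R ((p t + p b) * (p a + lpar p l)) := by
      rw [← psign_add]
      congr 1
      have h11 : (2 : ZMod 2) = 0 := by decide
      simp only [lpar_append, lpar_cons, lpar_nil, add_zero]
      linear_combination (p t * p b) * h11
    have h4 : psign R (l.length : ZMod 2) * psign R (l.length : ZMod 2) = 1 := psign_mul_self _
    rw [h2, psign_add, psign_one, ← h3]
    simp only [List.append_assoc, List.cons_append, List.nil_append]
    linear_combination (-m t u s * psign R (p b * (p a + lpar p (l ++ [t]))) *
      Y a (l ++ [t, b])) * h1 - (psign R (p t * (p u + lpar p l)) * m t u s *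
      psign R (p b * (p a + lpar p (l ++ [t]))) * m b a u * Y a (l ++ [t, b])) * h4
  rw [e1, ← key, neg_inj, Finset.sum_comm]
  refine Finset.sum_congr rfl fun t _ => Finset.sum_congr rfl fun u _ => ?_
  simp only [Finset.mul_sum]
  refine Finset.sum_congr rfl fun a _ => Finset.sum_congr rfl fun b _ => ?_
  have := h.mul_par (fun x => psign R (x * (p t + lpar p l))) a b u
  linear_combination (-m u t s * Y t (l ++ [a, b])) * this

/-- The Hochschild differential of an associative product squares to zero: the bar part does, and
the terms with the cyclic summand cancel in pairs. -/
theorem hochMul_hochMul (h : DGLaws m d p e) (Y : S → List S → R) :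
    hochMul m p (hochMul m p Y) = 0 := by
  have hsplit : hochMul m p Y = (fun s l => barD m (uncons Y) (s :: l)) + cycD m p Y := rfl
  funext s l
  rw [hochMul_apply]
  rw [hsplit, map_add, map_add, map_add, uncons_bar, barD_barD h]
  simp only [Pi.add_apply, Pi.zero_apply, zero_add]
  have e1 : cycD m p (fun s l => barD m (uncons Y) (s :: l)) s l =
      psign R (l.length + 1) * ∑ t, ∑ u, psign R (p u * (p t + lpar p l)) * m u t s *
        ∑ a, ∑ b, m a b t * Y a (b :: (l ++ [u])) -
      psign R (l.length + 1) * ∑ t, ∑ u, psign R (p u * (p t + lpar p l)) * m u t s *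
        barD m (cutLast u (Y t)) l +
      ∑ t, ∑ u, psign R (p u * (p t + lpar p l)) * m u t s *
        ∑ a, ∑ b, m a b u * Y t (l ++ [a, b]) := by
    have h4 : psign R (l.length + 1 : ZMod 2) * psign R (l.length : ZMod 2) = -1 := by
      rw [psign_add, psign_one, mul_neg_one, neg_mul, psign_mul_self]
    rw [cycD_apply]
    simp only [Finset.mul_sum (a := psign R (l.length + 1 : ZMod 2)), ← Finset.sum_sub_distrib,
      ← Finset.sum_add_distrib]
    refine Finset.sum_congr rfl fun t _ => Finset.sum_congr rfl fun u _ => ?_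
    rw [barD_cons, cut_uncons, barD_append]
    simp only [uncons_cons]
    linear_combination (-(psign R (p u * (p t + lpar p l)) * m u t s *
        ∑ a, ∑ b, m a b u * Y t (l ++ [a, b]))) * h4
  rw [e1, h.cyc_cyc, barD_cons, cut_uncons, h.bar_cyc]
  simp only [uncons_cons]
  rw [h.first_cyc, psign_add, psign_one]
  ring

/-- The internal differential is a derivation of the product of the last factor with the first. -/
lemma DGLaws.cyc_int (h : DGLaws m d p e) (Y : S → List S → R) :
    cycD m p (hochInt d p Y) = hochInt d p (cycD m p Y) := by
  funext s l
  have e1 : intD d p (cycD m p Y s) l =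
      psign R (l.length + 1) * ∑ t, ∑ u, psign R (p u * (p t + lpar p l + 1)) * m u t s *
        intD d p (cutLast u (Y t)) l := by
    have e1 : cycD m p Y s = ∑ t, ∑ u, m u t s • fun l' : List S =>
        (fun a b => psign R (a + 1) * psign R (p u * (p t + b))) l'.length (lpar p l') *
          cutLast u (Y t) l' := by
      funext l'
      rw [cycD_apply]
      simp only [Finset.sum_apply, Pi.smul_apply, smul_eq_mul, cutLast_apply, Finset.mul_sum]
      exact Finset.sum_congr rfl fun _ _ => Finset.sum_congr rfl fun _ _ => by ring
    rw [e1]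
    simp only [map_sum, map_smul, Finset.sum_apply, Pi.smul_apply, smul_eq_mul, Finset.mul_sum]
    refine Finset.sum_congr rfl fun t _ => Finset.sum_congr rfl fun u _ => ?_
    have := intD_twist h.par_d (fun a b => psign R (a + 1) * psign R (p u * (p t + b)))
      (cutLast u (Y t)) l
    rw [this, ← add_assoc (p t)]
    ring
  have key := h.leibniz_sum
    (fun u t => psign R (p u * (p t + lpar p l)) * Y t (l ++ [u])) s
  have e2 : ∑ a, d a s * cycD m p Y a l = psign R (l.length + 1) *
      ∑ a, d a s * ∑ u, ∑ t, m u t a * (psign R (p u * (p t + lpar p l)) * Y t (l ++ [u])) := by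
    rw [Finset.mul_sum]
    refine Finset.sum_congr rfl fun a _ => ?_
    rw [cycD_apply, Finset.sum_comm, mul_left_comm]
    congr 2
    exact Finset.sum_congr rfl fun _ _ => Finset.sum_congr rfl fun _ _ => by ring
  rw [hochInt_apply, intD_cons, cut_uncons, e1]
  simp only [uncons_cons]
  rw [e2, ← key, Finset.sum_comm, mul_left_comm, ← mul_add, cycD_apply]
  congr 1
  rw [Finset.mul_sum, ← Finset.sum_add_distrib]
  refine Finset.sum_congr rfl fun t _ => ?_
  rw [Finset.mul_sum, ← Finset.sum_add_distrib]
  refine Finset.sum_congr rfl fun u _ => ?_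
  rw [hochInt_apply, intD_cons, cut_uncons, intD_append]
  simp only [uncons_cons]
  have f1 : ∑ a, d a u * (psign R (p a * (p t + lpar p l)) * Y t (l ++ [a])) =
      psign R ((p u + 1) * (p t + lpar p l)) * ∑ a, d a u * Y t (l ++ [a]) := by
    rw [Finset.mul_sum]
    refine Finset.sum_congr rfl fun a _ => ?_
    by_cases h0 : d a u = 0
    · simp [h0]
    · have : p u + 1 = p a := by
        have h11 : (1 + 1 : ZMod 2) = 0 := by decide
        rw [h.par_d _ _ h0]; linear_combination h11
      rw [this]; ring
  have f2 : ∑ a, d a t * (psign R (p u * (p a + lpar p l)) * Y a (l ++ [u])) =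
      psign R (p u * (p t + 1 + lpar p l)) * ∑ a, d a t * Y a (l ++ [u]) := by
    rw [Finset.mul_sum]
    refine Finset.sum_congr rfl fun a _ => ?_
    by_cases h0 : d a t = 0
    · simp [h0]
    · have : p t + 1 = p a := by
        have h11 : (1 + 1 : ZMod 2) = 0 := by decide
        rw [h.par_d _ _ h0]; linear_combination h11
      rw [this]; ring
  rw [f1, f2]
  have g1 := h.mul_par (psign R) u t s
  have g2 : psign R (p u * (p t + 1 + lpar p l)) =
      psign R (p u * (p t + lpar p l)) * psign R (p u) := by
    rw [← psign_add]; congr 1; ring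
  have g3 : psign R ((p u + 1) * (p t + lpar p l)) =
      psign R (p u * (p t + lpar p l)) * (psign R (p t) * psign R (lpar p l)) := by
    rw [← psign_add, ← psign_add]; congr 1; ring
  have g4 : psign R (p u * (p t + lpar p l + 1)) =
      psign R (p u * (p t + lpar p l)) * psign R (p u) := by
    rw [← psign_add]; congr 1; ring
  have g5 : psign R (p u) * psign R (p u) = 1 := psign_mul_self _
  rw [psign_add] at g1
  rw [g2, g3, g4]
  linear_combination (-psign R (p u * (p t + lpar p l)) * psign R (p u) *
    intD d p (cutLast u (Y t)) l) * g1 - (m u t s * psign R (p u * (p t + lpar p l)) *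
    (psign R (p t) * intD d p (cutLast u (Y t)) l + ∑ a, d a t * Y a (l ++ [u]))) * g5

theorem hochMul_hochInt (h : DGLaws m d p e) (Y : S → List S → R) :
    hochMul m p (hochInt d p Y) = hochInt d p (hochMul m p Y) := by
  have hsplit : hochMul m p Y = (fun s l => barD m (uncons Y) (s :: l)) + cycD m p Y := rfl
  rw [hsplit, map_add, ← h.cyc_int]
  funext s l
  rw [hochMul_apply, Pi.add_apply, Pi.add_apply, hochInt_apply, uncons_hochInt, uncons_bar,
    barD_intD h]

end Cyclic

/-! ### The total differential -/

section Total

variable {R S : Type*} [CommRing R] [Fintype S]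
variable {m : S → S → S → R} {d : S → S → R} {p : S → ZMod 2} {e : S}

lemma hochMul_twist (h : DGLaws m d p e) (Z : S → List S → R) (s : S) (l : List S) :
    hochMul m p (fun s l => psign R l.length * Z s l) s l =
      psign R (l.length + 1) * hochMul m p Z s l := by
  have e1 : uncons (fun s l => psign R l.length * Z s l) =
      fun l' => (fun a _ => psign R (a + 1)) (l'.length : ZMod 2) (lpar p l') * uncons Z l' := by
    funext l'
    cases l' with
    | nil => simp
    | cons a l' =>
      have h2 : psign R (l'.length + 1 + 1 : ZMod 2) = psign R l'.length := by
        rw [add_assoc, CharTwo.add_self_eq_zero, add_zero]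
      simp [h2]
  rw [hochMul_apply, hochMul_apply, e1, barD_twist h.par_mul (fun a _ => psign R (a + 1)), mul_add]
  congr 1
  · have h2 : psign R ((s :: l).length + 1 + 1 : ZMod 2) = psign R (l.length + 1) := by
      rw [add_assoc, CharTwo.add_self_eq_zero, add_zero, List.length_cons, Nat.cast_succ]
    rw [h2]
  · simp only [cycD_apply, Finset.mul_sum]
    refine Finset.sum_congr rfl fun t _ => Finset.sum_congr rfl fun u _ => ?_
    rw [List.length_append, List.length_singleton, Nat.cast_succ]
    ring

lemma hochInt_twist (h : DGLaws m d p e) (Z : S → List S → R) (s : S) (l : List S) :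
    hochInt d p (fun s l => psign R l.length * Z s l) s l =
      psign R l.length * hochInt d p Z s l := by
  have e1 : uncons (fun s l => psign R l.length * Z s l) =
      fun l' => (fun a _ => psign R (a + 1)) (l'.length : ZMod 2) (lpar p l') * uncons Z l' := by
    funext l'
    cases l' with
    | nil => simp
    | cons a l' =>
      have h2 : psign R (l'.length + 1 + 1 : ZMod 2) = psign R l'.length := by
        rw [add_assoc, CharTwo.add_self_eq_zero, add_zero]
      simp [h2]
  rw [hochInt_apply, hochInt_apply, e1, intD_twist h.par_d (fun a _ => psign R (a + 1))]
  have h2 : psign R ((s :: l).length + 1 : ZMod 2) = psign R l.length := by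
    rw [List.length_cons, Nat.cast_succ, add_assoc, CharTwo.add_self_eq_zero, add_zero]
  rw [h2]

theorem hochTot_hochTot (h : DGLaws m d p e) (Y : S → List S → R) :
    hochTot m d p (hochTot m d p Y) = 0 := by
  have hsplit : hochTot m d p Y =
    hochMul m p Y + fun s l => psign R l.length * hochInt d p Y s l := rfl
  funext s l
  rw [hochTot_apply, hsplit, map_add, map_add, hochMul_hochMul h, Pi.add_apply, Pi.add_apply,
    Pi.add_apply, Pi.add_apply, hochMul_twist h, hochInt_twist h, hochInt_hochInt h,
    hochMul_hochInt h, psign_add, psign_one]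
  simp

/-! ### Normalization -/

/-- If one of two factors is the unit, then their product is a basis element `s ≠ 1` in two ways
only. -/
lemma DGLaws.sum_unit (h : DGLaws m d p e) (s : S) (hs : s ≠ e) (H : S → S → R)
    (hH : ∀ t u, t ≠ e → u ≠ e → H t u = 0) :
    ∑ t, ∑ u, m t u s * H t u = H e s + H s e := by
  classical
  have : ∀ t u, m t u s * H t u = (if t = e then if u = s then H e s else 0 else 0) +
      (if t = s then if u = e then H s e else 0 else 0) := by
    intro t u
    by_cases ht : t = e
    · subst ht
      by_cases hu : u = s
      · subst hu; simp [h.one_mul_self, hs.symm]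
      · simp [h.one_mul_ne _ _ hu, hu, hs.symm]
    · by_cases hu : u = e
      · subst hu
        by_cases hts : t = s
        · subst hts; simp [h.mul_one_self, ht]
        · simp [h.mul_one_ne _ _ hts, ht, hts]
      · simp [hH t u ht hu, ht, hu]
  simp [this, Finset.sum_add_distrib]

lemma DGLaws.sum_unit_right (h : DGLaws m d p e) (s : S) (H : S → S → R)
    (hH : ∀ t u, u ≠ e → H t u = 0) : ∑ t, ∑ u, m t u s * H t u = H s e := by
  classical
  have : ∀ t u, m t u s * H t u = if t = s then if u = e then H s e else 0 else 0 := by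
    intro t u
    by_cases hu : u = e
    · subst hu
      by_cases hts : t = s
      · subst hts; simp [h.mul_one_self]
      · simp [h.mul_one_ne _ _ hts, hts]
    · simp [hH t u hu, hu]
  simp [this]

/-- A bar chain that is supported on tensors with a unit factor has a boundary whose coefficients
at the other tensors come from units at the two ends only. -/
lemma DGLaws.barD_degenerate (h : DGLaws m d p e) (H : List S → R) (hH : ∀ l, e ∉ l → H l = 0)
    (l : List S) (hl : e ∉ l) :
    barD m H l = H (e :: l) - psign R l.length * H (l ++ [e]) := by
  induction l generalizing H with
  | nil => simp
  | cons s l ih =>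
    obtain ⟨hs, hl⟩ := not_or.1 (mt List.mem_cons.2 hl)
    rw [barD_cons, h.sum_unit s (Ne.symm hs), ih (cut s H) _ hl]
    · simp only [cut_apply, List.length_cons, Nat.cast_succ, psign_add, psign_one,
        List.cons_append]
      ring
    · exact fun l' hl' => hH _ (by simp [hs, hl'])
    · exact fun t u ht hu => hH _ (by simp [ht.symm, hu.symm, hl])

lemma DGLaws.intD_degenerate (h : DGLaws m d p e) (H : List S → R) (hH : ∀ l, e ∉ l → H l = 0)
    (l : List S) (hl : e ∉ l) : intD d p H l = 0 := by
  induction l generalizing H with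
  | nil => simp
  | cons s l ih =>
    obtain ⟨hs, hl⟩ := not_or.1 (mt List.mem_cons.2 hl)
    rw [intD_cons, ih (cut s H) _ hl, mul_zero, add_zero]
    · refine Finset.sum_eq_zero fun t _ => ?_
      by_cases ht : t = e
      · simp [ht, h.d_one]
      · rw [hH _ (by simp [hl, Ne.symm ht]), mul_zero]
    · exact fun l' hl' => hH _ (by simp [hs, hl'])

/-- The degenerate chains form a subcomplex: the two terms in which a unit at either end is
multiplied with the factor with index zero cancel. -/
theorem DGLaws.hochTot_degenerate (h : DGLaws m d p e) (H : S → List S → R)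
    (hH : ∀ s l, e ∉ l → H s l = 0) (s : S) (l : List S) (hl : e ∉ l) :
    hochTot m d p H s l = 0 := by
  rw [hochTot_apply, hochMul_apply, hochInt_apply, barD_cons, intD_cons, cut_uncons]
  simp only [uncons_cons]
  rw [h.sum_unit_right s _ (fun t u hu => hH _ _ (by simp [hu.symm, hl])),
    h.barD_degenerate _ (hH s) _ hl, h.intD_degenerate _ (hH s) _ hl, cycD_apply, Finset.sum_comm]
  rw [Finset.sum_eq_zero (f := fun t => d t s * H t l)
    (fun t _ => by rw [hH _ _ hl, mul_zero]), Finset.sum_comm, Finset.sum_comm]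
  have e1 : ∑ u, ∑ t, psign R (p u * (p t + lpar p l)) * m u t s * H t (l ++ [u]) =
      H s (l ++ [e]) := by
    have hu : ∀ u, u ≠ e → ∀ t, H t (l ++ [u]) = 0 := fun u hu t => hH _ _ (by simp [hu.symm, hl])
    rw [Fintype.sum_eq_single e fun u hu' => Finset.sum_eq_zero fun t _ => by rw [hu u hu']; ring,
      Fintype.sum_eq_single s fun t ht => by rw [h.one_mul_ne _ _ ht]; ring, h.one_mul_self,
      h.par_one]
    simp
  rw [e1, psign_add, psign_one]
  ring

end Total

/-! ### Hochschild chains as functions of lists -/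

section Conversion

variable {R S : Type*}

/-- The Hochschild chain with coefficients given by a function on lists. -/
def toChain (Y : S → List S → R) : HChain R S := fun _ w => Y (w 0) (List.ofFn fun j => w j.succ)

/-- The coefficients of a Hochschild chain as a function on lists. -/
def ofChain (c : HChain R S) : S → List S → R := fun s l => c l.length (Fin.cons s l.get)

lemma toChain_ofChain (c : HChain R S) : toChain (ofChain c) = c := by
  have key : ∀ (n : ℕ) (l : List S) (w : Fin (n + 1) → S), l.length = n →
      (∀ j : Fin n, ∀ h : (j : ℕ) < l.length, l[(j : ℕ)] = w j.succ) →
      c l.length (Fin.cons (w 0) l.get) = c n w := by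
    rintro n l w rfl hw
    congr 1
    funext j
    refine Fin.cases ?_ (fun j => ?_) j
    · rfl
    · rw [Fin.cons_succ, ← hw j j.2]; rfl
  funext i w
  exact key i _ w (by simp) (by simp)

lemma ofChain_toChain (Y : S → List S → R) : ofChain (toChain Y) = Y := by
  funext s l
  simp [ofChain, toChain, List.ofFn_getElem]

lemma toChain_injective : Function.Injective (toChain : (S → List S → R) → HChain R S) :=
  Function.LeftInverse.injective ofChain_toChain

lemma isDegenerate_iff (A : BasedDGAlgebra R S) {i : ℕ} (w : Fin (i + 1) → S) :
    IsDegenerate A w ↔ A.unit ∈ List.ofFn fun j => w j.succ := by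
  simp [IsDegenerate, List.mem_ofFn]

variable [CommRing R] [Fintype S]

/-- The parities of the basis elements. -/
def BasedDGAlgebra.par (A : BasedDGAlgebra R S) (s : S) : ZMod 2 := A.deg s

open Classical in
/-- The normalized Hochschild differential on functions of lists. -/
noncomputable def hochRed (A : BasedDGAlgebra R S) : (S → List S → R) →ₗ[R] (S → List S → R) where
  toFun Y s l := if A.unit ∈ l then 0 else hochTot A.mul A.diff A.par Y s l
  map_add' Y Z := by
    funext s l
    by_cases h : A.unit ∈ l <;> simp [h]
  map_smul' c Y := by
    funext s l
    by_cases h : A.unit ∈ l <;> simp [h]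

lemma hochRed_of_mem (A : BasedDGAlgebra R S) (Y : S → List S → R) (s : S) {l : List S}
    (h : A.unit ∈ l) : hochRed A Y s l = 0 := if_pos h

lemma hochRed_of_notMem (A : BasedDGAlgebra R S) (Y : S → List S → R) (s : S) {l : List S}
    (h : A.unit ∉ l) : hochRed A Y s l = hochTot A.mul A.diff A.par Y s l := if_neg h

/-- The sum over the positions of a product in a tensor, as the recursively defined bar
differential. -/
lemma sum_insertNth (m : S → S → S → R) (F : List S → R) (n : ℕ) (w : Fin n → S) :
    ∑ j : Fin n, ∑ t : S, ∑ u : S, (-1) ^ (j : ℕ) *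
      F (List.ofFn (Fin.insertNth (α := fun _ => S) j.succ u (Function.update w j t))) *
        m t u (w j) = barD m F (List.ofFn w) := by
  induction n generalizing F with
  | zero => simp
  | succ n ih =>
    rw [Fin.sum_univ_succ, List.ofFn_succ, barD_cons, ← ih (cut (w 0) F), sub_eq_add_neg,
      ← Finset.sum_neg_distrib]
    congr 1
    · refine Finset.sum_congr rfl fun t _ => Finset.sum_congr rfl fun u _ => ?_
      have : Fin.insertNth (α := fun _ => S) (Fin.succ 0) u (Function.update w 0 t) =
          (Fin.cons t (Fin.cons u fun j : Fin n => w j.succ) : Fin (n + 2) → S) := by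
        rw [← Fin.cons_self_tail w, Fin.update_cons_zero]
        funext j
        refine Fin.cases ?_ (fun j => ?_) j
        · rfl
        · refine Fin.cases ?_ (fun j => ?_) j
          · simp
          · have := Fin.insertNth_apply_succAbove (α := fun _ => S) (Fin.succ 0 : Fin (n + 2)) u
              (Fin.cons t (Fin.tail w)) j.succ
            rw [Fin.succ_succAbove_succ] at this
            simp only [Fin.zero_succAbove] at this
            rw [this]
            simp [Fin.tail]
      rw [this]
      simp only [List.ofFn_succ, Fin.cons_zero, Fin.cons_succ, Fin.val_zero, pow_zero, one_mul]
      ring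
    · refine Finset.sum_congr rfl fun j _ => ?_
      rw [← Finset.sum_neg_distrib]
      refine Finset.sum_congr rfl fun t _ => ?_
      rw [← Finset.sum_neg_distrib]
      refine Finset.sum_congr rfl fun u _ => ?_
      have : Fin.insertNth (α := fun _ => S) j.succ.succ u (Function.update w j.succ t) =
          (Fin.cons (w 0) (Fin.insertNth (α := fun _ => S) j.succ u
            (Function.update (fun j : Fin n => w j.succ) j t)) : Fin (n + 2) → S) := by
        have h0 : Function.update w j.succ t =
            (Fin.cons (w 0) (Function.update (fun j : Fin n => w j.succ) j t) :
              Fin (n + 1) → S) := by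
          rw [Fin.cons_update]
          congr 1
          exact (Fin.cons_self_tail w).symm
        rw [h0, Fin.insertNth_eq_iff]
        generalize Function.update (fun j : Fin n => w j.succ) j t = v
        constructor
        · simp
        · funext a
          refine Fin.cases ?_ (fun a => ?_) a <;> simp [Fin.removeNth]
      rw [this]
      simp only [List.ofFn_succ (f := Fin.cons _ _), Fin.cons_zero, Fin.cons_succ, cut_apply,
        Fin.val_succ, pow_succ]
      ring

/-- The sum over the positions in a tensor, as the recursively defined internal differential. -/
lemma sum_update (d : S → S → R) (p : S → ZMod 2) (q : S → ℕ) (hq : ∀ s, (q s : ZMod 2) = p s)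
    (F : List S → R) (n : ℕ) (w : Fin n → S) :
    ∑ j : Fin n, ∑ t : S, (-1) ^ (∑ l ∈ Finset.Iio j, q (w l)) *
      F (List.ofFn (Function.update w j t)) * d t (w j) = intD d p F (List.ofFn w) := by
  induction n generalizing F with
  | zero => simp
  | succ n ih =>
    rw [Fin.sum_univ_succ, List.ofFn_succ, intD_cons, ← ih (cut (w 0) F), Finset.mul_sum]
    congr 1
    · refine Finset.sum_congr rfl fun t _ => ?_
      rw [← Fin.cons_self_tail w, Fin.update_cons_zero]
      have : (Finset.Iio (0 : Fin (n + 1))) = ∅ := by ext x; simp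
      rw [this]
      simp only [Finset.sum_empty, pow_zero, one_mul, List.ofFn_succ, Fin.cons_zero, Fin.cons_succ,
        mul_comm]
    · refine Finset.sum_congr rfl fun j _ => ?_
      rw [Finset.mul_sum]
      refine Finset.sum_congr rfl fun t _ => ?_
      have h0 : Function.update w j.succ t =
          (Fin.cons (w 0) (Function.update (fun j : Fin n => w j.succ) j t) :
            Fin (n + 1) → S) := by
        rw [Fin.cons_update]
        congr 1
        exact (Fin.cons_self_tail w).symm
      have h1 : ∑ l ∈ Finset.Iio j.succ, q (w l) = q (w 0) + ∑ l ∈ Finset.Iio j, q (w l.succ) := by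
        simp only [Finset.sum_filter, ← Finset.filter_gt_eq_Iio]
        rw [Fin.sum_univ_succ]
        simp [Fin.succ_lt_succ_iff]
      rw [h0, h1, pow_add, ← psign_natCast (q (w 0)), hq]
      simp only [List.ofFn_succ (f := Fin.cons _ _), Fin.cons_zero, Fin.cons_succ, cut_apply]
      ring

/-- The Hochschild differential in terms of lists. -/
theorem hochD_toChain (A : BasedDGAlgebra R S) (Y : S → List S → R) :
    hochD A (toChain Y) = toChain (hochRed A Y) := by
  funext i w
  by_cases h : IsDegenerate A w
  · have h' := (isDegenerate_iff A w).1 h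
    rw [toChain, hochRed_of_mem A _ _ h']
    exact if_pos h
  · have h' := mt (isDegenerate_iff A w).2 h
    rw [toChain, hochRed_of_notMem A _ _ h']
    refine (if_neg h).trans ?_
    rw [hochTot_apply, hochMul_apply, hochInt_apply]
    have hofFn : (w 0 :: List.ofFn fun j : Fin i => w j.succ) = List.ofFn w :=
      (List.ofFn_succ (f := w)).symm
    have hY : ∀ (n : ℕ) (v : Fin (n + 1) → S), toChain Y n v = uncons Y (List.ofFn v) := by
      intro n v; rw [List.ofFn_succ]; rfl
    rw [hofFn, ← sum_insertNth, ← sum_update A.diff A.par A.deg (fun _ => rfl), multDiff,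
      internalDiff]
    simp only [hY]
    rw [List.length_ofFn, psign_natCast]
    congr 2
    rw [cycD_apply, Finset.mul_sum]
    refine Finset.sum_congr rfl fun t _ => ?_
    rw [Finset.mul_sum]
    refine Finset.sum_congr rfl fun u _ => ?_
    have h1 : List.ofFn (Fin.snoc (α := fun _ => S) (Function.update w 0 t) u) =
        t :: ((List.ofFn fun j : Fin i => w j.succ) ++ [u]) := by
      rw [List.ofFn_succ', ← List.cons_append]
      simp only [Fin.snoc_last, Fin.snoc_castSucc]
      rw [List.ofFn_succ]
      simp [Fin.succ_ne_zero]
    rw [h1, uncons_cons, List.length_ofFn]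
    have h2 : lpar A.par (List.ofFn fun j : Fin i => w j.succ) =
        ((∑ l : Fin i, A.deg (w l.succ) : ℕ) : ZMod 2) := by
      rw [lpar, List.map_ofFn, List.sum_ofFn, Nat.cast_sum]
      rfl
    have h3 : psign R ((i : ZMod 2) + 1) * psign R (A.par u * (A.par t + lpar A.par
        (List.ofFn fun j : Fin i => w j.succ))) =
        (-1) ^ (i + 1 + A.deg u * (A.deg t + ∑ l : Fin i, A.deg (w l.succ))) := by
      rw [h2, ← psign_add, ← psign_natCast]
      congr 1
      simp only [BasedDGAlgebra.par]
      push_cast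
      ring
    rw [← h3]
    ring

/-- The normalized differential squares to zero: the part that it drops is degenerate and has a
degenerate differential. -/
theorem hochRed_hochRed (A : BasedDGAlgebra R S) (h : DGLaws A.mul A.diff A.par A.unit)
    (Y : S → List S → R) : hochRed A (hochRed A Y) = 0 := by
  funext s l
  by_cases hl : A.unit ∈ l
  · rw [hochRed_of_mem A _ _ hl]; rfl
  · rw [hochRed_of_notMem A _ _ hl]
    have h1 := h.hochTot_degenerate (hochTot A.mul A.diff A.par Y - hochRed A Y)
      (fun s l hl => by
        rw [Pi.sub_apply, Pi.sub_apply, hochRed_of_notMem A _ _ hl, sub_self]) s l hl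
    rw [map_sub, hochTot_hochTot h, zero_sub, Pi.neg_apply, Pi.neg_apply, neg_eq_zero] at h1
    exact h1

theorem hochD_hochD (A : BasedDGAlgebra R S) (h : DGLaws A.mul A.diff A.par A.unit)
    (c : HChain R S) : hochD A (hochD A c) = 0 := by
  rw [← toChain_ofChain c, hochD_toChain, hochD_toChain, hochRed_hochRed A h]
  rfl

end Conversion

/-! ### Contractions, the differential and the Poisson bracket on the exterior algebra -/

section Exterior

variable {k g ι : Type*} [Field k] [LieRing g] [LieAlgebra k g]

/-- The parity automorphism of `Ch`, which is `(-1)^m` in degree `m`. -/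
noncomputable def gradeInv : Ch k g →ₐ[k] Ch k g := CliffordAlgebra.involute

@[simp] lemma gradeInv_ι (ξ : Module.Dual k g) :
    gradeInv (ExteriorAlgebra.ι k ξ) = - ExteriorAlgebra.ι k ξ :=
  CliffordAlgebra.involute_ι ξ

@[simp] lemma gradeInv_gradeInv (x : Ch k g) : gradeInv (gradeInv x) = x :=
  CliffordAlgebra.involute_involute x

lemma contrL_ι_mul (v : g) (ξ : Module.Dual k g) (x : Ch k g) :
    contrL v (ExteriorAlgebra.ι k ξ * x) = ξ v • x - ExteriorAlgebra.ι k ξ * contrL v x :=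
  CliffordAlgebra.contractLeft_ι_mul _ ξ x

@[simp] lemma contrL_one (v : g) : contrL v (1 : Ch k g) = 0 :=
  CliffordAlgebra.contractLeft_one _ _

lemma contrL_ι (v : g) (ξ : Module.Dual k g) :
    contrL v (ExteriorAlgebra.ι k ξ) = algebraMap k (Ch k g) (ξ v) :=
  CliffordAlgebra.contractLeft_ι _ _ ξ

lemma contrL_comm (v w : g) (x : Ch k g) : contrL v (contrL w x) = - contrL w (contrL v x) :=
  CliffordAlgebra.contractLeft_comm _ _ _

lemma contrL_add (v w : g) : (contrL (v + w) : Ch k g →ₗ[k] Ch k g) = contrL v + contrL w := by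
  simp [contrL]

lemma contrL_smul (c : k) (v : g) : (contrL (c • v) : Ch k g →ₗ[k] Ch k g) = c • contrL v := by
  simp [contrL]

/-- Contraction as a linear map in the contracted vector. -/
noncomputable def contrLin : g →ₗ[k] Ch k g →ₗ[k] Ch k g where
  toFun := contrL
  map_add' := contrL_add
  map_smul' := contrL_smul

lemma contrLin_apply (v : g) : (contrLin v : Ch k g →ₗ[k] Ch k g) = contrL v := rfl

lemma contrL_neg (v : g) (x : Ch k g) : contrL (-v) x = - contrL v x := by
  rw [← contrLin_apply, map_neg]; rfl

/-- Induction on elements of the exterior algebra that are products of generators. -/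
lemma ch_induction {P : Ch k g → Prop} (one : P 1) (add : ∀ x y, P x → P y → P (x + y))
    (smul : ∀ (c : k) x, P x → P (c • x))
    (mul : ∀ (ξ : Module.Dual k g) x, P x → P (ExteriorAlgebra.ι k ξ * x)) (x : Ch k g) : P x := by
  induction x using CliffordAlgebra.left_induction with
  | algebraMap r => rw [Algebra.algebraMap_eq_smul_one]; exact smul _ _ one
  | add x y hx hy => exact add _ _ hx hy
  | ι_mul x ξ hx => exact mul _ _ hx

lemma contrL_mul (v : g) (x y : Ch k g) :
    contrL v (x * y) = contrL v x * y + gradeInv x * contrL v y := by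
  induction x using ch_induction with
  | one => simp
  | add x z hx hz => simp only [add_mul, map_add, hx, hz]; abel
  | smul c x hx => simp only [smul_mul_assoc, map_smul, hx, smul_add]
  | mul ξ x hx =>
    rw [mul_assoc, contrL_ι_mul, hx, contrL_ι_mul, map_mul, gradeInv_ι]
    simp only [mul_add, sub_mul, smul_mul_assoc, neg_mul, mul_assoc]
    abel

lemma gradeInv_contrL (v : g) (x : Ch k g) :
    gradeInv (contrL v x) = - contrL v (gradeInv x) := by
  induction x using ch_induction with
  | one => simp
  | add x z hx hz => simp only [map_add, hx, hz]; abel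
  | smul c x hx => simp only [map_smul, hx, smul_neg]
  | mul ξ x hx =>
    have h : contrL v (gradeInv (ExteriorAlgebra.ι k ξ * x)) =
        - (ξ v • gradeInv x - ExteriorAlgebra.ι k ξ * contrL v (gradeInv x)) := by
      rw [map_mul, gradeInv_ι, neg_mul, map_neg, contrL_ι_mul]
    rw [contrL_ι_mul, map_sub, map_mul, hx, h, gradeInv_ι, map_smul, neg_mul_neg, neg_neg]

lemma ι_mul_comm (ξ : Module.Dual k g) (x : Ch k g) :
    ExteriorAlgebra.ι k ξ * x = gradeInv x * ExteriorAlgebra.ι k ξ := by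
  induction x using ch_induction with
  | one => simp
  | add x z hx hz => simp only [map_add, mul_add, add_mul, hx, hz]
  | smul c x hx => simp only [map_smul, smul_mul_assoc, mul_smul_comm, hx]
  | mul η x hx =>
    have h := ExteriorAlgebra.ι_add_mul_swap (R := k) ξ η
    rw [← mul_assoc, eq_neg_of_add_eq_zero_left h, neg_mul, mul_assoc, hx, map_mul, gradeInv_ι,
      neg_mul, neg_mul, mul_assoc]

/-- Contractions from the right agree with contractions from the left up to sign. -/
lemma contrR_eq (v : g) (x : Ch k g) : contrR v x = gradeInv (contrL v x) := by
  have h2 : ∀ (ξ : Module.Dual k g) (x : Ch k g), contrR v (x * ExteriorAlgebra.ι k ξ) =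
      ξ v • x - contrR v x * ExteriorAlgebra.ι k ξ :=
    fun ξ x => CliffordAlgebra.contractRight_mul_ι _ ξ x
  have h3 : ∀ (ξ : Module.Dual k g) (x : Ch k g),
      gradeInv (contrL v (x * ExteriorAlgebra.ι k ξ)) =
        ξ v • x - gradeInv (contrL v x) * ExteriorAlgebra.ι k ξ := by
    intro ξ x
    rw [contrL_mul, contrL_ι, map_add, map_mul, gradeInv_ι, map_mul, gradeInv_gradeInv,
      AlgHom.commutes, ← Algebra.commutes, ← Algebra.smul_def, mul_neg, neg_add_eq_sub]
  -- an induction on left multiplications needs the claim for `x` and its parity conjugate, since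
  -- `ξ x = gradeInv x * ξ`
  suffices h : contrR v x = gradeInv (contrL v x) ∧
      contrR v (gradeInv x) = gradeInv (contrL v (gradeInv x)) from h.1
  induction x using ch_induction with
  | one =>
    have h1 : gradeInv (1 : Ch k g) = 1 := map_one _
    rw [h1, contrL_one, map_zero, and_self]
    exact CliffordAlgebra.contractRight_one _ _
  | add x z hx hz => simp only [map_add, hx, hz, and_self]
  | smul c x hx => simp only [map_smul, hx, and_self]
  | mul ξ x hx =>
    have h1 : gradeInv (ExteriorAlgebra.ι k ξ * x) = - (x * ExteriorAlgebra.ι k ξ) := by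
      rw [map_mul, gradeInv_ι, neg_mul, ι_mul_comm, gradeInv_gradeInv]
    refine ⟨?_, ?_⟩
    · rw [ι_mul_comm, h2, h3, hx.2]
    · rw [h1, map_neg, map_neg, map_neg, h2, h3, hx.1]

/-- Induction on homogeneous elements that are built from `1` by multiplication with generators. -/
lemma exteriorPower_induction {m : ℕ} {P : ℕ → Ch k g → Prop} (one : P 0 1)
    (add : ∀ m x y, P m x → P m y → P m (x + y)) (smul : ∀ m (c : k) x, P m x → P m (c • x))
    (mul : ∀ m (ξ : Module.Dual k g) x, x ∈ ⋀[k]^m (Module.Dual k g) → P m x →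
      P (m + 1) (ExteriorAlgebra.ι k ξ * x))
    {x : Ch k g} (hx : x ∈ ⋀[k]^m (Module.Dual k g)) : P m x := by
  induction hx using Submodule.pow_induction_on_left' with
  | algebraMap r => rw [Algebra.algebraMap_eq_smul_one]; exact smul _ _ _ one
  | add x y i hx hy hx' hy' => exact add _ _ _ hx' hy'
  | mem_mul y hy i x hx hP =>
    obtain ⟨ξ, rfl⟩ := hy
    exact mul _ _ _ hx hP

lemma gradeInv_of_mem {m : ℕ} {x : Ch k g} (hx : x ∈ ⋀[k]^m (Module.Dual k g)) :
    gradeInv x = (-1 : k) ^ m • x := by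
  refine exteriorPower_induction (P := fun m x => gradeInv x = (-1 : k) ^ m • x) ?_ ?_ ?_ ?_ hx
  · simp
  · intro m x y hx hy; rw [map_add, hx, hy, smul_add]
  · intro m c x hx; rw [map_smul, hx, smul_comm]
  · intro m ξ x _ hx
    rw [map_mul, hx, gradeInv_ι, mul_smul_comm, neg_mul, smul_neg, pow_succ, mul_neg_one, neg_smul]

lemma ι_mem_exteriorPower (ξ : Module.Dual k g) :
    ExteriorAlgebra.ι k ξ ∈ ⋀[k]^1 (Module.Dual k g) := by
  simpa only [pow_one] using LinearMap.mem_range_self _ ξ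

lemma mul_mem_exteriorPower {m n : ℕ} {x y : Ch k g} (hx : x ∈ ⋀[k]^m (Module.Dual k g))
    (hy : y ∈ ⋀[k]^n (Module.Dual k g)) : x * y ∈ ⋀[k]^(m + n) (Module.Dual k g) := by
  exact SetLike.mul_mem_graded (A := fun n => ⋀[k]^n (Module.Dual k g)) hx hy

lemma contrL_mem_exteriorPower (v : g) {m : ℕ} {x : Ch k g}
    (hx : x ∈ ⋀[k]^(m + 1) (Module.Dual k g)) : contrL v x ∈ ⋀[k]^m (Module.Dual k g) := by
  have := exteriorPower_induction (P := fun m x => (m = 0 → contrL v x = 0) ∧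
    ∀ n, m = n + 1 → contrL v x ∈ ⋀[k]^n (Module.Dual k g)) ?_ ?_ ?_ ?_ hx
  · exact this.2 m rfl
  · exact ⟨fun _ => contrL_one v, fun n h => by omega⟩
  · intro m x y hx hy
    refine ⟨fun h => ?_, fun n h => ?_⟩
    · rw [map_add, hx.1 h, hy.1 h, add_zero]
    · rw [map_add]; exact add_mem (hx.2 n h) (hy.2 n h)
  · intro m c x hx
    refine ⟨fun h => ?_, fun n h => ?_⟩
    · rw [map_smul, hx.1 h, smul_zero]
    · rw [map_smul]; exact Submodule.smul_mem _ _ (hx.2 n h)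
  · intro m ξ x hxm hx
    refine ⟨fun h => by omega, fun n h => ?_⟩
    obtain rfl : m = n := by omega
    rw [contrL_ι_mul]
    refine sub_mem (Submodule.smul_mem _ _ hxm) ?_
    rcases m with _ | m
    · rw [hx.1 rfl, mul_zero]; exact zero_mem _
    · have := mul_mem_exteriorPower (ι_mem_exteriorPower ξ) (hx.2 m rfl)
      rwa [add_comm] at this

lemma contrL_of_mem_zero (v : g) {x : Ch k g} (hx : x ∈ ⋀[k]^0 (Module.Dual k g)) :
    contrL v x = 0 := by
  have hx : x ∈ (1 : Submodule k (Ch k g)) := by simpa only [pow_zero] using hx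
  obtain ⟨r, rfl⟩ := Submodule.mem_one.1 hx
  rw [Algebra.algebraMap_eq_smul_one, map_smul, contrL_one, smul_zero]

/-- Graded commutativity. -/
lemma mul_comm_of_mem {m n : ℕ} {x y : Ch k g} (hx : x ∈ ⋀[k]^m (Module.Dual k g))
    (hy : y ∈ ⋀[k]^n (Module.Dual k g)) : x * y = (-1 : k) ^ (m * n) • (y * x) := by
  refine exteriorPower_induction (P := fun m x => x * y = (-1 : k) ^ (m * n) • (y * x))
    ?_ ?_ ?_ ?_ hx
  · simp
  · intro m x z hx hz; rw [add_mul, hx, hz, mul_add, smul_add]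
  · intro m c x hx; rw [smul_mul_assoc, hx, mul_smul_comm, smul_comm]
  · intro m ξ x _ hx
    rw [mul_assoc, hx, mul_smul_comm, ← mul_assoc, ι_mul_comm, gradeInv_of_mem hy, smul_mul_assoc,
      smul_mul_assoc, smul_smul, mul_assoc, ← pow_add]
    congr 2; ring

variable [Fintype ι] [LinearOrder ι] (e : Module.Basis ι k g)

lemma chBasis_mem (s : Finset ι) : chBasis e s ∈ ⋀[k]^s.card (Module.Dual k g) := by
  rw [chBasis, ExteriorAlgebra.basis_apply]
  exact ExteriorAlgebra.ιMulti_range k _ (Set.mem_range_self _)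

lemma gradeInv_chBasis (s : Finset ι) :
    gradeInv (chBasis e s) = (-1 : k) ^ s.card • chBasis e s := gradeInv_of_mem (chBasis_mem e s)

@[simp] lemma chBasis_empty : chBasis e ∅ = 1 := by
  rw [chBasis, ExteriorAlgebra.basis_apply_ofCard _ (n := 0) (by simp)]
  simp [ExteriorAlgebra.ιMulti_family]

lemma chBasis_singleton (a : ι) : chBasis e {a} = ExteriorAlgebra.ι k (e.coord a) := by
  rw [chBasis, ExteriorAlgebra.basis_apply_ofCard _ (n := 1) (by simp)]
  simp only [ExteriorAlgebra.ιMulti_family, ExteriorAlgebra.ιMulti_apply, Function.comp_apply,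
    List.ofFn_succ, List.ofFn_zero, List.prod_cons, List.prod_nil, mul_one,
    Module.Basis.coe_dualBasis]
  congr 2
  have h := (Set.powersetCard.mem_range_ofFinEmbEquiv_symm_iff_mem
    (s := Set.powersetCard.ofCard (Finset.card_singleton a))
    (Set.powersetCard.ofFinEmbEquiv.symm
      (Set.powersetCard.ofCard (Finset.card_singleton a)) 0)).1 ⟨0, rfl⟩
  exact Finset.mem_singleton.1 h

/-- The number operator of the exterior algebra. -/
lemma sum_ι_mul_contrL {m : ℕ} {x : Ch k g} (hx : x ∈ ⋀[k]^m (Module.Dual k g)) :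
    ∑ a, ExteriorAlgebra.ι k (e.coord a) * contrL (e a) x = (m : k) • x := by
  refine exteriorPower_induction (P := fun m x =>
    ∑ a, ExteriorAlgebra.ι k (e.coord a) * contrL (e a) x = (m : k) • x) ?_ ?_ ?_ ?_ hx
  · simp
  · intro m x y hx hy; simp only [map_add, mul_add, Finset.sum_add_distrib, hx, hy, smul_add]
  · intro m c x hx
    simp only [map_smul, mul_smul_comm, ← Finset.smul_sum, hx, smul_comm c]
  · intro m ξ x _ hx
    have h1 : ∀ a, ExteriorAlgebra.ι k (e.coord a) * contrL (e a) (ExteriorAlgebra.ι k ξ * x) =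
        ξ (e a) • (ExteriorAlgebra.ι k (e.coord a) * x) +
          ExteriorAlgebra.ι k ξ * (ExteriorAlgebra.ι k (e.coord a) * contrL (e a) x) := by
      intro a
      have h := ExteriorAlgebra.ι_add_mul_swap (R := k) ξ (e.coord a)
      rw [contrL_ι_mul, mul_sub, mul_smul_comm, ← mul_assoc, ← mul_assoc,
        eq_neg_of_add_eq_zero_left h, neg_mul, sub_eq_add_neg]
    have h2 : ∑ a, ξ (e a) • ExteriorAlgebra.ι k (e.coord a) = ExteriorAlgebra.ι k ξ := by
      simp only [← map_smul, ← map_sum]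
      rw [e.sum_dual_apply_smul_coord]
    simp only [h1, Finset.sum_add_distrib, ← Finset.mul_sum, hx, ← smul_mul_assoc]
    rw [← Finset.sum_mul, h2, Nat.cast_succ, add_smul, one_smul, add_comm, mul_smul_comm,
      add_mul, smul_mul_assoc]

/-- Elements of degree `m` are combinations of monomials of degree `m`: compare the eigenvalues of
the number operator. -/
lemma card_of_repr_ne_zero [CharZero k] {m : ℕ} {x : Ch k g}
    (hx : x ∈ ⋀[k]^m (Module.Dual k g)) {s : Finset ι} (hs : (chBasis e).repr x s ≠ 0) :
    s.card = m := by
  have h1 := sum_ι_mul_contrL e hx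
  let N : Ch k g →ₗ[k] Ch k g := ∑ a, wedge (e.coord a) ∘ₗ contrL (e a)
  have hN : ∀ y, N y = ∑ a, ExteriorAlgebra.ι k (e.coord a) * contrL (e a) y := by
    intro y; simp [N, wedge]
  have h2 : N x = ∑ s, (chBasis e).repr x s • ((s.card : k) • chBasis e s) := by
    conv_lhs => rw [← (chBasis e).sum_repr x]
    rw [map_sum]
    refine Finset.sum_congr rfl fun t _ => ?_
    rw [map_smul, hN, sum_ι_mul_contrL e (chBasis_mem e t)]
  rw [← hN, h2] at h1
  have h3 := congrArg (fun y => (chBasis e).repr y s) h1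
  simp only [map_sum, map_smul, Finsupp.coe_finsetSum, Finset.sum_apply, Finsupp.smul_apply,
    Module.Basis.repr_self, smul_eq_mul, Finsupp.single_apply, mul_ite, mul_one, mul_zero,
    Finset.sum_ite_eq', Finset.mem_univ, if_true] at h3
  have h4 : ((s.card : k) - m) * (chBasis e).repr x s = 0 := by linear_combination h3
  rcases mul_eq_zero.1 h4 with h | h
  · exact_mod_cast sub_eq_zero.1 h
  · exact absurd h hs

lemma sum_repr_mul (F : Ch k g →ₗ[k] Ch k g) (x : Ch k g) (s : Finset ι) :
    ∑ t, (chBasis e).repr x t * (chBasis e).repr (F (chBasis e t)) s =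
      (chBasis e).repr (F x) s := by
  conv_rhs => rw [← (chBasis e).sum_repr x]
  simp only [map_sum, map_smul, Finsupp.coe_finsetSum, Finset.sum_apply, Finsupp.smul_apply,
    smul_eq_mul]

end Exterior

/-! ### The Chevalley--Eilenberg differential squares to zero -/

section Differential

variable {k g ι : Type*} [Field k] [LieRing g] [LieAlgebra k g]
variable [Fintype ι] [LinearOrder ι] (e : Module.Basis ι k g)

lemma sum_rotate {M : Type*} [AddCommMonoid M] (f : ι → ι → ι → M) :
    ∑ a, ∑ b, ∑ c, f a b c = ∑ a, ∑ b, ∑ c, f b c a := by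
  rw [Finset.sum_congr rfl fun a _ => Finset.sum_comm, Finset.sum_comm]

lemma ceD_apply (x : Ch k g) :
    ceD e x = (-(2 : k)⁻¹) • ∑ a, ∑ b, ExteriorAlgebra.ι k (e.coord a) *
      (ExteriorAlgebra.ι k (e.coord b) * contrL ⁅e a, e b⁆ x) := by
  simp [ceD, wedge]

@[simp] lemma ceD_one : ceD e (1 : Ch k g) = 0 := by simp [ceD_apply]

lemma ceD_mul (x y : Ch k g) : ceD e (x * y) = ceD e x * y + gradeInv x * ceD e y := by
  simp only [ceD_apply, smul_mul_assoc, mul_smul_comm, ← smul_add, Finset.sum_mul, Finset.mul_sum,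
    ← Finset.sum_add_distrib]
  congr 1
  refine Finset.sum_congr rfl fun a _ => Finset.sum_congr rfl fun b _ => ?_
  rw [contrL_mul, mul_add, mul_add, ← mul_assoc (ExteriorAlgebra.ι k (e.coord b)) (gradeInv x),
    ι_mul_comm (e.coord b) (gradeInv x), gradeInv_gradeInv, mul_assoc x,
    ← mul_assoc (ExteriorAlgebra.ι k (e.coord a)) x, ι_mul_comm (e.coord a) x]
  simp only [mul_assoc]

lemma gradeInv_ceD (x : Ch k g) : gradeInv (ceD e x) = - ceD e (gradeInv x) := by
  simp only [ceD_apply, map_smul, map_sum, map_mul, gradeInv_ι, gradeInv_contrL, neg_mul, mul_neg,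
    neg_neg, Finset.sum_neg_distrib, smul_neg]

/-- The Lie derivative on the exterior algebra: the derivation of degree zero that extends the
coadjoint action of `v`. -/
noncomputable def lieDer (v : g) : Ch k g →ₗ[k] Ch k g :=
  - ∑ c, wedge (e.coord c) ∘ₗ contrL ⁅v, e c⁆

lemma lieDer_apply (v : g) (x : Ch k g) :
    lieDer e v x = - ∑ c, ExteriorAlgebra.ι k (e.coord c) * contrL ⁅v, e c⁆ x := by
  simp [lieDer, wedge]

lemma sum_coord_contrL_left (v : g) (w : g) (x : Ch k g) :
    ∑ a, e.coord a v • contrL ⁅e a, w⁆ x = contrL ⁅v, w⁆ x := by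
  conv_rhs => rw [← e.sum_repr v, sum_lie, ← contrLin_apply, map_sum]
  simp [contrLin_apply, contrL_smul]

lemma sum_coord_contrL_right (v : g) (w : g) (x : Ch k g) :
    ∑ a, e.coord a v • contrL ⁅w, e a⁆ x = contrL ⁅w, v⁆ x := by
  conv_rhs => rw [← e.sum_repr v, lie_sum, ← contrLin_apply, map_sum]
  simp [contrLin_apply, contrL_smul]

/-- Cartan's formula. -/
lemma ceD_contrL [CharZero k] (v : g) (x : Ch k g) :
    ceD e (contrL v x) = lieDer e v x - contrL v (ceD e x) := by
  have h : ∀ a b, ExteriorAlgebra.ι k (e.coord a) * (ExteriorAlgebra.ι k (e.coord b) *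
        contrL ⁅e a, e b⁆ (contrL v x)) +
      contrL v (ExteriorAlgebra.ι k (e.coord a) * (ExteriorAlgebra.ι k (e.coord b) *
        contrL ⁅e a, e b⁆ x)) =
      e.coord a v • (ExteriorAlgebra.ι k (e.coord b) * contrL ⁅e a, e b⁆ x) -
        e.coord b v • (ExteriorAlgebra.ι k (e.coord a) * contrL ⁅e a, e b⁆ x) := by
    intro a b
    rw [contrL_ι_mul, contrL_ι_mul, contrL_comm v]
    simp only [mul_sub, mul_neg, mul_smul_comm]
    abel
  have h1 : ∑ a, ∑ b, e.coord a v • (ExteriorAlgebra.ι k (e.coord b) * contrL ⁅e a, e b⁆ x) =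
      - lieDer e v x := by
    rw [lieDer_apply, neg_neg, Finset.sum_comm]
    refine Finset.sum_congr rfl fun b _ => ?_
    rw [← sum_coord_contrL_left e v, Finset.mul_sum]
    simp only [mul_smul_comm]
  have h2 : ∑ a, ∑ b, e.coord b v • (ExteriorAlgebra.ι k (e.coord a) * contrL ⁅e a, e b⁆ x) =
      lieDer e v x := by
    rw [lieDer_apply, ← Finset.sum_neg_distrib]
    refine Finset.sum_congr rfl fun a _ => ?_
    rw [← mul_neg, ← contrL_neg, lie_skew, ← sum_coord_contrL_right e v, Finset.mul_sum]
    simp only [mul_smul_comm]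
  have h3 : ceD e (contrL v x) + contrL v (ceD e x) = lieDer e v x := by
    simp only [ceD_apply, map_smul, map_sum, ← smul_add, ← Finset.sum_add_distrib, h,
      Finset.sum_sub_distrib, h1, h2]
    rw [← neg_add', smul_neg, neg_smul, neg_neg, ← two_smul k, smul_smul,
      inv_mul_cancel₀ two_ne_zero, one_smul]
  exact eq_sub_of_add_eq h3

lemma ceD_ι (ξ : Module.Dual k g) :
    ceD e (ExteriorAlgebra.ι k ξ) = (-(2 : k)⁻¹) • ∑ a, ∑ b, ξ ⁅e a, e b⁆ •
      (ExteriorAlgebra.ι k (e.coord a) * ExteriorAlgebra.ι k (e.coord b)) := by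
  rw [ceD_apply]
  congr 1
  refine Finset.sum_congr rfl fun a _ => Finset.sum_congr rfl fun b _ => ?_
  rw [contrL_ι, ← Algebra.commutes, ← Algebra.smul_def, mul_smul_comm]

/-- The Chevalley--Eilenberg differential squares to zero. As it is an odd derivation, this has to
be checked on generators, where it is the Jacobi identity. -/
lemma ceD_ceD [CharZero k] (x : Ch k g) : ceD e (ceD e x) = 0 := by
  induction x using ExteriorAlgebra.induction with
  | algebraMap r => rw [Algebra.algebraMap_eq_smul_one]; simp
  | add x y hx hy => rw [map_add, map_add, hx, hy, add_zero]
  | mul x y hx hy =>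
    rw [ceD_mul, map_add, ceD_mul, ceD_mul, hx, hy, gradeInv_ceD, zero_mul, mul_zero, zero_add,
      add_zero, neg_mul, neg_add_cancel]
  | ι ξ =>
    have hswap : ∀ a b : ι, ExteriorAlgebra.ι k (e.coord a) * ExteriorAlgebra.ι k (e.coord b) =
        - (ExteriorAlgebra.ι k (e.coord b) * ExteriorAlgebra.ι k (e.coord a)) := fun a b =>
      eq_neg_of_add_eq_zero_left (ExteriorAlgebra.ι_add_mul_swap (R := k) (e.coord a) (e.coord b))
    let E : ι → ι → ι → Ch k g := fun a b c => ExteriorAlgebra.ι k (e.coord a) *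
      ExteriorAlgebra.ι k (e.coord b) * ExteriorAlgebra.ι k (e.coord c)
    have hE : ∀ a b c, E a b c = E b c a := by
      intro a b c
      simp only [E]
      rw [hswap a b, neg_mul, mul_assoc, hswap a c, mul_neg, neg_neg, mul_assoc]
    have h2 : ∀ a b, ceD e (ExteriorAlgebra.ι k (e.coord a) * ExteriorAlgebra.ι k (e.coord b)) =
        ceD e (ExteriorAlgebra.ι k (e.coord a)) * ExteriorAlgebra.ι k (e.coord b) -
        ceD e (ExteriorAlgebra.ι k (e.coord b)) * ExteriorAlgebra.ι k (e.coord a) := by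
      intro a b
      rw [ceD_mul, gradeInv_ι, neg_mul, ι_mul_comm (e.coord a), gradeInv_ceD, gradeInv_ι, map_neg,
        neg_neg, sub_eq_add_neg]
    have h3 : ∑ a, ∑ b, ξ ⁅e a, e b⁆ • (ceD e (ExteriorAlgebra.ι k (e.coord a)) *
        ExteriorAlgebra.ι k (e.coord b)) =
        (-(2 : k)⁻¹) • ∑ c, ∑ d, ∑ b, ξ ⁅⁅e c, e d⁆, e b⁆ • E c d b := by
      have : ∀ a b, ξ ⁅e a, e b⁆ • (ceD e (ExteriorAlgebra.ι k (e.coord a)) *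
          ExteriorAlgebra.ι k (e.coord b)) = (-(2 : k)⁻¹) • ∑ c, ∑ d,
            (e.coord a ⁅e c, e d⁆ * ξ ⁅e a, e b⁆) • E c d b := by
        intro a b
        rw [ceD_ι, smul_mul_assoc, smul_comm, Finset.sum_mul, Finset.smul_sum]
        congr 1
        refine Finset.sum_congr rfl fun c _ => ?_
        rw [Finset.sum_mul, Finset.smul_sum]
        refine Finset.sum_congr rfl fun d _ => ?_
        rw [smul_mul_assoc, smul_smul, mul_comm]
      simp only [this, ← Finset.smul_sum]
      congr 1
      have h4 : ∀ c d b, ξ ⁅⁅e c, e d⁆, e b⁆ = ∑ a, e.coord a ⁅e c, e d⁆ * ξ ⁅e a, e b⁆ := by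
        intro c d b
        conv_lhs => rw [← e.sum_repr ⁅e c, e d⁆, sum_lie, map_sum]
        simp
      simp only [h4, Finset.sum_smul]
      rw [Finset.sum_congr rfl fun a _ => Finset.sum_comm, Finset.sum_comm]
      refine Finset.sum_congr rfl fun c _ => ?_
      rw [Finset.sum_congr rfl fun a _ => Finset.sum_comm, Finset.sum_comm]
      refine Finset.sum_congr rfl fun d _ => ?_
      rw [Finset.sum_comm]
    -- three cyclic rotations of this sum add up to zero by the Jacobi identity
    have h5 : ∑ c, ∑ d, ∑ b, ξ ⁅⁅e c, e d⁆, e b⁆ • E c d b = 0 := by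
      let T : ι → ι → ι → Ch k g := fun c d b => ξ ⁅⁅e c, e d⁆, e b⁆ • E c d b
      have r1 := sum_rotate T
      have r2 := sum_rotate fun a b c => T b c a
      have r3 : ∑ c, ∑ d, ∑ b, (T c d b + T d b c + T b c d) = 0 := by
        refine Finset.sum_eq_zero fun c _ => Finset.sum_eq_zero fun d _ =>
          Finset.sum_eq_zero fun b _ => ?_
        simp only [T]
        rw [← hE c d b, hE b c d, ← add_smul, ← add_smul, ← map_add, ← map_add]
        have : ⁅⁅e c, e d⁆, e b⁆ + ⁅⁅e d, e b⁆, e c⁆ + ⁅⁅e b, e c⁆, e d⁆ = 0 := by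
          have := lie_jacobi (e c) (e d) (e b)
          rw [← lie_skew ⁅e c, e d⁆, ← lie_skew ⁅e d, e b⁆, ← lie_skew ⁅e b, e c⁆]
          rw [← neg_eq_zero, ← this]; abel
        rw [this, map_zero, zero_smul]
      simp only [Finset.sum_add_distrib] at r3
      have r4 : (3 : k) • ∑ c, ∑ d, ∑ b, T c d b = 0 := by
        rw [← r3, ← r2, ← r1]
        module
      exact (smul_eq_zero.1 r4).resolve_left three_ne_zero
    rw [ceD_ι, map_smul, map_sum]
    have h6 : ∑ a, ceD e (∑ b, ξ ⁅e a, e b⁆ •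
        (ExteriorAlgebra.ι k (e.coord a) * ExteriorAlgebra.ι k (e.coord b))) =
        (2 : k) • ∑ a, ∑ b, ξ ⁅e a, e b⁆ • (ceD e (ExteriorAlgebra.ι k (e.coord a)) *
          ExteriorAlgebra.ι k (e.coord b)) := by
      simp only [map_sum, map_smul, h2, smul_sub, Finset.sum_sub_distrib]
      rw [two_smul, sub_eq_add_neg]
      congr 1
      rw [Finset.sum_comm, ← Finset.sum_neg_distrib]
      refine Finset.sum_congr rfl fun a _ => ?_
      rw [← Finset.sum_neg_distrib]
      refine Finset.sum_congr rfl fun b _ => ?_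
      rw [← neg_smul, ← map_neg, lie_skew]
    rw [h6, h3, h5, smul_zero, smul_zero, smul_zero]

lemma ceD_mem_exteriorPower {m : ℕ} {x : Ch k g} (hx : x ∈ ⋀[k]^m (Module.Dual k g)) :
    ceD e x ∈ ⋀[k]^(m + 1) (Module.Dual k g) := by
  rw [ceD_apply]
  refine Submodule.smul_mem _ _ (sum_mem fun a _ => sum_mem fun b _ => ?_)
  rcases m with _ | m
  · rw [contrL_of_mem_zero _ hx, mul_zero, mul_zero]; exact zero_mem _
  · have := mul_mem_exteriorPower (ι_mem_exteriorPower (e.coord a))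
      (mul_mem_exteriorPower (ι_mem_exteriorPower (e.coord b))
        (contrL_mem_exteriorPower ⁅e a, e b⁆ hx))
    rwa [← add_assoc, add_comm] at this

variable (B : LinearMap.BilinForm k g)

lemma poisson_apply (x y : Ch k g) :
    poisson e B x y = ∑ p, ∑ q, (LinearMap.BilinForm.toMatrix e B)⁻¹ p q •
      (gradeInv (contrL (e p) x) * contrL (e q) y) := by
  simp [poisson, contrR_eq, LinearMap.sum_apply]

lemma poisson_one_left (y : Ch k g) : poisson e B 1 y = 0 := by simp [poisson_apply]

lemma poisson_one_right (x : Ch k g) : poisson e B x 1 = 0 := by simp [poisson_apply]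

/-- The Poisson bracket is a Hochschild cocycle: the deformed product is associative to first
order. -/
lemma poisson_cocycle (x y z : Ch k g) :
    poisson e B (x * y) z + poisson e B x y * z = poisson e B x (y * z) + x * poisson e B y z := by
  simp only [poisson_apply, Finset.sum_mul, Finset.mul_sum, ← Finset.sum_add_distrib]
  refine Finset.sum_congr rfl fun p _ => Finset.sum_congr rfl fun q _ => ?_
  rw [smul_mul_assoc, mul_smul_comm, ← smul_add, ← smul_add, contrL_mul, contrL_mul, map_add,
    map_mul, map_mul, gradeInv_gradeInv]
  congr 1
  noncomm_ring

lemma poisson_mem_exteriorPower {m n : ℕ} {x y : Ch k g} (hx : x ∈ ⋀[k]^(m + 1) (Module.Dual k g))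
    (hy : y ∈ ⋀[k]^(n + 1) (Module.Dual k g)) :
    poisson e B x y ∈ ⋀[k]^(m + n) (Module.Dual k g) := by
  rw [poisson_apply]
  refine sum_mem fun p _ => sum_mem fun q _ => Submodule.smul_mem _ _ ?_
  refine mul_mem_exteriorPower ?_ (contrL_mem_exteriorPower _ hy)
  rw [gradeInv_of_mem (contrL_mem_exteriorPower _ hx)]
  exact Submodule.smul_mem _ _ (contrL_mem_exteriorPower _ hx)

/-- The tensor inverse to an invariant scalar product is invariant. -/
lemma sum_inv_invariant (hnondeg : B.Nondegenerate)
    (hinv : ∀ x y z : g, B ⁅x, y⁆ z = B x ⁅y, z⁆) {M : Type*} [AddCommGroup M] [Module k M]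
    (Φ : g →ₗ[k] g →ₗ[k] M) (v : g) :
    ∑ p, ∑ q, (LinearMap.BilinForm.toMatrix e B)⁻¹ p q •
      (Φ ⁅e p, v⁆ (e q) + Φ (e p) ⁅e q, v⁆) = 0 := by
  set Bm := LinearMap.BilinForm.toMatrix e B with hBm
  have hdet : IsUnit Bm.det := by
    rw [isUnit_iff_ne_zero]
    exact (LinearMap.BilinForm.nondegenerate_iff_det_ne_zero (B := B) e).1 hnondeg
  -- the matrix of `x ↦ [x, v]`; invariance of `B` says that it is skew with respect to `B`, and
  -- conjugating with `B⁻¹` that its transpose is skew with respect to `B⁻¹`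
  let A : Matrix ι ι k := fun r p => e.repr ⁅e p, v⁆ r
  have hA : ∀ p, ⁅e p, v⁆ = ∑ r, A r p • e r := fun p => (e.sum_repr _).symm
  have h1 : A.transpose * Bm + Bm * A = 0 := by
    ext p q
    have e1 : (A.transpose * Bm) p q = B ⁅e p, v⁆ (e q) := by
      rw [Matrix.mul_apply, hA, map_sum, LinearMap.sum_apply]
      simp [hBm, LinearMap.BilinForm.toMatrix_apply]
    have e2 : (Bm * A) p q = B (e p) ⁅e q, v⁆ := by
      rw [Matrix.mul_apply, hA, map_sum]
      simp [hBm, LinearMap.BilinForm.toMatrix_apply, mul_comm]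
    rw [Matrix.add_apply, e1, e2, hinv, ← lie_skew (e q) v, map_neg]
    simp
  have h2 : Bm⁻¹ * A.transpose + A * Bm⁻¹ = 0 := by
    have := congrArg (fun X => Bm⁻¹ * X * Bm⁻¹) h1
    simp only [Matrix.mul_zero, Matrix.zero_mul, Matrix.mul_add, Matrix.add_mul] at this
    rwa [← Matrix.mul_assoc Bm⁻¹ Bm A, Matrix.nonsing_inv_mul _ hdet, Matrix.one_mul,
      Matrix.mul_assoc, Matrix.mul_assoc, Matrix.mul_nonsing_inv _ hdet, Matrix.mul_one] at this
  have h3 : ∑ p, ∑ q, Bm⁻¹ p q • Φ ⁅e p, v⁆ (e q) =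
      ∑ r, ∑ q, (A * Bm⁻¹) r q • Φ (e r) (e q) := by
    simp only [hA, map_sum, map_smul, LinearMap.sum_apply, LinearMap.smul_apply, Finset.smul_sum,
      Matrix.mul_apply, Finset.sum_smul, smul_smul]
    rw [sum_rotate]
    refine Finset.sum_congr rfl fun r _ => ?_
    rw [Finset.sum_comm]
    exact Finset.sum_congr rfl fun _ _ => Finset.sum_congr rfl fun _ _ => by rw [mul_comm]
  have h4 : ∑ p, ∑ q, Bm⁻¹ p q • Φ (e p) ⁅e q, v⁆ =
      ∑ r, ∑ q, (Bm⁻¹ * A.transpose) r q • Φ (e r) (e q) := by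
    simp only [hA, map_sum, map_smul, Finset.smul_sum, Matrix.mul_apply, Finset.sum_smul, smul_smul]
    refine Finset.sum_congr rfl fun r _ => ?_
    rw [Finset.sum_comm]
    rfl
  simp only [smul_add, Finset.sum_add_distrib, h3, h4]
  rw [add_comm]
  simp only [← Finset.sum_add_distrib, ← add_smul, ← Matrix.add_apply, h2]
  simp

/-- The differential is a derivation of the Poisson bracket of an invariant scalar product. -/
lemma ceD_poisson [CharZero k] (hnondeg : B.Nondegenerate)
    (hinv : ∀ x y z : g, B ⁅x, y⁆ z = B x ⁅y, z⁆) (x y : Ch k g) :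
    ceD e (poisson e B x y) = poisson e B (ceD e x) y + poisson e B (gradeInv x) (ceD e y) := by
  have h1 : ∀ p q, ceD e (gradeInv (contrL (e p) x) * contrL (e q) y) =
      gradeInv (contrL (e p) (ceD e x)) * contrL (e q) y +
        gradeInv (contrL (e p) (gradeInv x)) * contrL (e q) (ceD e y) -
      ∑ c, ExteriorAlgebra.ι k (e.coord c) * (gradeInv (contrL ⁅e p, e c⁆ x) * contrL (e q) y +
        gradeInv (contrL (e p) x) * contrL ⁅e q, e c⁆ y) := by
    intro p q
    have f1 : ceD e (gradeInv (contrL (e p) x)) = gradeInv (contrL (e p) (ceD e x)) -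
        ∑ c, ExteriorAlgebra.ι k (e.coord c) * gradeInv (contrL ⁅e p, e c⁆ x) := by
      have : ceD e (gradeInv (contrL (e p) x)) = - gradeInv (ceD e (contrL (e p) x)) := by
        rw [gradeInv_ceD, neg_neg]
      rw [this, ceD_contrL, map_sub, lieDer_apply, map_neg, map_sum]
      simp only [map_mul, gradeInv_ι, neg_mul, Finset.sum_neg_distrib]
      abel
    have f3 : gradeInv (contrL (e p) (gradeInv x)) = - contrL (e p) x := by
      rw [gradeInv_contrL, gradeInv_gradeInv]
    rw [ceD_mul, gradeInv_gradeInv, f1, f3, ceD_contrL, lieDer_apply, sub_mul, mul_sub, mul_neg]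
    simp only [mul_add, Finset.sum_add_distrib, Finset.sum_mul, Finset.mul_sum, neg_mul, mul_assoc]
    have f2 : ∀ c, contrL (e p) x * (ExteriorAlgebra.ι k (e.coord c) * contrL ⁅e q, e c⁆ y) =
        ExteriorAlgebra.ι k (e.coord c) *
          (gradeInv (contrL (e p) x) * contrL ⁅e q, e c⁆ y) := by
      intro c
      rw [← mul_assoc, ← mul_assoc, ι_mul_comm, gradeInv_gradeInv]
    simp only [f2]
    abel
  have h2 : ∀ c, ∑ p, ∑ q, (LinearMap.BilinForm.toMatrix e B)⁻¹ p q •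
      (gradeInv (contrL ⁅e p, e c⁆ x) * contrL (e q) y +
        gradeInv (contrL (e p) x) * contrL ⁅e q, e c⁆ y) = 0 := by
    intro c
    exact sum_inv_invariant e B hnondeg hinv
      ((LinearMap.mul k (Ch k g)).compl₁₂ (gradeInv.toLinearMap ∘ₗ contrLin.flip x)
        (contrLin.flip y)) (e c)
  simp only [poisson_apply, map_sum, map_smul, h1, smul_sub, smul_add, Finset.sum_sub_distrib,
    Finset.sum_add_distrib, sub_eq_self]
  have h3 : ∑ p, ∑ q, (LinearMap.BilinForm.toMatrix e B)⁻¹ p q • ∑ c,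
      ExteriorAlgebra.ι k (e.coord c) * (gradeInv (contrL ⁅e p, e c⁆ x) * contrL (e q) y +
        gradeInv (contrL (e p) x) * contrL ⁅e q, e c⁆ y) =
      ∑ c, ExteriorAlgebra.ι k (e.coord c) * ∑ p, ∑ q,
        (LinearMap.BilinForm.toMatrix e B)⁻¹ p q •
        (gradeInv (contrL ⁅e p, e c⁆ x) * contrL (e q) y +
        gradeInv (contrL (e p) x) * contrL ⁅e q, e c⁆ y) := by
    simp only [Finset.smul_sum, Finset.mul_sum, mul_smul_comm]
    rw [sum_rotate, sum_rotate]
  simp only [h2, mul_zero, Finset.sum_const_zero] at h3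
  simpa only [Finset.sum_add_distrib] using h3

end Differential

/-! ### The dg-algebra laws of the Chevalley--Eilenberg algebra and of its deformation -/

section StructureConstants

variable {k g ι : Type*} [Field k] [LieRing g] [LieAlgebra k g]
variable [Fintype ι] [LinearOrder ι] (e : Module.Basis ι k g) (B : LinearMap.BilinForm k g)

lemma chAlg_mul_def (t u s : Finset ι) :
    (chAlg e).mul t u s = (chBasis e).repr (chBasis e t * chBasis e u) s := rfl

lemma chAlg_diff_def (t s : Finset ι) :
    (chAlg e).diff t s = (chBasis e).repr (ceD e (chBasis e t)) s := rfl

/-- The structure constants of half the Poisson bracket. -/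
noncomputable def poissonCoeff (t u s : Finset ι) : k :=
  (2 : k)⁻¹ * (chBasis e).repr (poisson e B (chBasis e t) (chBasis e u)) s

lemma chAlgEps_mul_def (t u s : Finset ι) :
    (chAlgEps e B).mul t u s = TrivSqZeroExt.inl ((chAlg e).mul t u s) +
      TrivSqZeroExt.inr (poissonCoeff e B t u s) := rfl

lemma chAlgEps_diff_def (t s : Finset ι) :
    (chAlgEps e B).diff t s = TrivSqZeroExt.inl ((chAlg e).diff t s) := rfl

lemma sum_mul_smul_chBasis (t u : Finset ι) :
    ∑ s, (chAlg e).mul t u s • chBasis e s = chBasis e t * chBasis e u :=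
  (chBasis e).sum_repr _

lemma sum_diff_smul_chBasis (t : Finset ι) :
    ∑ s, (chAlg e).diff t s • chBasis e s = ceD e (chBasis e t) :=
  (chBasis e).sum_repr _

variable [CharZero k]

lemma card_of_mul_ne_zero {t u s : Finset ι} (h : (chAlg e).mul t u s ≠ 0) :
    s.card = t.card + u.card :=
  card_of_repr_ne_zero e (mul_mem_exteriorPower (chBasis_mem e t) (chBasis_mem e u)) h

lemma card_of_diff_ne_zero {t s : Finset ι} (h : (chAlg e).diff t s ≠ 0) :
    s.card = t.card + 1 :=
  card_of_repr_ne_zero e (ceD_mem_exteriorPower e (chBasis_mem e t)) h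

lemma card_of_poissonCoeff_ne_zero {t u s : Finset ι} (h : poissonCoeff e B t u s ≠ 0) :
    s.card + 2 = t.card + u.card := by
  have h0 : (chBasis e).repr (poisson e B (chBasis e t) (chBasis e u)) s ≠ 0 :=
    right_ne_zero_of_mul h
  rcases Finset.eq_empty_or_nonempty t with rfl | ht
  · simp [poisson_one_left] at h0
  rcases Finset.eq_empty_or_nonempty u with rfl | hu
  · simp [poisson_one_right] at h0
  obtain ⟨m, hm⟩ := Nat.exists_eq_succ_of_ne_zero (Finset.card_pos.2 ht).ne'
  obtain ⟨n, hn⟩ := Nat.exists_eq_succ_of_ne_zero (Finset.card_pos.2 hu).ne'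
  have h1 := chBasis_mem e t
  have h2 := chBasis_mem e u
  rw [hm] at h1
  rw [hn] at h2
  have := card_of_repr_ne_zero e (poisson_mem_exteriorPower e B h1 h2) h0
  omega

theorem chAlg_laws : DGLaws (chAlg e).mul (chAlg e).diff (chAlg e).par (chAlg e).unit where
  one_mul_self s := by simp [chAlg]
  one_mul_ne s t h := by simp [chAlg, h]
  mul_one_self s := by simp [chAlg]
  mul_one_ne s t h := by simp [chAlg, h]
  assoc a b c s := by
    have h1 := sum_repr_mul e (LinearMap.mulRight k (chBasis e c)) (chBasis e a * chBasis e b) s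
    have h2 := sum_repr_mul e (LinearMap.mulLeft k (chBasis e a)) (chBasis e b * chBasis e c) s
    simp only [LinearMap.mulRight_apply, LinearMap.mulLeft_apply] at h1 h2
    simp only [chAlg_mul_def, h1, h2, mul_assoc]
  d_one s := by simp [chAlg]
  leibniz t u s := by
    have h1 := sum_repr_mul e (ceD e) (chBasis e t * chBasis e u) s
    have h2 := sum_repr_mul e (LinearMap.mulRight k (chBasis e u)) (ceD e (chBasis e t)) s
    have h3 := sum_repr_mul e (LinearMap.mulLeft k (chBasis e t)) (ceD e (chBasis e u)) s
    simp only [LinearMap.mulRight_apply, LinearMap.mulLeft_apply] at h2 h3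
    simp only [chAlg_mul_def, chAlg_diff_def, h1, h2, h3]
    rw [ceD_mul, gradeInv_chBasis, smul_mul_assoc, map_add, map_smul, Finsupp.add_apply,
      Finsupp.smul_apply, smul_eq_mul, BasedDGAlgebra.par, psign_natCast]
    rfl
  d_sq t s := by
    have h1 := sum_repr_mul e (ceD e) (ceD e (chBasis e t)) s
    simp only [chAlg_diff_def, h1, ceD_ceD, map_zero, Finsupp.coe_zero, Pi.zero_apply]
  par_one := by simp [BasedDGAlgebra.par, chAlg]
  par_mul t u s h := by
    have := card_of_mul_ne_zero e h
    simp only [BasedDGAlgebra.par]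
    exact_mod_cast congrArg (Nat.cast : ℕ → ZMod 2) this
  par_d t s h := by
    have := card_of_diff_ne_zero e h
    simp only [BasedDGAlgebra.par]
    exact_mod_cast congrArg (Nat.cast : ℕ → ZMod 2) this

lemma psign_dual (a : ZMod 2) : psign k[ε] a = TrivSqZeroExt.inl (psign k a) := by
  by_cases h : a = 0 <;> simp [psign, h]

lemma fst_sum {α : Type*} (s : Finset α) (f : α → k[ε]) :
    TrivSqZeroExt.fst (∑ i ∈ s, f i) = ∑ i ∈ s, TrivSqZeroExt.fst (f i) :=
  map_sum (TrivSqZeroExt.fstHom k k k) f s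

lemma snd_sum {α : Type*} (s : Finset α) (f : α → k[ε]) :
    TrivSqZeroExt.snd (∑ i ∈ s, f i) = ∑ i ∈ s, TrivSqZeroExt.snd (f i) :=
  map_sum (TrivSqZeroExt.sndHom k k) f s

/-- The deformed product is associative modulo `ε²` since the Poisson bracket is a Hochschild
cocycle, and the differential is one of its derivations since the scalar product is invariant. -/
theorem chAlgEps_laws (hnondeg : B.Nondegenerate) (hinv : ∀ x y z : g, B ⁅x, y⁆ z = B x ⁅y, z⁆) :
    DGLaws (chAlgEps e B).mul (chAlgEps e B).diff (chAlgEps e B).par (chAlgEps e B).unit where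
  one_mul_self s := by
    rw [chAlgEps_mul_def]; simp [poissonCoeff, chAlg, chAlgEps, poisson_one_left]
  one_mul_ne s t h := by
    rw [chAlgEps_mul_def]; simp [poissonCoeff, chAlg, chAlgEps, poisson_one_left, h]
  mul_one_self s := by
    rw [chAlgEps_mul_def]; simp [poissonCoeff, chAlg, chAlgEps, poisson_one_right]
  mul_one_ne s t h := by
    rw [chAlgEps_mul_def]; simp [poissonCoeff, chAlg, chAlgEps, poisson_one_right, h]
  assoc a b c s := by
    ext
    · simpa [fst_sum, chAlgEps_mul_def] using (chAlg_laws e).assoc a b c s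
    · have h1 := sum_repr_mul e (LinearMap.mulRight k (chBasis e c))
        (poisson e B (chBasis e a) (chBasis e b)) s
      have h2 := sum_repr_mul e (LinearMap.mulLeft k (chBasis e a))
        (poisson e B (chBasis e b) (chBasis e c)) s
      have h3 := sum_repr_mul e ((poisson e B).flip (chBasis e c)) (chBasis e a * chBasis e b) s
      have h4 := sum_repr_mul e (poisson e B (chBasis e a)) (chBasis e b * chBasis e c) s
      have h5 := congrArg (fun x => (chBasis e).repr x s)
        (poisson_cocycle e B (chBasis e a) (chBasis e b) (chBasis e c))
      simp only [LinearMap.mulRight_apply, LinearMap.mulLeft_apply, LinearMap.flip_apply, map_add,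
        Finsupp.add_apply] at h1 h2 h3 h4 h5
      rw [← h1, ← h2, ← h3, ← h4] at h5
      simp only [snd_sum, chAlgEps_mul_def, TrivSqZeroExt.snd_mul, TrivSqZeroExt.snd_add,
        TrivSqZeroExt.fst_add, TrivSqZeroExt.fst_inl, TrivSqZeroExt.fst_inr,
        TrivSqZeroExt.snd_inl, TrivSqZeroExt.snd_inr, zero_add, add_zero, smul_eq_mul,
        MulOpposite.smul_eq_mul_unop, MulOpposite.unop_op, chAlg_mul_def, poissonCoeff,
        Finset.sum_add_distrib]
      simp only [mul_assoc, mul_left_comm _ (2 : k)⁻¹, ← Finset.mul_sum]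
      linear_combination (2 : k)⁻¹ * h5
  d_one s := by
    rw [chAlgEps_diff_def]; simp [chAlg, chAlgEps]
  leibniz t u s := by
    ext
    · have hp : (chAlgEps e B).par t = (chAlg e).par t := rfl
      simpa [fst_sum, chAlgEps_mul_def, chAlgEps_diff_def, psign_dual, hp] using
        (chAlg_laws e).leibniz t u s
    · have h1 := sum_repr_mul e (ceD e) (poisson e B (chBasis e t) (chBasis e u)) s
      have h2 := sum_repr_mul e ((poisson e B).flip (chBasis e u)) (ceD e (chBasis e t)) s
      have h3 := sum_repr_mul e (poisson e B (chBasis e t)) (ceD e (chBasis e u)) s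
      simp only [LinearMap.flip_apply] at h2
      have h4 := congrArg (fun x => (chBasis e).repr x s)
        (ceD_poisson e B hnondeg hinv (chBasis e t) (chBasis e u))
      have h5 : psign k ((chAlgEps e B).par t) = (-1) ^ t.card := psign_natCast _
      simp only [gradeInv_chBasis, map_add, map_smul, LinearMap.smul_apply, Finsupp.add_apply,
        Finsupp.smul_apply, smul_eq_mul] at h4
      rw [← h1, ← h2, ← h3] at h4
      simp only [snd_sum, fst_sum, chAlgEps_mul_def, chAlgEps_diff_def, TrivSqZeroExt.snd_mul,
        TrivSqZeroExt.snd_add, TrivSqZeroExt.fst_mul,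
        TrivSqZeroExt.fst_add, TrivSqZeroExt.fst_inl, TrivSqZeroExt.fst_inr,
        TrivSqZeroExt.snd_inl, TrivSqZeroExt.snd_inr, zero_add, add_zero, smul_eq_mul, mul_zero,
        MulOpposite.smul_eq_mul_unop, MulOpposite.unop_op, chAlg_mul_def, poissonCoeff,
        Finset.sum_add_distrib, psign_dual, zero_mul, chAlg_diff_def, h5]
      simp only [mul_assoc, mul_left_comm _ (2 : k)⁻¹, ← Finset.mul_sum]
      linear_combination (2 : k)⁻¹ * h4
  d_sq t s := by
    simp only [chAlgEps_diff_def, ← TrivSqZeroExt.inl_mul]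
    have := (chAlg_laws e).d_sq t s
    ext
    · simpa [fst_sum] using this
    · simp [snd_sum]
  par_one := by simp [BasedDGAlgebra.par, chAlgEps]
  par_mul t u s h := by
    rw [chAlgEps_mul_def] at h
    -- the Poisson bracket lowers the degree by two, which does not change the parity
    by_cases h1 : (chAlg e).mul t u s = 0
    · have h2 : poissonCoeff e B t u s ≠ 0 := by
        intro h2; rw [h1, h2] at h; simp at h
      have := card_of_poissonCoeff_ne_zero e B h2
      have h3 := congrArg (Nat.cast : ℕ → ZMod 2) this
      push_cast at h3
      have h11 : (2 : ZMod 2) = 0 := by decide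
      rw [h11, add_zero] at h3
      exact h3
    · exact (chAlg_laws e).par_mul t u s h1
  par_d t s h := by
    rw [chAlgEps_diff_def] at h
    refine (chAlg_laws e).par_d t s fun h1 => h ?_
    rw [h1, TrivSqZeroExt.inl_zero]

/-! ### Products with generators -/

lemma mul_singleton_of_mem {s : Finset ι} {a : ι} (h : a ∈ s) (t : Finset ι) :
    (chAlg e).mul s {a} t = 0 := by
  have := ExteriorAlgebra.basis_mul_of_not_disjoint e.dualBasis
    (s := Set.powersetCard.ofCard (rfl : s.card = _))
    (t := Set.powersetCard.ofCard (Finset.card_singleton a)) (by simpa using h)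
  simp only [Set.powersetCard.val_ofCard] at this
  rw [chAlg_mul_def, chBasis, this, map_zero, Finsupp.coe_zero, Pi.zero_apply]

/-- The product of a monomial with a new generator is a monomial up to sign. -/
lemma mul_singleton_of_notMem {s : Finset ι} {a : ι} (h : a ∉ s) :
    ∃ c : k, c * c = 1 ∧ chBasis e s * chBasis e {a} = c • chBasis e (insert a s) := by
  have hd : Disjoint s {a} := by simpa using h
  have := ExteriorAlgebra.basis_mul_of_disjoint e.dualBasis
    (s := Set.powersetCard.ofCard (rfl : s.card = _))
    (t := Set.powersetCard.ofCard (Finset.card_singleton a)) hd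
  have hu : s.disjUnion {a} hd = insert a s := by
    ext x; simp [or_comm]
  simp only [Set.powersetCard.val_ofCard] at this
  rw [Units.smul_def, ← Int.cast_smul_eq_zsmul k] at this
  refine ⟨(((Set.powersetCard.permOfDisjoint (s := Set.powersetCard.ofCard (rfl : s.card = _))
    (t := Set.powersetCard.ofCard (Finset.card_singleton a)) hd).sign : ℤ) : k), ?_, ?_⟩
  · rw [← Int.cast_mul, ← Units.val_mul, Int.units_mul_self]; simp
  · rw [← hu]; exact this

end StructureConstants

/-! ### The differential forms -/

section FormsAlgebra

variable {k g ι : Type*} [Field k] [LieRing g] [LieAlgebra k g]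
variable [Fintype ι] [LinearOrder ι] (e : Module.Basis ι k g)

lemma forms_induction {P : Forms k g ι → Prop} (tmul : ∀ x p, P (x ⊗ₜ p))
    (add : ∀ ω η, P ω → P η → P (ω + η)) (ω : Forms k g ι) : P ω := by
  induction ω using TensorProduct.induction_on with
  | zero => simpa using tmul 0 0
  | tmul x p => exact tmul x p
  | add ω η h h' => exact add _ _ h h'

/-- The negation of forms, expressed by the module structure. -/
lemma forms_neg (ω : Forms k g ι) : -ω = (-1 : k) • ω := by
  rw [neg_eq_iff_add_eq_zero]
  nth_rw 1 [← one_smul k ω]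
  rw [← add_smul, add_neg_cancel, zero_smul]

lemma forms_neg_mul (ω η : Forms k g ι) : -ω * η = -(ω * η) := by
  rw [forms_neg, forms_neg, smul_mul_assoc]

lemma forms_neg_smul (c : k) (ω : Forms k g ι) : -c • ω = -(c • ω) := by
  rw [forms_neg, smul_smul, neg_one_mul]

/-- The parity automorphism of the algebra of forms. -/
noncomputable def formInv : Forms k g ι →ₗ[k] Forms k g ι :=
  TensorProduct.map gradeInv.toLinearMap LinearMap.id

@[simp] lemma formInv_tmul (x : Ch k g) (p : MvPowerSeries ι k) :
    formInv (x ⊗ₜ[k] p) = gradeInv x ⊗ₜ[k] p := rfl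

lemma deRham_apply (x : Ch k g) :
    deRham e x = ∑ j, contrL (e j) x ⊗ₜ[k] (MvPowerSeries.X j : MvPowerSeries ι k) := by
  simp [deRham]

@[simp] lemma deRham_one : deRham e (1 : Ch k g) = 0 := by simp [deRham_apply]

lemma deRham_mul (x y : Ch k g) :
    deRham e (x * y) = deRham e x * (y ⊗ₜ[k] 1) + (gradeInv x ⊗ₜ[k] 1) * deRham e y := by
  simp only [deRham_apply, contrL_mul, TensorProduct.add_tmul, Finset.sum_add_distrib,
    Finset.sum_mul, Finset.mul_sum, Algebra.TensorProduct.tmul_mul_tmul, one_mul, mul_one]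

lemma formInv_deRham (x : Ch k g) : formInv (deRham e x) = - deRham e (gradeInv x) := by
  simp only [deRham_apply, map_sum, formInv_tmul, gradeInv_contrL, TensorProduct.neg_tmul,
    Finset.sum_neg_distrib]

lemma formInv_deRham_chBasis (s : Finset ι) :
    formInv (deRham e (chBasis e s)) = (-1 : k) ^ (s.card + 1) • deRham e (chBasis e s) := by
  rw [formInv_deRham, gradeInv_chBasis, map_smul, pow_succ, mul_neg_one,
    forms_neg_smul]

lemma chBasis_mul_deRham (s u : Finset ι) :
    chBasis e u ⊗ₜ[k] 1 * deRham e (chBasis e s) =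
      (-1 : k) ^ (u.card * (s.card + 1)) • (deRham e (chBasis e s) * chBasis e u ⊗ₜ[k] 1) := by
  rw [deRham_apply, Finset.mul_sum, Finset.sum_mul, Finset.smul_sum]
  refine Finset.sum_congr rfl fun j _ => ?_
  rw [Algebra.TensorProduct.tmul_mul_tmul, Algebra.TensorProduct.tmul_mul_tmul, one_mul, mul_one,
    TensorProduct.smul_tmul']
  congr 1
  rcases hs : s.card with _ | n
  · have h := chBasis_mem e s
    rw [hs] at h
    rw [contrL_of_mem_zero _ h, mul_zero, zero_mul, smul_zero]
  · have h := chBasis_mem e s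
    rw [hs] at h
    rw [mul_comm_of_mem (chBasis_mem e u) (contrL_mem_exteriorPower (e j) h)]
    congr 1
    rw [show u.card * (n + 1 + 1) = u.card * n + 2 * u.card by ring, pow_add, pow_mul _ 2]
    simp

lemma formsD_tmul (x : Ch k g) (p : MvPowerSeries ι k) :
    formsD e (x ⊗ₜ[k] p) = ceD e x ⊗ₜ[k] p +
      ∑ c, (ExteriorAlgebra.ι k (e.coord c) * x) ⊗ₜ[k] coadj e c p := by
  simp [formsD, wedge]

lemma formsD_mul (ω η : Forms k g ι) :
    formsD e (ω * η) = formsD e ω * η + formInv ω * formsD e η := by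
  induction ω using forms_induction with
  | add ω ω' h h' => simp only [add_mul, map_add, h, h']; abel
  | tmul x p =>
    induction η using forms_induction with
    | add η η' h h' => simp only [mul_add, map_add, h, h']; abel
    | tmul y q =>
      simp only [formsD_tmul, Algebra.TensorProduct.tmul_mul_tmul, ceD_mul, formInv_tmul, add_mul,
        mul_add, Finset.sum_mul, Finset.mul_sum, TensorProduct.add_tmul]
      have h : ∀ c, (ExteriorAlgebra.ι k (e.coord c) * (x * y)) ⊗ₜ[k] (coadj e c) (p * q) =
          (ExteriorAlgebra.ι k (e.coord c) * x * y) ⊗ₜ[k] (coadj e c p * q) +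
          (gradeInv x * (ExteriorAlgebra.ι k (e.coord c) * y)) ⊗ₜ[k] (p * coadj e c q) := by
        intro c
        rw [← mul_assoc (gradeInv x), ← ι_mul_comm, mul_assoc, ← TensorProduct.tmul_add]
        congr 1
        rw [Derivation.leibniz, smul_eq_mul, smul_eq_mul, mul_comm q, add_comm]
      simp only [h, Finset.sum_add_distrib]
      abel

lemma formsD_ofCh (x : Ch k g) : formsD e (x ⊗ₜ[k] 1) = ceD e x ⊗ₜ[k] 1 := by
  simp [formsD_tmul]

lemma coadj_apply (c : ι) (p : MvPowerSeries ι k) :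
    coadj e c p = ∑ b, adMatrix e b c * MvPowerSeries.pderiv k b p := by
  have : coadj e c p = Derivation.coeFnAddMonoidHom (coadj e c) p := rfl
  rw [this, coadj, map_sum, Finset.sum_apply]
  rfl

lemma coadj_X (c j : ι) : coadj e c (MvPowerSeries.X j) = adMatrix e j c := by
  rw [coadj_apply]
  simp [MvPowerSeries.pderiv_X, Pi.single_apply]

lemma formsD_deRham [CharZero k] (x : Ch k g) :
    formsD e (deRham e x) = - deRham e (ceD e x) := by
  simp only [deRham_apply, map_sum, formsD_tmul, coadj_X, Finset.sum_add_distrib, ceD_contrL,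
    TensorProduct.sub_tmul, Finset.sum_sub_distrib]
  suffices h : ∑ j, lieDer e (e j) x ⊗ₜ[k] (MvPowerSeries.X j : MvPowerSeries ι k) +
      ∑ j, ∑ c, (ExteriorAlgebra.ι k (e.coord c) * contrL (e j) x) ⊗ₜ[k] adMatrix e j c = 0 by
    rw [sub_add_eq_add_sub, h, zero_sub]
  have h1 : ∀ c, ∑ j, (ExteriorAlgebra.ι k (e.coord c) * contrL (e j) x) ⊗ₜ[k] adMatrix e j c =
      ∑ a, (ExteriorAlgebra.ι k (e.coord c) * contrL ⁅e a, e c⁆ x) ⊗ₜ[k]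
        (MvPowerSeries.X a : MvPowerSeries ι k) := by
    intro c
    have h2 : ∀ a, contrL ⁅e a, e c⁆ x = ∑ j, e.repr ⁅e a, e c⁆ j • contrL (e j) x := by
      intro a
      conv_lhs => rw [← e.sum_repr ⁅e a, e c⁆, ← contrLin_apply, map_sum]
      simp [contrLin_apply, contrL_smul]
    simp only [h2, adMatrix, Finset.mul_sum, TensorProduct.tmul_sum, TensorProduct.sum_tmul]
    rw [Finset.sum_comm]
    refine Finset.sum_congr rfl fun a _ => Finset.sum_congr rfl fun j _ => ?_
    rw [← MvPowerSeries.smul_eq_C_mul, mul_smul_comm, TensorProduct.tmul_smul,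
      TensorProduct.smul_tmul']
  rw [Finset.sum_comm, Finset.sum_congr rfl fun c _ => h1 c, Finset.sum_comm,
    ← Finset.sum_add_distrib]
  refine Finset.sum_eq_zero fun a _ => ?_
  rw [lieDer_apply, TensorProduct.neg_tmul, TensorProduct.sum_tmul, neg_add_cancel]

end FormsAlgebra

/-! ### The Hochschild--Kostant--Rosenberg map is a chain map -/

section HKR

variable {k g ι : Type*} [Field k] [LieRing g] [LieAlgebra k g]
variable [Fintype ι] [LinearOrder ι] (e : Module.Basis ι k g)

/-- The Hochschild--Kostant--Rosenberg map on `a_1 ⊗ ⋯ ⊗ a_i`, up to a factor: it is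
`(-1)^(∑ m, (i - m) deg a_m) d_dR a_1 ⋯ d_dR a_i`. -/
noncomputable def hkrTail : ℕ → (List (Finset ι) → k) →ₗ[k] Forms k g ι
  | 0 => (LinearMap.proj []).smulRight 1
  | i + 1 => ∑ s : Finset ι, (-1 : k) ^ (i * s.card) •
      LinearMap.mulLeft k (deRham e (chBasis e s)) ∘ₗ hkrTail i ∘ₗ cut s

lemma hkrTail_zero (F : List (Finset ι) → k) : hkrTail e 0 F = F [] • 1 := rfl

lemma hkrTail_succ (i : ℕ) (F : List (Finset ι) → k) :
    hkrTail e (i + 1) F = ∑ s : Finset ι, (-1 : k) ^ (i * s.card) •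
      (deRham e (chBasis e s) * hkrTail e i (cut s F)) := by
  simp [hkrTail]

lemma hkrTail_congr {i : ℕ} {F G : List (Finset ι) → k}
    (h : ∀ l, l.length = i → ∅ ∉ l → F l = G l) : hkrTail e i F = hkrTail e i G := by
  induction i generalizing F G with
  | zero => rw [hkrTail_zero, hkrTail_zero, h [] rfl (by simp)]
  | succ i ih =>
    rw [hkrTail_succ, hkrTail_succ]
    refine Finset.sum_congr rfl fun s _ => ?_
    by_cases hs : s = ∅
    · simp [hs]
    · rw [ih (F := cut s F) (G := cut s G) fun l hl hl' =>
        h (s :: l) (by simp [hl]) (by simp [hl', Ne.symm hs])]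

lemma chBasis_mul_hkrTail (u : Finset ι) (i : ℕ) (F : List (Finset ι) → k) :
    chBasis e u ⊗ₜ[k] 1 * hkrTail e i F =
      hkrTail e i (fun l => psign k (u.card * (lpar (chAlg e).par l + i)) * F l) *
        chBasis e u ⊗ₜ[k] 1 := by
  induction i generalizing F with
  | zero => simp [hkrTail_zero, lpar]
  | succ i ih =>
    rw [hkrTail_succ, hkrTail_succ, Finset.mul_sum, Finset.sum_mul]
    refine Finset.sum_congr rfl fun s _ => ?_
    have h : cut s (fun l => psign k (u.card * (lpar (chAlg e).par l + (i + 1 : ℕ))) * F l) =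
        (-1 : k) ^ (u.card * (s.card + 1)) •
          fun l => psign k (u.card * (lpar (chAlg e).par l + i)) * cut s F l := by
      funext l
      simp only [cut_apply, Pi.smul_apply, smul_eq_mul]
      rw [← mul_assoc, ← psign_natCast (R := k), ← psign_add]
      congr 2
      simp only [lpar, List.map_cons, List.sum_cons, BasedDGAlgebra.par, chAlg]
      push_cast
      ring
    rw [h, map_smul, mul_smul_comm, ← mul_assoc, chBasis_mul_deRham, smul_mul_assoc, mul_assoc, ih,
      mul_smul_comm, smul_mul_assoc, smul_mul_assoc, mul_assoc]

/-- The component of length `i + 1` of the Hochschild--Kostant--Rosenberg map, up to the factor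
`(-1)^i / i!`. -/
noncomputable def hkrRaw (i : ℕ) : (Finset ι → List (Finset ι) → k) →ₗ[k] Forms k g ι :=
  ∑ s : Finset ι, (-1 : k) ^ (i * s.card) •
    LinearMap.mulLeft k (chBasis e s ⊗ₜ[k] 1) ∘ₗ hkrTail e i ∘ₗ LinearMap.proj s

lemma hkrRaw_apply (i : ℕ) (Y : Finset ι → List (Finset ι) → k) :
    hkrRaw e i Y = ∑ s : Finset ι, (-1 : k) ^ (i * s.card) •
      (chBasis e s ⊗ₜ[k] 1 * hkrTail e i (Y s)) := by
  simp [hkrRaw]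

lemma hkrRaw_congr {i : ℕ} {Y Z : Finset ι → List (Finset ι) → k}
    (h : ∀ s l, l.length = i → ∅ ∉ l → Y s l = Z s l) : hkrRaw e i Y = hkrRaw e i Z := by
  rw [hkrRaw_apply, hkrRaw_apply]
  exact Finset.sum_congr rfl fun s _ => by rw [hkrTail_congr e (h s)]

variable [CharZero k]

/-- Regrouping of a sum over the basis that involves the structure constants of the product. -/
lemma sum_regroup_mul (i : ℕ) (A : Ch k g →ₗ[k] Forms k g ι)
    (T : Finset ι → Finset ι → Forms k g ι) :
    ∑ s : Finset ι, (-1 : k) ^ (i * s.card) • (A (chBasis e s) *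
      ∑ t, ∑ u, (chAlg e).mul t u s • T t u) =
    ∑ t : Finset ι, ∑ u : Finset ι, (-1 : k) ^ (i * (t.card + u.card)) •
      (A (chBasis e t * chBasis e u) * T t u) := by
  have h : ∀ t u, (-1 : k) ^ (i * (t.card + u.card)) • (A (chBasis e t * chBasis e u) * T t u) =
      ∑ s : Finset ι, (-1 : k) ^ (i * s.card) • (A (chBasis e s) *
        ((chAlg e).mul t u s • T t u)) := by
    intro t u
    rw [← sum_mul_smul_chBasis, map_sum, Finset.sum_mul, Finset.smul_sum]
    refine Finset.sum_congr rfl fun s _ => ?_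
    by_cases hs : (chAlg e).mul t u s = 0
    · simp [hs]
    · rw [card_of_mul_ne_zero e hs, map_smul, smul_mul_assoc, mul_smul_comm]
  simp only [h, Finset.mul_sum, Finset.smul_sum]
  rw [Finset.sum_comm]
  exact Finset.sum_congr rfl fun t _ => Finset.sum_comm

lemma sum_regroup_diff (i : ℕ) (A : Ch k g →ₗ[k] Forms k g ι) (T : Finset ι → Forms k g ι) :
    ∑ s : Finset ι, (-1 : k) ^ (i * s.card) • (A (chBasis e s) *
      ∑ t, (chAlg e).diff t s • T t) =
    ∑ t : Finset ι, (-1 : k) ^ (i * (t.card + 1)) • (A (ceD e (chBasis e t)) * T t) := by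
  have h : ∀ t, (-1 : k) ^ (i * (t.card + 1)) • (A (ceD e (chBasis e t)) * T t) =
      ∑ s : Finset ι, (-1 : k) ^ (i * s.card) • (A (chBasis e s) *
        ((chAlg e).diff t s • T t)) := by
    intro t
    rw [← sum_diff_smul_chBasis, map_sum, Finset.sum_mul, Finset.smul_sum]
    refine Finset.sum_congr rfl fun s _ => ?_
    by_cases hs : (chAlg e).diff t s = 0
    · simp [hs]
    · rw [card_of_diff_ne_zero e hs, map_smul, smul_mul_assoc, mul_smul_comm]
  simp only [h, Finset.mul_sum, Finset.smul_sum]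
  rw [Finset.sum_comm]

/-- The Hochschild--Kostant--Rosenberg map sends the bar differential to a commutator, because
`d_dR` is a derivation. -/
lemma hkrTail_barD (i : ℕ) (F : List (Finset ι) → k) :
    hkrTail e i (barD (chAlg e).mul F) =
      ∑ s : Finset ι, (-1 : k) ^ (i * s.card) • (chBasis e s ⊗ₜ[k] 1 * hkrTail e i (cut s F)) -
      (-1 : k) ^ i • ∑ u : Finset ι, hkrTail e i (cutLast u F) * chBasis e u ⊗ₜ[k] 1 := by
  induction i generalizing F with
  | zero => simp [hkrTail_zero, cut_apply, cutLast_apply]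
  | succ i ih =>
    have h1 : ∀ s, hkrTail e i (cut s (barD (chAlg e).mul F)) =
        ∑ t, ∑ u, (chAlg e).mul t u s • hkrTail e i (cut u (cut t F)) -
          hkrTail e i (barD (chAlg e).mul (cut s F)) := by
      intro s
      rw [cut_barD]
      simp only [map_sub, map_sum, map_smul]
    rw [hkrTail_succ]
    simp only [h1, mul_sub, smul_sub, Finset.sum_sub_distrib]
    rw [sum_regroup_mul]
    simp only [deRham_mul, ih, gradeInv_chBasis, mul_sub, smul_sub, Finset.sum_sub_distrib, add_mul,
      smul_add, Finset.sum_add_distrib, Finset.mul_sum, Finset.smul_sum]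
    have h2 : ∀ s t : Finset ι, (-1 : k) ^ (i * (s.card + t.card)) •
        (deRham e (chBasis e s) * chBasis e t ⊗ₜ[k] 1 * hkrTail e i (cut t (cut s F))) =
        (-1 : k) ^ (i * s.card) • (deRham e (chBasis e s) * (-1 : k) ^ (i * t.card) •
          (chBasis e t ⊗ₜ[k] 1 * hkrTail e i (cut t (cut s F)))) := by
      intro s t
      rw [mul_smul_comm, smul_smul, mul_assoc, mul_add, pow_add]
    simp only [h2]
    have h3 : ∀ s t : Finset ι, (-1 : k) ^ (i * (s.card + t.card)) •
        (((-1 : k) ^ s.card • chBasis e s) ⊗ₜ[k] 1 * deRham e (chBasis e t) *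
          hkrTail e i (cut t (cut s F))) =
        (-1 : k) ^ (i * s.card + 1 * s.card) • (chBasis e s ⊗ₜ[k] 1 * (-1 : k) ^ (i * t.card) •
          (deRham e (chBasis e t) * hkrTail e i (cut t (cut s F)))) := by
      intro s t
      rw [← TensorProduct.smul_tmul', smul_mul_assoc, smul_mul_assoc, mul_smul_comm, smul_smul,
        smul_smul, mul_assoc]
      congr 1
      ring
    simp only [h3]
    have h4 : ∀ s u : Finset ι, (-1 : k) ^ (i * s.card) • (deRham e (chBasis e s) *
        (-1 : k) ^ i • (hkrTail e i (cutLast u (cut s F)) * chBasis e u ⊗ₜ[k] 1)) =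
        -((-1 : k) ^ (i + 1) • ((-1 : k) ^ (i * s.card) • (deRham e (chBasis e s) *
          hkrTail e i (cut s (cutLast u F))) * chBasis e u ⊗ₜ[k] 1)) := by
      intro s u
      rw [mul_smul_comm, smul_mul_assoc, mul_assoc, cut_cutLast, pow_succ, mul_neg_one,
        forms_neg_smul, neg_neg, smul_comm]
    simp only [h4, hkrTail_succ, Finset.mul_sum, Finset.sum_mul, Finset.smul_sum,
      Finset.sum_neg_distrib]
    rw [Finset.sum_comm (γ := Finset ι) (f := fun s u => (-1 : k) ^ (i + 1) •
      ((-1 : k) ^ (i * s.card) • (deRham e (chBasis e s) *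
          hkrTail e i (cut s (cutLast u F))) * chBasis e u ⊗ₜ[k] 1))]
    abel

/-- The forms `d_dR a` satisfy `d (d_dR a) = - d_dR (d a)`; `formsD` is a derivation. -/
lemma formsD_hkrTail (i : ℕ) (F : List (Finset ι) → k) :
    formsD e (hkrTail e i F) =
      (-1 : k) ^ i • hkrTail e i (intD (chAlg e).diff (chAlg e).par F) := by
  induction i generalizing F with
  | zero =>
    have h := formsD_ofCh e (1 : Ch k g)
    rw [ceD_one, TensorProduct.zero_tmul] at h
    rw [hkrTail_zero, hkrTail_zero, map_smul, Algebra.TensorProduct.one_def, h]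
    simp
  | succ i ih =>
    have h1 : ∀ s, hkrTail e i (cut s (intD (chAlg e).diff (chAlg e).par F)) =
        ∑ t, (chAlg e).diff t s • hkrTail e i (cut t F) +
          (-1 : k) ^ s.card • hkrTail e i (intD (chAlg e).diff (chAlg e).par (cut s F)) := by
      intro s
      have : psign k ((chAlg e).par s) = (-1) ^ s.card := psign_natCast _
      rw [cut_intD, this]
      simp only [map_add, map_sum, map_smul]
    rw [hkrTail_succ, hkrTail_succ]
    simp only [h1, mul_add, smul_add, Finset.sum_add_distrib]
    rw [sum_regroup_diff]
    simp only [map_sum, map_smul, formsD_mul, ih, formsD_deRham, formInv_deRham_chBasis,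
      smul_add, Finset.sum_add_distrib, Finset.smul_sum]
    congr 1
    · refine Finset.sum_congr rfl fun s _ => ?_
      rw [forms_neg_mul, smul_neg, smul_smul, ← forms_neg_smul]
      congr 1
      ring_nf
      simp [mul_comm i 2, pow_mul]
    · refine Finset.sum_congr rfl fun s _ => ?_
      rw [smul_mul_assoc, mul_smul_comm, mul_smul_comm, smul_smul, smul_smul, smul_smul, smul_smul]
      congr 1
      ring

/-- Graded commutativity makes the Hochschild--Kostant--Rosenberg map vanish on the image of the
multiplicative part of the differential. -/
theorem hkrRaw_hochMul (i : ℕ) (Y : Finset ι → List (Finset ι) → k) :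
    hkrRaw e i (hochMul (chAlg e).mul (chAlg e).par Y) = 0 := by
  have h0 : hochMul (chAlg e).mul (chAlg e).par Y =
      (fun s => ∑ t, ∑ u, (chAlg e).mul t u s • cut u (Y t)) -
        (fun s => barD (chAlg e).mul (Y s)) + cycD (chAlg e).mul (chAlg e).par Y := by
    funext s l
    rw [hochMul_apply, barD_cons]
    simp [cut_apply]
  rw [h0, map_add, map_sub]
  -- the terms `a_0 a_1 ⊗ ⋯`
  have h1 : hkrRaw e i (fun s => ∑ t, ∑ u, (chAlg e).mul t u s • cut u (Y t)) =
      ∑ t : Finset ι, ∑ u : Finset ι, (-1 : k) ^ (i * t.card) • (chBasis e t ⊗ₜ[k] 1 *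
        (-1 : k) ^ (i * u.card) • (chBasis e u ⊗ₜ[k] 1 * hkrTail e i (cut u (Y t)))) := by
    rw [hkrRaw_apply]
    simp only [map_sum, map_smul]
    have := sum_regroup_mul e i ((TensorProduct.mk k (Ch k g) (MvPowerSeries ι k)).flip 1)
      (fun t u => hkrTail e i (cut u (Y t)))
    simp only [LinearMap.flip_apply, TensorProduct.mk_apply] at this
    rw [this]
    refine Finset.sum_congr rfl fun t _ => Finset.sum_congr rfl fun u _ => ?_
    rw [mul_smul_comm, smul_smul, ← mul_assoc, Algebra.TensorProduct.tmul_mul_tmul, one_mul,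
      mul_add, pow_add]
  -- the terms `± a_i a_0 ⊗ ⋯`; together, they are the commutator that comes from the bar
  -- differential
  have h2 : hkrRaw e i (cycD (chAlg e).mul (chAlg e).par Y) =
      -((-1 : k) ^ i • ∑ t : Finset ι, ∑ u : Finset ι, (-1 : k) ^ (i * t.card) •
        (chBasis e t ⊗ₜ[k] 1 * (hkrTail e i (cutLast u (Y t)) * chBasis e u ⊗ₜ[k] 1))) := by
    have h3 : ∀ s, hkrTail e i (cycD (chAlg e).mul (chAlg e).par Y s) =
        ∑ u, ∑ t, (chAlg e).mul u t s • hkrTail e i (fun l =>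
          psign k (i + 1 + u.card * (t.card + lpar (chAlg e).par l)) * cutLast u (Y t) l) := by
      intro s
      rw [Finset.sum_comm]
      simp only [← map_smul, ← map_sum]
      refine hkrTail_congr e fun l hl _ => ?_
      simp only [cycD_apply, hl, Finset.mul_sum, Finset.sum_apply, Pi.smul_apply, smul_eq_mul]
      refine Finset.sum_congr rfl fun t _ => Finset.sum_congr rfl fun u _ => ?_
      rw [psign_add (R := k) (i + 1)]
      simp only [BasedDGAlgebra.par, chAlg, cutLast_apply]
      ring
    rw [hkrRaw_apply]
    simp only [h3]
    have := sum_regroup_mul e i ((TensorProduct.mk k (Ch k g) (MvPowerSeries ι k)).flip 1)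
      (fun u t => hkrTail e i (fun l =>
          psign k (i + 1 + u.card * (t.card + lpar (chAlg e).par l)) * cutLast u (Y t) l))
    simp only [LinearMap.flip_apply, TensorProduct.mk_apply] at this
    rw [this, Finset.sum_comm, Finset.smul_sum, ← Finset.sum_neg_distrib]
    refine Finset.sum_congr rfl fun t _ => ?_
    rw [Finset.smul_sum, ← Finset.sum_neg_distrib]
    refine Finset.sum_congr rfl fun u _ => ?_
    rw [mul_comm_of_mem (chBasis_mem e u) (chBasis_mem e t), ← TensorProduct.smul_tmul',
      smul_mul_assoc, smul_smul]
    have h5 : (chBasis e t * chBasis e u) ⊗ₜ[k] (1 : MvPowerSeries ι k) =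
      chBasis e t ⊗ₜ[k] 1 * chBasis e u ⊗ₜ[k] 1 := by
        rw [Algebra.TensorProduct.tmul_mul_tmul, one_mul]
    rw [h5, mul_assoc, chBasis_mul_hkrTail]
    have h4 : (fun l => psign k (u.card * (lpar (chAlg e).par l + i)) *
        (psign k (i + 1 + u.card * (t.card + lpar (chAlg e).par l)) * cutLast u (Y t) l)) =
        (-1 : k) ^ (i + 1 + u.card * (t.card + i)) • cutLast u (Y t) := by
      funext l
      rw [Pi.smul_apply, smul_eq_mul, ← mul_assoc, ← psign_add, ← psign_natCast (R := k)]
      congr 2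
      have h : lpar (chAlg e).par l + lpar (chAlg e).par l = 0 := CharTwo.add_self_eq_zero _
      push_cast
      linear_combination (u.card : ZMod 2) * h
    rw [h4, map_smul, smul_mul_assoc, mul_smul_comm, smul_smul, smul_smul, ← forms_neg_smul]
    congr 1
    have h7 : ∀ n : ℕ, -(-1 : k) ^ n = (-1) ^ (n + 1) := fun n => by rw [pow_succ, mul_neg_one]
    rw [← pow_add, ← pow_add, ← pow_add, h7, ← psign_natCast (R := k), ← psign_natCast (R := k)]
    congr 1
    have h : ∀ a : ZMod 2, a + a = 0 := CharTwo.add_self_eq_zero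
    push_cast
    linear_combination h ((i : ZMod 2) * u.card) + h ((u.card : ZMod 2) * t.card)
  rw [h1, h2, hkrRaw_apply]
  simp only [hkrTail_barD, mul_sub, smul_sub, Finset.sum_sub_distrib, Finset.mul_sum,
    Finset.smul_sum]
  have h6 : ∀ s u, (-1 : k) ^ (i * s.card) • (chBasis e s ⊗ₜ[k] 1 * (-1 : k) ^ i •
      (hkrTail e i (cutLast u (Y s)) * chBasis e u ⊗ₜ[k] 1)) =
      (-1 : k) ^ i • (-1 : k) ^ (i * s.card) • (chBasis e s ⊗ₜ[k] 1 *
      (hkrTail e i (cutLast u (Y s)) * chBasis e u ⊗ₜ[k] 1)) := by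
    intro s u
    rw [mul_smul_comm, smul_comm]
  simp only [h6]
  abel

theorem hkrRaw_hochInt (i : ℕ) (Y : Finset ι → List (Finset ι) → k) :
    hkrRaw e i (hochInt (chAlg e).diff (chAlg e).par Y) =
      (-1 : k) ^ i • formsD e (hkrRaw e i Y) := by
  have h0 : hochInt (chAlg e).diff (chAlg e).par Y =
      fun s => ∑ t, (chAlg e).diff t s • Y t +
        (-1 : k) ^ s.card • intD (chAlg e).diff (chAlg e).par (Y s) := by
    funext s l
    have : psign k ((chAlg e).par s) = (-1) ^ s.card := psign_natCast _
    rw [hochInt_apply, intD_cons, this]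
    simp
  rw [h0, hkrRaw_apply, hkrRaw_apply]
  simp only [map_add, map_sum, map_smul, mul_add, smul_add, Finset.sum_add_distrib, formsD_mul,
    formsD_ofCh, formInv_tmul, gradeInv_chBasis, formsD_hkrTail, Finset.smul_sum]
  have := sum_regroup_diff e i ((TensorProduct.mk k (Ch k g) (MvPowerSeries ι k)).flip 1)
    (fun t => hkrTail e i (Y t))
  simp only [LinearMap.flip_apply, TensorProduct.mk_apply] at this
  rw [this]
  congr 1
  · refine Finset.sum_congr rfl fun s _ => ?_
    rw [smul_smul]
    congr 1
    ring
  · refine Finset.sum_congr rfl fun s _ => ?_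
    simp only [← TensorProduct.smul_tmul', smul_mul_assoc, mul_smul_comm, smul_smul]
    congr 1
    have h : (-1 : k) ^ i * (-1) ^ i = 1 := by rw [← mul_pow]; simp
    linear_combination (- (-1 : k) ^ (i * s.card) * (-1) ^ s.card) * h

theorem hkrRaw_hochRed (i : ℕ) (Y : Finset ι → List (Finset ι) → k) :
    hkrRaw e i (hochRed (chAlg e) Y) = formsD e (hkrRaw e i Y) := by
  have h : hkrRaw e i (hochRed (chAlg e) Y) =
      hkrRaw e i (hochMul (chAlg e).mul (chAlg e).par Y +
        (-1 : k) ^ i • hochInt (chAlg e).diff (chAlg e).par Y) := by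
    refine hkrRaw_congr e fun s l hl hl' => ?_
    rw [hochRed_of_notMem _ _ _ hl', hochTot_apply, hl, psign_natCast]
    rfl
  rw [h, map_add, hkrRaw_hochMul, zero_add, map_smul, hkrRaw_hochInt, smul_smul, ← mul_pow]
  simp

end HKR

/-! ### Homogeneous components of power series and forms -/

section Homogeneous

variable {k ι : Type*} [Field k]

lemma isHomogeneous_iff {f : MvPowerSeries ι k} {n : ℕ} :
    f.IsHomogeneous n ↔ ∀ α, MvPowerSeries.coeff α f ≠ 0 → α.degree = n := by
  refine ⟨fun h α hα => ?_, fun h α hα => ?_⟩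
  · by_contra h'
    exact hα (h.coeff_eq_zero h')
  · rw [← h α hα, Finsupp.degree_eq_weight_one]
    rfl

/-- Multiplication with a homogeneous power series shifts homogeneous components. -/
lemma homogeneousComponent_mul {f : MvPowerSeries ι k} {i : ℕ} (hf : f.IsHomogeneous i) (n : ℕ)
    (p : MvPowerSeries ι k) :
    (f * p).homogeneousComponent (i + n) = f * p.homogeneousComponent n := by
  classical
  ext α
  rw [MvPowerSeries.coeff_homogeneousComponent, MvPowerSeries.coeff_mul, MvPowerSeries.coeff_mul]
  have h : ∀ a ∈ Finset.HasAntidiagonal.antidiagonal α,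
      MvPowerSeries.coeff a.1 f * MvPowerSeries.coeff a.2 (p.homogeneousComponent n) =
        if α.degree = i + n then MvPowerSeries.coeff a.1 f * MvPowerSeries.coeff a.2 p else 0 := by
    intro a ha
    rw [MvPowerSeries.coeff_homogeneousComponent]
    by_cases h0 : MvPowerSeries.coeff a.1 f = 0
    · simp [h0]
    · have h1 := isHomogeneous_iff.1 hf _ h0
      rw [← Finset.HasAntidiagonal.mem_antidiagonal.1 ha, map_add, h1]
      simp only [add_right_inj, mul_ite, mul_zero]
  rw [Finset.sum_congr rfl h]
  split_ifs <;> simp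

lemma homogeneousComponent_mul_of_lt {f : MvPowerSeries ι k} {i n : ℕ} (hf : f.IsHomogeneous i)
    (hn : n < i) (p : MvPowerSeries ι k) : (f * p).homogeneousComponent n = 0 := by
  classical
  ext α
  rw [MvPowerSeries.coeff_homogeneousComponent, MvPowerSeries.coeff_mul, map_zero]
  refine ite_eq_right_iff.2 fun h => Finset.sum_eq_zero fun a ha => ?_
  by_cases h0 : MvPowerSeries.coeff a.1 f = 0
  · rw [h0, zero_mul]
  · have h1 := isHomogeneous_iff.1 hf _ h0
    rw [← Finset.HasAntidiagonal.mem_antidiagonal.1 ha, map_add, h1] at h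
    omega

lemma homogeneousComponent_pderiv (n : ℕ) (b : ι) (p : MvPowerSeries ι k) :
    (MvPowerSeries.pderiv k b p).homogeneousComponent n =
      MvPowerSeries.pderiv k b (p.homogeneousComponent (n + 1)) := by
  classical
  ext α
  simp only [MvPowerSeries.coeff_homogeneousComponent, MvPowerSeries.coeff_pderiv, map_add,
    Finsupp.degree_single, add_left_inj, ite_mul, zero_mul]

lemma pderiv_homogeneousComponent_zero (b : ι) (p : MvPowerSeries ι k) :
    MvPowerSeries.pderiv k b (p.homogeneousComponent 0) = 0 := by
  classical
  ext α
  simp [MvPowerSeries.coeff_homogeneousComponent, MvPowerSeries.coeff_pderiv]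

lemma isHomogeneous_X (j : ι) : (MvPowerSeries.X j : MvPowerSeries ι k).IsHomogeneous 1 := by
  classical
  refine isHomogeneous_iff.2 fun α hα => ?_
  rw [MvPowerSeries.coeff_X] at hα
  split_ifs at hα with h
  · simp [h]
  · exact absurd rfl hα

lemma isHomogeneous_C (c : k) : (MvPowerSeries.C c : MvPowerSeries ι k).IsHomogeneous 0 := by
  classical
  refine isHomogeneous_iff.2 fun α hα => ?_
  rw [MvPowerSeries.coeff_C] at hα
  split_ifs at hα with h
  · simp [h]
  · exact absurd rfl hα

lemma isHomogeneous_one : (1 : MvPowerSeries ι k).IsHomogeneous 0 := by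
  rw [← map_one MvPowerSeries.C]
  exact isHomogeneous_C 1

lemma isHomogeneous_sum {κ : Type*} (s : Finset κ) (f : κ → MvPowerSeries ι k) {n : ℕ}
    (h : ∀ a ∈ s, (f a).IsHomogeneous n) : (∑ a ∈ s, f a).IsHomogeneous n := by
  refine isHomogeneous_iff.2 fun α hα => ?_
  rw [map_sum] at hα
  obtain ⟨a, ha, ha'⟩ := Finset.exists_ne_zero_of_sum_ne_zero hα
  exact isHomogeneous_iff.1 (h a ha) α ha'

lemma ext_homogeneousComponent {p q : MvPowerSeries ι k}
    (h : ∀ n, p.homogeneousComponent n = q.homogeneousComponent n) : p = q := by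
  ext α
  have := congrArg (MvPowerSeries.coeff α) (h α.degree)
  simpa [MvPowerSeries.coeff_homogeneousComponent] using this

end Homogeneous

section FormComponents

variable {k g ι : Type*} [Field k] [LieRing g] [LieAlgebra k g]
variable [Fintype ι] [LinearOrder ι] (e : Module.Basis ι k g)

lemma isHomogeneous_adMatrix (b c : ι) : (adMatrix e b c).IsHomogeneous 1 := by
  refine isHomogeneous_sum _ _ fun a _ => ?_
  rw [← zero_add 1]
  exact MvPowerSeries.IsHomogeneous.mul (isHomogeneous_C _) (isHomogeneous_X a)

lemma homogeneousComponent_coadj (n : ℕ) (c : ι) (p : MvPowerSeries ι k) :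
    (coadj e c p).homogeneousComponent n = coadj e c (p.homogeneousComponent n) := by
  rw [coadj_apply, coadj_apply, map_sum]
  refine Finset.sum_congr rfl fun b _ => ?_
  rcases n with _ | n
  · rw [homogeneousComponent_mul_of_lt (isHomogeneous_adMatrix e b c) zero_lt_one,
      pderiv_homogeneousComponent_zero, mul_zero]
  · rw [add_comm n 1, homogeneousComponent_mul (isHomogeneous_adMatrix e b c),
      homogeneousComponent_pderiv, add_comm]

/-- The component of a form with coefficients of polynomial degree `n`. -/
noncomputable def formProj (n : ℕ) : Forms k g ι →ₗ[k] Forms k g ι :=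
  TensorProduct.map LinearMap.id (MvPowerSeries.homogeneousComponent n)

@[simp] lemma formProj_tmul (n : ℕ) (x : Ch k g) (p : MvPowerSeries ι k) :
    formProj n (x ⊗ₜ[k] p) = x ⊗ₜ[k] p.homogeneousComponent n := rfl

lemma formProj_formsD (n : ℕ) (ω : Forms k g ι) :
    formProj n (formsD e ω) = formsD e (formProj n ω) := by
  induction ω using forms_induction with
  | add ω η h h' => simp only [map_add, h, h']
  | tmul x p => simp only [formsD_tmul, formProj_tmul, map_add, map_sum, homogeneousComponent_coadj]

lemma formProj_mul_deRham (n : ℕ) (x : Ch k g) (ω : Forms k g ι) :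
    formProj (1 + n) (deRham e x * ω) = deRham e x * formProj n ω := by
  induction ω using forms_induction with
  | add ω η h h' => simp only [map_add, mul_add, h, h']
  | tmul y p =>
    simp only [deRham_apply, Finset.sum_mul, map_sum, Algebra.TensorProduct.tmul_mul_tmul,
      formProj_tmul, homogeneousComponent_mul (isHomogeneous_X _)]

lemma formProj_mul_ofCh (n : ℕ) (x : Ch k g) (ω : Forms k g ι) :
    formProj n (x ⊗ₜ[k] 1 * ω) = x ⊗ₜ[k] 1 * formProj n ω := by
  induction ω using forms_induction with
  | add ω η h h' => simp only [map_add, mul_add, h, h']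
  | tmul y p => simp only [Algebra.TensorProduct.tmul_mul_tmul, formProj_tmul, one_mul]

lemma formProj_hkrTail (i : ℕ) (F : List (Finset ι) → k) :
    formProj i (hkrTail e i F) = hkrTail e i F := by
  induction i generalizing F with
  | zero =>
    rw [hkrTail_zero, map_smul, Algebra.TensorProduct.one_def, formProj_tmul,
      ← MvPowerSeries.isHomogeneous_iff_eq_homogeneousComponent.1 isHomogeneous_one]
  | succ i ih =>
    rw [hkrTail_succ, map_sum]
    refine Finset.sum_congr rfl fun s _ => ?_
    rw [map_smul, add_comm i 1, formProj_mul_deRham, ih]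

lemma formProj_hkrRaw (i : ℕ) (Y : Finset ι → List (Finset ι) → k) :
    formProj i (hkrRaw e i Y) = hkrRaw e i Y := by
  rw [hkrRaw_apply, map_sum]
  refine Finset.sum_congr rfl fun s _ => ?_
  rw [map_smul, formProj_mul_ofCh, formProj_hkrTail]

/-- The power series coefficient of a form at a basis element of `Ch`. -/
noncomputable def formPart (s : Finset ι) : Forms k g ι →ₗ[k] MvPowerSeries ι k :=
  (TensorProduct.lid k _).toLinearMap ∘ₗ TensorProduct.map ((chBasis e).coord s) LinearMap.id

@[simp] lemma formPart_tmul (s : Finset ι) (x : Ch k g) (p : MvPowerSeries ι k) :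
    formPart e s (x ⊗ₜ[k] p) = (chBasis e).repr x s • p := rfl

lemma sum_formPart (ω : Forms k g ι) : ∑ s, chBasis e s ⊗ₜ[k] formPart e s ω = ω := by
  induction ω using forms_induction with
  | add ω η h h' =>
    simp only [map_add, TensorProduct.tmul_add, Finset.sum_add_distrib, h, h']
  | tmul x p =>
    conv_rhs => rw [← (chBasis e).sum_repr x, TensorProduct.sum_tmul]
    refine Finset.sum_congr rfl fun s _ => ?_
    rw [formPart_tmul, TensorProduct.tmul_smul, TensorProduct.smul_tmul']

lemma forms_ext {ω η : Forms k g ι} (h : ∀ s, formPart e s ω = formPart e s η) : ω = η := by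
  rw [← sum_formPart e ω, ← sum_formPart e η]
  simp only [h]

lemma formPart_sum (s : Finset ι) (p : Finset ι → MvPowerSeries ι k) :
    formPart e s (∑ t, chBasis e t ⊗ₜ[k] p t) = p s := by
  simp [Finsupp.single_apply]

lemma formPart_formProj (n : ℕ) (s : Finset ι) (ω : Forms k g ι) :
    formPart e s (formProj n ω) = (formPart e s ω).homogeneousComponent n := by
  induction ω using forms_induction with
  | add ω η h h' => simp only [map_add, h, h']
  | tmul x p => simp

lemma repr_formCoeff (α : ι →₀ ℕ) (s : Finset ι) (ω : Forms k g ι) :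
    (chBasis e).repr (formCoeff α ω) s = MvPowerSeries.coeff α (formPart e s ω) := by
  induction ω using forms_induction with
  | add ω η h h' => simp only [map_add, Finsupp.add_apply, h, h']
  | tmul x p =>
    simp [formCoeff, mul_comm]

lemma forms_ext_formProj (e : Module.Basis ι k g) {ω η : Forms k g ι}
    (h : ∀ n, formProj n ω = formProj n η) : ω = η := by
  have := fun s => fun n => (formPart_formProj e n s ω).symm.trans
    ((congrArg (formPart e s) (h n)).trans (formPart_formProj e n s η))
  exact forms_ext e fun s => ext_homogeneousComponent (this s)

lemma sum_ofFn_hkrTail (i : ℕ) (F : List (Finset ι) → k) :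
    ∑ w : Fin i → Finset ι, F (List.ofFn w) • (-1 : k) ^ (∑ m : Fin i, (i - (m + 1)) * (w m).card) •
      (List.ofFn fun j => deRham e (chBasis e (w j))).prod = hkrTail e i F := by
  induction i generalizing F with
  | zero => simp [hkrTail_zero]
  | succ i ih =>
    rw [hkrTail_succ, ← (Fin.consEquiv fun _ : Fin (i + 1) => Finset ι).sum_comp,
      Fintype.sum_prod_type]
    refine Finset.sum_congr rfl fun s _ => ?_
    rw [← ih, Finset.mul_sum, Finset.smul_sum]
    refine Finset.sum_congr rfl fun w _ => ?_
    simp only [Fin.consEquiv_apply, List.ofFn_succ, Fin.cons_zero, Fin.cons_succ, List.prod_cons,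
      Fin.sum_univ_succ, Fin.val_zero, zero_add, Nat.add_sub_cancel, Fin.val_succ,
      Nat.add_sub_add_right, cut_apply, mul_smul_comm, smul_smul]
    congr 1
    rw [pow_add, Nat.sub_zero]
    ring

lemma hkrComponent_toChain (i : ℕ) (Y : Finset ι → List (Finset ι) → k) :
    hkrComponent e i (toChain Y) = ((-1 : k) ^ i / (i.factorial : k)) • hkrRaw e i Y := by
  rw [hkrComponent, hkrRaw_apply, ← (Fin.consEquiv fun _ : Fin (i + 1) => Finset ι).sum_comp,
      Fintype.sum_prod_type, Finset.smul_sum]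
  refine Finset.sum_congr rfl fun s _ => ?_
  rw [← sum_ofFn_hkrTail, Finset.mul_sum, Finset.smul_sum, Finset.smul_sum]
  refine Finset.sum_congr rfl fun w _ => ?_
  simp only [hkrTerm, toChain, Fin.consEquiv_apply, Fin.cons_zero, Fin.cons_succ,
    Fin.sum_univ_succ, Fin.val_zero, Nat.sub_zero, Fin.val_succ, mul_smul_comm, smul_smul]
  congr 1
  ring

lemma coeff_series (f : (ι →₀ ℕ) → k) (α : ι →₀ ℕ) : MvPowerSeries.coeff α (series f) = f α := rfl

/-- The Hochschild--Kostant--Rosenberg map has the homogeneous components `hkrComponent`. -/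
lemma formProj_hkr (n : ℕ) (Y : Finset ι → List (Finset ι) → k) :
    formProj n (hkr e (toChain Y)) = hkrComponent e n (toChain Y) := by
  refine forms_ext e fun s => ?_
  ext α
  have h1 : formPart e s (hkr e (toChain Y)) = series fun α =>
      (chBasis e).repr (formCoeff α (hkrComponent e α.degree (toChain Y))) s := by
    rw [← formPart_sum e s fun s => series fun α =>
      (chBasis e).repr (formCoeff α (hkrComponent e α.degree (toChain Y))) s]
    rfl
  rw [formPart_formProj, h1, MvPowerSeries.coeff_homogeneousComponent, coeff_series, repr_formCoeff]
  split_ifs with h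
  · rw [h]
  · rw [hkrComponent_toChain, ← formProj_hkrRaw, map_smul, formPart_formProj,
      MvPowerSeries.coeff_smul,
      MvPowerSeries.coeff_homogeneousComponent, if_neg h, mul_zero]

/-- The Hochschild--Kostant--Rosenberg map is a chain map. -/
theorem hkr_hochD [CharZero k] (c : HChain k (Finset ι)) :
    hkr e (hochD (chAlg e) c) = formsD e (hkr e c) := by
  rw [← toChain_ofChain c, hochD_toChain]
  refine forms_ext_formProj e fun n => ?_
  rw [formProj_hkr, formProj_formsD, formProj_hkr, hkrComponent_toChain, hkrComponent_toChain,
    hkrRaw_hochRed, map_smul]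

end FormComponents

/-! ### Degrees -/

section HochschildDegree

variable {R S : Type*} [CommRing R] [Fintype S]

/-- The degree `∑ deg a_j - i` of the tensor `a_1 ⊗ ⋯ ⊗ a_i`. -/
def listDeg (q : S → ℕ) (l : List S) : ℤ := (l.map fun s => (q s : ℤ) - 1).sum

@[simp] lemma listDeg_nil (q : S → ℕ) : listDeg q [] = 0 := rfl

@[simp] lemma listDeg_cons (q : S → ℕ) (s : S) (l : List S) :
    listDeg q (s :: l) = (q s : ℤ) - 1 + listDeg q l := by simp [listDeg]

@[simp] lemma listDeg_append (q : S → ℕ) (l l' : List S) :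
    listDeg q (l ++ l') = listDeg q l + listDeg q l' := by simp [listDeg]

/-- The structure constants of `A` are compatible with the grading `H` of the ground ring, where
`H j` is the group of elements of degree `j`. -/
structure IsGradedBy (A : BasedDGAlgebra R S) (H : ℤ → AddSubgroup R) : Prop where
  mul_mem : ∀ i j a b, a ∈ H i → b ∈ H j → a * b ∈ H (i + j)
  mul : ∀ t u s, A.mul t u s ∈ H ((A.deg t : ℤ) + A.deg u - A.deg s)
  diff : ∀ t s, A.diff t s ∈ H ((A.deg t : ℤ) + 1 - A.deg s)

lemma psign_mul_mem (H : AddSubgroup R) (a : ZMod 2) {x : R} (hx : x ∈ H) : psign R a * x ∈ H := by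
  by_cases h : a = 0
  · simpa [psign, h] using hx
  · simpa [psign, h] using hx

variable {A : BasedDGAlgebra R S} {H : ℤ → AddSubgroup R}

lemma IsGradedBy.barD_mem (hA : IsGradedBy A H) {n : ℤ} {F : List S → R}
    (hF : ∀ l, F l ∈ H (n - listDeg A.deg l)) (l : List S) :
    barD A.mul F l ∈ H (n + 1 - listDeg A.deg l) := by
  induction l generalizing n F with
  | nil => rw [barD_nil]; exact zero_mem _
  | cons s l ih =>
    rw [barD_cons]
    refine sub_mem (sum_mem fun t _ => sum_mem fun u _ => ?_) ?_
    · have := hA.mul_mem _ _ _ _ (hA.mul t u s) (hF (t :: u :: l))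
      convert this using 2
      simp only [listDeg_cons]
      ring
    · have := ih (n := n - ((A.deg s : ℤ) - 1)) (F := cut s F) fun l => by
        have := hF (s :: l)
        rw [listDeg_cons, ← sub_sub] at this
        exact this
      convert this using 2
      simp only [listDeg_cons]
      ring

lemma IsGradedBy.intD_mem (hA : IsGradedBy A H) {n : ℤ} {F : List S → R}
    (hF : ∀ l, F l ∈ H (n - listDeg A.deg l)) (l : List S) :
    intD A.diff A.par F l ∈ H (n + 1 - listDeg A.deg l) := by
  induction l generalizing n F with
  | nil => rw [intD_nil]; exact zero_mem _
  | cons s l ih =>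
    rw [intD_cons]
    refine add_mem (sum_mem fun t _ => ?_) (psign_mul_mem _ _ ?_)
    · have := hA.mul_mem _ _ _ _ (hA.diff t s) (hF (t :: l))
      convert this using 2
      simp only [listDeg_cons]
      ring
    · have := ih (n := n - ((A.deg s : ℤ) - 1)) (F := cut s F) fun l => by
        have := hF (s :: l)
        rw [listDeg_cons, ← sub_sub] at this
        exact this
      convert this using 2
      simp only [listDeg_cons]
      ring

/-- The Hochschild differential has degree one. -/
lemma IsGradedBy.hochRed_mem (hA : IsGradedBy A H) {n : ℤ} {Y : S → List S → R}
    (hY : ∀ s l, Y s l ∈ H (n - listDeg A.deg (s :: l))) (s : S) (l : List S) :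
    hochRed A Y s l ∈ H (n + 1 - listDeg A.deg (s :: l)) := by
  by_cases hl : A.unit ∈ l
  · rw [hochRed_of_mem _ _ _ hl]; exact zero_mem _
  have hY' : ∀ l, uncons Y l ∈ H (n - listDeg A.deg l) := by
    rintro (_ | ⟨s, l⟩)
    · exact zero_mem _
    · exact hY s l
  rw [hochRed_of_notMem _ _ _ hl, hochTot_apply, hochMul_apply, cycD_apply, hochInt_apply]
  refine add_mem (add_mem (hA.barD_mem hY' _) (psign_mul_mem _ _ (sum_mem fun t _ =>
    sum_mem fun u _ => ?_))) (psign_mul_mem _ _ (hA.intD_mem hY' _))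
  rw [mul_assoc]
  refine psign_mul_mem _ _ ?_
  have := hA.mul_mem _ _ _ _ (hA.mul u t s) (hY t (l ++ [u]))
  convert this using 2
  simp only [listDeg_cons, listDeg_append, listDeg_nil]
  ring

lemma wordDeg_eq (A : BasedDGAlgebra R S) {i : ℕ} (w : Fin (i + 1) → S) :
    wordDeg A w = listDeg A.deg (w 0 :: List.ofFn fun j => w j.succ) + 1 := by
  have : (w 0 :: List.ofFn fun j => w j.succ) = List.ofFn w := by rw [List.ofFn_succ]
  rw [this, listDeg, List.map_ofFn, List.sum_ofFn]
  simp only [wordDeg, Function.comp_apply, Finset.sum_sub_distrib, Finset.sum_const,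
    Finset.card_univ, Fintype.card_fin, nsmul_eq_mul, mul_one]
  push_cast
  ring

lemma listDeg_cons_eq (A : BasedDGAlgebra R S) (s : S) (l : List S) :
    wordDeg A (Fin.cons s l.get : Fin (l.length + 1) → S) = listDeg A.deg (s :: l) + 1 := by
  rw [wordDeg_eq]
  simp [List.ofFn_getElem]

lemma IsGradedBy.hochD_mem (hA : IsGradedBy A H) {n : ℤ} {c : HChain R S}
    (hc : ∀ i w, c i w ∈ H (n - wordDeg A w)) (i : ℕ) (w : Fin (i + 1) → S) :
    hochD A c i w ∈ H (n + 1 - wordDeg A w) := by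
  rw [← toChain_ofChain c, hochD_toChain]
  have := hA.hochRed_mem (n := n - 1) (Y := ofChain c) (fun s l => by
    have := hc _ (Fin.cons s l.get : Fin (l.length + 1) → S)
    rw [listDeg_cons_eq] at this
    rwa [add_comm, ← sub_sub] at this) (w 0) (List.ofFn fun j => w j.succ)
  rw [wordDeg_eq, add_comm (listDeg _ _), ← sub_sub, add_sub_right_comm]
  exact this

lemma hochD_of_isDegenerate (A : BasedDGAlgebra R S) (c : HChain R S) {i : ℕ} {w : Fin (i + 1) → S}
    (h : IsDegenerate A w) : hochD A c i w = 0 := if_pos h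

end HochschildDegree

section HochschildChains

variable {k S : Type*} [Field k]

/-- The grading of a field by degree zero. -/
def fieldGrading (k : Type*) [Field k] (j : ℤ) : AddSubgroup k where
  carrier := {a | a ≠ 0 → j = 0}
  zero_mem' h := absurd rfl h
  add_mem' := by
    intro a b ha hb h
    by_cases h' : a = 0
    · exact hb (by rintro rfl; exact h (by simp [h']))
    · exact ha h'
  neg_mem' := by
    intro a ha h
    exact ha (neg_ne_zero.1 h)

/-- The grading of `k[ε]` with `deg ε = 2`. -/
def dualGrading (k : Type*) [Field k] (j : ℤ) : AddSubgroup k[ε] where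
  carrier := {a | (TrivSqZeroExt.fst a ≠ 0 → j = 0) ∧ (TrivSqZeroExt.snd a ≠ 0 → j = 2)}
  zero_mem' := ⟨fun h => absurd rfl h, fun h => absurd rfl h⟩
  add_mem' := by
    intro a b ha hb
    exact ⟨(fieldGrading k j).add_mem ha.1 hb.1,
      fun h => sub_eq_zero.1 ((fieldGrading k (j - 2)).add_mem (fun h => sub_eq_zero.2 (ha.2 h))
        (fun h => sub_eq_zero.2 (hb.2 h)) h)⟩
  neg_mem' := by
    intro a ha
    exact ⟨fun h => ha.1 (neg_ne_zero.1 h), fun h => ha.2 (neg_ne_zero.1 h)⟩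

/-- The degree conditions as conditions on the degrees of the coefficients. -/
lemma mem_hochChains_iff {A : BasedDGAlgebra k S} {n : ℤ} {c : HChain k S} :
    c ∈ hochChains A n ↔ (∀ i w, IsDegenerate A w → c i w = 0) ∧
      ∀ i w, c i w ∈ fieldGrading k (n - wordDeg A w) := by
  refine ⟨fun h => ⟨fun i w hw => ?_, fun i w hw => ?_⟩, fun h i w hw => ⟨fun hd => ?_, ?_⟩⟩
  · by_contra h'
    exact (h i w h').1 hw
  · rw [(h i w hw).2, sub_self]
  · exact hw (h.1 i w hd)
  · exact (sub_eq_zero.1 (h.2 i w hw)).symm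

lemma mem_hochChainsEps_iff {A : BasedDGAlgebra k[ε] S} {n : ℤ} {c : HChain k[ε] S} :
    c ∈ hochChainsEps A n ↔ (∀ i w, IsDegenerate A w → c i w = 0) ∧
      ∀ i w, c i w ∈ dualGrading k (n - wordDeg A w) := by
  refine ⟨fun h => ⟨fun i w hw => ?_, fun i w => ⟨fun hw => ?_, fun hw => ?_⟩⟩,
    fun h i w => ⟨fun hw hd => ?_, fun hw => ?_, fun hw => ?_⟩⟩
  · by_contra h'
    exact (h i w).1 h' hw
  · rw [(h i w).2.1 hw, sub_self]
  · rw [← (h i w).2.2 hw, add_sub_cancel_left]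
  · exact hw (h.1 i w hd)
  · exact (sub_eq_zero.1 ((h.2 i w).1 hw)).symm
  · have := (h.2 i w).2 hw; omega

variable [Fintype S]

lemma IsGradedBy.hochD_mem_hochChains {A : BasedDGAlgebra k S} (hA : IsGradedBy A (fieldGrading k))
    {n : ℤ} {c : HChain k S} (hc : c ∈ hochChains A n) : hochD A c ∈ hochChains A (n + 1) := by
  rw [mem_hochChains_iff] at hc ⊢
  exact ⟨fun i w hw => hochD_of_isDegenerate A c hw, hA.hochD_mem hc.2⟩

lemma IsGradedBy.hochD_mem_hochChainsEps {A : BasedDGAlgebra k[ε] S}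
    (hA : IsGradedBy A (dualGrading k)) {n : ℤ} {c : HChain k[ε] S} (hc : c ∈ hochChainsEps A n) :
    hochD A c ∈ hochChainsEps A (n + 1) := by
  rw [mem_hochChainsEps_iff] at hc ⊢
  exact ⟨fun i w hw => hochD_of_isDegenerate A c hw, hA.hochD_mem hc.2⟩

end HochschildChains

section ChevalleyDegree

variable {k g ι : Type*} [Field k] [LieRing g] [LieAlgebra k g]
variable [Fintype ι] [LinearOrder ι] (e : Module.Basis ι k g)

lemma chAlg_isGradedBy [CharZero k] : IsGradedBy (chAlg e) (fieldGrading k) where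
  mul_mem i j a b ha hb h := by
    rw [ha (left_ne_zero_of_mul h), hb (right_ne_zero_of_mul h), add_zero]
  mul t u s h := by
    have : (s.card : ℤ) = t.card + u.card := by exact_mod_cast card_of_mul_ne_zero e h
    exact sub_eq_zero.2 this.symm
  diff t s h := by
    have : (s.card : ℤ) = t.card + 1 := by exact_mod_cast card_of_diff_ne_zero e h
    exact sub_eq_zero.2 this.symm

lemma chAlgEps_isGradedBy [CharZero k] (B : LinearMap.BilinForm k g) :
    IsGradedBy (chAlgEps e B) (dualGrading k) where
  mul_mem i j a b ha hb := by
    refine ⟨fun h => ?_, fun h => ?_⟩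
    · rw [TrivSqZeroExt.fst_mul] at h
      rw [ha.1 (left_ne_zero_of_mul h), hb.1 (right_ne_zero_of_mul h), add_zero]
    · rw [TrivSqZeroExt.snd_mul] at h
      by_cases h1 : TrivSqZeroExt.fst a * TrivSqZeroExt.snd b = 0
      · have h2 : TrivSqZeroExt.snd a * TrivSqZeroExt.fst b ≠ 0 := by
          intro h2; apply h
          rw [smul_eq_mul, h1, zero_add]; exact h2
        rw [ha.2 (left_ne_zero_of_mul h2), hb.1 (right_ne_zero_of_mul h2), add_zero]
      · rw [ha.1 (left_ne_zero_of_mul h1), hb.2 (right_ne_zero_of_mul h1), zero_add]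
  mul t u s := by
    rw [chAlgEps_mul_def]
    refine ⟨fun h => (chAlg_isGradedBy e).mul t u s (by simpa using h), fun h => ?_⟩
    have := card_of_poissonCoeff_ne_zero e B (t := t) (u := u) (s := s) (by simpa using h)
    have : (s.card : ℤ) + 2 = t.card + u.card := by exact_mod_cast this
    change (t.card : ℤ) + u.card - s.card = 2
    omega
  diff t s := by
    rw [chAlgEps_diff_def]
    exact ⟨fun h => (chAlg_isGradedBy e).diff t s (by simpa using h), fun h => by simp at h⟩

/-! ### Degrees of forms -/

lemma tmul_mem_formsDeg {m : ℕ} {x : Ch k g} (hx : x ∈ ⋀[k]^m (Module.Dual k g))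
    (p : MvPowerSeries ι k) : x ⊗ₜ[k] p ∈ formsDeg (k := k) (g := g) (ι := ι) m :=
  Submodule.subset_span ⟨m, rfl, x, hx, p, rfl⟩

lemma mul_mem_formsDeg {m n : ℤ} {ω η : Forms k g ι} (hω : ω ∈ formsDeg m) (hη : η ∈ formsDeg n) :
    ω * η ∈ formsDeg (k := k) (g := g) (ι := ι) (m + n) := by
  have h := Submodule.mul_mem_mul hω hη
  rw [formsDeg, formsDeg, Submodule.span_mul_span] at h
  refine Submodule.span_le.2 ?_ h
  rintro _ ⟨_, ⟨m, rfl, a, ha, p, rfl⟩, _, ⟨n, rfl, b, hb, q, rfl⟩, rfl⟩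
  simp only [Algebra.TensorProduct.tmul_mul_tmul]
  exact_mod_cast tmul_mem_formsDeg (mul_mem_exteriorPower ha hb) (p * q)

lemma one_mem_formsDeg : (1 : Forms k g ι) ∈ formsDeg (k := k) (g := g) (ι := ι) 0 := by
  rw [Algebra.TensorProduct.one_def]
  have h : (1 : Ch k g) ∈ ⋀[k]^0 (Module.Dual k g) := by
    simpa only [pow_zero] using Submodule.mem_one.2 ⟨1, map_one _⟩
  exact_mod_cast tmul_mem_formsDeg h (1 : MvPowerSeries ι k)

lemma deRham_mem_formsDeg (s : Finset ι) :
    deRham e (chBasis e s) ∈ formsDeg (k := k) (g := g) (ι := ι) (s.card - 1) := by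
  have h := chBasis_mem e s
  rcases hs : s.card with _ | n
  · rw [Finset.card_eq_zero.1 hs, chBasis_empty, deRham_one]; exact zero_mem _
  · rw [deRham_apply]
    rw [hs] at h
    refine sum_mem fun j _ => ?_
    have := tmul_mem_formsDeg (contrL_mem_exteriorPower (e j) h)
      (MvPowerSeries.X j : MvPowerSeries ι k)
    convert this using 2
    push_cast; ring

lemma formsD_mem_formsDeg {n : ℤ} {ω : Forms k g ι} (hω : ω ∈ formsDeg n) :
    formsD e ω ∈ formsDeg (k := k) (g := g) (ι := ι) (n + 1) := by
  suffices h : formsDeg n ≤ (formsDeg (k := k) (g := g) (ι := ι) (n + 1)).comap (formsD e) from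
    h hω
  refine Submodule.span_le.2 ?_
  rintro _ ⟨m, rfl, a, ha, p, rfl⟩
  rw [SetLike.mem_coe, Submodule.mem_comap, formsD_tmul]
  refine add_mem ?_ (sum_mem fun c _ => ?_)
  · exact_mod_cast tmul_mem_formsDeg (ceD_mem_exteriorPower e ha) p
  · have := tmul_mem_formsDeg (mul_mem_exteriorPower (ι_mem_exteriorPower (e.coord c)) ha)
      (coadj e c p)
    rw [add_comm 1 m] at this
    exact_mod_cast this

lemma mem_formsDeg_iff [CharZero k] {n : ℤ} {ω : Forms k g ι} :
    ω ∈ formsDeg n ↔ ∀ s, formPart e s ω ≠ 0 → (s.card : ℤ) = n := by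
  refine ⟨fun h s => ?_, fun h => ?_⟩
  · by_cases hs : (s.card : ℤ) = n
    · exact fun _ => hs
    · intro h'
      refine absurd ?_ h'
      suffices h2 : formsDeg n ≤ LinearMap.ker (formPart e s) from h2 h
      refine Submodule.span_le.2 ?_
      rintro _ ⟨m, rfl, a, ha, p, rfl⟩
      rw [SetLike.mem_coe, LinearMap.mem_ker, formPart_tmul]
      have : (chBasis e).repr a s = 0 := by
        by_contra h3
        exact hs (by exact_mod_cast card_of_repr_ne_zero e ha h3)
      rw [this, zero_smul]
  · rw [← sum_formPart e ω]
    refine sum_mem fun s _ => ?_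
    by_cases hs : formPart e s ω = 0
    · rw [hs, TensorProduct.tmul_zero]; exact zero_mem _
    · rw [← h s hs]
      exact tmul_mem_formsDeg (chBasis_mem e s) _

lemma prod_deRham_mem_formsDeg {i : ℕ} (w : Fin i → Finset ι) :
    (List.ofFn fun j => deRham e (chBasis e (w j))).prod ∈
      formsDeg (k := k) (g := g) (ι := ι) (∑ j, (((w j).card : ℤ) - 1)) := by
  induction i with
  | zero => simpa using one_mem_formsDeg
  | succ i ih =>
    rw [List.ofFn_succ, List.prod_cons, Fin.sum_univ_succ]
    exact mul_mem_formsDeg (deRham_mem_formsDeg e _) (ih fun j => w j.succ)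

lemma hkrTerm_mem_formsDeg (i : ℕ) (w : Fin (i + 1) → Finset ι) :
    hkrTerm e i w ∈ formsDeg (k := k) (g := g) (ι := ι) (wordDeg (chAlg e) w) := by
  refine Submodule.smul_mem _ _ ?_
  have h := mul_mem_formsDeg (tmul_mem_formsDeg (chBasis_mem e (w 0)) (1 : MvPowerSeries ι k))
    (prod_deRham_mem_formsDeg e fun j => w j.succ)
  convert h using 2
  simp only [wordDeg, Fin.sum_univ_succ, chAlg, Finset.sum_sub_distrib, Finset.sum_const,
    Finset.card_univ, Fintype.card_fin, nsmul_eq_mul, mul_one]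
  ring

lemma hkr_mem_formsDeg [CharZero k] {n : ℤ} {c : HChain k (Finset ι)}
    (hc : c ∈ hochChains (chAlg e) n) : hkr e c ∈ formsDeg n := by
  have h : ∀ i, hkrComponent e i c ∈ formsDeg n := by
    intro i
    refine sum_mem fun w _ => ?_
    by_cases hw : c i w = 0
    · rw [hw, zero_smul]; exact zero_mem _
    · rw [← (hc i w hw).2]
      exact Submodule.smul_mem _ _ (hkrTerm_mem_formsDeg e i w)
  refine (mem_formsDeg_iff e).2 fun s hs => ?_
  by_contra hne
  refine hs (ext_homogeneousComponent fun i => ?_)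
  rw [← formPart_formProj, ← toChain_ofChain c, formProj_hkr, toChain_ofChain, map_zero]
  by_contra h'
  exact hne ((mem_formsDeg_iff e).1 (h i) s h')

end ChevalleyDegree

/-! ### The Koszul complex -/

section Koszul

variable {k g ι : Type*} [Field k] [LieRing g] [LieAlgebra k g]
variable [Fintype ι] [LinearOrder ι] (e : Module.Basis ι k g)

lemma contrR_mul_ι (v : g) (ξ : Module.Dual k g) (x : Ch k g) :
    contrR v (x * ExteriorAlgebra.ι k ξ) = ξ v • x - contrR v x * ExteriorAlgebra.ι k ξ :=
  CliffordAlgebra.contractRight_mul_ι _ ξ x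

lemma sum_contrR_mul_ι {m : ℕ} {x : Ch k g} (hx : x ∈ ⋀[k]^m (Module.Dual k g)) :
    ∑ a, contrR (e a) x * ExteriorAlgebra.ι k (e.coord a) = (m : k) • x := by
  rw [← sum_ι_mul_contrL e hx]
  refine Finset.sum_congr rfl fun a _ => ?_
  rw [contrR_eq, ι_mul_comm]

/-- The Koszul differential `Λ ⊗ Sym → Λ ⊗ Sym`, which moves a factor from the symmetric algebra to
the exterior algebra. An element of `Λ ⊗ Sym` is given by its coefficients, a function of
multisets. -/
noncomputable def koszulD (φ : Multiset ι → Ch k g) (M : Multiset ι) : Ch k g :=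
  ∑ a, φ (a ::ₘ M) * ExteriorAlgebra.ι k (e.coord a)

/-- The Koszul homotopy, which moves a factor from the exterior algebra to the symmetric algebra. -/
noncomputable def koszulH (φ : Multiset ι → Ch k g) (M : Multiset ι) : Ch k g :=
  (M.map fun a => contrR (e a) (φ (M.erase a))).sum

lemma koszulH_cons (φ : Multiset ι → Ch k g) (a : ι) (M : Multiset ι) :
    koszulH e φ (a ::ₘ M) = contrR (e a) (φ M) +
      (M.map fun b => contrR (e b) (φ (a ::ₘ M.erase b))).sum := by
  rw [koszulH, Multiset.map_cons, Multiset.sum_cons, Multiset.erase_cons_head]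
  congr 2
  refine Multiset.map_congr rfl fun b hb => ?_
  rw [Multiset.erase_cons_tail_of_mem hb]

/-- Exactness of the Koszul complex: on cycles of weight `W`, the composition of the differential
with the homotopy is multiplication with `W`. -/
lemma koszulD_koszulH {W : ℕ} {φ : Multiset ι → Ch k g}
    (hφ : ∀ M s, (chBasis e).repr (φ M) s ≠ 0 → s.card + M.card = W)
    (hd : ∀ M, koszulD e φ M = 0) (M : Multiset ι) :
    koszulD e (koszulH e φ) M = (W : k) • φ M := by
  have h1 : ∑ a, contrR (e a) (φ M) * ExteriorAlgebra.ι k (e.coord a) =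
      ((W : k) - M.card) • φ M := by
    conv_lhs => rw [← (chBasis e).sum_repr (φ M)]
    conv_rhs => rw [← (chBasis e).sum_repr (φ M)]
    simp only [map_sum, map_smul, Finset.sum_mul, Finset.smul_sum, smul_mul_assoc]
    rw [Finset.sum_comm]
    refine Finset.sum_congr rfl fun s _ => ?_
    rw [← Finset.smul_sum, sum_contrR_mul_ι e (chBasis_mem e s), smul_comm]
    by_cases hs : (chBasis e).repr (φ M) s = 0
    · rw [hs, zero_smul, smul_zero, smul_zero]
    · rw [← hφ M s hs, Nat.cast_add, add_sub_cancel_right]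
  have h2 : ∑ a, (M.map fun b => contrR (e b) (φ (a ::ₘ M.erase b))).sum *
      ExteriorAlgebra.ι k (e.coord a) = (M.card : k) • φ M := by
    have h3 : ∀ a, (M.map fun b => contrR (e b) (φ (a ::ₘ M.erase b))).sum *
        ExteriorAlgebra.ι k (e.coord a) = (M.map fun b => contrR (e b) (φ (a ::ₘ M.erase b)) *
          ExteriorAlgebra.ι k (e.coord a)).sum := fun a => Multiset.sum_map_mul_right.symm
    rw [Finset.sum_congr rfl fun a _ => h3 a, ← Multiset.sum_map_sum]
    have h4 : M.map (fun b => ∑ a, contrR (e b) (φ (a ::ₘ M.erase b)) *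
        ExteriorAlgebra.ι k (e.coord a)) = M.map fun _ => φ M := by
      refine Multiset.map_congr rfl fun b hb => ?_
      have h5 : ∀ a, contrR (e b) (φ (a ::ₘ M.erase b)) * ExteriorAlgebra.ι k (e.coord a) =
          e.coord a (e b) • φ (a ::ₘ M.erase b) -
            contrR (e b) (φ (a ::ₘ M.erase b) * ExteriorAlgebra.ι k (e.coord a)) := by
        intro a; rw [contrR_mul_ι, sub_sub_cancel]
      have h6 := hd (M.erase b)
      rw [koszulD] at h6
      rw [Finset.sum_congr rfl fun a _ => h5 a, Finset.sum_sub_distrib, ← map_sum, h6, map_zero,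
        sub_zero]
      simp [Finsupp.single_apply, ite_smul, Multiset.cons_erase hb]
    rw [h4, Multiset.map_const', Multiset.sum_replicate, Nat.cast_smul_eq_nsmul]
  simp only [koszulD, koszulH_cons, add_mul, Finset.sum_add_distrib, h1, h2, ← add_smul,
    sub_add_cancel]

lemma repr_contrR_ne_zero [CharZero k] {v : g} {x : Ch k g} {t : Finset ι}
    (h : (chBasis e).repr (contrR v x) t ≠ 0) :
    ∃ s, (chBasis e).repr x s ≠ 0 ∧ s.card = t.card + 1 := by
  rw [← sum_repr_mul] at h
  obtain ⟨s, _, hs⟩ := Finset.exists_ne_zero_of_sum_ne_zero h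
  refine ⟨s, left_ne_zero_of_mul hs, ?_⟩
  have h1 := right_ne_zero_of_mul hs
  have h2 := chBasis_mem e s
  rw [contrR_eq] at h1
  rcases hn : s.card with _ | n
  · rw [hn] at h2
    rw [contrL_of_mem_zero _ h2] at h1
    simp at h1
  · rw [hn] at h2
    have h3 := contrL_mem_exteriorPower v h2
    rw [gradeInv_of_mem h3] at h1
    rw [card_of_repr_ne_zero e (Submodule.smul_mem _ _ h3) h1]

lemma repr_koszulH_ne_zero [CharZero k] {W : ℕ} {φ : Multiset ι → Ch k g}
    (hφ : ∀ M s, (chBasis e).repr (φ M) s ≠ 0 → s.card + M.card = W) (M : Multiset ι)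
    (s : Finset ι) (h : (chBasis e).repr (koszulH e φ M) s ≠ 0) : s.card + M.card = W := by
  rw [koszulH] at h
  by_contra hne
  refine h ?_
  have : ∀ N : Multiset ι, N ≤ M → (chBasis e).repr
      ((N.map fun a => contrR (e a) (φ (M.erase a))).sum) s = 0 := by
    intro N hN
    induction N using Multiset.induction with
    | empty => simp
    | cons a N ih =>
      rw [Multiset.map_cons, Multiset.sum_cons, map_add, Finsupp.add_apply,
        ih ((Multiset.le_cons_self N a).trans hN), add_zero]
      by_contra h'
      obtain ⟨t, ht, hts⟩ := repr_contrR_ne_zero e h'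
      have ha : a ∈ M := Multiset.mem_of_le hN (Multiset.mem_cons_self a N)
      have h1 := hφ _ _ ht
      have h2 := Multiset.card_erase_add_one ha
      omega
  exact this M le_rfl

end Koszul

/-! ### Symmetric tensors in the bar complex -/

section SymTail

variable {k g ι : Type*} [Field k] [LieRing g] [LieAlgebra k g]
variable [Fintype ι] [LinearOrder ι] (e : Module.Basis ι k g)

/-- The underlying function of `symTail`. -/
def symTailFun : List (Finset ι) → (Multiset ι → k) → k
  | [], f => f 0
  | s :: l, f => ∑ a, if s = {a} then symTailFun l (fun M => f (a ::ₘ M)) else 0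

/-- The symmetric tensor in generators of `Ch` whose coefficient at `ξ_{a_1} ⊗ ⋯ ⊗ ξ_{a_i}` is
`f {a_1, …, a_i}`. -/
def symTail : (Multiset ι → k) →ₗ[k] (List (Finset ι) → k) where
  toFun f l := symTailFun l f
  map_add' f f' := by
    funext l
    induction l generalizing f f' with
    | nil => rfl
    | cons s l ih =>
      simp only [symTailFun, Pi.add_apply, ← Finset.sum_add_distrib]
      refine Finset.sum_congr rfl fun a _ => ?_
      split_ifs
      · exact ih (fun M => f (a ::ₘ M)) (fun M => f' (a ::ₘ M))
      · rw [add_zero]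
  map_smul' c f := by
    funext l
    induction l generalizing f with
    | nil => rfl
    | cons s l ih =>
      simp only [symTailFun, Pi.smul_apply, smul_eq_mul, RingHom.id_apply, Finset.mul_sum]
      refine Finset.sum_congr rfl fun a _ => ?_
      split_ifs
      · exact ih fun M => f (a ::ₘ M)
      · rw [mul_zero]

/-- Partial derivatives of the generating series of a function on multisets. -/
def consMul (a : ι) : (Multiset ι → k) →ₗ[k] (Multiset ι → k) where
  toFun f M := f (a ::ₘ M)
  map_add' _ _ := rfl
  map_smul' _ _ := rfl

@[simp] lemma consMul_apply (a : ι) (f : Multiset ι → k) (M : Multiset ι) :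
    consMul a f M = f (a ::ₘ M) := rfl

lemma consMul_comm (a b : ι) (f : Multiset ι → k) :
    consMul a (consMul b f) = consMul b (consMul a f) := by
  funext M
  simp only [consMul_apply, Multiset.cons_swap]

@[simp] lemma symTail_nil (f : Multiset ι → k) : symTail f [] = f 0 := rfl

lemma cut_symTail (s : Finset ι) (f : Multiset ι → k) :
    cut s (symTail f) = ∑ a, if s = {a} then symTail (consMul a f) else 0 := by
  funext l
  rw [Finset.sum_apply]
  change (∑ a, if s = {a} then _ else 0) = _
  refine Finset.sum_congr rfl fun a _ => ?_
  split_ifs <;> rfl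

lemma cut_singleton_symTail (a : ι) (f : Multiset ι → k) :
    cut {a} (symTail f) = symTail (consMul a f) := by
  rw [cut_symTail]
  simp [Finset.singleton_inj]

lemma cut_symTail_of_card_ne {s : Finset ι} (hs : s.card ≠ 1) (f : Multiset ι → k) :
    cut s (symTail f) = 0 := by
  rw [cut_symTail]
  refine Finset.sum_eq_zero fun a _ => if_neg ?_
  rintro rfl
  exact hs (Finset.card_singleton a)

lemma sum_eq_sum_singleton {M : Type*} [AddCommMonoid M] (f : Finset ι → M)
    (h : ∀ s, s.card ≠ 1 → f s = 0) : ∑ s, f s = ∑ a, f {a} := by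
  have h1 : ∑ s ∈ Finset.univ.map ⟨fun a : ι => ({a} : Finset ι), Finset.singleton_injective⟩, f s =
      ∑ a, f {a} := Finset.sum_map _ _ _
  rw [← h1]
  refine (Finset.sum_subset (Finset.subset_univ _) fun s _ hs => h s fun hs' => hs ?_).symm
  obtain ⟨a, rfl⟩ := Finset.card_eq_one.1 hs'
  simp

/-- Symmetry, for the exchange of the first and the last factor. -/
lemma cutLast_symTail (u : Finset ι) (f : Multiset ι → k) :
    cutLast u (symTail f) = cut u (symTail f) := by
  funext l
  induction l generalizing f with
  | nil => rfl
  | cons s l ih =>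
    have h1 : cutLast u (symTail f) (s :: l) = cutLast u (cut s (symTail f)) l := rfl
    have h2 : cut u (symTail f) (s :: l) = cut s (cut u (symTail f)) l := rfl
    rw [h1, h2]
    by_cases hs : s.card = 1
    · obtain ⟨a, rfl⟩ := Finset.card_eq_one.1 hs
      rw [cut_singleton_symTail, ih]
      by_cases hu : u.card = 1
      · obtain ⟨b, rfl⟩ := Finset.card_eq_one.1 hu
        rw [cut_singleton_symTail, cut_singleton_symTail, cut_singleton_symTail, consMul_comm]
      · rw [cut_symTail_of_card_ne hu, cut_symTail_of_card_ne hu, map_zero]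
    · rw [cut_symTail_of_card_ne hs, map_zero]
      by_cases hu : u.card = 1
      · obtain ⟨b, rfl⟩ := Finset.card_eq_one.1 hu
        rw [cut_singleton_symTail, cut_symTail_of_card_ne hs]
      · rw [cut_symTail_of_card_ne hu, map_zero]

lemma symTail_map_singleton (f : Multiset ι → k) (v : List ι) :
    symTail f (v.map fun a => ({a} : Finset ι)) = f v := by
  induction v generalizing f with
  | nil => rfl
  | cons a v ih =>
    have : symTail f ((a :: v).map fun a => ({a} : Finset ι)) =
      cut {a} (symTail f) (v.map fun a => ({a} : Finset ι)) := rfl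
    rw [this, cut_singleton_symTail, ih]
    rfl

lemma symTail_ne_zero {f : Multiset ι → k} {l : List (Finset ι)} (h : symTail f l ≠ 0) :
    ∃ v : List ι, l = v.map (fun a => ({a} : Finset ι)) ∧ f v ≠ 0 := by
  induction l generalizing f with
  | nil => exact ⟨[], rfl, h⟩
  | cons s l ih =>
    have h1 : symTail f (s :: l) = cut s (symTail f) l := rfl
    rw [h1] at h
    by_cases hs : s.card = 1
    · obtain ⟨a, rfl⟩ := Finset.card_eq_one.1 hs
      rw [cut_singleton_symTail] at h
      obtain ⟨v, rfl, hv⟩ := ih h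
      exact ⟨a :: v, rfl, hv⟩
    · rw [cut_symTail_of_card_ne hs] at h
      exact absurd rfl h

lemma symTail_injective : Function.Injective (symTail : (Multiset ι → k) →ₗ[k] _) := by
  intro f f' h
  funext M
  induction M using Quotient.inductionOn with
  | h v =>
    have := congrFun h (v.map fun a => ({a} : Finset ι))
    rwa [symTail_map_singleton, symTail_map_singleton] at this

/-- Generators anticommute. -/
lemma mul_singleton_swap (a b : ι) (s : Finset ι) :
    (chAlg e).mul {a} {b} s = - (chAlg e).mul {b} {a} s := by
  have h := ExteriorAlgebra.ι_add_mul_swap (R := k) (e.coord a) (e.coord b)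
  rw [chAlg_mul_def, chAlg_mul_def, chBasis_singleton, chBasis_singleton,
    eq_neg_of_add_eq_zero_left h, map_neg, Finsupp.neg_apply]

/-- The product of neighbouring factors of a symmetric tensor vanishes, as generators
anticommute. -/
lemma sum_cut_cut_symTail [CharZero k] (f : Multiset ι → k) (s : Finset ι) :
    ∑ t, ∑ u, (chAlg e).mul t u s • cut u (cut t (symTail f)) = 0 := by
  rw [sum_eq_sum_singleton _ fun t ht => by simp [cut_symTail_of_card_ne ht]]
  have h : ∀ a, ∑ u, (chAlg e).mul {a} u s • cut u (cut {a} (symTail f)) =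
      ∑ b, (chAlg e).mul {a} {b} s • symTail (consMul b (consMul a f)) := by
    intro a
    rw [cut_singleton_symTail, sum_eq_sum_singleton _ fun t ht => by
      simp [cut_symTail_of_card_ne ht]]
    simp only [cut_singleton_symTail]
  simp only [h]
  refine self_eq_neg.1 ?_
  conv_lhs => rw [Finset.sum_comm]
  rw [← Finset.sum_neg_distrib]
  refine Finset.sum_congr rfl fun a _ => ?_
  rw [← Finset.sum_neg_distrib]
  refine Finset.sum_congr rfl fun b _ => ?_
  rw [mul_singleton_swap, consMul_comm, neg_smul]

lemma barD_symTail [CharZero k] (f : Multiset ι → k) : barD (chAlg e).mul (symTail f) = 0 := by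
  funext l
  induction l generalizing f with
  | nil => rfl
  | cons s l ih =>
    have h1 : barD (chAlg e).mul (symTail f) (s :: l) =
      cut s (barD (chAlg e).mul (symTail f)) l := rfl
    rw [h1, cut_barD, sum_cut_cut_symTail, zero_sub]
    by_cases hs : s.card = 1
    · obtain ⟨a, rfl⟩ := Finset.card_eq_one.1 hs
      rw [cut_singleton_symTail, Pi.neg_apply, ih, Pi.zero_apply, neg_zero]; rfl
    · rw [cut_symTail_of_card_ne hs, map_zero, neg_zero]; rfl

end SymTail

/-! ### The homology of the reduced bar complex of an exterior algebra -/

section BarHomology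

variable {k g ι : Type*} [Field k] [LieRing g] [LieAlgebra k g]
variable [Fintype ι] [LinearOrder ι] (e : Module.Basis ι k g)

/-- The sum of the degrees of the factors of a tensor. -/
def listCard (l : List (Finset ι)) : ℕ := (l.map Finset.card).sum

@[simp] lemma listCard_nil : listCard ([] : List (Finset ι)) = 0 := rfl

@[simp] lemma listCard_cons (s : Finset ι) (l : List (Finset ι)) :
    listCard (s :: l) = s.card + listCard l := by simp [listCard]

@[simp] lemma listCard_append (l l' : List (Finset ι)) :
    listCard (l ++ l') = listCard l + listCard l' := by simp [listCard]

lemma listCard_singletons (v : List ι) :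
    listCard (v.map fun a => ({a} : Finset ι)) = v.length := by
  induction v with
  | nil => rfl
  | cons a v ih => rw [List.map_cons, listCard_cons, ih, Finset.card_singleton, List.length_cons,
      add_comm]

lemma length_le_listCard {l : List (Finset ι)} (h : ∅ ∉ l) : l.length ≤ listCard l := by
  induction l with
  | nil => simp
  | cons s l ih =>
    rw [List.mem_cons, not_or] at h
    have h1 := ih h.2
    have h2 : 0 < s.card := Finset.card_pos.2 (Finset.nonempty_iff_ne_empty.2 (Ne.symm h.1))
    rw [List.length_cons, listCard_cons]
    omega

/-- A tensor in the reduced bar complex, of weight `W`. -/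
def IsBarWeight (W : ℕ) (F : List (Finset ι) → k) : Prop :=
  ∀ l, F l ≠ 0 → ∅ ∉ l ∧ listCard l = W

lemma IsBarWeight.add {W : ℕ} {F G : List (Finset ι) → k} (hF : IsBarWeight W F)
    (hG : IsBarWeight W G) : IsBarWeight W (F + G) := by
  intro l hl
  by_cases h : F l = 0
  · exact hG l (by intro h'; exact hl (by rw [Pi.add_apply, h, h', add_zero]))
  · exact hF l h

lemma IsBarWeight.neg {W : ℕ} {F : List (Finset ι) → k} (hF : IsBarWeight W F) :
    IsBarWeight W (-F) := fun l hl => hF l (neg_ne_zero.1 hl)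

lemma IsBarWeight.sub {W : ℕ} {F G : List (Finset ι) → k} (hF : IsBarWeight W F)
    (hG : IsBarWeight W G) : IsBarWeight W (F - G) := by
  rw [sub_eq_add_neg]; exact hF.add hG.neg

variable (k ι) in
lemma IsBarWeight.zero (W : ℕ) : IsBarWeight W (0 : List (Finset ι) → k) := fun _ h => absurd rfl h

lemma IsBarWeight.cut {W : ℕ} {F : List (Finset ι) → k} (hF : IsBarWeight W F) (s : Finset ι) :
    IsBarWeight (W - s.card) (cut s F) := by
  intro l hl
  obtain ⟨h1, h2⟩ := hF (s :: l) hl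
  rw [listCard_cons] at h2
  exact ⟨fun h => h1 (List.mem_cons_of_mem _ h), by omega⟩

lemma IsBarWeight.cut_empty {W : ℕ} {F : List (Finset ι) → k} (hF : IsBarWeight W F) :
    ChevalleyHochschild.cut ∅ F = 0 := by
  funext l
  by_contra h
  exact (hF (∅ :: l) h).1 List.mem_cons_self

lemma IsBarWeight.cut_eq_zero {W : ℕ} {F : List (Finset ι) → k} (hF : IsBarWeight W F)
    {s : Finset ι} (hs : W < s.card) : ChevalleyHochschild.cut s F = 0 := by
  funext l
  by_contra h
  have := (hF (s :: l) h).2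
  rw [listCard_cons] at this
  omega

variable [CharZero k]

lemma mul_eq_zero_of_card {t u s : Finset ι} (h : s.card ≠ t.card + u.card) :
    (chAlg e).mul t u s = 0 := by
  by_contra h'
  exact h (card_of_mul_ne_zero e h')

lemma barD_ne_zero {F : List (Finset ι) → k} {l : List (Finset ι)}
    (h : barD (chAlg e).mul F l ≠ 0) :
    ∃ l', F l' ≠ 0 ∧ (∅ ∉ l' → ∅ ∉ l) ∧ listCard l' = listCard l ∧ l'.length = l.length + 1 := by
  induction l generalizing F with
  | nil => exact absurd rfl h
  | cons s l ih =>
    rw [barD_cons] at h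
    by_cases h0 : ∑ t, ∑ u, (chAlg e).mul t u s * F (t :: u :: l) = 0
    · rw [h0, zero_sub, neg_ne_zero] at h
      obtain ⟨l', h1, h2, h3, h4⟩ := ih h
      refine ⟨s :: l', h1, ?_, ?_, ?_⟩
      · simp only [List.mem_cons, not_or]
        exact fun h => ⟨h.1, h2 h.2⟩
      · simp [h3]
      · simp [h4]
    · obtain ⟨t, _, ht⟩ := Finset.exists_ne_zero_of_sum_ne_zero h0
      obtain ⟨u, _, hu⟩ := Finset.exists_ne_zero_of_sum_ne_zero ht
      have hc := card_of_mul_ne_zero e (left_ne_zero_of_mul hu)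
      refine ⟨t :: u :: l, right_ne_zero_of_mul hu, ?_, ?_, ?_⟩
      · simp only [List.mem_cons, not_or]
        rintro ⟨h1, h2, h3⟩
        refine ⟨?_, h3⟩
        rintro rfl
        rw [Finset.card_empty] at hc
        exact h1 (Finset.card_eq_zero.1 (by omega)).symm
      · simp only [listCard_cons]; omega
      · simp

lemma IsBarWeight.barD {W : ℕ} {F : List (Finset ι) → k} (hF : IsBarWeight W F) :
    IsBarWeight W (barD (chAlg e).mul F) := by
  intro l hl
  obtain ⟨l', h1, h2, h3, _⟩ := barD_ne_zero e hl
  exact ⟨h2 (hF l' h1).1, h3 ▸ (hF l' h1).2⟩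

/-- A symmetric tensor in generators is a boundary only if it is zero: it has length equal to its
weight, and longer tensors of this weight have a unit factor. -/
lemma symTail_eq_zero_of_eq_barD {W : ℕ} {F : List (Finset ι) → k} (hF : IsBarWeight W F)
    {f : Multiset ι → k} (h : symTail f = ChevalleyHochschild.barD (chAlg e).mul F) :
    symTail f = 0 := by
  funext l
  by_contra hl
  obtain ⟨v, rfl, _⟩ := symTail_ne_zero hl
  rw [h] at hl
  obtain ⟨l', h1, _, h3, h4⟩ := barD_ne_zero e hl
  have := length_le_listCard (hF l' h1).1
  rw [h3, h4, listCard_singletons, List.length_map] at this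
  omega

/-- Changing a bar chain only in parts with first factor of degree at least `deg s` changes the part
of the boundary with first factor `s` by a boundary. -/
lemma cut_barD_uncons {Z : Finset ι → List (Finset ι) → k} {W : ℕ}
    (hZ : IsBarWeight W (uncons Z)) {s : Finset ι}
    (h : ∀ t : Finset ι, t.card < s.card → Z t = 0) :
    cut s (barD (chAlg e).mul (uncons Z)) = - barD (chAlg e).mul (Z s) := by
  rw [cut_barD, cut_uncons, sub_eq_neg_self]
  refine Finset.sum_eq_zero fun t _ => Finset.sum_eq_zero fun u _ => ?_
  rw [cut_uncons]
  by_cases hu : u = ∅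
  · subst hu
    have h0 : cut ∅ (Z t) = 0 := by
      funext l
      by_contra hl
      exact (hZ (t :: ∅ :: l) hl).1 (by simp)
    rw [h0, smul_zero]
  · have hu' : 0 < u.card := Finset.card_pos.2 (Finset.nonempty_iff_ne_empty.2 hu)
    by_cases ht : t.card < s.card
    · rw [h t ht, map_zero, smul_zero]
    · rw [mul_eq_zero_of_card e (by omega), zero_smul]

/-- If the parts of a bar cycle with a first factor of lower degree are symmetric, then the part
with first factor `s` is a cycle, and it satisfies the equations of the Koszul complex. -/
lemma cut_cycle {W : ℕ} {F : List (Finset ι) → k} (hF : IsBarWeight W F)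
    (hb : barD (chAlg e).mul F = 0) (s : Finset ι) (f : Finset ι → Multiset ι → k)
    (hf : ∀ t : Finset ι, t.card < s.card → cut t F = symTail (f t)) :
    barD (chAlg e).mul (cut s F) = 0 ∧
      ∑ t, ∑ a, (chAlg e).mul t {a} s • consMul a (f t) = 0 := by
  have h1 : cut s (barD (chAlg e).mul F) = 0 := by rw [hb, map_zero]
  rw [cut_barD, sub_eq_zero] at h1
  have h2 : ∑ t, ∑ u, (chAlg e).mul t u s • cut u (cut t F) =
      symTail (∑ t, ∑ a, (chAlg e).mul t {a} s • consMul a (f t)) := by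
    simp only [map_sum, map_smul]
    refine Finset.sum_congr rfl fun t _ => ?_
    by_cases ht : t.card < s.card
    · rw [hf t ht, sum_eq_sum_singleton _ fun u hu => by
        rw [cut_symTail_of_card_ne hu, smul_zero]]
      simp only [cut_singleton_symTail]
    · rw [Finset.sum_eq_zero, Finset.sum_eq_zero]
      · intro a _
        rw [mul_eq_zero_of_card e (by rw [Finset.card_singleton]; omega), zero_smul]
      · intro u _
        by_cases hu : u = ∅
        · subst hu
          have h0 : cut ∅ (cut t F) = 0 := (hF.cut t).cut_empty
          rw [h0, smul_zero]
        · have hu' : 0 < u.card := Finset.card_pos.2 (Finset.nonempty_iff_ne_empty.2 hu)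
          rw [mul_eq_zero_of_card e (by omega), zero_smul]
  rw [h2] at h1
  have h3 := symTail_eq_zero_of_eq_barD e (hF.cut s) h1
  refine ⟨h1.symm.trans h3, symTail_injective ?_⟩
  rw [h3, map_zero]

/-- Step from tensors whose parts with fixed first factor are symmetric to symmetric tensors, by
the exactness of the Koszul complex. -/
lemma koszul_step {W : ℕ} (hW : 0 < W) {F : List (Finset ι) → k} (hF : IsBarWeight W F)
    (hb : barD (chAlg e).mul F = 0) (f : Finset ι → Multiset ι → k)
    (hf : ∀ t : Finset ι, cut t F = symTail (f t)) :
    ∃ h y, IsBarWeight W y ∧ F = symTail h + barD (chAlg e).mul y := by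
  -- the element of `Λ ⊗ Sym` given by the parts of `F`; it is a cycle of the Koszul complex
  let φ : Multiset ι → Ch k g := fun M => ∑ s, f s M • chBasis e s
  have hrepr : ∀ M s, (chBasis e).repr (φ M) s = f s M := by
    intro M s
    simp [φ, Finsupp.single_apply]
  have hφ : ∀ M s, (chBasis e).repr (φ M) s ≠ 0 → s.card + M.card = W := by
    intro M s h
    rw [hrepr] at h
    induction M using Quotient.inductionOn with
    | h v =>
      have h1 : F (s :: v.map fun a => ({a} : Finset ι)) ≠ 0 := by
        have : F (s :: v.map fun a => ({a} : Finset ι)) =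
          cut s F (v.map fun a => ({a} : Finset ι)) := rfl
        rw [this, hf, symTail_map_singleton]
        exact h
      have := (hF _ h1).2
      rwa [listCard_cons, listCard_singletons] at this
  have hD : ∀ (G : Finset ι → Multiset ι → k) (ψ : Multiset ι → Ch k g)
      (_ : ∀ M s, (chBasis e).repr (ψ M) s = G s M) (M : Multiset ι) (s : Finset ι),
      (∑ t, ∑ a, (chAlg e).mul t {a} s • consMul a (G t)) M =
        (chBasis e).repr (koszulD e ψ M) s := by
    intro G ψ hψ M s
    simp only [koszulD, map_sum, Finsupp.coe_finsetSum, Finset.sum_apply, Pi.smul_apply,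
      consMul_apply, smul_eq_mul]
    rw [Finset.sum_comm]
    refine Finset.sum_congr rfl fun a _ => ?_
    have := sum_repr_mul e (LinearMap.mulRight k (ExteriorAlgebra.ι k (e.coord a)))
      (ψ (a ::ₘ M)) s
    rw [LinearMap.mulRight_apply] at this
    rw [← this]
    refine Finset.sum_congr rfl fun t _ => ?_
    rw [chAlg_mul_def, chBasis_singleton, hψ, mul_comm, LinearMap.mulRight_apply]
  have hd : ∀ M, koszulD e φ M = 0 := by
    intro M
    refine (chBasis e).repr.injective (Finsupp.ext fun s => ?_)
    rw [← hD f φ hrepr, (cut_cycle e hF hb s f fun t _ => hf t).2]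
    simp
  -- a primitive of `φ`; its part with trivial exterior factor is the symmetric tensor, the
  -- remaining parts form the chain whose boundary is subtracted
  let f' : Finset ι → Multiset ι → k := fun s M => (W : k)⁻¹ * (chBasis e).repr (koszulH e φ M) s
  have hf' : ∀ s, ∑ t, ∑ a, (chAlg e).mul t {a} s • consMul a (f' t) = f s := by
    intro s
    funext M
    rw [hD f' (fun M => (W : k)⁻¹ • koszulH e φ M) (fun M s => by simp [f'])]
    have h1 : koszulD e (fun M => (W : k)⁻¹ • koszulH e φ M) M =
        (W : k)⁻¹ • koszulD e (koszulH e φ) M := by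
      simp only [koszulD, smul_mul_assoc, Finset.smul_sum]
    rw [h1, koszulD_koszulH e hφ hd, smul_smul, inv_mul_cancel₀ (by exact_mod_cast hW.ne'),
      one_smul, hrepr]
  let Z : Finset ι → List (Finset ι) → k := fun t => if t = ∅ then 0 else symTail (f' t)
  have hZ : IsBarWeight W (uncons Z) := by
    rintro (_ | ⟨t, l⟩) hl
    · exact absurd rfl hl
    · rw [uncons_cons] at hl
      by_cases ht : t = ∅
      · simp [Z, ht] at hl
      · simp only [Z, ht, if_false] at hl
        obtain ⟨v, rfl, hv⟩ := symTail_ne_zero hl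
        have h1 := repr_koszulH_ne_zero e hφ _ _ (right_ne_zero_of_mul hv)
        refine ⟨?_, ?_⟩
        · simp [ht, Ne.symm ht]
        · rw [listCard_cons, listCard_singletons]
          exact h1
  refine ⟨f' ∅, uncons Z, hZ, ?_⟩
  funext l
  rcases l with _ | ⟨s, l⟩
  · have h0 : F [] = 0 := by
      by_contra h
      have := (hF [] h).2
      rw [listCard_nil] at this
      omega
    rw [h0, Pi.add_apply, symTail_nil, barD_nil]
    simp [f', koszulH]
  · refine congrFun (?_ : cut s F = cut s (symTail (f' ∅) + barD (chAlg e).mul (uncons Z))) l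
    have h1 : cut s (symTail (f' ∅)) = ∑ a, (chAlg e).mul ∅ {a} s • symTail (consMul a (f' ∅)) := by
      rw [cut_symTail]
      refine Finset.sum_congr rfl fun a _ => ?_
      have h2 : (chAlg e).mul ∅ {a} s = if s = {a} then 1 else 0 := by
        simp [chAlg_mul_def, Finsupp.single_apply, eq_comm]
      rw [h2, ite_smul, one_smul, zero_smul]
    have h2 : barD (chAlg e).mul (Z s) = 0 := by
      by_cases hs : s = ∅
      · simp [Z, hs]
      · simp only [Z, hs, if_false, barD_symTail]
    have h3 : ∀ t, ∑ u, (chAlg e).mul t u s • cut u (Z t) = if t = ∅ then 0 else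
        ∑ a, (chAlg e).mul t {a} s • symTail (consMul a (f' t)) := by
      intro t
      by_cases ht : t = ∅
      · simp [Z, ht]
      · simp only [Z, ht, if_false]
        rw [sum_eq_sum_singleton _ fun u hu => by rw [cut_symTail_of_card_ne hu, smul_zero]]
        simp only [cut_singleton_symTail]
    rw [map_add, cut_barD, cut_uncons, h2, sub_zero, hf s, ← hf' s, h1]
    simp only [cut_uncons, h3, map_sum, map_smul]
    rw [← Finset.sum_erase_add _ _ (Finset.mem_univ (∅ : Finset ι)), add_comm]
    refine congrArg₂ (· + ·) rfl ?_
    refine Eq.trans (Finset.sum_congr rfl fun t ht => ?_)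
      (Finset.sum_erase Finset.univ (a := (∅ : Finset ι)) (if_pos rfl))
    exact (if_neg (Finset.ne_of_mem_erase ht)).symm

/-- A cycle of the reduced bar complex of an exterior algebra is homologous to a symmetric tensor
in generators. -/
theorem bar_cycle (W : ℕ) {F : List (Finset ι) → k} (hF : IsBarWeight W F)
    (hb : barD (chAlg e).mul F = 0) :
    ∃ h y, IsBarWeight W y ∧ F = symTail h + barD (chAlg e).mul y := by
  induction W using Nat.strong_induction_on generalizing F with
  | _ W ih =>
  -- in weight zero, there is only the empty tensor
  rcases Nat.eq_zero_or_pos W with rfl | hW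
  · refine ⟨fun M => if M = 0 then F [] else 0, 0, IsBarWeight.zero k ι 0, ?_⟩
    rw [map_zero, add_zero]
    funext l
    by_cases hl : l = []
    · subst hl; simp
    · have h1 : F l = 0 := by
        by_contra h
        have h2 := hF l h
        have h3 := length_le_listCard h2.1
        exact hl (List.eq_nil_of_length_eq_zero (by omega))
      rw [h1]
      by_contra h
      obtain ⟨v, rfl, hv⟩ := symTail_ne_zero (Ne.symm h)
      refine hv (if_neg ?_)
      rintro h4
      rw [Multiset.coe_eq_zero] at h4
      exact hl (by rw [h4]; rfl)
  · -- the parts with first factor of degree at most `p` are made symmetric by induction on `p`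
    have key : ∀ p : ℕ, ∃ y, IsBarWeight W y ∧ ∀ s : Finset ι, s.card ≤ p →
        ∃ f, cut s (F - barD (chAlg e).mul y) = symTail f := by
      intro p
      induction p with
      | zero =>
        refine ⟨0, IsBarWeight.zero k ι W, fun s hs => ⟨0, ?_⟩⟩
        rw [Finset.card_eq_zero.1 (Nat.le_zero.1 hs), map_zero, sub_zero, map_zero, hF.cut_empty]
      | succ p ihp =>
        obtain ⟨y, hy, hp⟩ := ihp
        choose! f hf using hp
        have hF' : IsBarWeight W (F - barD (chAlg e).mul y) := hF.sub (hy.barD e)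
        have hb' : barD (chAlg e).mul (F - barD (chAlg e).mul y) = 0 := by
          rw [map_sub, hb, barD_barD (chAlg_laws e), sub_zero]
        -- the parts with first factor of degree `p + 1` are cycles of smaller weight
        have h1 : ∀ s : Finset ι, s.card = p + 1 → ∃ h z, IsBarWeight (W - s.card) z ∧
            (W < s.card → z = 0) ∧
            cut s (F - barD (chAlg e).mul y) = symTail h + barD (chAlg e).mul z := by
          intro s hs
          by_cases hW' : W < s.card
          · refine ⟨0, 0, IsBarWeight.zero k ι _, fun _ => rfl, ?_⟩
            rw [hF'.cut_eq_zero hW', map_zero, map_zero, add_zero]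
          · obtain ⟨h, z, hz, hz'⟩ := ih (W - s.card) (by omega) (hF'.cut s)
              (cut_cycle e hF' hb' s f fun t ht => hf t (by omega)).1
            exact ⟨h, z, hz, fun h => absurd h hW', hz'⟩
        choose! h z hz hz0 hz' using h1
        let Z : Finset ι → List (Finset ι) → k := fun s => if s.card = p + 1 then z s else 0
        have hZ : IsBarWeight W (uncons Z) := by
          rintro (_ | ⟨s, l⟩) hl
          · exact absurd rfl hl
          · rw [uncons_cons] at hl
            by_cases hs : s.card = p + 1
            · simp only [Z, hs, if_true] at hl
              obtain ⟨h2, h3⟩ := hz s hs l hl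
              refine ⟨?_, ?_⟩
              · rw [List.mem_cons, not_or]
                refine ⟨?_, h2⟩
                rintro rfl
                simp at hs
              · rw [listCard_cons, h3]
                by_contra hW'
                rw [hz0 s hs (by omega)] at hl
                exact hl rfl
            · simp [Z, hs] at hl
        refine ⟨y - uncons Z, hy.sub hZ, fun s hs => ?_⟩
        have h2 : cut s (F - barD (chAlg e).mul (y - uncons Z)) =
            cut s (F - barD (chAlg e).mul y) - barD (chAlg e).mul (Z s) := by
          rw [map_sub (barD (chAlg e).mul), ← sub_add, map_add, cut_barD_uncons e hZ
            fun t ht => if_neg (by omega), ← sub_eq_add_neg]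
        rw [h2]
        by_cases hs' : s.card = p + 1
        · refine ⟨h s, ?_⟩
          rw [hz' s hs']
          simp [Z, hs']
        · refine ⟨f s, ?_⟩
          rw [hf s (by omega)]
          simp [Z, hs']
    -- all monomials have degree at most `dim g`
    obtain ⟨y, hy, hs⟩ := key (Fintype.card ι)
    choose f hf using fun s => hs s (Finset.card_le_univ s)
    obtain ⟨h, y', hy', h1⟩ := koszul_step e hW (hF.sub (hy.barD e))
      (by rw [map_sub, hb, barD_barD (chAlg_laws e), sub_zero]) f hf
    refine ⟨h, y' + y, hy'.add hy, ?_⟩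
    rw [map_add, ← add_assoc, ← h1, sub_add_cancel]

end BarHomology

/-! ### Cycles of the multiplicative part of the Hochschild differential -/

section HochschildAcyclic

variable {k g ι : Type*} [Field k] [LieRing g] [LieAlgebra k g]
variable [Fintype ι] [LinearOrder ι] (e : Module.Basis ι k g)

/-- A reduced Hochschild chain of weight `W`. -/
def IsHochWeight (W : ℕ) (Y : Finset ι → List (Finset ι) → k) : Prop :=
  ∀ s l, Y s l ≠ 0 → ∅ ∉ l ∧ s.card + listCard l = W

lemma IsHochWeight.add {W : ℕ} {F G : Finset ι → List (Finset ι) → k} (hF : IsHochWeight W F)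
    (hG : IsHochWeight W G) : IsHochWeight W (F + G) := by
  intro s l hl
  by_cases h : F s l = 0
  · exact hG s l (by intro h'; exact hl (by rw [Pi.add_apply, Pi.add_apply, h, h', add_zero]))
  · exact hF s l h

lemma IsHochWeight.sub {W : ℕ} {F G : Finset ι → List (Finset ι) → k} (hF : IsHochWeight W F)
    (hG : IsHochWeight W G) : IsHochWeight W (F - G) := by
  rw [sub_eq_add_neg]
  exact hF.add fun s l hl => hG s l (neg_ne_zero.1 hl)

variable (k ι) in
lemma IsHochWeight.zero (W : ℕ) : IsHochWeight W (0 : Finset ι → List (Finset ι) → k) :=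
  fun _ _ h => absurd rfl h

lemma IsHochWeight.apply {W : ℕ} {Y : Finset ι → List (Finset ι) → k} (hY : IsHochWeight W Y)
    (s : Finset ι) : IsBarWeight (W - s.card) (Y s) := fun l hl =>
  ⟨(hY s l hl).1, by have := (hY s l hl).2; omega⟩

lemma IsHochWeight.apply_eq_zero {W : ℕ} {Y : Finset ι → List (Finset ι) → k}
    (hY : IsHochWeight W Y) {s : Finset ι} (hs : W < s.card) : Y s = 0 := by
  funext l
  by_contra h
  have := (hY s l h).2
  omega

variable [CharZero k]

lemma IsHochWeight.hochMul {W : ℕ} {Y : Finset ι → List (Finset ι) → k} (hY : IsHochWeight W Y) :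
    IsHochWeight W (hochMul (chAlg e).mul (chAlg e).par Y) := by
  intro s l hl
  rw [hochMul_apply, barD_cons, cut_uncons] at hl
  by_cases h0 : ∑ t, ∑ u, (chAlg e).mul t u s * Y t (u :: l) = 0
  · by_cases h1 : barD (chAlg e).mul (Y s) l = 0
    · simp only [uncons_cons, h0, h1, sub_zero, zero_add, cycD_apply] at hl
      obtain ⟨t, _, ht⟩ := Finset.exists_ne_zero_of_sum_ne_zero (right_ne_zero_of_mul hl)
      obtain ⟨u, _, hu⟩ := Finset.exists_ne_zero_of_sum_ne_zero ht
      have hc := card_of_mul_ne_zero e (right_ne_zero_of_mul (left_ne_zero_of_mul hu))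
      obtain ⟨h2, h3⟩ := hY _ _ (right_ne_zero_of_mul hu)
      simp only [List.mem_append, not_or, listCard_append, listCard_cons, listCard_nil] at h2 h3
      exact ⟨h2.1, by omega⟩
    · obtain ⟨h2, h3⟩ := (hY.apply s).barD e l h1
      refine ⟨h2, ?_⟩
      by_contra h
      rw [hY.apply_eq_zero (by omega), map_zero] at h1
      exact h1 rfl
  · obtain ⟨t, _, ht⟩ := Finset.exists_ne_zero_of_sum_ne_zero h0
    obtain ⟨u, _, hu⟩ := Finset.exists_ne_zero_of_sum_ne_zero ht
    have hc := card_of_mul_ne_zero e (left_ne_zero_of_mul hu)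
    obtain ⟨h2, h3⟩ := hY _ _ (right_ne_zero_of_mul hu)
    rw [List.mem_cons, not_or] at h2
    rw [listCard_cons] at h3
    exact ⟨h2.2, by omega⟩

/-- A Hochschild chain all of whose factors but the first one are generators, and which is symmetric
in these factors. -/
def symHoch (f : Finset ι → Multiset ι → k) (s : Finset ι) (l : List (Finset ι)) : k :=
  symTail (f s) l

lemma lpar_singletons (v : List ι) :
    lpar (chAlg e).par (v.map fun a => ({a} : Finset ι)) = v.length := by
  induction v with
  | nil => rfl
  | cons a v ih =>
    rw [List.map_cons, lpar_cons, ih, BasedDGAlgebra.par, List.length_cons, Nat.cast_succ, add_comm]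
    simp [chAlg]

lemma mul_singleton_comm (a : ι) (t s : Finset ι) :
    (chAlg e).mul {a} t s = psign k t.card * (chAlg e).mul t {a} s := by
  have h := mul_comm_of_mem (chBasis_mem e {a}) (chBasis_mem e t)
  rw [chAlg_mul_def, chAlg_mul_def, h, map_smul, Finsupp.smul_apply, smul_eq_mul, psign_natCast,
    Finset.card_singleton, one_mul]

/-- The multiplication of the last factor with the first one cancels the multiplication of the first
two factors. -/
lemma hochMul_symHoch (f : Finset ι → Multiset ι → k) :
    hochMul (chAlg e).mul (chAlg e).par (symHoch f) = 0 := by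
  funext s l
  have h0 : barD (chAlg e).mul (symHoch f s) = 0 := barD_symTail e (f s)
  rw [hochMul_apply, barD_cons, cut_uncons, h0, cycD_apply, Finset.mul_sum, Pi.zero_apply, sub_zero,
    ← Finset.sum_add_distrib]
  refine Finset.sum_eq_zero fun t _ => ?_
  have h1 : ∀ u, symHoch f t (u :: l) = cut u (symTail (f t)) l := fun u => rfl
  have h2 : ∀ u, symHoch f t (l ++ [u]) = cut u (symTail (f t)) l := fun u => by
    rw [← cutLast_symTail]; rfl
  simp only [uncons_cons, h1, h2]
  rw [sum_eq_sum_singleton _ fun u hu => by rw [cut_symTail_of_card_ne hu, Pi.zero_apply, mul_zero],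
    sum_eq_sum_singleton (fun u => _ * cut u (symTail (f t)) l)
      fun u hu => by rw [cut_symTail_of_card_ne hu, Pi.zero_apply, mul_zero],
    Finset.mul_sum, ← Finset.sum_add_distrib]
  refine Finset.sum_eq_zero fun a _ => ?_
  rw [cut_singleton_symTail]
  by_cases h : symTail (consMul a (f t)) l = 0
  · simp [h]
  · obtain ⟨v, rfl, _⟩ := symTail_ne_zero h
    have h3 : (chAlg e).par {a} = 1 := by simp [BasedDGAlgebra.par, chAlg]
    have h4 : (chAlg e).par t = t.card := rfl
    have h5 : psign k ((v.length : ZMod 2) + 1) * (psign k ((t.card : ZMod 2) + v.length) *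
        psign k (t.card : ZMod 2)) = -1 := by
      rw [← psign_add, ← psign_add]
      have h6 : ((v.length : ZMod 2) + 1) + (t.card + v.length + t.card) = 1 := by
        have h7 : ∀ a : ZMod 2, a + a = 0 := CharTwo.add_self_eq_zero
        linear_combination h7 (v.length : ZMod 2) + h7 (t.card : ZMod 2)
      rw [h6, psign_one]
    rw [lpar_singletons, h3, h4, one_mul, List.length_map, mul_singleton_comm]
    linear_combination ((chAlg e).mul t {a} s * symTail (consMul a (f t))
      (v.map fun a => ({a} : Finset ι))) * h5

/-- Besides the bar differential of `Y s`, the value of `hochMul` at the first factor `s` involves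
only the `Y t` with `t` of smaller degree: these terms multiply `t` by a factor of positive
degree. -/
lemma hochMul_congr_card {Y Z : Finset ι → List (Finset ι) → k} (hY : ∀ t l, ∅ ∈ l → Y t l = 0)
    (hZ : ∀ t l, ∅ ∈ l → Z t l = 0) {s : Finset ι}
    (h : ∀ t : Finset ι, t.card < s.card → Y t = Z t) (l : List (Finset ι)) :
    hochMul (chAlg e).mul (chAlg e).par Y s l + barD (chAlg e).mul (Y s) l =
      hochMul (chAlg e).mul (chAlg e).par Z s l + barD (chAlg e).mul (Z s) l := by
  simp only [hochMul_apply, barD_cons, cut_uncons, cycD_apply, uncons_cons]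
  have h1 : ∀ t u l', u ∈ l' → (chAlg e).mul t u s * Y t l' = (chAlg e).mul t u s * Z t l' := by
    intro t u l' hu
    by_cases hu' : u = ∅
    · rw [hY t l' (hu' ▸ hu), hZ t l' (hu' ▸ hu)]
    · have hu'' : 0 < u.card := Finset.card_pos.2 (Finset.nonempty_iff_ne_empty.2 hu')
      by_cases ht : t.card < s.card
      · rw [h t ht]
      · rw [mul_eq_zero_of_card e (by omega), zero_mul, zero_mul]
  have h2 : ∀ t u l', u ∈ l' → (chAlg e).mul u t s * Y t l' = (chAlg e).mul u t s * Z t l' := by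
    intro t u l' hu
    by_cases hu' : u = ∅
    · rw [hY t l' (hu' ▸ hu), hZ t l' (hu' ▸ hu)]
    · have hu'' : 0 < u.card := Finset.card_pos.2 (Finset.nonempty_iff_ne_empty.2 hu')
      by_cases ht : t.card < s.card
      · rw [h t ht]
      · rw [mul_eq_zero_of_card e (by omega), zero_mul, zero_mul]
  have h3 : ∑ t, ∑ u, (chAlg e).mul t u s * Y t (u :: l) =
      ∑ t, ∑ u, (chAlg e).mul t u s * Z t (u :: l) :=
    Finset.sum_congr rfl fun t _ => Finset.sum_congr rfl fun u _ => h1 t u _ (by simp)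
  have h4 : ∑ t, ∑ u, psign k ((chAlg e).par u * ((chAlg e).par t + lpar (chAlg e).par l)) *
      (chAlg e).mul u t s * Y t (l ++ [u]) = ∑ t, ∑ u, psign k ((chAlg e).par u *
        ((chAlg e).par t + lpar (chAlg e).par l)) * (chAlg e).mul u t s * Z t (l ++ [u]) :=
    Finset.sum_congr rfl fun t _ => Finset.sum_congr rfl fun u _ => by
      rw [mul_assoc, mul_assoc, h2 t u _ (by simp)]
  rw [h3, h4]
  ring

lemma IsHochWeight.eq_zero_of_mem {W : ℕ} {Y : Finset ι → List (Finset ι) → k}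
    (hY : IsHochWeight W Y) (t : Finset ι) (l : List (Finset ι)) (hl : ∅ ∈ l) : Y t l = 0 := by
  by_contra h
  exact (hY t l h).1 hl

lemma symHoch_eq_zero_of_mem (f : Finset ι → Multiset ι → k) (t : Finset ι) (l : List (Finset ι))
    (hl : ∅ ∈ l) : symHoch f t l = 0 := by
  by_contra h
  obtain ⟨v, rfl, _⟩ := symTail_ne_zero h
  simp at hl

/-- A cycle for the multiplicative part of the Hochschild differential is homologous to a
symmetric tensor in generators with coefficients in `Ch`. -/
theorem hochMul_cycle {W : ℕ} {Y : Finset ι → List (Finset ι) → k} (hY : IsHochWeight W Y)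
    (hb : hochMul (chAlg e).mul (chAlg e).par Y = 0) :
    ∃ f y, IsHochWeight W y ∧ Y = symHoch f + hochMul (chAlg e).mul (chAlg e).par y := by
  -- Induction on the degree of the first factor: up to a boundary, the components with first factor
  -- of degree less than `p` are symmetric.
  have key : ∀ p : ℕ, ∃ y, IsHochWeight W y ∧ ∀ s : Finset ι, s.card < p →
      ∃ f, (Y - hochMul (chAlg e).mul (chAlg e).par y) s = symTail f := by
    intro p
    induction p with
    | zero => exact ⟨0, IsHochWeight.zero k ι W, fun s hs => absurd hs (Nat.not_lt_zero _)⟩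
    | succ p ihp =>
      obtain ⟨y, hy, hp⟩ := ihp
      choose! f hf using hp
      set Y' := Y - hochMul (chAlg e).mul (chAlg e).par y with hY'
      have hw : IsHochWeight W Y' := hY.sub (hy.hochMul e)
      have hb' : hochMul (chAlg e).mul (chAlg e).par Y' = 0 := by
        rw [hY', map_sub, hb, hochMul_hochMul (chAlg_laws e), sub_zero]
      have h1 : ∀ s : Finset ι, s.card = p → ∃ h z, IsBarWeight (W - s.card) z ∧
          (W < s.card → z = 0) ∧ Y' s = symTail h + barD (chAlg e).mul z := by
        intro s hs
        by_cases hW' : W < s.card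
        · refine ⟨0, 0, IsBarWeight.zero k ι _, fun _ => rfl, ?_⟩
          rw [hw.apply_eq_zero hW', map_zero, map_zero, add_zero]
        -- The components of smaller degree are symmetric. As symmetric chains are annihilated by
        -- `hochMul`, what remains of the cycle condition concerns the component at `s` alone.
        · have hc : barD (chAlg e).mul (Y' s) = 0 := by
            funext l
            have h2 := hochMul_congr_card e hw.eq_zero_of_mem
              (symHoch_eq_zero_of_mem fun t => if t.card < s.card then f t else 0) (s := s)
              (fun t ht => by
                rw [hf t (by omega)]
                funext l
                simp [symHoch, ht]) l
            have h3 : barD (chAlg e).mul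
                (symHoch (fun t => if t.card < s.card then f t else 0) s) = 0 := barD_symTail e _
            rw [hochMul_symHoch, hb', h3] at h2
            simpa using h2
          obtain ⟨h, z, hz, hz'⟩ := bar_cycle e (W - s.card) (hw.apply s) hc
          exact ⟨h, z, hz, fun h => absurd h hW', hz'⟩
      choose! h z hz hz0 hz' using h1
      let Z : Finset ι → List (Finset ι) → k := fun s => if s.card = p then z s else 0
      have hZ : IsHochWeight W Z := by
        intro s l hl
        by_cases hs : s.card = p
        · simp only [Z, hs, if_true] at hl
          obtain ⟨h2, h3⟩ := hz s hs l hl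
          refine ⟨h2, ?_⟩
          rw [h3]
          by_contra hW'
          rw [hz0 s hs (by omega)] at hl
          exact hl rfl
        · simp [Z, hs] at hl
      refine ⟨y - Z, fun s l hl => (hy.sub hZ) s l hl, fun s hs => ?_⟩
      have h2 : (Y - hochMul (chAlg e).mul (chAlg e).par (y - Z)) s =
          Y' s - barD (chAlg e).mul (Z s) := by
        funext l
        have h3 := hochMul_congr_card e hZ.eq_zero_of_mem
          (Z := 0) (fun _ _ _ => rfl) (s := s) (fun t ht => if_neg (by omega)) l
        simp only [map_zero, Pi.zero_apply, add_zero] at h3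
        simp only [map_sub, hY', Pi.sub_apply]
        linear_combination h3
      rw [h2]
      by_cases hs' : s.card = p
      · refine ⟨h s, ?_⟩
        rw [hz' s hs']
        simp [Z, hs']
      · refine ⟨f s, ?_⟩
        rw [hf s (by omega)]
        simp [Z, hs']
  -- All monomials have degree at most the dimension of the Lie algebra.
  obtain ⟨y, hy, hs⟩ := key (Fintype.card ι + 1)
  choose f hf using fun s => hs s (Nat.lt_succ_of_le (Finset.card_le_univ s))
  refine ⟨f, y, hy, ?_⟩
  rw [← sub_eq_iff_eq_add]
  exact funext hf

end HochschildAcyclic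

/-! ### Words and polynomials -/

section WordSeries

variable {k g ι : Type*} [Field k] [LieRing g] [LieAlgebra k g]
variable [Fintype ι] [LinearOrder ι] (e : Module.Basis ι k g)

/-- The polynomial `∑ F(a_1, …, a_i) x_{a_1} ⋯ x_{a_i}`. -/
noncomputable def wordSeries (i : ℕ) (F : List ι → k) : MvPowerSeries ι k :=
  ∑ w : Fin i → ι, MvPowerSeries.monomial (∑ j, Finsupp.single (w j) 1) (F (List.ofFn w))

lemma coeff_wordSeries (i : ℕ) (F : List ι → k) (α : ι →₀ ℕ) :
    MvPowerSeries.coeff α (wordSeries i F) =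
      ∑ w : Fin i → ι, if ∑ j, Finsupp.single (w j) 1 = α then F (List.ofFn w) else 0 := by
  rw [wordSeries, map_sum]
  refine Finset.sum_congr rfl fun w _ => ?_
  rw [MvPowerSeries.coeff_monomial]
  simp only [eq_comm]

lemma wordSeries_zero (F : List ι → k) : wordSeries 0 F = MvPowerSeries.C (F []) := by
  simp [wordSeries, MvPowerSeries.monomial_zero_eq_C_apply]

lemma wordSeries_succ (i : ℕ) (F : List ι → k) :
    wordSeries (i + 1) F = ∑ a, MvPowerSeries.X a * wordSeries i fun l => F (a :: l) := by
  rw [wordSeries, ← (Fin.consEquiv fun _ : Fin (i + 1) => ι).sum_comp, Fintype.sum_prod_type]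
  refine Finset.sum_congr rfl fun a _ => ?_
  rw [wordSeries, Finset.mul_sum]
  refine Finset.sum_congr rfl fun w _ => ?_
  rw [MvPowerSeries.X, MvPowerSeries.monomial_mul_monomial, one_mul]
  simp only [Fin.consEquiv_apply, Fin.sum_univ_succ, Fin.cons_zero, Fin.cons_succ, List.ofFn_succ]

/-- All factors of the tensors that occur in `F` are generators. -/
def IsLinear (F : List (Finset ι) → k) : Prop := ∀ l, F l ≠ 0 → ∀ s ∈ l, s.card = 1

lemma IsLinear.cut {F : List (Finset ι) → k} (hF : IsLinear F) (s : Finset ι) :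
    IsLinear (cut s F) := fun l hl u hu => hF (s :: l) hl u (List.mem_cons_of_mem _ hu)

lemma IsLinear.cut_eq_zero {F : List (Finset ι) → k} (hF : IsLinear F) {s : Finset ι}
    (hs : s.card ≠ 1) : ChevalleyHochschild.cut s F = 0 := by
  funext l
  by_contra h
  exact hs (hF (s :: l) h s List.mem_cons_self)

lemma deRham_singleton (a : ι) :
    deRham e (chBasis e {a}) = 1 ⊗ₜ[k] (MvPowerSeries.X a : MvPowerSeries ι k) := by
  rw [chBasis_singleton, deRham_apply, Finset.sum_eq_single a]
  · rw [contrL_ι]; simp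
  · intro b _ hb
    rw [contrL_ι]; simp [Finsupp.single_apply, hb]
  · simp

/-- On tensors of generators, the map `hkrTail` is the multiplication of power series. -/
lemma hkrTail_of_isLinear (i : ℕ) {F : List (Finset ι) → k} (hF : IsLinear F) :
    hkrTail e i F = (-1 : k) ^ (i.choose 2) •
      (1 ⊗ₜ[k] wordSeries i fun v => F (v.map fun a => ({a} : Finset ι))) := by
  induction i generalizing F with
  | zero =>
    rw [hkrTail_zero, wordSeries_zero, Algebra.TensorProduct.one_def, ← mul_one (MvPowerSeries.C _),
      ← MvPowerSeries.smul_eq_C_mul, TensorProduct.tmul_smul]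
    simp
  | succ i ih =>
    rw [hkrTail_succ, sum_eq_sum_singleton _ fun s hs => by
      rw [hF.cut_eq_zero hs, map_zero, mul_zero, smul_zero], wordSeries_succ,
      TensorProduct.tmul_sum, Finset.smul_sum]
    refine Finset.sum_congr rfl fun a _ => ?_
    rw [ih (hF.cut {a}), deRham_singleton, mul_smul_comm, Algebra.TensorProduct.tmul_mul_tmul,
      one_mul, smul_smul, ← pow_add, Finset.card_singleton, mul_one,
      Nat.choose_succ_succ' i 1, Nat.choose_one_right]
    rfl

/-- On chains in generators, the map `hkrRaw` multiplies the coordinates of the generators. -/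
lemma formPart_hkrRaw (i : ℕ) {Y : Finset ι → List (Finset ι) → k} (hY : ∀ s, IsLinear (Y s))
    (s : Finset ι) :
    formPart e s (hkrRaw e i Y) = ((-1 : k) ^ (i * s.card) * (-1) ^ (i.choose 2)) •
      wordSeries i fun v => Y s (v.map fun a => ({a} : Finset ι)) := by
  rw [hkrRaw_apply]
  simp only [fun s => hkrTail_of_isLinear e i (hY s), mul_smul_comm,
    Algebra.TensorProduct.tmul_mul_tmul, one_mul, mul_one, smul_smul, ← TensorProduct.tmul_smul]
  rw [formPart_sum]

lemma isLinear_symTail (f : Multiset ι → k) : IsLinear (symTail f) := by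
  intro l hl s hs
  obtain ⟨v, rfl, _⟩ := symTail_ne_zero hl
  obtain ⟨a, _, rfl⟩ := List.mem_map.1 hs
  exact Finset.card_singleton a

/-- The number of words of length `i` with given content. -/
noncomputable def wordCount (i : ℕ) (α : ι →₀ ℕ) : ℕ :=
  (Finset.univ.filter fun w : Fin i → ι => ∑ j, Finsupp.single (w j) 1 = α).card

lemma card_toMultiset_eq (α : ι →₀ ℕ) : (Finsupp.toMultiset α).card = α.degree := by
  rw [Finsupp.card_toMultiset, Finsupp.degree_apply]
  rfl

lemma toMultiset_ofFn {i : ℕ} (w : Fin i → ι) :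
    Finsupp.toMultiset (∑ j, Finsupp.single (w j) 1) = (List.ofFn w : Multiset ι) := by
  rw [map_sum]
  simp only [Finsupp.toMultiset_single, one_smul]
  induction i with
  | zero => simp
  | succ i ih =>
    rw [Fin.sum_univ_succ, ih, List.ofFn_succ, ← Multiset.cons_coe, Multiset.singleton_add]

lemma wordCount_pos (α : ι →₀ ℕ) : 0 < wordCount α.degree α := by
  refine Finset.card_pos.2 ?_
  have h : (Finsupp.toMultiset α).toList.length = α.degree := by
    rw [Multiset.length_toList, card_toMultiset_eq]
  rw [← h]
  refine ⟨fun j => (Finsupp.toMultiset α).toList[j], ?_⟩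
  simp only [Finset.mem_filter, Finset.mem_univ, true_and]
  refine Multiset.toFinsupp.symm.injective ?_
  change Finsupp.toMultiset _ = Finsupp.toMultiset _
  rw [toMultiset_ofFn]
  simp only [Fin.getElem_fin, List.ofFn_getElem, Multiset.coe_toList]

lemma coeff_wordSeries_symm (i : ℕ) (f : Multiset ι → k) (α : ι →₀ ℕ) :
    MvPowerSeries.coeff α (wordSeries i fun v => f v) =
      wordCount i α * f (Finsupp.toMultiset α) := by
  rw [coeff_wordSeries, wordCount, ← nsmul_eq_mul, ← Finset.sum_const, Finset.sum_filter]
  refine Finset.sum_congr rfl fun w _ => ?_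
  split_ifs with h
  · rw [← h, toMultiset_ofFn]
  · rfl

lemma formPart_hkrRaw_symHoch (i : ℕ) (f : Finset ι → Multiset ι → k) (s : Finset ι)
    (α : ι →₀ ℕ) :
    MvPowerSeries.coeff α (formPart e s (hkrRaw e i (symHoch f))) =
      ((-1 : k) ^ (i * s.card) * (-1) ^ (i.choose 2)) *
        (wordCount i α * f s (Finsupp.toMultiset α)) := by
  rw [formPart_hkrRaw e i (Y := symHoch f) fun s => isLinear_symTail (f s),
    MvPowerSeries.coeff_smul, ← coeff_wordSeries_symm]
  simp only [symHoch, symTail_map_singleton]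

lemma neg_one_pow_mul_self (m n : ℕ) :
    ((-1 : k) ^ m * (-1) ^ n) * ((-1 : k) ^ m * (-1) ^ n) = 1 := by
  rw [← pow_add, ← mul_pow]; simp

variable [CharZero k]

lemma symHoch_eq_zero {i : ℕ} {f : Finset ι → Multiset ι → k}
    (h : hkrRaw e i (symHoch f) = 0) (s : Finset ι) (l : List (Finset ι)) (hl : l.length = i) :
    symHoch f s l = 0 := by
  by_contra hne
  obtain ⟨v, rfl, hv⟩ := symTail_ne_zero hne
  rw [List.length_map] at hl
  refine hv ?_
  have h1 := formPart_hkrRaw_symHoch e i f s (Multiset.toFinsupp (v : Multiset ι))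
  rw [h, map_zero, map_zero, Multiset.toFinsupp_toMultiset] at h1
  have h2 := wordCount_pos (Multiset.toFinsupp (v : Multiset ι))
  have h3 : (Multiset.toFinsupp (v : Multiset ι)).degree = i := by
    rw [← card_toMultiset_eq, Multiset.toFinsupp_toMultiset, Multiset.coe_card, hl]
  rw [h3] at h2
  rcases mul_eq_zero.1 h1.symm with h4 | h4
  · have h5 := neg_one_pow_mul_self (k := k) (i * s.card) (i.choose 2)
    rw [h4, zero_mul] at h5
    exact absurd h5 zero_ne_one
  · rcases mul_eq_zero.1 h4 with h5 | h5
    · exact absurd h5 (by exact_mod_cast h2.ne')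
    · exact h5

/-- Every form of polynomial degree `i` is the image of a symmetric chain. In characteristic zero,
one can divide the coefficients by the number of words with given content. -/
lemma exists_symHoch {i : ℕ} {ω : Forms k g ι} (hω : formProj i ω = ω) :
    ∃ f : Finset ι → Multiset ι → k, hkrRaw e i (symHoch f) = ω ∧
      ∀ s M, f s M ≠ 0 → M.card = i ∧ formPart e s ω ≠ 0 := by
  refine ⟨fun s M => ((-1 : k) ^ (i * s.card) * (-1) ^ (i.choose 2)) *
    ((wordCount i (Multiset.toFinsupp M) : k)⁻¹ *
      MvPowerSeries.coeff (Multiset.toFinsupp M) (formPart e s ω)), ?_, fun s M h => ?_⟩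
  · refine forms_ext e fun s => ?_
    ext α
    rw [formPart_hkrRaw_symHoch, Finsupp.toMultiset_toFinsupp]
    by_cases hα : α.degree = i
    · have h2 := wordCount_pos α
      rw [hα] at h2
      have h3 : (wordCount i α : k) ≠ 0 := by exact_mod_cast h2.ne'
      have h5 := neg_one_pow_mul_self (k := k) (i * s.card) (i.choose 2)
      field_simp
      linear_combination (MvPowerSeries.coeff α (formPart e s ω)) * h5
    · rw [← hω, formPart_formProj, MvPowerSeries.coeff_homogeneousComponent, if_neg hα]
      ring
  · have h1 := right_ne_zero_of_mul (right_ne_zero_of_mul h)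
    refine ⟨?_, fun h2 => h1 (by rw [h2, map_zero])⟩
    rw [← hω, formPart_formProj, MvPowerSeries.coeff_homogeneousComponent] at h1
    split_ifs at h1 with h3
    · rw [← h3, ← card_toMultiset_eq, Multiset.toFinsupp_toMultiset]
    · exact absurd rfl h1

end WordSeries

/-! ### Locality of the differentials in the length of words -/

section Length

variable {R S : Type*} [CommRing R] [Fintype S]

lemma barD_congr {m : S → S → S → R} {F G : List S → R} {l : List S}
    (h : ∀ l', l'.length = l.length + 1 → F l' = G l') : barD m F l = barD m G l := by
  induction l generalizing F G with
  | nil => rfl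
  | cons s l ih =>
    rw [barD_cons, barD_cons, ih (F := cut s F) (G := cut s G) fun l' hl' =>
      h (s :: l') (by simp [hl'])]
    congr 1
    exact Finset.sum_congr rfl fun t _ => Finset.sum_congr rfl fun u _ => by
      rw [h (t :: u :: l) (by simp)]

lemma intD_congr {d : S → S → R} {p : S → ZMod 2} {F G : List S → R} {l : List S}
    (h : ∀ l', l'.length = l.length → F l' = G l') : intD d p F l = intD d p G l := by
  induction l generalizing F G with
  | nil => rfl
  | cons s l ih =>
    rw [intD_cons, intD_cons, ih (F := cut s F) (G := cut s G) fun l' hl' =>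
      h (s :: l') (by simp [hl'])]
    congr 1
    exact Finset.sum_congr rfl fun t _ => by rw [h (t :: l) (by simp)]

lemma hochMul_congr {m : S → S → S → R} {p : S → ZMod 2} {Y Z : S → List S → R} {l : List S}
    (h : ∀ s l', l'.length = l.length + 1 → Y s l' = Z s l') (s : S) :
    hochMul m p Y s l = hochMul m p Z s l := by
  rw [hochMul_apply, hochMul_apply, cycD_apply, cycD_apply]
  congr 1
  · refine barD_congr fun l' hl' => ?_
    rcases l' with _ | ⟨s', l'⟩
    · rfl
    · exact h s' l' (by simpa using hl')
  · congr 1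
    exact Finset.sum_congr rfl fun t _ => Finset.sum_congr rfl fun u _ => by
      rw [h t (l ++ [u]) (by simp)]

lemma hochInt_congr {d : S → S → R} {p : S → ZMod 2} {Y Z : S → List S → R} {l : List S}
    (h : ∀ s l', l'.length = l.length → Y s l' = Z s l') (s : S) :
    hochInt d p Y s l = hochInt d p Z s l := by
  rw [hochInt_apply, hochInt_apply]
  refine intD_congr fun l' hl' => ?_
  rcases l' with _ | ⟨s', l'⟩
  · rfl
  · exact h s' l' (by simpa using hl')

/-- The components of length `n` of the differential of a chain depend only on the components of
length at most `n + 1`. -/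
lemma hochRed_congr (A : BasedDGAlgebra R S) {Y Z : S → List S → R} {l : List S}
    (h : ∀ s l', l'.length ≤ l.length + 1 → Y s l' = Z s l') (s : S) :
    hochRed A Y s l = hochRed A Z s l := by
  by_cases hl : A.unit ∈ l
  · rw [hochRed_of_mem _ _ _ hl, hochRed_of_mem _ _ _ hl]
  · rw [hochRed_of_notMem _ _ _ hl, hochRed_of_notMem _ _ _ hl, hochTot_apply, hochTot_apply,
      hochMul_congr fun s' l' hl' => h s' l' hl'.le,
      hochInt_congr fun s' l' hl' => h s' l' (by omega)]

end Length

/-! ### The kernel of the Hochschild--Kostant--Rosenberg map is acyclic -/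

section Exactness

variable {k g ι : Type*} [Field k] [LieRing g] [LieAlgebra k g]
variable [Fintype ι] [LinearOrder ι] (e : Module.Basis ι k g)

/-- A reduced Hochschild chain of cohomological degree `n`. -/
def IsHochDeg (n : ℤ) (Y : Finset ι → List (Finset ι) → k) : Prop :=
  ∀ s l, Y s l ≠ 0 → ∅ ∉ l ∧ ((s.card + listCard l : ℕ) : ℤ) = n + l.length

lemma listDeg_eq (l : List (Finset ι)) :
    listDeg (chAlg e).deg l = (listCard l : ℤ) - l.length := by
  induction l with
  | nil => rfl
  | cons s l ih =>
    rw [listDeg_cons, ih, listCard_cons, List.length_cons]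
    simp only [chAlg]
    push_cast
    ring

lemma toChain_mem_iff {n : ℤ} {Y : Finset ι → List (Finset ι) → k} :
    toChain Y ∈ hochChains (chAlg e) n ↔ IsHochDeg n Y := by
  have hdeg : ∀ s l, listDeg (chAlg e).deg (s :: l) + 1 = n ↔
      ((s.card + listCard l : ℕ) : ℤ) = n + l.length := by
    intro s l
    rw [listDeg_eq, listCard_cons, List.length_cons]
    push_cast
    constructor <;> intro h <;> linarith
  refine ⟨fun h s l hl => ?_, fun h i w hw => ?_⟩
  · have h1 : toChain Y l.length (Fin.cons s l.get : Fin (l.length + 1) → Finset ι) ≠ 0 := by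
      have : ofChain (toChain Y) s l ≠ 0 := by rw [ofChain_toChain]; exact hl
      exact this
    obtain ⟨h2, h3⟩ := h _ _ h1
    rw [isDegenerate_iff] at h2
    rw [listDeg_cons_eq, hdeg] at h3
    refine ⟨?_, h3⟩
    simpa [chAlg, List.ofFn_getElem] using h2
  · obtain ⟨h2, h3⟩ := h _ _ hw
    rw [isDegenerate_iff, wordDeg_eq]
    exact ⟨h2, (hdeg _ _).2 h3⟩

lemma IsHochDeg.sub {n : ℤ} {F G : Finset ι → List (Finset ι) → k} (hF : IsHochDeg n F)
    (hG : IsHochDeg n G) : IsHochDeg n (F - G) := by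
  intro s l hl
  by_cases h : F s l = 0
  · exact hG s l (by intro h'; exact hl (by rw [Pi.sub_apply, Pi.sub_apply, h, h', sub_zero]))
  · exact hF s l h

variable [CharZero k]

lemma IsHochDeg.hochRed {n : ℤ} {Y : Finset ι → List (Finset ι) → k} (hY : IsHochDeg n Y) :
    IsHochDeg (n + 1) (hochRed (chAlg e) Y) := by
  rw [← toChain_mem_iff e, ← hochD_toChain]
  exact (chAlg_isGradedBy e).hochD_mem_hochChains ((toChain_mem_iff e).2 hY)

lemma hkrRaw_mem_formsDeg {n : ℤ} {Y : Finset ι → List (Finset ι) → k} (hY : IsHochDeg n Y)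
    (i : ℕ) : hkrRaw e i Y ∈ formsDeg n := by
  have hc := (toChain_mem_iff e).2 hY
  have h : hkrComponent e i (toChain Y) ∈ formsDeg n := by
    refine sum_mem fun w _ => ?_
    by_cases hw : toChain Y i w = 0
    · rw [hw, zero_smul]; exact zero_mem _
    · rw [← (hc i w hw).2]
      exact Submodule.smul_mem _ _ (hkrTerm_mem_formsDeg e i w)
  rw [hkrComponent_toChain] at h
  refine (Submodule.smul_mem_iff _ ?_).1 h
  exact div_ne_zero (pow_ne_zero _ (neg_ne_zero.2 one_ne_zero))
    (by exact_mod_cast i.factorial_ne_zero)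

/-- Removal of the component of lowest length of a cycle. -/
lemma hoch_step {n : ℤ} {i : ℕ} {z : Finset ι → List (Finset ι) → k} (hz : IsHochDeg n z)
    (hD : hochRed (chAlg e) z = 0) (h0 : ∀ s l, l.length < i → z s l = 0)
    (hk : hkrRaw e i z = 0) :
    ∃ y, IsHochDeg (n - 1) y ∧ (∀ s l, y s l ≠ 0 → l.length = i + 1) ∧ hkrRaw e (i + 1) y = 0 ∧
      ∀ s l, l.length = i → z s l = hochMul (chAlg e).mul (chAlg e).par y s l := by
  -- A tensor of length `i` and degree `n` has weight `n + i`, so there is none if this number is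
  -- negative.
  by_cases hn : n + i < 0
  · refine ⟨0, fun s l hl => absurd rfl hl, fun s l hl => absurd rfl hl, map_zero _,
      fun s l hl => ?_⟩
    rw [map_zero]
    by_contra h
    have := (hz s l h).2
    rw [hl] at this
    omega
  obtain ⟨W, hW⟩ := Int.eq_ofNat_of_zero_le (not_lt.1 hn)
  -- The component of lowest length is a cycle for the multiplicative part of the differential.
  let Y : Finset ι → List (Finset ι) → k := fun s l => if l.length = i then z s l else 0
  have hY : IsHochWeight W Y := by
    intro s l hl
    by_cases hl' : l.length = i
    · simp only [Y, hl', if_true] at hl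
      obtain ⟨h1, h2⟩ := hz s l hl
      exact ⟨h1, by rw [hl'] at h2; omega⟩
    · simp [Y, hl'] at hl
  have hb : hochMul (chAlg e).mul (chAlg e).par Y = 0 := by
    funext s l
    by_contra h
    have hl := (hY.hochMul e s l h).1
    by_cases hi : l.length + 1 = i
    · have h1 : hochMul (chAlg e).mul (chAlg e).par Y s l =
          hochMul (chAlg e).mul (chAlg e).par z s l :=
        hochMul_congr (fun s' l' hl' => if_pos (hl'.trans hi)) s
      have h2 := congrFun (congrFun hD s) l
      have h3 : hochInt (chAlg e).diff (chAlg e).par z s l =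
          hochInt (chAlg e).diff (chAlg e).par 0 s l :=
        hochInt_congr (fun s' l' hl' => h0 s' l' (by omega)) s
      rw [hochRed_of_notMem _ _ _ hl, hochTot_apply, h3, map_zero, Pi.zero_apply, Pi.zero_apply,
        mul_zero, add_zero, ← h1] at h2
      exact h h2
    · refine h ?_
      rw [hochMul_congr (Y := Y) (Z := 0) fun s' l' hl' => if_neg (by omega), map_zero]
  obtain ⟨f, y, hy, hfy⟩ := hochMul_cycle e hY hb
  -- The symmetric part of this component is determined by its image, which is zero.
  have hf : ∀ s l, l.length = i → symHoch f s l = 0 := by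
    refine symHoch_eq_zero e ?_
    have h1 : hkrRaw e i z = hkrRaw e i Y :=
      hkrRaw_congr e fun s l hl _ => (if_pos hl).symm
    rw [h1, hfy, map_add, hkrRaw_hochMul, add_zero] at hk
    exact hk
  let y1 : Finset ι → List (Finset ι) → k := fun s l => if l.length = i + 1 then y s l else 0
  have hy1 : IsHochDeg (n - 1) y1 := by
    intro s l hl
    by_cases hl' : l.length = i + 1
    · simp only [y1, hl', if_true] at hl
      obtain ⟨h1, h2⟩ := hy s l hl
      exact ⟨h1, by rw [h2, hl']; push_cast; omega⟩
    · simp [y1, hl'] at hl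
  -- The primitive is corrected by a symmetric chain with the same image; this does not change its
  -- boundary.
  obtain ⟨f', hf', hf''⟩ := exists_symHoch e (formProj_hkrRaw e (i + 1) y1)
  have hlen : ∀ s l, symHoch f' s l ≠ 0 → l.length = i + 1 := by
    intro s l hl
    obtain ⟨v, rfl, hv⟩ := symTail_ne_zero hl
    have := (hf'' s _ hv).1
    rwa [List.length_map]
  have hfdeg : IsHochDeg (n - 1) (symHoch f') := by
    intro s l hl
    obtain ⟨v, rfl, hv⟩ := symTail_ne_zero hl
    have h1 := (mem_formsDeg_iff e).1 (hkrRaw_mem_formsDeg e hy1 (i + 1)) s (hf'' s _ hv).2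
    refine ⟨by simp, ?_⟩
    rw [listCard_singletons, List.length_map]
    push_cast
    rw [h1]
  refine ⟨y1 - symHoch f', hy1.sub hfdeg, fun s l hl => ?_, ?_, fun s l hl => ?_⟩
  · by_contra h
    refine hl ?_
    rw [Pi.sub_apply, Pi.sub_apply, not_ne_iff.1 (mt (hlen s l) h), sub_zero]
    exact if_neg h
  · rw [map_sub, hf', sub_self]
  · rw [map_sub, hochMul_symHoch, sub_zero,
      hochMul_congr (Z := y) fun s' l' hl' => if_pos (by omega)]
    have := congrFun (congrFun hfy s) l
    rw [Pi.add_apply, Pi.add_apply, hf s l hl, zero_add] at this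
    rw [← this]
    exact (if_pos hl).symm

/-- The kernel of the Hochschild--Kostant--Rosenberg map is acyclic: the components of a
primitive are constructed by recursion on the length. -/
theorem hoch_exact {n : ℤ} {z : Finset ι → List (Finset ι) → k} (hz : IsHochDeg n z)
    (hD : hochRed (chAlg e) z = 0) (hk : ∀ i, hkrRaw e i z = 0) :
    ∃ y, IsHochDeg (n - 1) y ∧ hochRed (chAlg e) y = z ∧ ∀ i, hkrRaw e i y = 0 := by
  -- `P i z`: a cycle in the kernel all of whose components have length at least `i`.
  let P : ℕ → (Finset ι → List (Finset ι) → k) → Prop := fun i z =>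
    IsHochDeg n z ∧ hochRed (chAlg e) z = 0 ∧ (∀ s l, l.length < i → z s l = 0) ∧
      ∀ j, hkrRaw e j z = 0
  have step : ∀ i z, P i z → ∃ y, IsHochDeg (n - 1) y ∧ (∀ s l, y s l ≠ 0 → l.length = i + 1) ∧
      (∀ j, hkrRaw e j y = 0) ∧ P (i + 1) (z - hochRed (chAlg e) y) := by
    rintro i z ⟨hz, hD, h0, hk⟩
    obtain ⟨y, h1, h2, h3, h4⟩ := hoch_step e hz hD h0 (hk i)
    have h5 : ∀ j, hkrRaw e j y = 0 := by
      intro j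
      by_cases hj : j = i + 1
      · rw [hj, h3]
      · rw [hkrRaw_congr e (Z := 0) fun s l hl _ => by
          by_contra h
          exact hj (hl.symm.trans (h2 s l h)), map_zero]
    have h6 := h1.hochRed e
    rw [sub_add_cancel] at h6
    refine ⟨y, h1, h2, h5, hz.sub h6, ?_, fun s l hl => ?_, fun j => ?_⟩
    · rw [map_sub, hD, hochRed_hochRed _ (chAlg_laws e), sub_zero]
    · rw [Pi.sub_apply, Pi.sub_apply, sub_eq_zero]
      by_cases hl' : (chAlg e).unit ∈ l
      · rw [hochRed_of_mem _ _ _ hl']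
        by_contra h
        exact (hz s l h).1 hl'
      · have h7 : hochInt (chAlg e).diff (chAlg e).par y s l =
            hochInt (chAlg e).diff (chAlg e).par 0 s l :=
          hochInt_congr (fun s' l' hl' => by
            by_contra h
            have := h2 s' l' h
            omega) s
        rw [hochRed_of_notMem _ _ _ hl', hochTot_apply, h7, map_zero, Pi.zero_apply, Pi.zero_apply,
          mul_zero, add_zero]
        rcases Nat.lt_succ_iff_lt_or_eq.1 hl with hl | hl
        · rw [h0 s l hl, hochMul_congr (Z := 0) fun s' l' hl' => by
            by_contra h
            have := h2 s' l' h
            omega, map_zero]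
          rfl
        · exact h4 s l hl
    · rw [map_sub, hk, hkrRaw_hochRed, h5, map_zero, sub_zero]
  choose! y hy using step
  -- `Z i` is what remains of `z` after the removal of the components of length less than `i`.
  let Z : ℕ → (Finset ι → List (Finset ι) → k) := fun i =>
    Nat.rec z (fun i z => z - hochRed (chAlg e) (y i z)) i
  have hP : ∀ i, P i (Z i) := by
    intro i
    induction i with
    | zero => exact ⟨hz, hD, fun s l hl => absurd hl (Nat.not_lt_zero _), hk⟩
    | succ i ih => exact (hy i (Z i) ih).2.2.2
  have hZ : ∀ i, Z i = z - hochRed (chAlg e) (∑ j ∈ Finset.range i, y j (Z j)) := by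
    intro i
    induction i with
    | zero => simp [Z]
    | succ i ih =>
      rw [Finset.sum_range_succ, map_add, ← sub_sub, ← ih]
  -- The infinite sum of the `y j (Z j)`, which is finite at every word since `y j (Z j)` is
  -- concentrated in length `j + 1`.
  let Y : Finset ι → List (Finset ι) → k := fun s l =>
    ∑ j ∈ Finset.range l.length, y j (Z j) s l
  have hY : ∀ i s l, l.length ≤ i → Y s l = (∑ j ∈ Finset.range i, y j (Z j)) s l := by
    intro i s l hl
    rw [Finset.sum_apply, Finset.sum_apply]
    refine Finset.sum_subset (Finset.range_mono hl) fun j _ hj => ?_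
    by_contra h
    have := (hy j (Z j) (hP j)).2.1 s l h
    rw [Finset.mem_range] at hj
    omega
  refine ⟨Y, fun s l hl => ?_, ?_, fun i => ?_⟩
  · obtain ⟨j, _, hj⟩ := Finset.exists_ne_zero_of_sum_ne_zero hl
    exact (hy j (Z j) (hP j)).1 s l hj
  · funext s l
    have h1 := (hP (l.length + 1)).2.2.1 s l (Nat.lt_succ_self _)
    rw [hZ (l.length + 1), Pi.sub_apply, Pi.sub_apply, sub_eq_zero] at h1
    rw [h1]
    exact hochRed_congr _ (fun s' l' hl' => hY _ s' l' hl') s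
  · rw [hkrRaw_congr e (fun s l hl _ => hY i s l hl.le), map_sum]
    exact Finset.sum_eq_zero fun j _ => (hy j (Z j) (hP j)).2.2.1 i

lemma hkr_toChain_eq_zero {Y : Finset ι → List (Finset ι) → k} :
    hkr e (toChain Y) = 0 ↔ ∀ i, hkrRaw e i Y = 0 := by
  refine ⟨fun h i => ?_, fun h => forms_ext_formProj e fun i => ?_⟩
  · have h1 := formProj_hkr e i Y
    rw [h, map_zero, hkrComponent_toChain] at h1
    refine (smul_eq_zero.1 h1.symm).resolve_left ?_
    exact div_ne_zero (pow_ne_zero _ (neg_ne_zero.2 one_ne_zero))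
      (by exact_mod_cast i.factorial_ne_zero)
  · rw [formProj_hkr, hkrComponent_toChain, h, smul_zero, map_zero]

/-- A Hochschild cycle in the kernel of the Hochschild--Kostant--Rosenberg map is the boundary of a
chain in this kernel. -/
theorem exists_hochD_eq {n : ℤ} {z : HChain k (Finset ι)} (hz : z ∈ hochChains (chAlg e) n)
    (hD : hochD (chAlg e) z = 0) (hk : hkr e z = 0) :
    ∃ y ∈ hochChains (chAlg e) (n - 1), hochD (chAlg e) y = z ∧ hkr e y = 0 := by
  rw [← toChain_ofChain z] at hz hD hk ⊢
  rw [hochD_toChain] at hD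
  obtain ⟨y, h1, h2, h3⟩ := hoch_exact e ((toChain_mem_iff e).1 hz) (toChain_injective hD)
    ((hkr_toChain_eq_zero e).1 hk)
  exact ⟨toChain y, (toChain_mem_iff e).2 h1, by rw [hochD_toChain, h2],
    (hkr_toChain_eq_zero e).2 h3⟩

end Exactness

/-! ### Formal vector fields -/

section VectorFields

variable {k ι : Type*} [Field k]

lemma homogeneousComponent_mul_eq_sum (n : ℕ) (p q : MvPowerSeries ι k) :
    (p * q).homogeneousComponent n = ∑ x ∈ Finset.HasAntidiagonal.antidiagonal n,
      p.homogeneousComponent x.1 * q.homogeneousComponent x.2 := by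
  classical
  ext α
  rw [MvPowerSeries.coeff_homogeneousComponent, MvPowerSeries.coeff_mul, map_sum]
  simp only [MvPowerSeries.coeff_mul]
  rw [Finset.sum_comm]
  have h : ∀ a ∈ Finset.HasAntidiagonal.antidiagonal α,
      ∑ x ∈ Finset.HasAntidiagonal.antidiagonal n,
        MvPowerSeries.coeff a.1 (p.homogeneousComponent x.1) *
          MvPowerSeries.coeff a.2 (q.homogeneousComponent x.2) =
      if α.degree = n then MvPowerSeries.coeff a.1 p * MvPowerSeries.coeff a.2 q else 0 := by
    intro a ha
    have hd : α.degree = a.1.degree + a.2.degree := by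
      rw [← Finset.HasAntidiagonal.mem_antidiagonal.1 ha, map_add]
    simp only [MvPowerSeries.coeff_homogeneousComponent]
    split_ifs with hn
    · rw [Finset.sum_eq_single (a.1.degree, a.2.degree)]
      · simp
      · rintro ⟨i, j⟩ - hx
        by_cases h1 : a.1.degree = i
        · by_cases h2 : a.2.degree = j
          · exact absurd (by rw [h1, h2]) hx
          · simp [h2]
        · simp [h1]
      · intro hx
        exact absurd (Finset.HasAntidiagonal.mem_antidiagonal.2 (by rw [← hd, hn])) hx
    · refine Finset.sum_eq_zero ?_
      rintro ⟨i, j⟩ hx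
      have hx := Finset.HasAntidiagonal.mem_antidiagonal.1 hx
      by_cases h1 : a.1.degree = i
      · by_cases h2 : a.2.degree = j
        · exact absurd (by rw [hd, h1, h2, hx]) hn
        · simp [h2]
      · simp [h1]
  rw [Finset.sum_congr rfl h]
  split_ifs <;> simp

/-- If `q` vanishes in degrees less than `n`, then only the constant term of `p` contributes to the
degree `n` component of `p * q`. -/
lemma homogeneousComponent_mul_of_forall_lt (n : ℕ) (p q : MvPowerSeries ι k)
    (hq : ∀ m < n, q.homogeneousComponent m = 0) :
    (p * q).homogeneousComponent n = p.homogeneousComponent 0 * q.homogeneousComponent n := by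
  rw [homogeneousComponent_mul_eq_sum, Finset.sum_eq_single (0, n)]
  · rintro ⟨i, j⟩ hx hne
    have hx := Finset.HasAntidiagonal.mem_antidiagonal.1 hx
    simp only at hx ⊢
    rw [hq j, mul_zero]
    rcases Nat.eq_zero_or_pos i with rfl | hi
    · exact absurd (by rw [← hx, zero_add]) hne
    · omega
  · intro h
    exact absurd (Finset.HasAntidiagonal.mem_antidiagonal.2 (zero_add n)) h

variable [Fintype ι]

/-- The vector field `∑ b, p b • ∂/∂x_b`. -/
noncomputable def vectorField (p : ι → MvPowerSeries ι k) :
    Derivation k (MvPowerSeries ι k) (MvPowerSeries ι k) :=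
  ∑ b, p b • MvPowerSeries.pderiv k b

lemma vectorField_apply (p : ι → MvPowerSeries ι k) (f : MvPowerSeries ι k) :
    vectorField p f = ∑ b, p b * MvPowerSeries.pderiv k b f := by
  rw [vectorField, ← Derivation.coeFnAddMonoidHom_apply, map_sum, Finset.sum_apply]
  rfl

lemma vectorField_X (p : ι → MvPowerSeries ι k) (b : ι) :
    vectorField p (MvPowerSeries.X b) = p b := by
  classical
  rw [vectorField_apply]
  simp [MvPowerSeries.pderiv_X, Pi.single_apply]

lemma vectorField_sum {κ : Type*} (s : Finset κ) (p : κ → ι → MvPowerSeries ι k) :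
    vectorField (∑ a ∈ s, p a) = ∑ a ∈ s, vectorField (p a) := by
  simp only [vectorField, Finset.sum_apply, Finset.sum_smul]
  rw [Finset.sum_comm]

lemma vectorField_smul (r : MvPowerSeries ι k) (p : ι → MvPowerSeries ι k) :
    vectorField (r • p) = r • vectorField p := by
  simp only [vectorField, Pi.smul_apply, Finset.smul_sum, smul_assoc]

lemma pderiv_comm (a b : ι) (f : MvPowerSeries ι k) :
    MvPowerSeries.pderiv k a (MvPowerSeries.pderiv k b f) =
      MvPowerSeries.pderiv k b (MvPowerSeries.pderiv k a f) := by
  classical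
  ext α
  simp only [MvPowerSeries.coeff_pderiv]
  rw [add_right_comm]
  by_cases h : a = b
  · rw [h]
  · simp only [Finsupp.add_apply, Finsupp.single_apply, h, Ne.symm h, if_false, add_zero]
    ring

/-- The second derivatives cancel in the commutator of two vector fields. -/
lemma lie_vectorField (p q : ι → MvPowerSeries ι k) :
    ⁅vectorField p, vectorField q⁆ =
      vectorField fun b => vectorField p (q b) - vectorField q (p b) := by
  ext1 f
  rw [Derivation.commutator_apply]
  have key : ∀ p q : ι → MvPowerSeries ι k, vectorField p (vectorField q f) =
      ∑ b, vectorField p (q b) * MvPowerSeries.pderiv k b f +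
        ∑ a, ∑ b, p a * q b *
          MvPowerSeries.pderiv k a (MvPowerSeries.pderiv k b f) := by
    intro p q
    rw [vectorField_apply q, map_sum, Finset.sum_comm, ← Finset.sum_add_distrib]
    refine Finset.sum_congr rfl fun b _ => ?_
    rw [Derivation.leibniz, vectorField_apply p (MvPowerSeries.pderiv k b f), smul_eq_mul,
      smul_eq_mul, Finset.mul_sum, add_comm]
    congr 1
    · ring
    · exact Finset.sum_congr rfl fun a _ => by ring
  have h2 : ∑ a, ∑ b, p a * q b * MvPowerSeries.pderiv k a (MvPowerSeries.pderiv k b f) =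
      ∑ a, ∑ b, q a * p b * MvPowerSeries.pderiv k a (MvPowerSeries.pderiv k b f) := by
    rw [Finset.sum_comm]
    refine Finset.sum_congr rfl fun b _ => Finset.sum_congr rfl fun a _ => ?_
    rw [pderiv_comm, mul_comm (p a)]
  rw [key, key, h2, vectorField_apply]
  simp only [sub_mul, Finset.sum_sub_distrib]
  abel

/-- A vector field is determined by its values at the coordinates. -/
lemma vectorField_eq_iff (p q : ι → MvPowerSeries ι k) : vectorField p = vectorField q ↔ p = q :=
  ⟨fun h => funext fun b => by rw [← vectorField_X p b, h, vectorField_X], fun h => by rw [h]⟩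

lemma lie_smul_derivation (r : MvPowerSeries ι k)
    (D D' : Derivation k (MvPowerSeries ι k) (MvPowerSeries ι k)) :
    ⁅r • D, D'⁆ = r • ⁅D, D'⁆ - D' r • D := by
  ext1 f
  simp only [Derivation.commutator_apply, Derivation.sub_apply, Derivation.smul_apply, smul_eq_mul,
    Derivation.leibniz]
  ring

/-- The Euler vector field `∑ b, x_b ∂/∂x_b`. -/
noncomputable def euler : Derivation k (MvPowerSeries ι k) (MvPowerSeries ι k) :=
  vectorField MvPowerSeries.X

lemma euler_X (b : ι) : euler (MvPowerSeries.X b : MvPowerSeries ι k) = MvPowerSeries.X b :=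
  vectorField_X _ b

lemma coeff_euler (f : MvPowerSeries ι k) (α : ι →₀ ℕ) :
    MvPowerSeries.coeff α (euler f) = α.degree * MvPowerSeries.coeff α f := by
  classical
  rw [euler, vectorField_apply, map_sum]
  have h : ∀ b, MvPowerSeries.coeff α (MvPowerSeries.X b * MvPowerSeries.pderiv k b f) =
      α b * MvPowerSeries.coeff α f := by
    intro b
    rw [MvPowerSeries.X_def, MvPowerSeries.coeff_monomial_mul, one_mul]
    split_ifs with hb
    · rw [MvPowerSeries.coeff_pderiv, tsub_add_cancel_of_le hb, mul_comm]
      congr 1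
      have h1 : 1 ≤ α b := by simpa using hb b
      rw [Finsupp.tsub_apply, Finsupp.single_eq_same, Nat.cast_sub h1]
      simp
    · have h1 : α b = 0 := by
        by_contra h1
        refine hb fun j => ?_
        by_cases hj : b = j
        · subst hj; simpa using Nat.one_le_iff_ne_zero.2 h1
        · simp [Finsupp.single_apply, hj]
      rw [h1, Nat.cast_zero, zero_mul]
  rw [Finset.sum_congr rfl fun b _ => h b, ← Finset.sum_mul, Finsupp.degree_eq_sum, Nat.cast_sum]

lemma homogeneousComponent_euler (n : ℕ) (f : MvPowerSeries ι k) :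
    (euler f).homogeneousComponent n = (n : k) • f.homogeneousComponent n := by
  classical
  ext α
  simp only [MvPowerSeries.coeff_homogeneousComponent, coeff_euler, MvPowerSeries.coeff_smul]
  split_ifs with h
  · rw [h]
  · simp

end VectorFields

/-! ### Power series in the adjoint representation -/

section AdSeries

variable {k g ι : Type*} [Field k] [LieRing g] [LieAlgebra k g]
variable [Fintype ι] [LinearOrder ι] (e : Module.Basis ι k g)

lemma isHomogeneous_adMatrix_pow (n : ℕ) (b c : ι) : ((adMatrix e ^ n) b c).IsHomogeneous n := by
  induction n generalizing c with
  | zero =>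
    rw [pow_zero, Matrix.one_apply]
    split_ifs
    · exact isHomogeneous_one
    · exact isHomogeneous_iff.2 fun α hα => absurd rfl hα
  | succ n ih =>
    rw [pow_succ, Matrix.mul_apply]
    exact isHomogeneous_sum _ _ fun a _ =>
      MvPowerSeries.IsHomogeneous.mul (ih a) (isHomogeneous_adMatrix e a c)

/-- The matrix `∑ n, f_n Ad^n` for a power series `f = ∑ n, f_n z^n`. As the entries of `Ad^n` are
homogeneous of degree `n`, the coefficient at `α` is the one of the term with `n = |α|`. -/
noncomputable def adSeries (f : PowerSeries k) : Matrix ι ι (MvPowerSeries ι k) := fun b c =>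
  series fun α => PowerSeries.coeff α.degree f *
    MvPowerSeries.coeff α ((adMatrix e ^ α.degree) b c)

lemma coeff_adSeries (f : PowerSeries k) (b c : ι) (α : ι →₀ ℕ) :
    MvPowerSeries.coeff α (adSeries e f b c) = PowerSeries.coeff α.degree f *
      MvPowerSeries.coeff α ((adMatrix e ^ α.degree) b c) := coeff_series _ _

lemma homogeneousComponent_adSeries (f : PowerSeries k) (b c : ι) (n : ℕ) :
    (adSeries e f b c).homogeneousComponent n =
      PowerSeries.coeff n f • (adMatrix e ^ n) b c := by
  classical
  ext α
  rw [MvPowerSeries.coeff_homogeneousComponent, coeff_adSeries, MvPowerSeries.coeff_smul]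
  split_ifs with h
  · rw [h]
  · by_cases h0 : MvPowerSeries.coeff α ((adMatrix e ^ n) b c) = 0
    · rw [h0, mul_zero]
    · exact absurd (isHomogeneous_iff.1 (isHomogeneous_adMatrix_pow e n b c) α h0) h

lemma adSeries_add (f f' : PowerSeries k) : adSeries e (f + f') = adSeries e f + adSeries e f' := by
  ext b c : 1
  ext α
  rw [Matrix.add_apply, map_add]
  simp only [coeff_adSeries, map_add, add_mul]

lemma adSeries_mul (f f' : PowerSeries k) : adSeries e (f * f') = adSeries e f * adSeries e f' := by
  ext b c : 1
  refine ext_homogeneousComponent fun n => ?_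
  rw [Matrix.mul_apply, map_sum]
  simp only [homogeneousComponent_mul_eq_sum, homogeneousComponent_adSeries]
  rw [Finset.sum_comm, PowerSeries.coeff_mul, Finset.sum_smul]
  refine Finset.sum_congr rfl fun x hx => ?_
  rw [← Finset.HasAntidiagonal.mem_antidiagonal.1 hx, pow_add, Matrix.mul_apply, Finset.smul_sum]
  exact Finset.sum_congr rfl fun a _ => (smul_mul_smul_comm _ _ _ _).symm

lemma adSeries_X : adSeries e (PowerSeries.X : PowerSeries k) = adMatrix e := by
  ext b c : 1
  ext α
  rw [coeff_adSeries, PowerSeries.coeff_X]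
  split_ifs with h
  · rw [h, pow_one, one_mul]
  · rw [zero_mul]
    by_contra h'
    exact h (isHomogeneous_iff.1 (isHomogeneous_adMatrix e b c) α (Ne.symm h'))

lemma euler_adSeries (f : PowerSeries k) (b c : ι) :
    euler (adSeries e f b c) = adSeries e (PowerSeries.X * PowerSeries.derivative k f) b c := by
  ext α
  rw [coeff_euler, coeff_adSeries, coeff_adSeries]
  rcases h : α.degree with _ | n
  · simp
  · rw [PowerSeries.coeff_succ_X_mul, PowerSeries.coeff_derivative]
    push_cast
    ring

/-- `ad_x x = 0`. -/
lemma adMatrix_mulVec_X (b : ι) : ∑ c, adMatrix e b c * MvPowerSeries.X c = 0 := by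
  have h : ∑ c, adMatrix e b c * MvPowerSeries.X c = ∑ c, ∑ a,
      MvPowerSeries.C (e.repr ⁅e a, e c⁆ b) * (MvPowerSeries.X a * MvPowerSeries.X c) := by
    refine Finset.sum_congr rfl fun c _ => ?_
    rw [adMatrix, Finset.sum_mul]
    exact Finset.sum_congr rfl fun a _ => mul_assoc _ _ _
  rw [h]
  have hself : ∀ a c, MvPowerSeries.C (e.repr ⁅e a, e c⁆ b) *
      (MvPowerSeries.X a * MvPowerSeries.X c : MvPowerSeries ι k) =
      -(MvPowerSeries.C (e.repr ⁅e c, e a⁆ b) * (MvPowerSeries.X c * MvPowerSeries.X a)) := by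
    intro a c
    rw [← lie_skew, map_neg, Finsupp.neg_apply, map_neg, mul_comm (MvPowerSeries.X a)]
    ring
  have hdiag : ∀ a, MvPowerSeries.C (e.repr ⁅e a, e a⁆ b) *
      (MvPowerSeries.X a * MvPowerSeries.X a : MvPowerSeries ι k) = 0 := by
    intro a
    rw [lie_self, map_zero, Finsupp.zero_apply, map_zero, zero_mul]
  rw [← Finset.sum_product']
  refine Finset.sum_involution (fun x _ => (x.2, x.1)) ?_ ?_ (by simp) (by simp)
  · rintro ⟨c, a⟩ -
    simp only
    rw [hself a c, neg_add_cancel]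
  · rintro ⟨c, a⟩ - hne heq
    simp only [Prod.mk.injEq] at heq
    rw [heq.1] at hne
    exact hne (hdiag c)

lemma adMatrix_pow_mulVec_X (n : ℕ) (b : ι) :
    ∑ c, (adMatrix e ^ (n + 1)) b c * MvPowerSeries.X c = 0 := by
  have h : ∑ c, (adMatrix e ^ (n + 1)) b c * MvPowerSeries.X c =
      ∑ a, (adMatrix e ^ n) b a * ∑ c, adMatrix e a c * MvPowerSeries.X c := by
    simp only [pow_succ, Matrix.mul_apply, Finset.sum_mul, Finset.mul_sum]
    rw [Finset.sum_comm]
    exact Finset.sum_congr rfl fun a _ => Finset.sum_congr rfl fun c _ => mul_assoc _ _ _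
  rw [h]
  exact Finset.sum_eq_zero fun a _ => by rw [adMatrix_mulVec_X, mul_zero]

/-- `f(ad_x) x = f(0) x`. -/
lemma adSeries_mulVec_X (f : PowerSeries k) (b : ι) :
    ∑ c, MvPowerSeries.X c * adSeries e f b c =
      PowerSeries.coeff 0 f • MvPowerSeries.X b := by
  refine ext_homogeneousComponent fun n => ?_
  rw [map_sum, map_smul]
  rcases n with _ | n
  · have h : ∀ f : MvPowerSeries ι k, ∀ c,
        (MvPowerSeries.X c * f).homogeneousComponent 0 = 0 := fun f c =>
      homogeneousComponent_mul_of_lt (isHomogeneous_X c) zero_lt_one f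
    have h' := h 1 b
    rw [mul_one] at h'
    rw [h', smul_zero]
    exact Finset.sum_eq_zero fun c _ => h _ c
  · have h : ∀ f : MvPowerSeries ι k, ∀ c, (MvPowerSeries.X c * f).homogeneousComponent (n + 1) =
        MvPowerSeries.X c * f.homogeneousComponent n := fun f c => by
      rw [add_comm n 1, homogeneousComponent_mul (isHomogeneous_X c)]
    have h' := h 1 b
    rw [mul_one] at h'
    have h1 : ∀ c, (MvPowerSeries.X c * adSeries e f b c).homogeneousComponent (n + 1) =
        PowerSeries.coeff n f • ((adMatrix e ^ n) b c * MvPowerSeries.X c) := fun c => by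
      rw [h, homogeneousComponent_adSeries, mul_smul_comm, mul_comm]
    rw [Finset.sum_congr rfl fun c _ => h1 c, ← Finset.smul_sum, h']
    rcases n with _ | n
    · have h2 : ∀ c, ((adMatrix e ^ 0) b c * MvPowerSeries.X c : MvPowerSeries ι k) =
          if b = c then MvPowerSeries.X b else 0 := fun c => by
        rw [pow_zero, Matrix.one_apply]
        split_ifs with hc
        · rw [hc, one_mul]
        · rw [zero_mul]
      rw [Finset.sum_congr rfl fun c _ => h2 c, Finset.sum_ite_eq, if_pos (Finset.mem_univ b)]
      have : (1 : MvPowerSeries ι k).homogeneousComponent 0 = 1 := by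
        ext α
        rw [MvPowerSeries.coeff_homogeneousComponent]
        split_ifs with hα
        · rfl
        · by_contra h0
          exact hα (isHomogeneous_iff.1 isHomogeneous_one α (Ne.symm h0))
      rw [this, mul_one]
    · rw [adMatrix_pow_mulVec_X, smul_zero]
      have h3 : (1 : MvPowerSeries ι k).homogeneousComponent (n + 1) = 0 := by
        ext α
        rw [MvPowerSeries.coeff_homogeneousComponent, map_zero]
        refine ite_eq_right_iff.2 fun hα => ?_
        by_contra h0
        have := isHomogeneous_iff.1 isHomogeneous_one α h0
        omega
      rw [h3, mul_zero, smul_zero]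

end AdSeries

section LieRing

variable {k ι : Type*} [Field k]

/-- A shortcut: lemmas such as `lie_sub` do not find this instance by unification. -/
noncomputable instance vectorFieldsLieRing :
    LieRing (Derivation k (MvPowerSeries ι k) (MvPowerSeries ι k)) := inferInstance

/-- A shortcut, as for `vectorFieldsLieRing`. -/
noncomputable instance vectorFieldsLieAlgebra :
    LieAlgebra k (Derivation k (MvPowerSeries ι k) (MvPowerSeries ι k)) := inferInstance

end LieRing

/-! ### The left invariant vector fields in exponential coordinates -/

section Flat

variable {k g ι : Type*} [Field k] [LieRing g] [LieAlgebra k g]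
variable [CharZero k]

/-- The Riccati equation of the power series `z / (1 - e^{-z})`. -/
lemma riccati_bernoulli' :
    PowerSeries.X * PowerSeries.derivative k (bernoulli'PowerSeries k) =
      bernoulli'PowerSeries k + bernoulli'PowerSeries k * PowerSeries.X -
        bernoulli'PowerSeries k * bernoulli'PowerSeries k := by
  set P := bernoulli'PowerSeries k with hP
  set E := PowerSeries.exp k with hE
  -- The equation follows from the derivative of `P * (exp - 1) = X * exp`.
  have h1 : P * (E - 1) = PowerSeries.X * E := bernoulli'PowerSeries_mul_exp_sub_one k
  have hE' : PowerSeries.derivative k E = E := by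
    ext n
    rw [PowerSeries.coeff_derivative, hE, PowerSeries.coeff_exp, PowerSeries.coeff_exp,
      Nat.factorial_succ]
    have : ((n : k) + 1) ≠ 0 := by exact_mod_cast Nat.succ_ne_zero n
    have h3 : (n.factorial : k) ≠ 0 := by exact_mod_cast n.factorial_ne_zero
    simp
    field_simp
  have h2 := congrArg (PowerSeries.derivative k) h1
  rw [Derivation.leibniz, Derivation.leibniz, map_sub, hE', PowerSeries.derivative_X,
    PowerSeries.derivative_one] at h2
  simp only [smul_eq_mul, sub_zero, mul_one] at h2
  have hne : E - 1 ≠ 0 := by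
    intro h
    have := congrArg (PowerSeries.coeff 1) h
    simp [hE, PowerSeries.coeff_exp, PowerSeries.coeff_one] at this
  refine mul_right_cancel₀ hne ?_
  linear_combination PowerSeries.X * h2 + (P - 1 - PowerSeries.X) * h1

variable [Fintype ι] [LinearOrder ι] (e : Module.Basis ι k g)

/-- The matrix `Ad / (1 - e^{-Ad})` of the left invariant vector fields in exponential
coordinates. -/
noncomputable def bernMatrix : Matrix ι ι (MvPowerSeries ι k) :=
  adSeries e (bernoulli'PowerSeries k)

/-- The left invariant vector field in exponential coordinates with value `e c` at the origin. -/
noncomputable def leftField (c : ι) : Derivation k (MvPowerSeries ι k) (MvPowerSeries ι k) :=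
  vectorField fun b => bernMatrix e b c

/-- The Riccati equation of the matrix of the left invariant vector fields. -/
lemma euler_bernMatrix (b c : ι) : euler (bernMatrix e b c) =
    bernMatrix e b c + ∑ a, bernMatrix e b a * (adMatrix e a c - bernMatrix e a c) := by
  have h : adSeries e (PowerSeries.X * PowerSeries.derivative k (bernoulli'PowerSeries k)) +
      bernMatrix e * bernMatrix e = bernMatrix e + bernMatrix e * adMatrix e := by
    rw [bernMatrix, ← adSeries_mul, ← adSeries_add, riccati_bernoulli', sub_add_cancel,
      adSeries_add, adSeries_mul, adSeries_X]
  have h1 := congrFun (congrFun h b) c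
  simp only [Matrix.add_apply, Matrix.mul_apply] at h1
  rw [bernMatrix, euler_adSeries, ← bernMatrix]
  simp only [mul_sub, Finset.sum_sub_distrib]
  rw [← add_sub_assoc, ← h1, add_sub_cancel_right]

lemma bernoulli'PowerSeries_coeff_zero : PowerSeries.coeff 0 (bernoulli'PowerSeries k) = 1 := by
  simp [bernoulli'PowerSeries]

/-- The value of the left invariant field of `x` at the point `x` is `x`, as the curve `exp (t x)`
is an integral curve: here, `f(ad_x) x = f(0) x`. -/
lemma euler_eq_sum_leftField :
    (euler : Derivation k (MvPowerSeries ι k) (MvPowerSeries ι k)) =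
      ∑ c, (MvPowerSeries.X c : MvPowerSeries ι k) • leftField e c := by
  rw [euler]
  have h : (MvPowerSeries.X : ι → MvPowerSeries ι k) =
      ∑ c : ι, (MvPowerSeries.X c : MvPowerSeries ι k) •
        (fun b : ι => bernMatrix e b c : ι → MvPowerSeries ι k) := by
    funext b
    rw [Finset.sum_apply]
    simp only [Pi.smul_apply, smul_eq_mul]
    rw [bernMatrix, adSeries_mulVec_X, bernoulli'PowerSeries_coeff_zero, one_smul]
  conv_lhs => rw [h]
  rw [vectorField_sum]
  exact Finset.sum_congr rfl fun c _ => vectorField_smul _ _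

/-- The commutator of the Euler field with the left invariant fields. -/
lemma lie_euler_leftField (c : ι) : ⁅(euler : Derivation k (MvPowerSeries ι k) _), leftField e c⁆ =
    ∑ a, (adMatrix e a c - bernMatrix e a c) • leftField e a := by
  have h : ∑ a, (adMatrix e a c - bernMatrix e a c) • leftField e a =
      vectorField (∑ a, (adMatrix e a c - bernMatrix e a c) • fun b => bernMatrix e b a) := by
    rw [vectorField_sum]
    exact Finset.sum_congr rfl fun a _ => (vectorField_smul _ _).symm
  rw [h, euler, leftField, lie_vectorField]
  congr 1
  funext b
  rw [vectorField_X, ← euler, euler_bernMatrix, add_sub_cancel_left, Finset.sum_apply]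
  exact Finset.sum_congr rfl fun a _ => mul_comm _ _

/-- The structure constants of `g`. -/
noncomputable def structConst (c d a : ι) : k := e.repr ⁅e c, e d⁆ a

lemma structConst_skew (c d a : ι) : structConst e c d a = -structConst e d c a := by
  rw [structConst, ← lie_skew, map_neg, Finsupp.neg_apply, structConst]

lemma lie_eq_sum_structConst (c d : ι) : ⁅e c, e d⁆ = ∑ a, structConst e c d a • e a :=
  (e.sum_repr _).symm

lemma adMatrix_apply (b c : ι) :
    adMatrix e b c = ∑ a, structConst e a c b • MvPowerSeries.X a :=
  Finset.sum_congr rfl fun _ _ => (MvPowerSeries.smul_eq_C_mul _ _).symm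

lemma derivation_adMatrix (D : Derivation k (MvPowerSeries ι k) (MvPowerSeries ι k)) (b c : ι) :
    D (adMatrix e b c) = ∑ a, structConst e a c b • D (MvPowerSeries.X a) := by
  rw [adMatrix_apply, map_sum]
  exact Finset.sum_congr rfl fun a _ => D.map_smul _ _

/-- The Jacobi identity in structure constants. -/
lemma structConst_jacobi (x c d b : ι) :
    ∑ a, structConst e c d a * structConst e x a b =
      ∑ a, structConst e x c a * structConst e a d b +
        ∑ a, structConst e x d a * structConst e c a b := by
  have h := congrArg (fun z => e.repr z b) (leibniz_lie (e x) (e c) (e d))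
  simp only [map_add, Finsupp.add_apply] at h
  rw [lie_eq_sum_structConst e c d, lie_eq_sum_structConst e x c, lie_eq_sum_structConst e x d,
    lie_sum, lie_sum, sum_lie] at h
  simp only [lie_smul, smul_lie, map_sum, map_smul, Finsupp.smul_apply, Finsupp.coe_finsetSum,
    Finset.sum_apply, smul_eq_mul] at h
  exact h

lemma adMatrix_jacobi (c d b : ι) :
    ∑ a, structConst e c d a • adMatrix e b a =
      ∑ a, structConst e a d b • adMatrix e a c + ∑ a, structConst e c a b • adMatrix e a d := by
  simp only [adMatrix_apply, Finset.smul_sum, smul_smul]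
  have hc : ∀ F : ι → ι → k, ∑ a, ∑ x, F a x • (MvPowerSeries.X x : MvPowerSeries ι k) =
      ∑ x, (∑ a, F a x) • MvPowerSeries.X x := by
    intro F
    rw [Finset.sum_comm]
    exact Finset.sum_congr rfl fun x _ => (Finset.sum_smul).symm
  rw [hc, hc, hc, ← Finset.sum_add_distrib]
  refine Finset.sum_congr rfl fun x _ => ?_
  rw [← add_smul, structConst_jacobi]
  simp only [mul_comm]

/-- The defect of the left invariant fields from being a Lie algebra map. -/
noncomputable def leftDefect (c d : ι) : Derivation k (MvPowerSeries ι k) (MvPowerSeries ι k) :=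
  ⁅leftField e c, leftField e d⁆ - ∑ a, structConst e c d a • leftField e a

lemma leftDefect_X (c d b : ι) : leftDefect e c d (MvPowerSeries.X b) =
    leftField e c (bernMatrix e b d) - leftField e d (bernMatrix e b c) -
      ∑ a, structConst e c d a • bernMatrix e b a := by
  have h : (∑ a, structConst e c d a • leftField e a) (MvPowerSeries.X b) =
      ∑ a, structConst e c d a • bernMatrix e b a := by
    rw [← Derivation.coeFnAddMonoidHom_apply, map_sum, Finset.sum_apply]
    refine Finset.sum_congr rfl fun a _ => ?_
    rw [Derivation.coeFnAddMonoidHom_apply, Derivation.smul_apply, leftField, vectorField_X]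
  rw [leftDefect, Derivation.sub_apply, h, Derivation.commutator_apply]
  simp only [leftField, vectorField_X]

/-- The commutator of the Euler field with the defect is linear in the defect: the terms without
defect cancel by the Jacobi identity for vector fields and in `g`. -/
lemma lie_euler_leftDefect (c d : ι) :
    ⁅(euler : Derivation k (MvPowerSeries ι k) _), leftDefect e c d⁆ =
      ∑ a, (adMatrix e a c - bernMatrix e a c) • leftDefect e a d +
      ∑ a, (adMatrix e a d - bernMatrix e a d) • leftDefect e c a -
      ∑ b, leftDefect e c d (MvPowerSeries.X b) • leftField e b := by
  have hU : ∀ (D : Derivation k (MvPowerSeries ι k) (MvPowerSeries ι k)) (c : ι),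
      ⁅∑ a, (adMatrix e a c - bernMatrix e a c) • leftField e a, D⁆ =
        ∑ a, ((adMatrix e a c - bernMatrix e a c) • ⁅leftField e a, D⁆ -
          D (adMatrix e a c - bernMatrix e a c) • leftField e a) := by
    intro D c
    rw [sum_lie]
    exact Finset.sum_congr rfl fun a _ => lie_smul_derivation _ _ _
  have hL : ∀ c d, ⁅leftField e c, leftField e d⁆ =
      leftDefect e c d + ∑ a, structConst e c d a • leftField e a := fun c d => by
    rw [leftDefect, sub_add_cancel]
  have h1 : ⁅(euler : Derivation k (MvPowerSeries ι k) _), leftDefect e c d⁆ =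
      ⁅⁅(euler : Derivation k (MvPowerSeries ι k) _), leftField e c⁆, leftField e d⁆ -
      ⁅⁅(euler : Derivation k (MvPowerSeries ι k) _), leftField e d⁆, leftField e c⁆ -
      ∑ a, structConst e c d a • ⁅(euler : Derivation k (MvPowerSeries ι k) _), leftField e a⁆ := by
    rw [leftDefect, lie_sub, leibniz_lie, lie_sum, ← lie_skew (leftField e c)]
    simp only [lie_smul, sub_eq_add_neg]
  have hV : ∀ c a, leftField e c (MvPowerSeries.X a) = bernMatrix e a c := fun c a =>
    vectorField_X _ a
  -- The coefficient of `leftField e b` in the terms that are not visibly linear in the defect.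
  have hcoef : ∀ b, ∑ a, structConst e a d b • (adMatrix e a c - bernMatrix e a c) -
      leftField e d (adMatrix e b c - bernMatrix e b c) -
      (∑ a, structConst e a c b • (adMatrix e a d - bernMatrix e a d) -
        leftField e c (adMatrix e b d - bernMatrix e b d)) -
      ∑ a, structConst e c d a • (adMatrix e b a - bernMatrix e b a) =
        - leftDefect e c d (MvPowerSeries.X b) := by
    intro b
    rw [leftDefect_X, map_sub, map_sub, derivation_adMatrix, derivation_adMatrix]
    simp only [hV, smul_sub, Finset.sum_sub_distrib]
    rw [adMatrix_jacobi]
    simp only [structConst_skew e c _ b, neg_smul, Finset.sum_neg_distrib]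
    abel
  have hs1 : ∀ (u : ι → MvPowerSeries ι k) (s : ι → ι → k),
      ∑ a, u a • ∑ b, s a b • leftField e b = ∑ b, (∑ a, s a b • u a) • leftField e b := by
    intro u s
    simp only [Finset.smul_sum, Finset.sum_smul]
    rw [Finset.sum_comm]
    refine Finset.sum_congr rfl fun b _ => Finset.sum_congr rfl fun a _ => ?_
    ext1 f
    simp only [Derivation.smul_apply, smul_eq_mul, mul_smul_comm, smul_mul_assoc]
  have hs2 : ∀ (s : ι → k) (u : ι → ι → MvPowerSeries ι k),
      ∑ a, s a • ∑ b, u b a • leftField e b = ∑ b, (∑ a, s a • u b a) • leftField e b := by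
    intro s u
    simp only [Finset.smul_sum, Finset.sum_smul]
    rw [Finset.sum_comm]
    refine Finset.sum_congr rfl fun b _ => Finset.sum_congr rfl fun a _ => ?_
    ext1 f
    simp only [Derivation.smul_apply, smul_eq_mul, mul_smul_comm, smul_mul_assoc]
  have hskew : ∀ a, leftDefect e a c = - leftDefect e c a := by
    intro a
    rw [leftDefect, leftDefect, ← lie_skew]
    simp only [structConst_skew e a c, neg_smul, Finset.sum_neg_distrib]
    abel
  rw [h1, lie_euler_leftField, lie_euler_leftField, hU, hU]
  simp only [hL, lie_euler_leftField, smul_add, Finset.sum_add_distrib, Finset.sum_sub_distrib,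
    hskew, smul_neg, Finset.sum_neg_distrib]
  rw [hs1, hs1, hs2]
  have hfin := Finset.sum_congr rfl fun b (_ : b ∈ Finset.univ) =>
    congrArg (fun r => r • leftField e b) (hcoef b)
  simp only [sub_smul, neg_smul, Finset.sum_sub_distrib, Finset.sum_neg_distrib] at hfin ⊢
  rw [sub_eq_add_neg _ (∑ b, leftDefect e c d (MvPowerSeries.X b) • leftField e b), ← hfin]
  abel

lemma adSeries_homogeneousComponent_zero (f : PowerSeries k) (b c : ι) :
    (adSeries e f b c).homogeneousComponent 0 =
      PowerSeries.coeff 0 f • (1 : Matrix ι ι (MvPowerSeries ι k)) b c := by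
  rw [homogeneousComponent_adSeries, pow_zero]

lemma homogeneousComponent_zero_adMatrix (b c : ι) :
    (adMatrix e b c).homogeneousComponent 0 = 0 := by
  rw [← mul_one (adMatrix e b c)]
  exact homogeneousComponent_mul_of_lt (isHomogeneous_adMatrix e b c) zero_lt_one 1

lemma homogeneousComponent_zero_bernMatrix (b c : ι) :
    (bernMatrix e b c).homogeneousComponent 0 = if b = c then 1 else 0 := by
  rw [bernMatrix, adSeries_homogeneousComponent_zero, bernoulli'PowerSeries_coeff_zero, one_smul,
    Matrix.one_apply]

/-- The degree `n` part of the defect is multiplied by `n` and by `-2` under the Euler field, so it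
vanishes. -/
lemma leftDefect_X_eq_zero (c d b : ι) : leftDefect e c d (MvPowerSeries.X b) = 0 := by
  suffices h : ∀ n c d b, (leftDefect e c d (MvPowerSeries.X b)).homogeneousComponent n = 0 from
    ext_homogeneousComponent fun n => by rw [h, map_zero]
  intro n
  induction n using Nat.strong_induction_on with
  | _ n ih =>
    intro c d b
    have hsum : ∀ (κ : ι → Derivation k (MvPowerSeries ι k) (MvPowerSeries ι k)),
        (∑ a, κ a) (MvPowerSeries.X b) = ∑ a, κ a (MvPowerSeries.X b) := by
      intro κ
      rw [← Derivation.coeFnAddMonoidHom_apply, map_sum, Finset.sum_apply]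
      rfl
    have h := congrArg (fun D => (D (MvPowerSeries.X b)).homogeneousComponent n)
      (lie_euler_leftDefect e c d)
    simp only [Derivation.commutator_apply, euler_X, Derivation.sub_apply, Derivation.add_apply,
      hsum, Derivation.smul_apply, smul_eq_mul, map_sub, map_add, map_sum,
      homogeneousComponent_euler] at h
    have hm : ∀ p c d b, (p * leftDefect e c d (MvPowerSeries.X b)).homogeneousComponent n =
        p.homogeneousComponent 0 * (leftDefect e c d (MvPowerSeries.X b)).homogeneousComponent n :=
      fun p c d b => homogeneousComponent_mul_of_forall_lt n p _ fun m hm => ih m hm c d b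
    simp only [hm, mul_comm (leftDefect e _ _ _), leftField, vectorField_X, map_sub,
      homogeneousComponent_zero_adMatrix, homogeneousComponent_zero_bernMatrix, zero_sub, neg_mul,
      ite_mul, one_mul, zero_mul, Finset.sum_neg_distrib, Finset.sum_ite_eq, Finset.sum_ite_eq',
      Finset.mem_univ, if_true] at h
    have h2 : ((n : k) + 2) •
        (leftDefect e c d (MvPowerSeries.X b)).homogeneousComponent n = 0 := by
      rw [add_smul, two_smul, ← add_sub_cancel_right ((n : k) • _)
        ((leftDefect e c d (MvPowerSeries.X b)).homogeneousComponent n)]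
      rw [add_sub_right_comm, h]
      abel
    have hne : (n : k) + 2 ≠ 0 := by exact_mod_cast (Nat.succ_ne_zero (n + 1))
    exact (smul_eq_zero.1 h2).resolve_left hne

/-- The vector fields `leftField e c` satisfy the commutation relations of `g`. -/
theorem lie_leftField (c d : ι) :
    ⁅leftField e c, leftField e d⁆ = ∑ a, structConst e c d a • leftField e a := by
  have h : (∑ a, structConst e c d a • leftField e a) =
      vectorField (∑ a, (MvPowerSeries.C (structConst e c d a) : MvPowerSeries ι k) •
        (fun b => bernMatrix e b a : ι → MvPowerSeries ι k)) := by
    rw [vectorField_sum]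
    refine Finset.sum_congr rfl fun a _ => ?_
    rw [vectorField_smul]
    ext1 f
    rw [Derivation.smul_apply, Derivation.smul_apply, MvPowerSeries.smul_eq_C_mul, smul_eq_mul]
    rfl
  have h' : ⁅leftField e c, leftField e d⁆ = vectorField _ := lie_vectorField _ _
  rw [h, h', vectorField_eq_iff]
  funext b
  have h0 := leftDefect_X_eq_zero e c d b
  rw [leftDefect_X, sub_eq_zero] at h0
  refine h0.trans ?_
  rw [Finset.sum_apply]
  exact Finset.sum_congr rfl fun a _ => MvPowerSeries.smul_eq_C_mul _ _

end Flat

/-! ### Sums over words -/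

section WordSums

variable {k ι : Type*} [Field k] [Fintype ι] [LinearOrder ι]

lemma wordSeries_add (i : ℕ) (F G : List ι → k) :
    wordSeries i (F + G) = wordSeries i F + wordSeries i G := by
  simp only [wordSeries, Pi.add_apply, map_add, Finset.sum_add_distrib]

lemma wordSeries_smul (i : ℕ) (r : k) (F : List ι → k) :
    wordSeries i (r • F) = r • wordSeries i F := by
  simp only [wordSeries, Pi.smul_apply, map_smul, Finset.smul_sum]

lemma wordSeries_sum {κ : Type*} (s : Finset κ) (i : ℕ) (F : κ → List ι → k) :
    wordSeries i (∑ a ∈ s, F a) = ∑ a ∈ s, wordSeries i (F a) := by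
  simp only [wordSeries, Finset.sum_apply, map_sum]
  rw [Finset.sum_comm]

lemma wordSeries_congr (i : ℕ) {F G : List ι → k} (h : ∀ l, l.length = i → F l = G l) :
    wordSeries i F = wordSeries i G :=
  Finset.sum_congr rfl fun w _ => by rw [h _ (List.length_ofFn)]

lemma isHomogeneous_wordSeries (i : ℕ) (F : List ι → k) : (wordSeries i F).IsHomogeneous i := by
  induction i generalizing F with
  | zero => rw [wordSeries_zero]; exact isHomogeneous_C _
  | succ i ih =>
    rw [wordSeries_succ]
    refine isHomogeneous_sum _ _ fun a _ => ?_
    rw [add_comm]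
    exact MvPowerSeries.IsHomogeneous.mul (isHomogeneous_X a) (ih _)

/-- The power series `∑ x_{a_1} ⋯ x_{a_i} F(a_1, …, a_i)` for a family of power series `F`. -/
noncomputable def wordSum : ℕ → (List ι → MvPowerSeries ι k) →ₗ[k] MvPowerSeries ι k
  | 0 => LinearMap.proj []
  | i + 1 => ∑ a, LinearMap.mulLeft k (MvPowerSeries.X a) ∘ₗ wordSum i ∘ₗ
      LinearMap.funLeft k (MvPowerSeries ι k) (List.cons a)

lemma wordSum_zero (F : List ι → MvPowerSeries ι k) : wordSum 0 F = F [] := rfl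

lemma wordSum_succ (i : ℕ) (F : List ι → MvPowerSeries ι k) :
    wordSum (i + 1) F = ∑ a, MvPowerSeries.X a * wordSum i fun l => F (a :: l) := by
  rw [wordSum, LinearMap.sum_apply]
  rfl

lemma wordSum_mul (i : ℕ) (r : MvPowerSeries ι k) (F : List ι → MvPowerSeries ι k) :
    (wordSum i fun l => r * F l) = r * wordSum i F := by
  induction i generalizing F with
  | zero => rfl
  | succ i ih =>
    rw [wordSum_succ, wordSum_succ, Finset.mul_sum]
    exact Finset.sum_congr rfl fun a _ => by rw [ih, mul_left_comm]

lemma euler_wordSum (i : ℕ) (F : List ι → MvPowerSeries ι k) :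
    euler (wordSum i F) = (i : k) • wordSum i F + wordSum i fun l => euler (F l) := by
  induction i generalizing F with
  | zero => simp [wordSum_zero]
  | succ i ih =>
    simp only [wordSum_succ, map_sum, Finset.smul_sum, ← Finset.sum_add_distrib]
    refine Finset.sum_congr rfl fun a _ => ?_
    rw [Derivation.leibniz, euler_X, ih, smul_eq_mul, smul_eq_mul, mul_add, mul_smul_comm,
      Nat.cast_succ, add_smul, one_smul, mul_comm (wordSum i _)]
    abel

lemma homogeneousComponent_zero_eq (f : MvPowerSeries ι k) :
    f.homogeneousComponent 0 = MvPowerSeries.C (MvPowerSeries.constantCoeff f) := by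
  classical
  ext α
  rw [MvPowerSeries.coeff_homogeneousComponent, MvPowerSeries.coeff_C]
  by_cases h : α = 0
  · rw [h, if_pos rfl, if_pos (map_zero _), MvPowerSeries.coeff_zero_eq_constantCoeff_apply]
  · rw [if_neg h, if_neg (mt (Finsupp.degree_eq_zero_iff α).1 h)]

lemma homogeneousComponent_wordSum (i : ℕ) (F : List ι → MvPowerSeries ι k) :
    (wordSum i F).homogeneousComponent i =
      wordSeries i fun l => MvPowerSeries.constantCoeff (F l) := by
  induction i generalizing F with
  | zero => rw [wordSum_zero, wordSeries_zero, homogeneousComponent_zero_eq]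
  | succ i ih =>
    rw [wordSum_succ, wordSeries_succ, map_sum]
    refine Finset.sum_congr rfl fun a _ => ?_
    rw [add_comm i 1, homogeneousComponent_mul (isHomogeneous_X a), ih]

end WordSums

/-! ### The enveloping algebra and the exponential map -/

section Enveloping

attribute [local instance 100] LieRing.ofAssociativeRing

variable {k g ι : Type*} [Field k] [LieRing g] [LieAlgebra k g]
variable [Fintype ι] [LinearOrder ι] (e : Module.Basis ι k g)

/-- The product in the enveloping algebra of the basis vectors given by a word. -/
noncomputable def envWord (v : List ι) : UniversalEnvelopingAlgebra k g :=
  (v.map fun a => UniversalEnvelopingAlgebra.ι k (e a)).prod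

lemma envWord_nil : envWord e [] = 1 := rfl

lemma envWord_cons (a : ι) (v : List ι) :
    envWord e (a :: v) = UniversalEnvelopingAlgebra.ι k (e a) * envWord e v := by
  rw [envWord, List.map_cons, List.prod_cons, envWord]

lemma envWord_append (v w : List ι) : envWord e (v ++ w) = envWord e v * envWord e w := by
  rw [envWord, List.map_append, List.prod_append, envWord, envWord]

/-- An element of the enveloping algebra is in a subalgebra that contains `g`. -/
lemma mem_of_ι_mem (T : Subalgebra k (UniversalEnvelopingAlgebra k g))
    (hT : ∀ y, UniversalEnvelopingAlgebra.ι k y ∈ T) (u : UniversalEnvelopingAlgebra k g) :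
    u ∈ T := by
  let f : g →ₗ⁅k⁆ T :=
    { toFun := fun y => ⟨UniversalEnvelopingAlgebra.ι k y, hT y⟩
      map_add' := fun x y => Subtype.ext (map_add _ x y)
      map_smul' := fun r x => Subtype.ext (map_smul _ r x)
      map_lie' := fun {x y} => Subtype.ext (LieHom.map_lie (UniversalEnvelopingAlgebra.ι k) x y) }
  have h : T.val.comp (UniversalEnvelopingAlgebra.lift k f) = AlgHom.id k _ := by
    refine UniversalEnvelopingAlgebra.hom_ext k ?_
    ext y
    exact congrArg Subtype.val (UniversalEnvelopingAlgebra.lift_ι_apply k f y)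
  have h1 := AlgHom.congr_fun h u
  rw [AlgHom.id_apply] at h1
  rw [← h1]
  exact (UniversalEnvelopingAlgebra.lift k f u).2

lemma span_envWord : Submodule.span k (Set.range (envWord e)) = ⊤ := by
  set S := Submodule.span k (Set.range (envWord e)) with hS
  have hι : ∀ y, ∀ s ∈ S, UniversalEnvelopingAlgebra.ι k y * s ∈ S := by
    intro y s hs
    induction hs using Submodule.span_induction with
    | mem s hs =>
      obtain ⟨v, rfl⟩ := hs
      rw [← e.sum_repr y, map_sum, Finset.sum_mul]
      refine Submodule.sum_mem _ fun a _ => ?_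
      rw [map_smul, smul_mul_assoc, ← envWord_cons]
      exact S.smul_mem _ (Submodule.subset_span ⟨_, rfl⟩)
    | zero => rw [mul_zero]; exact S.zero_mem
    | add s t _ _ hs ht => rw [mul_add]; exact S.add_mem hs ht
    | smul r s _ hs => rw [mul_smul_comm]; exact S.smul_mem _ hs
  let T : Subalgebra k (UniversalEnvelopingAlgebra k g) :=
    { carrier := {u | ∀ s ∈ S, u * s ∈ S}
      mul_mem' := fun {u v} hu hv s hs => by rw [mul_assoc]; exact hu _ (hv s hs)
      add_mem' := fun {u v} hu hv s hs => by rw [add_mul]; exact S.add_mem (hu s hs) (hv s hs)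
      algebraMap_mem' := fun r s hs => by
        rw [← Algebra.smul_def]; exact S.smul_mem r hs }
  refine eq_top_iff.2 fun u _ => ?_
  have h := mem_of_ι_mem T hι u 1 (Submodule.subset_span ⟨[], rfl⟩)
  rwa [mul_one] at h

lemma dual_ext_envWord {M : Type*} [AddCommGroup M] [Module k M]
    {f f' : UniversalEnvelopingAlgebra k g →ₗ[k] M}
    (h : ∀ v, f (envWord e v) = f' (envWord e v)) : f = f' := by
  refine LinearMap.ext_on (span_envWord e) ?_
  rintro _ ⟨v, rfl⟩
  exact h v

/-- The degree `m` part of `f ∘ exp`, up to the factor `m!`. -/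
noncomputable def expPart (m : ℕ) (f : Module.Dual k (UniversalEnvelopingAlgebra k g)) :
    MvPowerSeries ι k := wordSeries m fun v => f (envWord e v)

lemma homogeneousComponent_expStar (m : ℕ) (f : Module.Dual k (UniversalEnvelopingAlgebra k g)) :
    (expStar e f).homogeneousComponent m = (m.factorial : k)⁻¹ • expPart e m f := by
  classical
  ext α
  have hc : MvPowerSeries.coeff α (expStar e f) =
      (α.degree.factorial : k)⁻¹ * MvPowerSeries.coeff α (expPart e α.degree f) := by
    rw [expPart, coeff_wordSeries]
    refine congrArg ((α.degree.factorial : k)⁻¹ * ·) (Finset.sum_congr rfl fun w _ => ?_)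
    rw [envWord, List.map_ofFn]
    rfl
  rw [MvPowerSeries.coeff_homogeneousComponent, MvPowerSeries.coeff_smul, hc]
  split_ifs with h
  · rw [h]
  · by_cases h0 : MvPowerSeries.coeff α (expPart e m f) = 0
    · rw [h0, mul_zero]
    · exact absurd (isHomogeneous_iff.1 (isHomogeneous_wordSeries m _) α h0) h

variable [CharZero k]

lemma expPart_eq (m : ℕ) (f : Module.Dual k (UniversalEnvelopingAlgebra k g)) :
    expPart e m f = (m.factorial : k) • (expStar e f).homogeneousComponent m := by
  rw [homogeneousComponent_expStar, smul_smul, mul_inv_cancel₀, one_smul]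
  exact_mod_cast m.factorial_ne_zero

lemma ι_mul_sub_ι_mul (p q : ι) :
    UniversalEnvelopingAlgebra.ι k (e p) * UniversalEnvelopingAlgebra.ι k (e q) -
      UniversalEnvelopingAlgebra.ι k (e q) * UniversalEnvelopingAlgebra.ι k (e p) =
      ∑ t, structConst e p q t • UniversalEnvelopingAlgebra.ι k (e t) := by
  rw [← LieRing.of_associative_ring_bracket, ← LieHom.map_lie, lie_eq_sum_structConst, map_sum]
  exact Finset.sum_congr rfl fun t _ => map_smul _ _ _

/-- A linear form on the enveloping algebra is determined by its values at the symmetrized words: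
on words of length `m`, it is symmetric up to its values at shorter words. -/
lemma expStar_injective : Function.Injective (expStar e) := by
  refine (injective_iff_map_eq_zero (expStar e)).2 fun f hf => ?_
  suffices h : ∀ m, ∀ v : List ι, v.length = m → f (envWord e v) = 0 from
    dual_ext_envWord e fun v => h _ v rfl
  intro m
  induction m using Nat.strong_induction_on with
  | _ m ih =>
    -- By induction, `f` vanishes on shorter words, so it is symmetric on words of length `m`.
    have hswap : ∀ (u : List ι) (a b : ι) (v : List ι), (u ++ a :: b :: v).length = m →
        f (envWord e (u ++ a :: b :: v)) = f (envWord e (u ++ b :: a :: v)) := by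
      intro u a b v hl
      have h : envWord e (u ++ a :: b :: v) - envWord e (u ++ b :: a :: v) =
          ∑ t, structConst e a b t • envWord e (u ++ t :: v) := by
        simp only [envWord_append, envWord_cons]
        rw [← mul_sub, ← mul_assoc, ← mul_assoc, ← sub_mul, ι_mul_sub_ι_mul, Finset.sum_mul,
          Finset.mul_sum]
        exact Finset.sum_congr rfl fun t _ => by rw [smul_mul_assoc, mul_smul_comm]
      rw [← sub_eq_zero, ← map_sub, h, map_sum]
      refine Finset.sum_eq_zero fun t _ => ?_
      rw [map_smul, ih _ (by simp at hl ⊢; omega) _ rfl, smul_zero]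
    have hperm : ∀ l l' : List ι, l.Perm l' → ∀ u : List ι, (u ++ l).length = m →
        f (envWord e (u ++ l)) = f (envWord e (u ++ l')) := by
      intro l l' h
      induction h with
      | nil => exact fun u _ => rfl
      | cons a _ ih' =>
        intro u hu
        have := ih' (u ++ [a])
        simp only [List.append_assoc, List.singleton_append] at this
        exact this hu
      | swap a b l => exact fun u hu => hswap u b a l hu
      | trans h1 _ ih1 ih2 =>
        intro u hu
        rw [ih1 u hu, ih2 u]
        rw [← hu, List.length_append, List.length_append, h1.length_eq]
    have hlist : ∀ l : List ι, l.Perm (l : Multiset ι).toList := fun l =>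
      Multiset.coe_eq_coe.1 (Multiset.coe_toList _).symm
    intro v hv
    -- A symmetric function on words is determined by its polynomial.
    have hpart : expPart e m f = 0 := by rw [expPart_eq, hf, map_zero, smul_zero]
    have hsymm : expPart e m f =
        wordSeries m fun l => (fun s : Multiset ι => f (envWord e s.toList)) l :=
      wordSeries_congr m fun l hl => hperm l _ (hlist l) [] hl
    rw [hsymm] at hpart
    have h := congrArg (MvPowerSeries.coeff (Multiset.toFinsupp (v : Multiset ι))) hpart
    have hdeg : (Multiset.toFinsupp (v : Multiset ι)).degree = m := by
      rw [← card_toMultiset_eq, Multiset.toFinsupp_toMultiset, Multiset.coe_card, hv]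
    rw [coeff_wordSeries_symm m fun s : Multiset ι => f (envWord e s.toList), map_zero,
      Multiset.toFinsupp_toMultiset] at h
    have hne : ((wordCount m (Multiset.toFinsupp (v : Multiset ι)) : ℕ) : k) ≠ 0 := by
      have := wordCount_pos (Multiset.toFinsupp (v : Multiset ι))
      rw [hdeg] at this
      exact_mod_cast this.ne'
    have h' := (mul_eq_zero.1 h).resolve_left hne
    exact (hperm v _ (hlist v) [] hv).trans h'

end Enveloping

/-! ### Invariant vector fields -/

section Exponential

attribute [local instance 100] LieRing.ofAssociativeRing

variable {k g ι : Type*} [Field k] [LieRing g] [LieAlgebra k g]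
variable [Fintype ι] [LinearOrder ι] (e : Module.Basis ι k g)
variable [CharZero k]

/-- The left invariant vector fields in exponential coordinates. -/
noncomputable def leftFields : g →ₗ[k] Derivation k (MvPowerSeries ι k) (MvPowerSeries ι k) :=
  e.constr k (leftField e)

lemma leftFields_basis (c : ι) : leftFields e (e c) = leftField e c := e.constr_basis k _ c

/-- A linear map is compatible with brackets if it is so on a basis. -/
lemma map_lie_of_basis {L : Type*} [LieRing L] [LieAlgebra k L] (F : g →ₗ[k] L)
    (h : ∀ p q, F ⁅e p, e q⁆ = ⁅F (e p), F (e q)⁆) (x y : g) : F ⁅x, y⁆ = ⁅F x, F y⁆ := by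
  have hx : ∀ z, z = ∑ a, e.repr z a • e a := fun z => (e.sum_repr z).symm
  rw [hx x, hx y]
  simp only [lie_sum, sum_lie, lie_smul, smul_lie, map_sum, map_smul, h]

lemma leftFields_lie (x y : g) : leftFields e ⁅x, y⁆ = ⁅leftFields e x, leftFields e y⁆ :=
  map_lie_of_basis e (leftFields e) (fun p q => by
    rw [leftFields_basis, leftFields_basis, lie_leftField, lie_eq_sum_structConst, map_sum]
    exact Finset.sum_congr rfl fun t _ => by rw [map_smul, leftFields_basis]) x y

/-- The action of the enveloping algebra on power series by left invariant differential
operators. -/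
noncomputable def leftRep :
    UniversalEnvelopingAlgebra k g →ₐ[k] Module.End k (MvPowerSeries ι k) :=
  UniversalEnvelopingAlgebra.lift k
    { toFun := fun y => (leftFields e y).toLinearMap
      map_add' := fun x y => by rw [map_add]; rfl
      map_smul' := fun r x => by rw [map_smul]; rfl
      map_lie' := fun {x y} => by
        rw [leftFields_lie]
        refine LinearMap.ext fun p => ?_
        exact Derivation.commutator_apply (D1 := leftFields e x) (D2 := leftFields e y) p }

lemma leftRep_ι (y : g) (p : MvPowerSeries ι k) :
    leftRep e (UniversalEnvelopingAlgebra.ι k y) p = leftFields e y p := by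
  rw [leftRep, UniversalEnvelopingAlgebra.lift_ι_apply]
  rfl

lemma leftRep_envWord_cons (a : ι) (v : List ι) (p : MvPowerSeries ι k) :
    leftRep e (envWord e (a :: v)) p = leftField e a (leftRep e (envWord e v) p) := by
  rw [envWord_cons, map_mul, Module.End.mul_apply, leftRep_ι, leftFields_basis]

/-- The linear form `u ↦ (u p)(0)` on the enveloping algebra. -/
noncomputable def evalAtOne (p : MvPowerSeries ι k) :
    Module.Dual k (UniversalEnvelopingAlgebra k g) where
  toFun u := MvPowerSeries.constantCoeff (leftRep e u p)
  map_add' u v := by rw [map_add, LinearMap.add_apply, map_add]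
  map_smul' r u := by
    rw [map_smul, LinearMap.smul_apply, MvPowerSeries.constantCoeff_smul, RingHom.id_apply]

/-- As `∑ a, x_a V_a` is the Euler field `E`, the sum `∑ x_w V_w p` over the words of length `m`
equals `(E - m + 1) ⋯ (E - 1) E p`. -/
lemma homogeneousComponent_wordSum_leftRep (n m : ℕ) (p : MvPowerSeries ι k) :
    (wordSum m fun v => leftRep e (envWord e v) p).homogeneousComponent n =
      (n.descFactorial m : k) • p.homogeneousComponent n := by
  induction m with
  | zero => simp [wordSum_zero, envWord_nil]
  | succ m ih =>
    have h : (wordSum (m + 1) fun v => leftRep e (envWord e v) p) =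
        wordSum m fun v => euler (leftRep e (envWord e v) p) := by
      have h1 : (fun v => euler (leftRep e (envWord e v) p)) =
          ∑ a, fun v => MvPowerSeries.X a * leftRep e (envWord e (a :: v)) p := by
        funext v
        rw [Finset.sum_apply, euler_eq_sum_leftField e, ← Derivation.coeFnAddMonoidHom_apply,
          map_sum, Finset.sum_apply]
        refine Finset.sum_congr rfl fun a _ => ?_
        rw [leftRep_envWord_cons]
        rfl
      rw [h1, map_sum, wordSum_succ]
      exact Finset.sum_congr rfl fun a _ => (wordSum_mul m _ _).symm
    have h2 := congrArg (MvPowerSeries.homogeneousComponent n)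
      (euler_wordSum m fun v => leftRep e (envWord e v) p)
    rw [homogeneousComponent_euler, map_add, map_smul, ← h, ih] at h2
    rw [← sub_eq_iff_eq_add'] at h2
    rw [← h2, ← sub_smul, smul_smul]
    congr 1
    rw [Nat.descFactorial_succ]
    rcases le_or_gt m n with hmn | hmn
    · rw [Nat.cast_mul, Nat.cast_sub hmn]
    · rw [Nat.descFactorial_of_lt hmn]
      simp

lemma expStar_evalAtOne (p : MvPowerSeries ι k) : expStar e (evalAtOne e p) = p := by
  refine ext_homogeneousComponent fun m => ?_
  have h := homogeneousComponent_wordSum_leftRep e m m p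
  rw [homogeneousComponent_wordSum, Nat.descFactorial_self] at h
  rw [homogeneousComponent_expStar]
  have h' : expPart e m (evalAtOne e p) = (m.factorial : k) • p.homogeneousComponent m := h
  rw [h', smul_smul, inv_mul_cancel₀, one_smul]
  exact_mod_cast m.factorial_ne_zero

/-- The inverse sends a power series `p` to `u ↦ (u p)(0)`, where the enveloping algebra acts by
left invariant differential operators. -/
theorem expStar_bijective : Function.Bijective (expStar e) :=
  ⟨expStar_injective e, fun p => ⟨_, expStar_evalAtOne e p⟩⟩

lemma evalAtOne_expStar (f : Module.Dual k (UniversalEnvelopingAlgebra k g)) :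
    evalAtOne e (expStar e f) = f :=
  expStar_injective e (expStar_evalAtOne e _)

/-- The form `u ↦ (u (V_y p))(0)` is `u ↦ ((u y) p)(0)`. -/
theorem leftFields_isLeftInvariant : IsLeftInvariant e (leftFields e) := by
  intro y f
  rw [← expStar_evalAtOne e (leftFields e y (expStar e f))]
  congr 1
  conv_rhs => rw [← evalAtOne_expStar e f]
  refine LinearMap.ext fun u => ?_
  change MvPowerSeries.constantCoeff (leftRep e u _) =
    MvPowerSeries.constantCoeff (leftRep e (u * UniversalEnvelopingAlgebra.ι k y) _)
  rw [map_mul, Module.End.mul_apply, leftRep_ι]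

lemma expPart_succ (m : ℕ) (f : Module.Dual k (UniversalEnvelopingAlgebra k g)) :
    expPart e (m + 1) f = ∑ a, MvPowerSeries.X a *
      expPart e m (f ∘ₗ LinearMap.mulLeft k (UniversalEnvelopingAlgebra.ι k (e a))) := by
  rw [expPart, wordSeries_succ]
  refine Finset.sum_congr rfl fun a _ => ?_
  rw [expPart]
  simp only [envWord_cons, LinearMap.comp_apply, LinearMap.mulLeft_apply]

lemma expPart_add (m : ℕ) (f f' : Module.Dual k (UniversalEnvelopingAlgebra k g)) :
    expPart e m (f + f') = expPart e m f + expPart e m f' := wordSeries_add m _ _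

lemma expPart_smul (m : ℕ) (r : k) (f : Module.Dual k (UniversalEnvelopingAlgebra k g)) :
    expPart e m (r • f) = r • expPart e m f := wordSeries_smul m r _

lemma expPart_sum {κ : Type*} (s : Finset κ) (m : ℕ)
    (f : κ → Module.Dual k (UniversalEnvelopingAlgebra k g)) :
    expPart e m (∑ a ∈ s, f a) = ∑ a ∈ s, expPart e m (f a) := by
  refine Eq.trans (congrArg (wordSeries m) (funext fun v => ?_))
    (wordSeries_sum s m fun a v => f a (envWord e v))
  rw [LinearMap.sum_apply, Finset.sum_apply]

/-- The coadjoint action on power series is the infinitesimal conjugation of functions on the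
group. -/
lemma coadj_expPart (c : ι) (m : ℕ) (f : Module.Dual k (UniversalEnvelopingAlgebra k g)) :
    coadj e c (expPart e m f) =
      expPart e m (f ∘ₗ (LinearMap.mulRight k (UniversalEnvelopingAlgebra.ι k (e c)) -
        LinearMap.mulLeft k (UniversalEnvelopingAlgebra.ι k (e c)))) := by
  induction m generalizing f with
  | zero =>
    rw [expPart, expPart, wordSeries_zero, wordSeries_zero]
    simp only [envWord_nil, LinearMap.comp_apply, LinearMap.sub_apply, LinearMap.mulLeft_apply,
      LinearMap.mulRight_apply, one_mul, mul_one, sub_self, map_zero]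
    exact (coadj e c).map_algebraMap _
  | succ m ih =>
    rw [expPart_succ, expPart_succ, map_sum]
    simp only [Derivation.leibniz, smul_eq_mul, ih, coadj_X, Finset.sum_add_distrib]
    have h1 : ∑ a, expPart e m (f ∘ₗ LinearMap.mulLeft k (UniversalEnvelopingAlgebra.ι k (e a))) *
        adMatrix e a c = ∑ b, MvPowerSeries.X b * expPart e m (∑ a, structConst e b c a •
          (f ∘ₗ LinearMap.mulLeft k (UniversalEnvelopingAlgebra.ι k (e a)))) := by
      simp only [adMatrix_apply, expPart_sum, expPart_smul, Finset.mul_sum]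
      rw [Finset.sum_comm]
      refine Finset.sum_congr rfl fun b _ => Finset.sum_congr rfl fun a _ => ?_
      rw [mul_smul_comm, mul_smul_comm, mul_comm]
    rw [h1, ← Finset.sum_add_distrib]
    refine Finset.sum_congr rfl fun b _ => ?_
    rw [← mul_add, ← expPart_add]
    congr 2
    refine LinearMap.ext fun u => ?_
    have h2 : (∑ a, structConst e b c a •
        (f ∘ₗ LinearMap.mulLeft k (UniversalEnvelopingAlgebra.ι k (e a)))) u =
        f ((∑ t, structConst e b c t • UniversalEnvelopingAlgebra.ι k (e t)) * u) := by
      rw [LinearMap.sum_apply, Finset.sum_mul, map_sum]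
      refine Finset.sum_congr rfl fun t _ => ?_
      rw [LinearMap.smul_apply, smul_mul_assoc, map_smul]
      rfl
    rw [LinearMap.add_apply, h2, ← ι_mul_sub_ι_mul]
    simp only [LinearMap.comp_apply, LinearMap.sub_apply, LinearMap.mulLeft_apply,
      LinearMap.mulRight_apply, map_sub, sub_mul, mul_sub, mul_assoc]
    abel

lemma coadj_expStar (c : ι) (f : Module.Dual k (UniversalEnvelopingAlgebra k g)) :
    coadj e c (expStar e f) =
      expStar e (f ∘ₗ (LinearMap.mulRight k (UniversalEnvelopingAlgebra.ι k (e c)) -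
        LinearMap.mulLeft k (UniversalEnvelopingAlgebra.ι k (e c)))) := by
  refine ext_homogeneousComponent fun m => ?_
  rw [homogeneousComponent_coadj, homogeneousComponent_expStar, homogeneousComponent_expStar,
    ← coadj_expPart]
  exact (coadj e c).map_smul _ _

/-- The right invariant vector fields in exponential coordinates. -/
noncomputable def rightFields : g →ₗ[k] Derivation k (MvPowerSeries ι k) (MvPowerSeries ι k) :=
  e.constr k fun c => leftField e c - coadj e c

lemma rightFields_basis (c : ι) : rightFields e (e c) = leftField e c - coadj e c :=
  e.constr_basis k _ c

/-- Left and right translations differ by conjugation, which is the coadjoint action on power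
series. -/
theorem rightFields_isRightInvariant : IsRightInvariant e (rightFields e) := by
  intro y f
  have hc : ∀ c, rightFields e (e c) (expStar e f) =
      expStar e (f ∘ₗ LinearMap.mulLeft k (UniversalEnvelopingAlgebra.ι k (e c))) := by
    intro c
    rw [rightFields_basis, Derivation.sub_apply, coadj_expStar, ← leftFields_basis,
      leftFields_isLeftInvariant e (e c) f, ← map_sub]
    congr 1
    refine LinearMap.ext fun u => ?_
    simp
  rw [← e.sum_repr y, map_sum, ← Derivation.coeFnAddMonoidHom_apply, map_sum, Finset.sum_apply]
  have h : f ∘ₗ LinearMap.mulLeft k (UniversalEnvelopingAlgebra.ι k (∑ c, e.repr y c • e c)) =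
      ∑ c, e.repr y c • (f ∘ₗ LinearMap.mulLeft k (UniversalEnvelopingAlgebra.ι k (e c))) := by
    refine LinearMap.ext fun u => ?_
    simp only [LinearMap.comp_apply, LinearMap.mulLeft_apply, map_sum, map_smul, Finset.sum_mul,
      smul_mul_assoc, LinearMap.sum_apply, LinearMap.smul_apply]
  rw [h, map_sum]
  refine Finset.sum_congr rfl fun c _ => ?_
  rw [Derivation.coeFnAddMonoidHom_apply, map_smul, map_smul, Derivation.smul_apply, hc]

/-- The series `z / (1 - e^{-z}) - z / 2` is the even part of `z / (e^z - 1)`. -/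
lemma coeff_bernoulliMatrix (b c : ι) (α : ι →₀ ℕ) :
    MvPowerSeries.coeff α (bernMatrix e b c - (2 : k)⁻¹ • adMatrix e b c) =
      MvPowerSeries.coeff α (bernoulliMatrix e b c) := by
  have hv : ∀ j, α.degree ≠ j → MvPowerSeries.coeff α ((adMatrix e ^ j) b c) = 0 := fun j hj => by
    by_contra h
    exact hj (isHomogeneous_iff.1 (isHomogeneous_adMatrix_pow e j b c) α h)
  have hB : MvPowerSeries.coeff α (bernoulliMatrix e b c) =
      MvPowerSeries.coeff α ((adMatrix e ^ 0) b c) + ∑ n ∈ Finset.Icc 1 α.degree,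
        ((bernoulli (2 * n) / ((2 * n).factorial : ℚ) : ℚ) : k) *
          MvPowerSeries.coeff α ((adMatrix e ^ (2 * n)) b c) := rfl
  have hM : MvPowerSeries.coeff α (adMatrix e b c) =
      MvPowerSeries.coeff α ((adMatrix e ^ 1) b c) := by rw [pow_one]
  have hP : ∀ n, PowerSeries.coeff n (bernoulli'PowerSeries k) =
      ((bernoulli' n / (n.factorial : ℚ) : ℚ) : k) := fun n => by
    rw [bernoulli'PowerSeries, PowerSeries.coeff_mk, eq_ratCast]
  rw [hB, map_sub, MvPowerSeries.coeff_smul, bernMatrix, coeff_adSeries, hP, hM]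
  rcases Nat.even_or_odd' α.degree with ⟨n, hn | hn⟩
  · rcases Nat.eq_zero_or_pos n with rfl | hpos
    · rw [hv 1 (by omega), hn]
      simp
    · rw [hv 1 (by omega), hv 0 (by omega), Finset.sum_eq_single n, hn,
        bernoulli_eq_bernoulli'_of_ne_one (by omega)]
      · simp
      · intro m _ hm
        rw [hv _ (by omega), mul_zero]
      · intro h
        exact absurd (Finset.mem_Icc.2 ⟨hpos, by omega⟩) h
  · rw [hv 0 (by omega), Finset.sum_eq_zero fun m _ => by rw [hv _ (by omega), mul_zero], hn]
    rcases Nat.eq_zero_or_pos n with rfl | hpos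
    · simp [bernoulli'_one]
    · rw [bernoulli'_eq_zero_of_odd ⟨n, rfl⟩ (by omega), hv 1 (by omega)]
      simp

/-- The coadjoint field with matrix `Ad` is the difference of the left and the right invariant
field, so the half-sum has the matrix `Ad / (1 - e^{-Ad}) - Ad / 2`. -/
theorem half_leftFields_add_rightFields (c : ι) :
    (2 : k)⁻¹ • (leftFields e (e c) + rightFields e (e c)) =
      ∑ b, bernoulliMatrix e b c • MvPowerSeries.pderiv k b := by
  have h : (2 : k)⁻¹ • (leftFields e (e c) + rightFields e (e c)) =
      leftField e c - (2 : k)⁻¹ • coadj e c := by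
    rw [leftFields_basis, rightFields_basis, ← add_sub_assoc, ← two_smul k (leftField e c),
      smul_sub, smul_smul, inv_mul_cancel₀ two_ne_zero, one_smul]
  rw [h]
  ext1 f
  rw [Derivation.sub_apply, Derivation.smul_apply, coadj_apply, leftField, vectorField_apply]
  change _ = vectorField (fun b => bernoulliMatrix e b c) f
  rw [vectorField_apply, Finset.smul_sum, ← Finset.sum_sub_distrib]
  refine Finset.sum_congr rfl fun b _ => ?_
  rw [← smul_mul_assoc, ← sub_mul]
  congr 1
  ext α
  exact coeff_bernoulliMatrix e b c α

end Exponential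

/-! ### The Hochschild differential on tensors of generators -/

section LinearTails

variable {k g ι : Type*} [Field k] [LieRing g] [LieAlgebra k g]
variable [Fintype ι] [LinearOrder ι] (e : Module.Basis ι k g)

lemma exists_map_singleton {l : List (Finset ι)} (h : ∀ s ∈ l, s.card = 1) :
    ∃ v : List ι, l = v.map fun a => ({a} : Finset ι) := by
  induction l with
  | nil => exact ⟨[], rfl⟩
  | cons s l ih =>
    obtain ⟨a, rfl⟩ := Finset.card_eq_one.1 (h s List.mem_cons_self)
    obtain ⟨v, rfl⟩ := ih fun t ht => h t (List.mem_cons_of_mem _ ht)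
    exact ⟨a :: v, rfl⟩

/-- A list of monomials that are not all generators has a first one that is not. -/
lemma exists_first_not_singleton {l : List (Finset ι)} (h : ¬ ∀ s ∈ l, s.card = 1) :
    ∃ (v : List ι) (w : Finset ι) (l' : List (Finset ι)), w.card ≠ 1 ∧
      l = (v.map fun a => ({a} : Finset ι)) ++ w :: l' := by
  induction l with
  | nil => simp at h
  | cons s l ih =>
    by_cases hs : s.card = 1
    · obtain ⟨a, rfl⟩ := Finset.card_eq_one.1 hs
      obtain ⟨v, w, l', hw, rfl⟩ := ih fun hl => h fun t ht => by
        rcases List.mem_cons.1 ht with rfl | ht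
        · exact hs
        · exact hl t ht
      exact ⟨a :: v, w, l', hw, rfl⟩
    · exact ⟨[], s, l, hs, rfl⟩

lemma IsLinear.eq_zero {F : List (Finset ι) → k} (hF : IsLinear F) {l : List (Finset ι)}
    {w : Finset ι} (hw : w.card ≠ 1) (hl : w ∈ l) : F l = 0 := by
  by_contra h
  exact hw (hF l h w hl)

/-- On a tensor with a factor `w` that is not a generator, only the terms of the bar differential of
a tensor in generators that create `w` contribute. -/
lemma IsLinear.barD (m : Finset ι → Finset ι → Finset ι → k) {F : List (Finset ι) → k}
    (hF : IsLinear F) (v : List ι) {w : Finset ι} (hw : w.card ≠ 1) (l : List (Finset ι)) :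
    barD m F ((v.map fun a => ({a} : Finset ι)) ++ w :: l) = (-1) ^ v.length *
      ∑ t, ∑ u, m t u w * F ((v.map fun a => ({a} : Finset ι)) ++ t :: u :: l) := by
  induction v generalizing F with
  | nil =>
    rw [List.map_nil, List.nil_append, barD_cons, hF.cut_eq_zero hw, map_zero, Pi.zero_apply]
    simp
  | cons a v ih =>
    rw [List.map_cons, List.cons_append, barD_cons, ih (hF.cut {a}), Finset.sum_eq_zero]
    · rw [List.length_cons, pow_succ]
      simp only [cut_apply, List.cons_append]
      ring
    · refine fun t _ => Finset.sum_eq_zero fun u _ => ?_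
      rw [hF.eq_zero hw (by simp), mul_zero]

/-- The analogue of `IsLinear.barD` for the internal differential. -/
lemma IsLinear.intD (d : Finset ι → Finset ι → k) {F : List (Finset ι) → k}
    (hF : IsLinear F) (v : List ι) {w : Finset ι} (hw : w.card ≠ 1) (l : List (Finset ι)) :
    intD d (chAlg e).par F ((v.map fun a => ({a} : Finset ι)) ++ w :: l) = (-1) ^ v.length *
      ∑ t, d t w * F ((v.map fun a => ({a} : Finset ι)) ++ t :: l) := by
  induction v generalizing F with
  | nil =>
    rw [List.map_nil, List.nil_append, intD_cons, hF.cut_eq_zero hw, map_zero, Pi.zero_apply]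
    simp
  | cons a v ih =>
    rw [List.map_cons, List.cons_append, intD_cons, ih (hF.cut {a}), Finset.sum_eq_zero]
    · have hp : psign k ((chAlg e).par {a}) = -1 := by
        simp [BasedDGAlgebra.par, chAlg]
      rw [hp, List.length_cons, pow_succ]
      simp only [cut_apply, List.cons_append]
      ring
    · intro t _
      rw [hF.eq_zero hw (by simp), mul_zero]

/-- The differential of a chain in generators, at a tensor with a factor `w` that is not a
generator. -/
lemma hochTot_of_isLinear {Y : Finset ι → List (Finset ι) → k} (hY : ∀ s, IsLinear (Y s))
    (s : Finset ι) (v : List ι) {w : Finset ι} (hw : w.card ≠ 1) (l : List (Finset ι)) :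
    hochTot (chAlg e).mul (chAlg e).diff (chAlg e).par Y s
        ((v.map fun a => ({a} : Finset ι)) ++ w :: l) =
      -(-1) ^ v.length * (∑ t, ∑ u, (chAlg e).mul t u w *
          Y s ((v.map fun a => ({a} : Finset ι)) ++ t :: u :: l) -
        (-1) ^ (v.length + 1 + l.length + s.card) * ∑ t, (chAlg e).diff t w *
          Y s ((v.map fun a => ({a} : Finset ι)) ++ t :: l)) := by
  have hmem : w ∈ (v.map fun a => ({a} : Finset ι)) ++ w :: l := by simp
  have hcut : cut s (uncons Y) = Y s := rfl
  have h1 : ∀ t u, Y t (u :: ((v.map fun a => ({a} : Finset ι)) ++ w :: l)) = 0 := fun t u =>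
    (hY t).eq_zero hw (List.mem_cons_of_mem _ hmem)
  have h2 : ∀ t u, Y t (((v.map fun a => ({a} : Finset ι)) ++ w :: l) ++ [u]) = 0 := fun t u =>
    (hY t).eq_zero hw (List.mem_append_left _ hmem)
  have h3 : ∀ t, Y t ((v.map fun a => ({a} : Finset ι)) ++ w :: l) = 0 := fun t =>
    (hY t).eq_zero hw hmem
  rw [hochTot_apply, hochMul_apply, hochInt_apply, cycD_apply, barD_cons, intD_cons, hcut,
    (hY s).barD _ v hw l, (hY s).intD e _ v hw l]
  simp only [uncons_cons, h1, h2, h3, mul_zero, Finset.sum_const_zero]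
  have hp : psign k ((chAlg e).par s) = (-1) ^ s.card := psign_natCast _
  rw [hp, psign_natCast]
  simp only [List.length_append, List.length_map, List.length_cons, pow_add]
  ring

lemma sum_sum_singleton {M : Type*} [AddCommMonoid M] (f : Finset ι → Finset ι → M)
    (h : ∀ s t, s.card ≠ 1 ∨ t.card ≠ 1 → f s t = 0) :
    ∑ s, ∑ t, f s t = ∑ a, ∑ b, f {a} {b} := by
  rw [sum_eq_sum_singleton _ fun s hs => Finset.sum_eq_zero fun t _ => h s t (Or.inl hs)]
  exact Finset.sum_congr rfl fun a _ => sum_eq_sum_singleton _ fun t ht => h _ t (Or.inr ht)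

/-- The products of two generators, up to a common sign. -/
lemma exists_mul_pair [CharZero k] {p q : ι} (hpq : p ≠ q) : ∃ c : k, c * c = 1 ∧
    ∀ a b, (chAlg e).mul {a} {b} {p, q} = c * ((if a = p then 1 else 0) * (if b = q then 1 else 0) -
      (if a = q then 1 else 0) * (if b = p then 1 else 0)) := by
  have key : ∀ {a b : ι} (h : b ≠ a), ∃ c : k, c * c = 1 ∧ ∀ s, (chAlg e).mul {a} {b} s =
      if s = {a, b} then c else 0 := by
    intro a b h
    obtain ⟨c, hc, h'⟩ := mul_singleton_of_notMem e (s := {a}) (a := b) (by simpa using h)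
    refine ⟨c, hc, fun s => ?_⟩
    rw [chAlg_mul_def, h', map_smul, Finsupp.smul_apply, Module.Basis.repr_self,
      Finsupp.single_apply, Finset.pair_comm]
    simp only [eq_comm, smul_eq_mul, mul_ite, mul_one, mul_zero]
  obtain ⟨c, hc, h⟩ := key hpq.symm
  refine ⟨c, hc, fun a b => ?_⟩
  by_cases h1 : a = p ∧ b = q
  · obtain ⟨rfl, rfl⟩ := h1
    rw [h, if_pos rfl]
    simp [hpq, hpq.symm]
  by_cases h2 : a = q ∧ b = p
  · obtain ⟨rfl, rfl⟩ := h2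
    rw [mul_singleton_comm, h, Finset.pair_comm, if_pos rfl]
    simp [hpq, hpq.symm, psign]
  · have hzero : (chAlg e).mul {a} {b} {p, q} = 0 := by
      by_cases hab : b = a
      · rw [hab]
        exact mul_singleton_of_mem e (Finset.mem_singleton_self a) _
      · obtain ⟨c', -, h'⟩ := key hab
        rw [h', if_neg]
        intro heq
        have ha : a ∈ ({p, q} : Finset ι) := by rw [heq]; simp
        have hb : b ∈ ({p, q} : Finset ι) := by rw [heq]; simp
        simp only [Finset.mem_insert, Finset.mem_singleton] at ha hb
        rcases ha with rfl | rfl <;> rcases hb with rfl | rfl <;> simp_all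
    rw [hzero]
    by_cases ha : a = p
    · have hb : b ≠ q := fun hb => h1 ⟨ha, hb⟩
      have ha' : a ≠ q := fun h => hpq (ha.symm.trans h)
      simp [hb, ha']
    · by_cases ha' : a = q
      · have hb : b ≠ p := fun hb => h2 ⟨ha', hb⟩
        simp [ha, hb]
      · simp [ha, ha']

lemma sum_mul_pair {p q : ι} {c : k} (hc : ∀ a b, (chAlg e).mul {a} {b} {p, q} =
      c * ((if a = p then 1 else 0) * (if b = q then 1 else 0) -
        (if a = q then 1 else 0) * (if b = p then 1 else 0))) (H : ι → ι → k) :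
    ∑ a, ∑ b, (chAlg e).mul {a} {b} {p, q} * H a b = c * (H p q - H q p) := by
  simp only [hc, mul_sub, sub_mul, Finset.sum_sub_distrib]
  simp [mul_assoc]

/-- The internal differential of a generator, in terms of the sign `c` in the product of two
generators. -/
lemma diff_pair [CharZero k] {p q : ι} {c : k} (hc : ∀ a b, (chAlg e).mul {a} {b} {p, q} =
      c * ((if a = p then 1 else 0) * (if b = q then 1 else 0) -
        (if a = q then 1 else 0) * (if b = p then 1 else 0))) (t : ι) :
    (chAlg e).diff {t} {p, q} = -(c * structConst e p q t) := by
  have h : (chAlg e).diff {t} {p, q} = -(2 : k)⁻¹ * ∑ a, ∑ b,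
      (chAlg e).mul {a} {b} {p, q} * structConst e a b t := by
    rw [chAlg_diff_def, chBasis_singleton, ceD_ι, map_smul, Finsupp.smul_apply, smul_eq_mul]
    simp only [map_sum, map_smul, Finsupp.coe_finsetSum, Finset.sum_apply, Finsupp.smul_apply,
      smul_eq_mul, chAlg_mul_def, chBasis_singleton]
    congr 1
    exact Finset.sum_congr rfl fun a _ => Finset.sum_congr rfl fun b _ => mul_comm _ _
  rw [h, sum_mul_pair e hc fun a b => structConst e a b t, structConst_skew e q p]
  field_simp
  ring

/-- The sign that relates a chain in generators with a family of functions on words. -/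
noncomputable def wordSign (k : Type*) [Field k] (m i : ℕ) : k :=
  (-1) ^ (i + i * m + i.choose 2)

lemma wordSign_mul_self (m i : ℕ) : wordSign k m i * wordSign k m i = 1 := by
  rw [wordSign, ← mul_pow]
  simp

lemma wordSign_succ (m i : ℕ) : wordSign k m (i + 1) = -(-1) ^ (m + i) * wordSign k m i := by
  rw [wordSign, wordSign, Nat.choose_succ_succ', Nat.choose_one_right]
  simp only [pow_add, add_mul, pow_one, one_mul]
  ring

/-- The functions on words that are compatible with the commutation relations of `g`. -/
def IsLieFunction (φ : List ι → k) : Prop := ∀ (l : List ι) (p q : ι) (l' : List ι),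
  φ (l ++ p :: q :: l') - φ (l ++ q :: p :: l') = ∑ t, structConst e p q t * φ (l ++ t :: l')

/-- For a chain in generators, having a differential in generators amounts to the commutation
relations. -/
lemma hochTot_pair [CharZero k] {Y : Finset ι → List (Finset ι) → k} (hY : ∀ s, IsLinear (Y s))
    {φ : List ι → k} {s : Finset ι}
    (hφ : ∀ v, Y s (v.map fun a => ({a} : Finset ι)) = wordSign k s.card v.length * φ v)
    (l l' : List ι) {p q : ι} (hpq : p ≠ q) : ∃ c : k, c ≠ 0 ∧
      hochTot (chAlg e).mul (chAlg e).diff (chAlg e).par Y s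
        ((l.map fun a => ({a} : Finset ι)) ++ {p, q} :: l'.map fun a => ({a} : Finset ι)) =
      c * (φ (l ++ p :: q :: l') - φ (l ++ q :: p :: l') -
        ∑ t, structConst e p q t * φ (l ++ t :: l')) := by
  obtain ⟨c, hc1, hc⟩ := exists_mul_pair e hpq
  have hw : ({p, q} : Finset ι).card ≠ 1 := by rw [Finset.card_pair hpq]; decide
  have hφ' : ∀ u : List ι, Y s ((l.map fun a => ({a} : Finset ι)) ++
      (u ++ l').map fun a => ({a} : Finset ι)) =
      wordSign k s.card (l.length + u.length + l'.length) * φ (l ++ (u ++ l')) := by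
    intro u
    rw [← List.map_append, hφ]
    simp only [List.length_append, add_assoc]
  rw [hochTot_of_isLinear e hY s l hw, sum_sum_singleton, sum_eq_sum_singleton]
  · have h2 : ∀ a b, Y s ((l.map fun a => ({a} : Finset ι)) ++
        {a} :: {b} :: l'.map fun a => ({a} : Finset ι)) =
        wordSign k s.card (l.length + l'.length + 1 + 1) * φ (l ++ a :: b :: l') := fun a b =>
      (hφ' [a, b]).trans (by
        rw [List.length_cons, List.length_singleton, add_right_comm]; rfl)
    have h1 : ∀ a, Y s ((l.map fun a => ({a} : Finset ι)) ++
        {a} :: l'.map fun a => ({a} : Finset ι)) =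
        wordSign k s.card (l.length + l'.length + 1) * φ (l ++ a :: l') := fun a =>
      (hφ' [a]).trans (by rw [List.length_singleton, add_right_comm]; rfl)
    simp only [h1, h2]
    rw [sum_mul_pair e hc fun a b => wordSign k s.card (l.length + l'.length + 1 + 1) *
      φ (l ++ a :: b :: l')]
    simp only [diff_pair e hc]
    rw [wordSign_succ, List.length_map]
    refine ⟨(-1) ^ l.length * c * ((-1) ^ (s.card + (l.length + l'.length + 1)) *
      wordSign k s.card (l.length + l'.length + 1)), ?_, ?_⟩
    · refine mul_ne_zero (mul_ne_zero (pow_ne_zero _ (by simp)) ?_)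
        (mul_ne_zero (pow_ne_zero _ (by simp)) ?_)
      · rintro rfl; simp at hc1
      · intro h
        have := wordSign_mul_self (k := k) s.card (l.length + l'.length + 1)
        rw [h] at this
        simp at this
    · have hsum : ∑ t, -(c * structConst e p q t) *
          (wordSign k s.card (l.length + l'.length + 1) * φ (l ++ t :: l')) =
          -(c * wordSign k s.card (l.length + l'.length + 1)) *
            ∑ t, structConst e p q t * φ (l ++ t :: l') := by
        rw [Finset.mul_sum]
        exact Finset.sum_congr rfl fun t _ => by ring
      have hexp : l.length + 1 + l'.length + s.card = s.card + (l.length + l'.length + 1) := by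
        ring
      rw [hsum, hexp]
      ring
  · intro t ht
    rw [(hY s).eq_zero ht (by simp), mul_zero]
  · rintro t u (h | h)
    · rw [(hY s).eq_zero h (by simp), mul_zero]
    · rw [(hY s).eq_zero h (by simp), mul_zero]

end LinearTails

/-! ### Linear forms on the enveloping algebra as functions on words -/

section LieFunctions

attribute [local instance 100] LieRing.ofAssociativeRing

variable {k g ι : Type*} [Field k] [LieRing g] [LieAlgebra k g]
variable [Fintype ι] [LinearOrder ι] (e : Module.Basis ι k g)
variable [CharZero k]

lemma isLieFunction_envWord (f : Module.Dual k (UniversalEnvelopingAlgebra k g)) :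
    IsLieFunction e fun v => f (envWord e v) := by
  intro l p q l'
  simp only [envWord_append, envWord_cons]
  rw [← map_sub, ← mul_sub, ← mul_assoc, ← mul_assoc, ← sub_mul, ι_mul_sub_ι_mul, Finset.sum_mul,
    Finset.mul_sum, map_sum]
  exact Finset.sum_congr rfl fun t _ => by rw [smul_mul_assoc, mul_smul_comm, map_smul, smul_eq_mul]

/-- The space of functions on words that are compatible with the commutation relations. -/
def lieFunctions : Submodule k (List ι → k) where
  carrier := {φ | IsLieFunction e φ}
  zero_mem' := fun l p q l' => by simp
  add_mem' := fun {φ ψ} hφ hψ l p q l' => by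
    simp only [Pi.add_apply, mul_add, Finset.sum_add_distrib, ← hφ l p q l', ← hψ l p q l']
    ring
  smul_mem' := fun r φ hφ l p q l' => by
    simp only [Pi.smul_apply, smul_eq_mul, mul_left_comm _ r, ← Finset.mul_sum, ← hφ l p q l']
    ring

/-- The action of a basis vector of `g` by appending it to words. -/
def appendLetter (a : ι) : Module.End k (lieFunctions e) where
  toFun φ := ⟨fun l => φ.1 (l ++ [a]), fun l p q l' => by
    simpa only [List.append_assoc, List.cons_append] using φ.2 l p q (l' ++ [a])⟩
  map_add' _ _ := rfl
  map_smul' _ _ := rfl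

lemma appendLetter_apply (a : ι) (φ : lieFunctions e) (l : List ι) :
    (appendLetter e a φ).1 l = φ.1 (l ++ [a]) := rfl

lemma lie_appendLetter (p q : ι) :
    ⁅appendLetter e p, appendLetter e q⁆ = ∑ t, structConst e p q t • appendLetter e t := by
  refine LinearMap.ext fun φ => Subtype.ext (funext fun l => ?_)
  have hlie : ⁅appendLetter e p, appendLetter e q⁆ =
    appendLetter e p * appendLetter e q - appendLetter e q * appendLetter e p := rfl
  rw [hlie, LinearMap.sum_apply, LinearMap.sub_apply]
  have h := φ.2 l p q []
  simp only [Submodule.coe_sum, Finset.sum_apply]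
  refine Eq.trans ?_ h
  change φ.1 ((l ++ [p]) ++ [q]) - φ.1 ((l ++ [q]) ++ [p]) = _
  simp only [List.append_assoc, List.cons_append, List.nil_append]

/-- The action of the enveloping algebra on functions on words. -/
noncomputable def wordRep : UniversalEnvelopingAlgebra k g →ₐ[k] Module.End k (lieFunctions e) :=
  UniversalEnvelopingAlgebra.lift k
    { e.constr k (appendLetter e) with
      map_lie' := fun {x y} => map_lie_of_basis e (e.constr k (appendLetter e)) (fun p q => by
        simp only [Module.Basis.constr_basis, lie_appendLetter, lie_eq_sum_structConst, map_sum,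
          map_smul]) x y }

lemma wordRep_ι (a : ι) : wordRep e (UniversalEnvelopingAlgebra.ι k (e a)) = appendLetter e a := by
  rw [wordRep, UniversalEnvelopingAlgebra.lift_ι_apply]
  exact e.constr_basis k _ a

lemma wordRep_envWord (v : List ι) (φ : lieFunctions e) (l : List ι) :
    (wordRep e (envWord e v) φ).1 l = φ.1 (l ++ v) := by
  induction v generalizing l with
  | nil => rw [envWord_nil, map_one, List.append_nil]; rfl
  | cons a v ih =>
    rw [envWord_cons, map_mul, Module.End.mul_apply, wordRep_ι, appendLetter_apply, ih,
      List.append_assoc, List.singleton_append]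

/-- Functions on words that are compatible with the commutation relations are linear forms on the
enveloping algebra. -/
theorem IsLieFunction.exists_dual {φ : List ι → k} (hφ : IsLieFunction e φ) :
    ∃ f : Module.Dual k (UniversalEnvelopingAlgebra k g), ∀ v, f (envWord e v) = φ v := by
  let ψ : lieFunctions e := ⟨φ, hφ⟩
  refine ⟨{ toFun := fun u => (wordRep e u ψ).1 []
            map_add' := fun u v => by rw [map_add]; rfl
            map_smul' := fun r u => by rw [map_smul]; rfl }, fun v => ?_⟩
  exact wordRep_envWord e v ψ []

end LieFunctions

/-! ### Linear chains -/

section LinearChains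

variable {k g ι : Type*} [Field k] [LieRing g] [LieAlgebra k g]
variable [Fintype ι] [LinearOrder ι] (e : Module.Basis ι k g)

/-- The tensor in generators with given coefficients. -/
def linTail : List (Finset ι) → (List ι → k) → k
  | [], φ => φ []
  | s :: l, φ => ∑ a, if s = {a} then linTail l (fun v => φ (a :: v)) else 0

lemma linTail_map_singleton (φ : List ι → k) (v : List ι) :
    linTail (v.map fun a => ({a} : Finset ι)) φ = φ v := by
  induction v generalizing φ with
  | nil => rfl
  | cons a v ih => simp [linTail, ih, Finset.singleton_inj]

lemma isLinear_linTail (φ : List ι → k) : IsLinear fun l => linTail l φ := by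
  intro l
  induction l generalizing φ with
  | nil => simp
  | cons s l ih =>
    intro h u hu
    obtain ⟨a, -, ha⟩ := Finset.exists_ne_zero_of_sum_ne_zero h
    have hs : s = {a} := by
      by_contra hs
      exact ha (if_neg hs)
    rw [if_pos hs] at ha
    rcases List.mem_cons.1 hu with rfl | hu
    · rw [hs, Finset.card_singleton]
    · exact ih _ ha u hu

/-- The chain in generators that corresponds to a family of functions on the formal group. -/
noncomputable def linChain (f : Finset ι → Module.Dual k (UniversalEnvelopingAlgebra k g))
    (s : Finset ι) (l : List (Finset ι)) : k :=
  linTail l fun v => wordSign k s.card v.length * f s (envWord e v)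

lemma isLinear_linChain (f : Finset ι → Module.Dual k (UniversalEnvelopingAlgebra k g))
    (s : Finset ι) : IsLinear (linChain e f s) := isLinear_linTail _

lemma linChain_map_singleton (f : Finset ι → Module.Dual k (UniversalEnvelopingAlgebra k g))
    (s : Finset ι) (v : List ι) : linChain e f s (v.map fun a => ({a} : Finset ι)) =
      wordSign k s.card v.length * f s (envWord e v) := linTail_map_singleton _ v

lemma IsLinear.ext {F G : List (Finset ι) → k} (hF : IsLinear F) (hG : IsLinear G)
    (h : ∀ v : List ι, F (v.map fun a => ({a} : Finset ι)) = G (v.map fun a => ({a} : Finset ι))) :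
    F = G := by
  funext l
  by_cases hl : ∀ s ∈ l, s.card = 1
  · obtain ⟨v, rfl⟩ := exists_map_singleton hl
    exact h v
  · obtain ⟨v, w, l', hw, rfl⟩ := exists_first_not_singleton hl
    rw [hF.eq_zero hw (by simp), hG.eq_zero hw (by simp)]

variable [CharZero k]

/-- A chain in generators whose differential is a chain in generators corresponds to a family of
functions on the formal group. -/
lemma exists_eq_linChain {Y : Finset ι → List (Finset ι) → k} (hY : ∀ s, IsLinear (Y s))
    (hD : ∀ s, IsLinear (hochRed (chAlg e) Y s)) :
    ∃ f : Finset ι → Module.Dual k (UniversalEnvelopingAlgebra k g), Y = linChain e f := by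
  have hφ : ∀ (s : Finset ι) (v : List ι), Y s (v.map fun a => ({a} : Finset ι)) =
      wordSign k s.card v.length *
        (wordSign k s.card v.length * Y s (v.map fun a => ({a} : Finset ι))) := fun s v => by
    rw [← mul_assoc, wordSign_mul_self, one_mul]
  have hlie : ∀ s, IsLieFunction e fun v =>
      wordSign k s.card v.length * Y s (v.map fun a => ({a} : Finset ι)) := by
    intro s l p q l'
    by_cases hpq : p = q
    · rw [hpq, sub_self]
      exact (Finset.sum_eq_zero fun t _ => by
        rw [structConst, lie_self, map_zero, Finsupp.zero_apply, zero_mul]).symm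
    · obtain ⟨c, hc, h⟩ := hochTot_pair e hY (hφ s) l l' hpq
      have hcard : ({p, q} : Finset ι).card = 2 := Finset.card_pair hpq
      have hl : (chAlg e).unit ∉ (l.map fun a => ({a} : Finset ι)) ++
          {p, q} :: l'.map fun a => ({a} : Finset ι) := by
        intro hmem
        have h0 : ∀ a, ¬ ({a} : Finset ι) = (chAlg e).unit := fun a => Finset.singleton_ne_empty a
        have h1 : (chAlg e).unit ≠ ({p, q} : Finset ι) := fun h => by
          rw [← h] at hcard; simp [chAlg] at hcard
        simp [h0, h1] at hmem
      rw [← hochRed_of_notMem (chAlg e) _ _ hl, (hD s).eq_zero (w := {p, q}) (by rw [hcard]; decide)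
        (by simp)] at h
      exact sub_eq_zero.1 ((mul_eq_zero.1 h.symm).resolve_left hc)
  choose f hf using fun s => (hlie s).exists_dual
  refine ⟨f, funext fun s => (hY s).ext (isLinear_linChain e f s) fun v => ?_⟩
  rw [linChain_map_singleton, hf, ← hφ]

/-- A factor of the differential that is not a generator has degree two and is alone to be so, and
its coefficient vanishes by the commutation relations. -/
lemma isLinear_hochRed_linChain (f : Finset ι → Module.Dual k (UniversalEnvelopingAlgebra k g))
    (s : Finset ι) : IsLinear (hochRed (chAlg e) (linChain e f) s) := by
  intro l hl
  have hmem : (chAlg e).unit ∉ l := fun h => hl (hochRed_of_mem _ _ _ h)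
  rw [hochRed_of_notMem _ _ _ hmem] at hl
  by_contra hne
  obtain ⟨v, w, l', hw, rfl⟩ := exists_first_not_singleton hne
  have hY := isLinear_linChain e f
  have hw0 : w.card ≠ 0 := fun h => hmem (by rw [Finset.card_eq_zero.1 h]; simp [chAlg])
  by_cases h2 : w.card = 2 ∧ ∀ t ∈ l', t.card = 1
  · obtain ⟨p, q, hpq, rfl⟩ := Finset.card_eq_two.1 h2.1
    obtain ⟨v', rfl⟩ := exists_map_singleton h2.2
    obtain ⟨c, -, h⟩ := hochTot_pair e hY (linChain_map_singleton e f s) v v' hpq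
    rw [isLieFunction_envWord e (f s) v p q v', sub_self, mul_zero] at h
    exact hl h
  · refine hl ?_
    rw [hochTot_of_isLinear e hY s v hw l', Finset.sum_eq_zero, Finset.sum_eq_zero]
    · simp
    · intro t _
      by_contra hne'
      have hlin := hY s _ (right_ne_zero_of_mul hne')
      have hcard := card_of_diff_ne_zero e (left_ne_zero_of_mul hne')
      rw [hlin t (by simp)] at hcard
      exact h2 ⟨hcard, fun x hx => hlin x (by simp [hx])⟩
    · refine fun t _ => Finset.sum_eq_zero fun u _ => ?_
      by_contra hne'
      have hlin := hY s _ (right_ne_zero_of_mul hne')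
      have hcard := card_of_mul_ne_zero e (left_ne_zero_of_mul hne')
      rw [hlin t (by simp), hlin u (by simp)] at hcard
      exact h2 ⟨hcard, fun x hx => hlin x (by simp [hx])⟩

/-- The image of a chain in generators under the Hochschild--Kostant--Rosenberg map. -/
lemma formPart_hkr {Y : Finset ι → List (Finset ι) → k} (hY : ∀ s, IsLinear (Y s)) (s : Finset ι)
    {f : Module.Dual k (UniversalEnvelopingAlgebra k g)}
    (hf : ∀ v : List ι, Y s (v.map fun a => ({a} : Finset ι)) =
      wordSign k s.card v.length * f (envWord e v)) :
    formPart e s (hkr e (toChain Y)) = expStar e f := by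
  refine ext_homogeneousComponent fun n => ?_
  rw [← formPart_formProj, formProj_hkr, hkrComponent_toChain, map_smul, formPart_hkrRaw e n hY,
    homogeneousComponent_expStar, expPart, smul_smul]
  have h : (wordSeries n fun v => Y s (v.map fun a => ({a} : Finset ι))) =
      wordSign k s.card n • wordSeries n fun v => f (envWord e v) := by
    rw [← wordSeries_smul]
    refine wordSeries_congr n fun v hv => ?_
    rw [hf, hv]
    rfl
  rw [h, smul_smul]
  congr 1
  have h1 : (-1 : k) ^ n * ((-1) ^ (n * s.card) * (-1) ^ (n.choose 2)) = wordSign k s.card n := by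
    rw [wordSign, pow_add, pow_add, mul_assoc]
  rw [div_mul_eq_mul_div, h1, div_mul_eq_mul_div, wordSign_mul_self, one_div]

lemma hkr_linChain (f : Finset ι → Module.Dual k (UniversalEnvelopingAlgebra k g)) :
    hkr e (toChain (linChain e f)) = ∑ s, chBasis e s ⊗ₜ[k] expStar e (f s) := by
  refine forms_ext e fun s => ?_
  rw [formPart_sum]
  exact formPart_hkr e (isLinear_linChain e f) s (linChain_map_singleton e f s)

/-- Every form comes from a chain in generators whose differential is a chain in generators. -/
lemma exists_hkr_linChain_eq (ω : Forms k g ι) :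
    ∃ f : Finset ι → Module.Dual k (UniversalEnvelopingAlgebra k g),
      hkr e (toChain (linChain e f)) = ω ∧ ∀ s, formPart e s ω = expStar e (f s) := by
  choose f hf using fun s => (expStar_bijective e).2 (formPart e s ω)
  refine ⟨f, ?_, fun s => (hf s).symm⟩
  rw [hkr_linChain]
  simp only [hf]
  exact sum_formPart e ω

lemma linChain_eq_zero {f : Finset ι → Module.Dual k (UniversalEnvelopingAlgebra k g)}
    (h : hkr e (toChain (linChain e f)) = 0) : f = 0 := by
  funext s
  refine (expStar_bijective e).1 ?_
  have h1 := congrArg (formPart e s) h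
  rw [hkr_linChain, formPart_sum, map_zero] at h1
  rw [h1]
  exact (map_zero _).symm

/-- The chain in generators of a form of degree `n` has degree `n`. -/
lemma linChain_isHochDeg {n : ℤ} {f : Finset ι → Module.Dual k (UniversalEnvelopingAlgebra k g)}
    (h : ∀ s, f s ≠ 0 → (s.card : ℤ) = n) : IsHochDeg n (linChain e f) := by
  intro s l hl
  obtain ⟨v, rfl⟩ := exists_map_singleton (isLinear_linChain e f s l hl)
  rw [linChain_map_singleton] at hl
  have hs := h s fun h0 => hl (by rw [h0]; simp)
  refine ⟨by simp, ?_⟩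
  rw [listCard_singletons, List.length_map, ← hs]
  push_cast
  ring

end LinearChains

/-! ### The deformed Hochschild differential -/

section Deformation

variable {k g ι : Type*} [Field k] [LieRing g] [LieAlgebra k g]
variable [Fintype ι] [LinearOrder ι] (e : Module.Basis ι k g) (B : LinearMap.BilinForm k g)
variable [CharZero k]

lemma fst_barD_eps (G : List (Finset ι) → k[ε]) (l : List (Finset ι)) :
    (barD (chAlgEps e B).mul G l).fst = barD (chAlg e).mul (fun l => (G l).fst) l := by
  induction l generalizing G with
  | nil => rfl
  | cons s l ih =>
    rw [barD_cons, barD_cons, TrivSqZeroExt.fst_sub, ih]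
    simp only [fst_sum, chAlgEps_mul_def, TrivSqZeroExt.fst_mul, TrivSqZeroExt.fst_add,
      TrivSqZeroExt.fst_inl, TrivSqZeroExt.fst_inr, add_zero]
    rfl

lemma snd_barD_eps (G : List (Finset ι) → k[ε]) (l : List (Finset ι)) :
    (barD (chAlgEps e B).mul G l).snd = barD (chAlg e).mul (fun l => (G l).snd) l +
      barD (poissonCoeff e B) (fun l => (G l).fst) l := by
  induction l generalizing G with
  | nil => exact (add_zero _).symm
  | cons s l ih =>
    rw [barD_cons, barD_cons, barD_cons, TrivSqZeroExt.snd_sub, ih]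
    simp only [snd_sum, chAlgEps_mul_def, TrivSqZeroExt.snd_mul, TrivSqZeroExt.fst_add,
      TrivSqZeroExt.snd_add, TrivSqZeroExt.fst_inl, TrivSqZeroExt.fst_inr, TrivSqZeroExt.snd_inl,
      TrivSqZeroExt.snd_inr, add_zero, zero_add, smul_eq_mul, MulOpposite.smul_eq_mul_unop,
      MulOpposite.unop_op, Finset.sum_add_distrib]
    change _ - (barD _ (cut s fun l => (G l).snd) l + barD _ (cut s fun l => (G l).fst) l) = _
    ring

lemma fst_intD_eps (G : List (Finset ι) → k[ε]) (l : List (Finset ι)) :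
    (intD (chAlgEps e B).diff (chAlgEps e B).par G l).fst =
      intD (chAlg e).diff (chAlg e).par (fun l => (G l).fst) l := by
  induction l generalizing G with
  | nil => rfl
  | cons s l ih =>
    rw [intD_cons, intD_cons, TrivSqZeroExt.fst_add, TrivSqZeroExt.fst_mul, ih, psign_dual]
    simp only [fst_sum, chAlgEps_diff_def, TrivSqZeroExt.fst_mul, TrivSqZeroExt.fst_inl]
    rfl

lemma snd_intD_eps (G : List (Finset ι) → k[ε]) (l : List (Finset ι)) :
    (intD (chAlgEps e B).diff (chAlgEps e B).par G l).snd =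
      intD (chAlg e).diff (chAlg e).par (fun l => (G l).snd) l := by
  induction l generalizing G with
  | nil => rfl
  | cons s l ih =>
    rw [intD_cons, intD_cons, TrivSqZeroExt.snd_add, TrivSqZeroExt.snd_mul, ih, psign_dual]
    simp only [snd_sum, chAlgEps_diff_def, TrivSqZeroExt.snd_mul, TrivSqZeroExt.fst_inl,
      TrivSqZeroExt.snd_inl, smul_zero, add_zero, smul_eq_mul]
    rfl

open Classical in
/-- The Hochschild differential of the Poisson bracket: the first order deformation of the
Hochschild differential on functions on lists. -/
noncomputable def poissonD :
    (Finset ι → List (Finset ι) → k) →ₗ[k] (Finset ι → List (Finset ι) → k) where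
  toFun Y s l := if ∅ ∈ l then 0 else hochMul (poissonCoeff e B) (chAlg e).par Y s l
  map_add' Y Z := by
    funext s l
    by_cases h : ∅ ∈ l <;> simp [h]
  map_smul' r Y := by
    funext s l
    by_cases h : ∅ ∈ l <;> simp [h]

lemma poissonD_of_mem (Y : Finset ι → List (Finset ι) → k) (s : Finset ι) {l : List (Finset ι)}
    (h : ∅ ∈ l) : poissonD e B Y s l = 0 := if_pos h

lemma poissonD_of_notMem (Y : Finset ι → List (Finset ι) → k) (s : Finset ι)
    {l : List (Finset ι)} (h : ∅ ∉ l) :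
    poissonD e B Y s l = hochMul (poissonCoeff e B) (chAlg e).par Y s l := if_neg h

lemma fst_uncons (Y : Finset ι → List (Finset ι) → k[ε]) :
    (fun l => (uncons Y l).fst) = uncons fun s l => (Y s l).fst := by
  funext l; cases l <;> rfl

lemma snd_uncons (Y : Finset ι → List (Finset ι) → k[ε]) :
    (fun l => (uncons Y l).snd) = uncons fun s l => (Y s l).snd := by
  funext l; cases l <;> rfl

lemma par_eps : (chAlgEps e B).par = (chAlg e).par := rfl

lemma fst_hochRed_eps (Y : Finset ι → List (Finset ι) → k[ε]) (s : Finset ι)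
    (l : List (Finset ι)) :
    (hochRed (chAlgEps e B) Y s l).fst = hochRed (chAlg e) (fun s l => (Y s l).fst) s l := by
  by_cases h : ∅ ∈ l
  · rw [hochRed_of_mem (chAlgEps e B) _ _ h, hochRed_of_mem (chAlg e) _ _ h]
    rfl
  · rw [hochRed_of_notMem (chAlgEps e B) _ _ h, hochRed_of_notMem (chAlg e) _ _ h, hochTot_apply,
      hochTot_apply, hochMul_apply, hochMul_apply, hochInt_apply, hochInt_apply,
      TrivSqZeroExt.fst_add, TrivSqZeroExt.fst_add, TrivSqZeroExt.fst_mul, fst_barD_eps,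
      fst_intD_eps, fst_uncons, cycD_apply, cycD_apply, psign_dual, psign_dual,
      TrivSqZeroExt.fst_mul]
    simp only [fst_sum, chAlgEps_mul_def, psign_dual, TrivSqZeroExt.fst_mul, TrivSqZeroExt.fst_add,
      TrivSqZeroExt.fst_inl, TrivSqZeroExt.fst_inr, add_zero, par_eps]

/-- The component at `ε` of the deformed differential. -/
lemma snd_hochRed_eps (Y : Finset ι → List (Finset ι) → k[ε]) (s : Finset ι)
    (l : List (Finset ι)) :
    (hochRed (chAlgEps e B) Y s l).snd = hochRed (chAlg e) (fun s l => (Y s l).snd) s l +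
      poissonD e B (fun s l => (Y s l).fst) s l := by
  by_cases h : ∅ ∈ l
  · rw [hochRed_of_mem (chAlgEps e B) _ _ h, hochRed_of_mem (chAlg e) _ _ h,
      poissonD_of_mem e B _ _ h, add_zero]
    rfl
  · rw [hochRed_of_notMem (chAlgEps e B) _ _ h, hochRed_of_notMem (chAlg e) _ _ h,
      poissonD_of_notMem e B _ _ h, hochTot_apply,
      hochTot_apply, hochMul_apply, hochMul_apply, hochMul_apply, hochInt_apply, hochInt_apply,
      TrivSqZeroExt.snd_add, TrivSqZeroExt.snd_add, TrivSqZeroExt.snd_mul, snd_barD_eps,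
      snd_intD_eps, snd_uncons, fst_uncons, cycD_apply, cycD_apply, cycD_apply, psign_dual,
      psign_dual, TrivSqZeroExt.snd_mul]
    simp only [snd_sum, fst_sum, chAlgEps_mul_def, psign_dual, TrivSqZeroExt.snd_mul,
      TrivSqZeroExt.fst_mul, TrivSqZeroExt.fst_add, TrivSqZeroExt.snd_add,
      TrivSqZeroExt.fst_inl, TrivSqZeroExt.fst_inr, TrivSqZeroExt.snd_inl, TrivSqZeroExt.snd_inr,
      add_zero, zero_add, smul_eq_mul, MulOpposite.smul_eq_mul_unop, MulOpposite.unop_op,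
      par_eps, smul_zero, mul_zero, Finset.sum_add_distrib, mul_add]
    ring

lemma fst_hochD_eps (c : HChain k[ε] (Finset ι)) (i : ℕ) (v : Fin (i + 1) → Finset ι) :
    (hochD (chAlgEps e B) c i v).fst = hochD (chAlg e) (fun i v => (c i v).fst) i v := by
  rw [← toChain_ofChain c, hochD_toChain]
  have h : (fun i v => (toChain (ofChain c) i v).fst) =
    toChain fun s l => (ofChain c s l).fst := rfl
  rw [h, hochD_toChain]
  exact fst_hochRed_eps e B _ _ _

lemma firstOrder_toChain (Y : Finset ι → List (Finset ι) → k) :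
    firstOrder e B (toChain Y) = toChain (poissonD e B Y) := by
  funext i v
  have h : (fun i v => TrivSqZeroExt.inl (toChain Y i v) : HChain k[ε] (Finset ι)) =
    toChain fun s l => TrivSqZeroExt.inl (Y s l) := rfl
  rw [firstOrder, h, hochD_toChain]
  refine (snd_hochRed_eps e B _ _ _).trans ?_
  simp only [TrivSqZeroExt.snd_inl, TrivSqZeroExt.fst_inl]
  have h0 : (fun _ _ => 0 : Finset ι → List (Finset ι) → k) = 0 := rfl
  rw [h0, map_zero]
  exact zero_add _

lemma snd_hochD_eps (c : HChain k[ε] (Finset ι)) (i : ℕ) (v : Fin (i + 1) → Finset ι) :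
    (hochD (chAlgEps e B) c i v).snd = hochD (chAlg e) (fun i v => (c i v).snd) i v +
      firstOrder e B (fun i v => (c i v).fst) i v := by
  rw [← toChain_ofChain c, hochD_toChain]
  have h : (fun i v => (toChain (ofChain c) i v).snd) =
    toChain fun s l => (ofChain c s l).snd := rfl
  have h' : (fun i v => (toChain (ofChain c) i v).fst) =
    toChain fun s l => (ofChain c s l).fst := rfl
  rw [h, h', hochD_toChain, firstOrder_toChain]
  exact snd_hochRed_eps e B _ _ _

end Deformation

/-! ### The first order deformation on linear chains -/

section FirstOrder

variable {k g ι : Type*} [Field k] [LieRing g] [LieAlgebra k g]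
variable [Fintype ι] [LinearOrder ι] (e : Module.Basis ι k g) (B : LinearMap.BilinForm k g)

/-- The coefficient at the monomial `s` of half the contraction of the monomial `t` with the vector
that the scalar product on the dual associates to the `a`-th generator. -/
noncomputable def contrCoeff (a : ι) (t s : Finset ι) : k :=
  (2 : k)⁻¹ * ∑ q, (LinearMap.BilinForm.toMatrix e B)⁻¹ a q *
    (chBasis e).repr (contrL (e q) (chBasis e t)) s

lemma contrL_chBasis_singleton (a b : ι) :
    contrL (e b) (chBasis e {a}) = if b = a then 1 else 0 := by
  rw [chBasis_singleton, contrL_ι, Module.Basis.coord_apply, Module.Basis.repr_self,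
    Finsupp.single_apply]
  split_ifs <;> simp

lemma poissonCoeff_singleton_left (a : ι) (t s : Finset ι) :
    poissonCoeff e B {a} t s = contrCoeff e B a t s := by
  rw [poissonCoeff, poisson_apply, contrCoeff]
  congr 1
  simp only [contrL_chBasis_singleton, apply_ite (gradeInv (k := k) (g := g)), map_one, map_zero,
    ite_mul, one_mul, zero_mul]
  rw [Finset.sum_eq_single a]
  · simp [Finsupp.finsetSum_apply]
  · intro b _ hb
    simp [hb]
  · simp

lemma repr_gradeInv (x : Ch k g) (s : Finset ι) :
    (chBasis e).repr (gradeInv x) s = (-1) ^ s.card * (chBasis e).repr x s := by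
  conv_lhs => rw [← (chBasis e).sum_repr x]
  simp only [map_sum, map_smul, gradeInv_chBasis, Module.Basis.repr_self, Finsupp.coe_finsetSum,
    Finset.sum_apply, Finsupp.smul_apply, Finsupp.single_apply, smul_eq_mul, mul_ite, mul_one,
    mul_zero, Finset.sum_ite_eq', Finset.mem_univ, if_true]
  exact mul_comm _ _

lemma toMatrix_inv_symm (hsymm : B.IsSymm) (p q : ι) :
    (LinearMap.BilinForm.toMatrix e B)⁻¹ p q = (LinearMap.BilinForm.toMatrix e B)⁻¹ q p := by
  have h : (LinearMap.BilinForm.toMatrix e B).transpose = LinearMap.BilinForm.toMatrix e B := by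
    ext i j
    simp [LinearMap.BilinForm.toMatrix_apply, hsymm.eq (e j) (e i)]
  have h' := Matrix.transpose_nonsing_inv (LinearMap.BilinForm.toMatrix e B)
  rw [h] at h'
  exact (congrFun (congrFun h' q) p)

lemma poissonCoeff_singleton_right (hsymm : B.IsSymm) (a : ι) (t s : Finset ι) :
    poissonCoeff e B t {a} s = (-1) ^ s.card * contrCoeff e B a t s := by
  rw [poissonCoeff, poisson_apply, contrCoeff, mul_left_comm]
  congr 1
  simp only [contrL_chBasis_singleton, mul_ite, mul_one, mul_zero, smul_ite, smul_zero,
    Finset.sum_ite_eq', Finset.mem_univ, if_true, map_sum, map_smul, Finsupp.coe_finsetSum,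
    Finset.sum_apply, Finsupp.smul_apply, repr_gradeInv, smul_eq_mul, Finset.mul_sum]
  refine Finset.sum_congr rfl fun q _ => ?_
  rw [toMatrix_inv_symm e B hsymm q a]
  ring

variable [CharZero k]

lemma card_of_contrCoeff_ne_zero {a : ι} {t s : Finset ι} (h : contrCoeff e B a t s ≠ 0) :
    t.card = s.card + 1 := by
  rw [← poissonCoeff_singleton_left] at h
  have := card_of_poissonCoeff_ne_zero e B h
  rw [Finset.card_singleton] at this
  omega

/-- The bracket of two generators is a scalar, so it vanishes in the reduced complex. -/
lemma IsLinear.barD_poissonCoeff {F : List (Finset ι) → k} (hF : IsLinear F)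
    {l : List (Finset ι)} (hl : ∅ ∉ l) : ChevalleyHochschild.barD (poissonCoeff e B) F l = 0 := by
  induction l generalizing F with
  | nil => rfl
  | cons w l ih =>
    rw [barD_cons, ih (hF.cut w) fun h => hl (List.mem_cons_of_mem _ h), sub_zero]
    refine Finset.sum_eq_zero fun t _ => Finset.sum_eq_zero fun u _ => ?_
    by_contra h
    have h1 := card_of_poissonCoeff_ne_zero e B (left_ne_zero_of_mul h)
    have h2 := hF _ (right_ne_zero_of_mul h)
    rw [h2 t (by simp), h2 u (by simp)] at h1
    have h3 : w = ∅ := Finset.card_eq_zero.1 (by omega)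
    exact hl (by rw [h3]; exact List.mem_cons_self)

/-- On tensors in generators, only the terms of the deformation that involve the factor with index
zero contribute. -/
lemma poissonD_of_isLinear {Y : Finset ι → List (Finset ι) → k} (hY : ∀ s, IsLinear (Y s))
    (s : Finset ι) {l : List (Finset ι)} (hl : ∅ ∉ l) :
    poissonD e B Y s l = ∑ t, ∑ u, poissonCoeff e B t u s * Y t (u :: l) +
      psign k (l.length + 1) * ∑ t, ∑ u, psign k ((chAlg e).par u *
        ((chAlg e).par t + lpar (chAlg e).par l)) * poissonCoeff e B u t s * Y t (l ++ [u]) := by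
  have hcut : cut s (uncons Y) = Y s := rfl
  rw [poissonD_of_notMem e B Y s hl, hochMul_apply, cycD_apply, barD_cons, hcut,
    (hY s).barD_poissonCoeff e B hl, sub_zero]
  simp only [uncons_cons]

lemma isLinear_poissonD {Y : Finset ι → List (Finset ι) → k} (hY : ∀ s, IsLinear (Y s))
    (s : Finset ι) : IsLinear (poissonD e B Y s) := by
  intro l hl w hw
  by_contra hw1
  have hmem : ∅ ∉ l := fun h => hl (poissonD_of_mem e B Y s h)
  have h1 : ∀ t u, Y t (u :: l) = 0 := fun t u => (hY t).eq_zero hw1 (List.mem_cons_of_mem _ hw)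
  have h2 : ∀ t u, Y t (l ++ [u]) = 0 := fun t u =>
    (hY t).eq_zero hw1 (List.mem_append_left _ hw)
  refine hl ?_
  rw [poissonD_of_isLinear e B hY s hmem]
  simp only [h1, h2, mul_zero, Finset.sum_const_zero, add_zero]

/-- The first order deformation of chains in generators, in terms of the corresponding functions on
the formal group: translations from both sides. -/
lemma poissonD_linChain (hsymm : B.IsSymm)
    (f : Finset ι → Module.Dual k (UniversalEnvelopingAlgebra k g)) (s : Finset ι) (v : List ι) :
    poissonD e B (linChain e f) s (v.map fun a => ({a} : Finset ι)) = wordSign k s.card v.length *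
      (∑ t, ∑ a, contrCoeff e B a t s •
        (f t ∘ₗ LinearMap.mulRight k (UniversalEnvelopingAlgebra.ι k (e a)) +
          f t ∘ₗ LinearMap.mulLeft k (UniversalEnvelopingAlgebra.ι k (e a)))) (envWord e v) := by
  have hl : ∅ ∉ v.map fun a => ({a} : Finset ι) := by simp
  rw [poissonD_of_isLinear e B (isLinear_linChain e f) s hl, LinearMap.sum_apply, Finset.mul_sum,
    Finset.mul_sum, ← Finset.sum_add_distrib]
  refine Finset.sum_congr rfl fun t _ => ?_
  rw [sum_eq_sum_singleton _ fun u hu => by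
      rw [(isLinear_linChain e f t).eq_zero hu List.mem_cons_self, mul_zero],
    sum_eq_sum_singleton _ fun u hu => by
      rw [(isLinear_linChain e f t).eq_zero hu (by simp), mul_zero],
    LinearMap.sum_apply, Finset.mul_sum, Finset.mul_sum, ← Finset.sum_add_distrib]
  refine Finset.sum_congr rfl fun a _ => ?_
  have h1 : linChain e f t ({a} :: v.map fun a => ({a} : Finset ι)) =
      wordSign k t.card (v.length + 1) *
        f t (UniversalEnvelopingAlgebra.ι k (e a) * envWord e v) :=
    linChain_map_singleton e f t (a :: v)
  have h2 : linChain e f t ((v.map fun a => ({a} : Finset ι)) ++ [{a}]) =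
      wordSign k t.card (v.length + 1) *
        f t (envWord e v * UniversalEnvelopingAlgebra.ι k (e a)) := by
    have := linChain_map_singleton e f t (v ++ [a])
    rw [envWord_append, envWord_cons, envWord_nil, mul_one, List.map_append, List.length_append]
      at this
    exact this
  rw [h1, h2, poissonCoeff_singleton_left, poissonCoeff_singleton_right e B hsymm,
    LinearMap.smul_apply, LinearMap.add_apply, LinearMap.comp_apply, LinearMap.comp_apply,
    LinearMap.mulLeft_apply, LinearMap.mulRight_apply, smul_eq_mul]
  by_cases h0 : contrCoeff e B a t s = 0
  · rw [h0]; simp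
  have hcard := card_of_contrCoeff_ne_zero e B h0
  -- The sign of the term with the last factor is the one of the term with the first factor.
  have hw : wordSign k t.card (v.length + 1) = (-1) ^ s.card * wordSign k s.card v.length := by
    rw [hcard, wordSign_succ, wordSign, wordSign]
    rcases neg_one_pow_eq_or k s.card with h | h <;>
    rcases neg_one_pow_eq_or k v.length with h' | h' <;>
    simp [pow_add, mul_add, pow_mul, h, h']
  have hp : psign k (((v.map fun a => ({a} : Finset ι)).length : ZMod 2) + 1) *
      psign k ((chAlg e).par {a} * ((chAlg e).par t +
        lpar (chAlg e).par (v.map fun a => ({a} : Finset ι)))) = (-1) ^ s.card := by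
    have ha : (chAlg e).par {a} = 1 := by simp [BasedDGAlgebra.par, chAlg]
    have ht : (chAlg e).par t = s.card + 1 := by
      have : (chAlg e).par t = (t.card : ZMod 2) := rfl
      rw [this, hcard, Nat.cast_succ]
    rw [lpar_singletons, ha, ht, one_mul, List.length_map, psign_add, psign_add, psign_add,
      psign_natCast, psign_natCast, psign_one]
    rcases neg_one_pow_eq_or k v.length with h' | h' <;> rw [h'] <;> ring
  have hs : (-1 : k) ^ s.card * (-1) ^ s.card = 1 := by rw [← mul_pow]; simp
  rw [hw]
  linear_combination (contrCoeff e B a t s * ((-1) ^ s.card * wordSign k s.card v.length) *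
    f t (envWord e v * UniversalEnvelopingAlgebra.ι k (e a))) * hp +
    (contrCoeff e B a t s * wordSign k s.card v.length *
      (f t (UniversalEnvelopingAlgebra.ι k (e a) * envWord e v) +
      f t (envWord e v * UniversalEnvelopingAlgebra.ι k (e a)))) * hs

variable {VL VR : g →ₗ[k] Derivation k (MvPowerSeries ι k) (MvPowerSeries ι k)}

lemma formPart_halfSum (p : Finset ι → MvPowerSeries ι k) (s : Finset ι) :
    formPart e s (halfSum e B VL VR (∑ t, chBasis e t ⊗ₜ[k] p t)) =
      ∑ t, ∑ a, contrCoeff e B a t s • (VL (e a) (p t) + VR (e a) (p t)) := by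
  simp only [halfSum, secondOrder, LinearMap.smul_apply, LinearMap.add_apply, LinearMap.sum_apply,
    map_smul, map_add, map_sum, TensorProduct.map_tmul, formPart_tmul, contrCoeff, Finset.smul_sum,
    smul_add, Finset.mul_sum, Finset.sum_smul, Finset.sum_add_distrib, mul_smul]
  rfl

/-- The first order deformation corresponds to the half-sum of the invariant second order operators
on chains in generators. -/
theorem hkr_poissonD_linChain (hsymm : B.IsSymm) (hL : IsLeftInvariant e VL)
    (hR : IsRightInvariant e VR)
    (f : Finset ι → Module.Dual k (UniversalEnvelopingAlgebra k g)) :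
    hkr e (toChain (poissonD e B (linChain e f))) =
      halfSum e B VL VR (hkr e (toChain (linChain e f))) := by
  refine forms_ext e fun s => ?_
  rw [formPart_hkr e (isLinear_poissonD e B (isLinear_linChain e f)) s
    (poissonD_linChain e B hsymm f s), hkr_linChain, formPart_halfSum]
  simp only [map_sum, map_smul, map_add]
  exact Finset.sum_congr rfl fun t _ => Finset.sum_congr rfl fun a _ => by rw [hL, hR]

end FirstOrder

/-! ### Comparison of the two complexes -/

section Comparison

variable {k g ι : Type*} [Field k] [CharZero k] [LieRing g] [LieAlgebra k g]
variable [Fintype ι] [LinearOrder ι] (e : Module.Basis ι k g) (B : LinearMap.BilinForm k g)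

lemma hasLinearEntries_toChain {Y : Finset ι → List (Finset ι) → k} :
    HasLinearEntries (toChain Y) ↔ ∀ s, IsLinear (Y s) := by
  refine ⟨fun h s l hl u hu => ?_, fun h i v hv j => h _ _ hv _ (List.mem_ofFn.2 ⟨j, rfl⟩)⟩
  obtain ⟨j, rfl⟩ := List.get_of_mem hu
  have h1 : toChain Y l.length (Fin.cons s l.get) = Y s l := by
    conv_rhs => rw [← ofChain_toChain Y]
    rfl
  exact h l.length (Fin.cons s l.get) (by rwa [h1]) j

lemma firstOrder_add (z w : HChain k (Finset ι)) :
    firstOrder e B (z + w) = firstOrder e B z + firstOrder e B w := by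
  rw [← toChain_ofChain z, ← toChain_ofChain w, firstOrder_toChain, firstOrder_toChain]
  exact (firstOrder_toChain e B (ofChain z + ofChain w)).trans (by rw [map_add]; rfl)

lemma firstOrder_zero : firstOrder e B 0 = 0 := by
  have h := firstOrder_add e B 0 0
  rwa [add_zero, left_eq_add] at h

lemma inl_mem_hochChainsEps {n : ℤ} {z : HChain k (Finset ι)} (hz : z ∈ hochChains (chAlg e) n) :
    (fun i v => TrivSqZeroExt.inl (z i v)) ∈ hochChainsEps (chAlgEps e B) n := by
  refine fun i v => ⟨fun h => (hz i v ?_).1, fun h => (hz i v h).2, fun h => absurd rfl h⟩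
  exact fun h0 => h (congrArg TrivSqZeroExt.inl h0)

lemma snd_mem_hochChains {n : ℤ} {c : HChain k[ε] (Finset ι)}
    (hc : c ∈ hochChainsEps (chAlgEps e B) n) :
    (fun i v => TrivSqZeroExt.snd (c i v)) ∈ hochChains (chAlg e) (n - 2) := by
  refine fun i v h => ⟨(hc i v).1 ?_, eq_sub_of_add_eq ((hc i v).2.2 h)⟩
  exact fun h0 => h (congrArg TrivSqZeroExt.snd h0)

lemma firstOrder_mem {n : ℤ} {z : HChain k (Finset ι)} (hz : z ∈ hochChains (chAlg e) n) :
    firstOrder e B z ∈ hochChains (chAlg e) (n - 1) := by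
  have h := snd_mem_hochChains e B
    ((chAlgEps_isGradedBy e B).hochD_mem_hochChainsEps (inl_mem_hochChainsEps e B hz))
  rwa [show n + 1 - 2 = n - 1 by ring] at h

/-- The first order deformation anticommutes with the Hochschild differential, as the deformed
differential squares to zero. -/
lemma hochD_firstOrder (hnondeg : B.Nondegenerate) (hinv : ∀ x y z : g, B ⁅x, y⁆ z = B x ⁅y, z⁆)
    (z : HChain k (Finset ι)) :
    hochD (chAlg e) (firstOrder e B z) + firstOrder e B (hochD (chAlg e) z) = 0 := by
  have h := hochD_hochD (chAlgEps e B) (chAlgEps_laws e B hnondeg hinv)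
    (fun i v => TrivSqZeroExt.inl (z i v))
  funext i v
  have h1 := congrArg TrivSqZeroExt.snd (congrFun (congrFun h i) v)
  rw [snd_hochD_eps] at h1
  simp only [fst_hochD_eps, TrivSqZeroExt.fst_inl] at h1
  exact h1

/-- The first order deformation corresponds to the half-sum of the invariant second order operators
on chains with linear entries whose differential has linear entries. -/
theorem hkr_firstOrder {VL VR : g →ₗ[k] Derivation k (MvPowerSeries ι k) (MvPowerSeries ι k)}
    (hsymm : B.IsSymm) (hL : IsLeftInvariant e VL) (hR : IsRightInvariant e VR)
    {z : HChain k (Finset ι)} (hz : HasLinearEntries z)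
    (hDz : HasLinearEntries (hochD (chAlg e) z)) :
    hkr e (firstOrder e B z) = halfSum e B VL VR (hkr e z) := by
  rw [← toChain_ofChain z] at hz hDz ⊢
  rw [hochD_toChain] at hDz
  obtain ⟨f, hf⟩ := exists_eq_linChain e (hasLinearEntries_toChain.1 hz)
    (hasLinearEntries_toChain.1 hDz)
  rw [hf, firstOrder_toChain, hkr_poissonD_linChain e B hsymm hL hR]

lemma hasLinearEntries_linChain
    (f : Finset ι → Module.Dual k (UniversalEnvelopingAlgebra k g)) :
    HasLinearEntries (toChain (linChain e f)) :=
  hasLinearEntries_toChain.2 (isLinear_linChain e f)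

lemma hasLinearEntries_hochD_linChain
    (f : Finset ι → Module.Dual k (UniversalEnvelopingAlgebra k g)) :
    HasLinearEntries (hochD (chAlg e) (toChain (linChain e f))) := by
  rw [hochD_toChain]
  exact hasLinearEntries_toChain.2 (isLinear_hochRed_linChain e f)

/-- Linear chains that correspond to functions on the formal group form a subcomplex. -/
lemma exists_hochD_linChain_eq
    (f : Finset ι → Module.Dual k (UniversalEnvelopingAlgebra k g)) :
    ∃ f', hochD (chAlg e) (toChain (linChain e f)) = toChain (linChain e f') := by
  obtain ⟨f', hf'⟩ := exists_eq_linChain e (isLinear_hochRed_linChain e f) fun s => by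
    rw [hochRed_hochRed _ (chAlg_laws e)]
    exact fun l hl => absurd rfl hl
  exact ⟨f', by rw [hochD_toChain, hf']⟩

lemma hochD_linChain_eq_zero {f : Finset ι → Module.Dual k (UniversalEnvelopingAlgebra k g)}
    (h : formsD e (hkr e (toChain (linChain e f))) = 0) :
    hochD (chAlg e) (toChain (linChain e f)) = 0 := by
  obtain ⟨f', hf'⟩ := exists_hochD_linChain_eq e f
  rw [← hkr_hochD, hf'] at h
  rw [hf', linChain_eq_zero e h]
  have h0 : linChain e 0 = 0 := funext fun s => (isLinear_linChain e 0 s).ext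
    (fun l hl => absurd rfl hl) fun v => by rw [linChain_map_singleton]; simp
  rw [h0]
  rfl

/-- Every form of degree `n` comes from a chain in generators of degree `n`. -/
lemma exists_linChain_mem {n : ℤ} {ω : Forms k g ι} (hω : ω ∈ formsDeg n) :
    ∃ f : Finset ι → Module.Dual k (UniversalEnvelopingAlgebra k g),
      toChain (linChain e f) ∈ hochChains (chAlg e) n ∧ hkr e (toChain (linChain e f)) = ω := by
  obtain ⟨f, hf, hfs⟩ := exists_hkr_linChain_eq e ω
  refine ⟨f, (toChain_mem_iff e).2 (linChain_isHochDeg e fun s hs => ?_), hf⟩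
  refine (mem_formsDeg_iff e).1 hω s fun h0 => hs ((expStar_bijective e).1 ?_)
  rw [← hfs, h0, map_zero]

/-- The map `hkr` from the complex of linear chains to forms is onto, and the Hochschild
differential squares to zero. -/
theorem formsD_formsD (ω : Forms k g ι) : formsD e (formsD e ω) = 0 := by
  obtain ⟨f, rfl, -⟩ := exists_hkr_linChain_eq e ω
  rw [← hkr_hochD, ← hkr_hochD, hochD_hochD _ (chAlg_laws e), map_zero]

/-- On linear chains, the operator is the first order deformation, which anticommutes with the
Hochschild differential. -/
theorem formsD_halfSum {VL VR : g →ₗ[k] Derivation k (MvPowerSeries ι k) (MvPowerSeries ι k)}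
    (hsymm : B.IsSymm) (hnondeg : B.Nondegenerate) (hinv : ∀ x y z : g, B ⁅x, y⁆ z = B x ⁅y, z⁆)
    (hL : IsLeftInvariant e VL) (hR : IsRightInvariant e VR) (ω : Forms k g ι) :
    formsD e (halfSum e B VL VR ω) = -halfSum e B VL VR (formsD e ω) := by
  obtain ⟨f, rfl, -⟩ := exists_hkr_linChain_eq e ω
  obtain ⟨f', hf'⟩ := exists_hochD_linChain_eq e f
  rw [← hkr_hochD, ← hkr_firstOrder e B hsymm hL hR (hasLinearEntries_linChain e f)
    (hasLinearEntries_hochD_linChain e f), ← hkr_hochD, hf',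
    ← hkr_firstOrder e B hsymm hL hR (hasLinearEntries_linChain e f')
    (hasLinearEntries_hochD_linChain e f'), ← hf',
    eq_neg_of_add_eq_zero_left (hochD_firstOrder e B hnondeg hinv _)]
  exact map_neg _ _

/-- The Hochschild--Kostant--Rosenberg map is a quasi-isomorphism: its kernel is acyclic, and chains
in generators provide preimages of forms. -/
theorem isQuasiIso_hkr :
    IsQuasiIso (hochChains (chAlg e)) (hochD (chAlg e)) formsDeg (formsD e) (hkr e) where
  source_deg n z hz := (chAlg_isGradedBy e).hochD_mem_hochChains hz
  source_sq n z _ := hochD_hochD _ (chAlg_laws e) z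
  target_deg n z hz := formsD_mem_formsDeg e hz
  target_sq n z _ := formsD_formsD e z
  map_deg n z hz := hkr_mem_formsDeg e hz
  map_comm n z _ := hkr_hochD e z
  injective n z hz hD := by
    rintro ⟨x, hx, hzx⟩
    obtain ⟨f, hf, rfl⟩ := exists_linChain_mem e hx
    have hDf := (chAlg_isGradedBy e).hochD_mem_hochChains hf
    rw [sub_add_cancel] at hDf
    obtain ⟨y, hy, hy', -⟩ := exists_hochD_eq e (sub_mem hz hDf)
      (by rw [map_sub, hD, hochD_hochD _ (chAlg_laws e), sub_zero])
      (by rw [map_sub, hkr_hochD, hzx, sub_self])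
    exact ⟨y + toChain (linChain e f), add_mem hy hf, by rw [map_add, hy', sub_add_cancel]⟩
  surjective n x hx hD := by
    obtain ⟨f, hf, rfl⟩ := exists_linChain_mem e hx
    exact ⟨_, hf, hochD_linChain_eq_zero e hD, 0, zero_mem _, by rw [map_zero, add_zero]⟩

/-- A cocycle differs from a chain in generators by the differential of a chain in the kernel of the
Hochschild--Kostant--Rosenberg map. -/
lemma exists_eq_linChain_add {n : ℤ} {z : HChain k (Finset ι)} (hz : z ∈ hochChains (chAlg e) n)
    (hD : hochD (chAlg e) z = 0) :
    ∃ (f : Finset ι → Module.Dual k (UniversalEnvelopingAlgebra k g)),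
      ∃ y ∈ hochChains (chAlg e) (n - 1), z = toChain (linChain e f) + hochD (chAlg e) y ∧
        hkr e y = 0 := by
  obtain ⟨f, hf, hfz⟩ := exists_linChain_mem e (hkr_mem_formsDeg e hz)
  have h0 : hochD (chAlg e) (toChain (linChain e f)) = 0 :=
    hochD_linChain_eq_zero e (by rw [hfz, ← hkr_hochD, hD, map_zero])
  obtain ⟨y, hy, hy', hy''⟩ := exists_hochD_eq e (sub_mem hz hf)
    (by rw [map_sub, hD, h0, sub_zero]) (by rw [map_sub, hfz, sub_self])
  exact ⟨f, y, hy, by rw [hy', add_sub_cancel], hy''⟩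

/-- A cocycle is the sum of a linear chain, to which `hkr_firstOrder` applies, and of the boundary
of a chain `y` with `hkr y = 0`, for which the deformation gives the form `-d (hkr (D₁ y))`. -/
theorem hkr_firstOrder_of_cocycle
    {VL VR : g →ₗ[k] Derivation k (MvPowerSeries ι k) (MvPowerSeries ι k)}
    (hsymm : B.IsSymm) (hnondeg : B.Nondegenerate) (hinv : ∀ x y z : g, B ⁅x, y⁆ z = B x ⁅y, z⁆)
    (hL : IsLeftInvariant e VL) (hR : IsRightInvariant e VR) {n : ℤ} {z : HChain k (Finset ι)}
    (hz : z ∈ hochChains (chAlg e) n) (hD : hochD (chAlg e) z = 0) :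
    ∃ η ∈ formsDeg (n - 2),
      hkr e (firstOrder e B z) = halfSum e B VL VR (hkr e z) + formsD e η := by
  obtain ⟨f, y, hy, rfl, hy0⟩ := exists_eq_linChain_add e hz hD
  have hmem := firstOrder_mem e B hy
  rw [show n - 1 - 1 = n - 2 by ring] at hmem
  refine ⟨hkr e (-firstOrder e B y), hkr_mem_formsDeg e (neg_mem hmem), ?_⟩
  rw [firstOrder_add, map_add, map_add, hkr_hochD e y, hy0, map_zero, add_zero, ← hkr_hochD,
    map_neg, hkr_firstOrder e B hsymm hL hR (hasLinearEntries_linChain e f)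
      (hasLinearEntries_hochD_linChain e f),
    eq_neg_of_add_eq_zero_right (hochD_firstOrder e B hnondeg hinv y)]

/-- The chain `z` itself lifts `z` to the deformed complex. -/
lemma isSpectralDifferential_firstOrder {n : ℤ} {z : HChain k (Finset ι)}
    (hz : z ∈ hochChains (chAlg e) n) (hD : hochD (chAlg e) z = 0) :
    IsSpectralDifferential e B n z (firstOrder e B z) := by
  refine ⟨_, inl_mem_hochChainsEps e B hz, fun _ _ => rfl, fun i v => TrivSqZeroExt.ext ?_ rfl⟩
  rw [fst_hochD_eps]
  simp only [TrivSqZeroExt.fst_inl, hD]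
  rfl

/-- Different lifts of a cocycle change the value of the spectral differential by a coboundary. -/
lemma IsSpectralDifferential.exists_eq {n : ℤ} {z w : HChain k (Finset ι)}
    (h : IsSpectralDifferential e B n z w) :
    ∃ z' ∈ hochChains (chAlg e) (n - 2), w = hochD (chAlg e) z' + firstOrder e B z := by
  obtain ⟨c, hc, hcz, hcw⟩ := h
  refine ⟨_, snd_mem_hochChains e B hc, funext fun i => funext fun v => ?_⟩
  have h1 := congrArg TrivSqZeroExt.snd (hcw i v)
  rw [snd_hochD_eps, TrivSqZeroExt.snd_inr] at h1
  simp only [hcz] at h1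
  exact h1.symm

end Comparison

end ChevalleyHochschild

open ChevalleyHochschild

theorem mainTheorem2 {k g ι : Type*} [Field k] [CharZero k] [LieRing g] [LieAlgebra k g]
    [Fintype ι] [LinearOrder ι] (e : Module.Basis ι k g) (B : LinearMap.BilinForm k g)
    (hsymm : B.IsSymm) (hnondeg : B.Nondegenerate)
    (hinv : ∀ x y z : g, B ⁅x, y⁆ z = B x ⁅y, z⁆) :
    -- the map `hkr` is a quasi-isomorphism
    IsQuasiIso (hochChains (chAlg e)) (hochD (chAlg e)) formsDeg (formsD e) (hkr e) ∧
    -- the deformed Hochschild complex is a complex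
    (∀ n, ∀ c ∈ hochChainsEps (chAlgEps e B) n,
      hochD (chAlgEps e B) c ∈ hochChainsEps (chAlgEps e B) (n + 1) ∧
      hochD (chAlgEps e B) (hochD (chAlgEps e B) c) = 0) ∧
    -- formal functions on the group are identified with `k[[g^∨]]` by the exponential map
    Function.Bijective (expStar e) ∧
    ∃ VL VR : g →ₗ[k] Derivation k (MvPowerSeries ι k) (MvPowerSeries ι k),
      IsLeftInvariant e VL ∧ IsRightInvariant e VR ∧
      -- the half-sum of the two operators is an operator on the complex of forms
      (∀ ω, formsD e (halfSum e B VL VR ω) = - halfSum e B VL VR (formsD e ω)) ∧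
      -- in cohomology, it corresponds to the differential of the spectral sequence
      (∀ n, ∀ z ∈ hochChains (chAlg e) n, hochD (chAlg e) z = 0 →
        (∃ w, IsSpectralDifferential e B n z w) ∧
        ∀ w, IsSpectralDifferential e B n z w →
          w ∈ hochChains (chAlg e) (n - 1) ∧ hochD (chAlg e) w = 0 ∧
          ∃ η ∈ formsDeg (n - 2), hkr e w = halfSum e B VL VR (hkr e z) + formsD e η) ∧
      -- on chains with linear entries it is equal to the first order deformation
      (∀ n, ∀ z ∈ hochChains (chAlg e) n, HasLinearEntries z →
        HasLinearEntries (hochD (chAlg e) z) →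
        hkr e (firstOrder e B z) = halfSum e B VL VR (hkr e z)) ∧
      -- the matrix of the half-sum
      (∀ c, (2 : k)⁻¹ • (VL (e c) + VR (e c)) =
        ∑ b, bernoulliMatrix e b c • MvPowerSeries.pderiv k b) := by
  have hL := leftFields_isLeftInvariant e
  have hR := rightFields_isRightInvariant e
  refine ⟨isQuasiIso_hkr e, fun n c hc => ⟨(chAlgEps_isGradedBy e B).hochD_mem_hochChainsEps hc,
    hochD_hochD _ (chAlgEps_laws e B hnondeg hinv) c⟩, expStar_bijective e, leftFields e,
    rightFields e, hL, hR, formsD_halfSum e B hsymm hnondeg hinv hL hR, fun n z hz hD =>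
    ⟨⟨_, isSpectralDifferential_firstOrder e B hz hD⟩, fun w hw => ?_⟩,
    fun n z _ h h' => hkr_firstOrder e B hsymm hL hR h h', half_leftFields_add_rightFields e⟩
  obtain ⟨z', hz', rfl⟩ := hw.exists_eq
  have hDz' := (chAlg_isGradedBy e).hochD_mem_hochChains hz'
  rw [show n - 2 + 1 = n - 1 by ring] at hDz'
  have h0 := hochD_firstOrder e B hnondeg hinv z
  rw [hD, firstOrder_zero, add_zero] at h0
  refine ⟨add_mem hDz' (firstOrder_mem e B hz), ?_, ?_⟩
  · rw [map_add, hochD_hochD _ (chAlg_laws e), h0, add_zero]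
  · obtain ⟨η, hη, h⟩ := hkr_firstOrder_of_cocycle e B hsymm hnondeg hinv hL hR hz hD
    refine ⟨η + hkr e z', add_mem hη (hkr_mem_formsDeg e hz'), ?_⟩
    rw [map_add, h, hkr_hochD, map_add, add_comm, add_assoc]
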